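/- All running times refer to random access machines with the logarithmic cost criterion, and $\tilde O(f)$ hides a constant factor and a power of the logarithm of the magnitude of the input (its length plus the sum of the absolute values of its entries). **Problem.** An instance $\mathcal J$ of $1||\sum p_jU_j$ consists of $n\ge 1$ jobs with processing times $p_j\ge 1$ and due dates $e_j\ge 1$ (integers). Put $P=\sum_j p_j$. The jobs are run one after another in some order, a job is tardy if it is completed after its due date, and the total processing time of the tardy jobs is to be minimized. Let $d_1<\dots<d_{D}$ be the distinct due dates, $\mathcal J_I$ the set of jobs whose due date is $d_i$ for some $i\in I$, and $P_I=\sum_{J_j\in\mathcal J_I}p_j$. **Convolution.** The max-min-skewed-convolution of integer vectors $A[0..n]$, $B[0..n]$ is $C[k]=\max_{\max\{0,k-n\}\le i\le\min\{k,n\}}\min\{A[i],B[k-i]+k\}$ for $0\le k\le 2n$; the size of the vectors is $n+1$. **Algorithm $\mathrm{Solve}$ with parameter $\delta\in(0,1)$.** The due date $d_k$ is *red* if $P_{\{k\}}>P^{1-\delta}$. While some due date is neither red nor in a bundle, let $m$ be the largest index of such a due date and $k\le m$ the smallest index such that none of $d_k,\dots,d_m$ is red and $P_{\{k,\dots,m\}}\le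 P^{1-\delta}$; then $d_k,\dots,d_m$ form a *bundle* with start $k$ and end $m$. For $I=\{k,\dots,m\}$ let $M(I)[x]$ be the latest time $t\ge 0$ from which some subset of $\mathcal J_I$ of total processing time $x$ can be run with no job tardy ($-\infty$ if there is none; $M(I)[0]=+\infty$). Start with $T=\{0\}$, and for $i=1,\dots,D$ do the following. * If $d_i$ is red, replace $T$ by the set of all $x+s\le d_i$ where $x\in T$ and $s$ is a subset sum of the processing times of the jobs with due date $d_i$. * If $i$ is the end of a bundle with start $k$, let $I=\{k,\dots,i\}$ and $t=d_k-P_I$. Let $S=\{x\in\{0,\dots,P_I\}: M(I)[x]\neq-\infty\}$, let $M'[x]=0$ for $x\in T$ with $t<x<d_k$ and $M'[x]=-\infty$ otherwise, and $C[y]=\max_{0\le x\le y}\min\{M'[x],M(I)[y-x]-x\}$ for $0\le y\le d_k-1+P_I$. Add to $T$ all $y$ with $C[y]=0$ and, if $t\ge0$, all $x+s$ with $x\in T$ (the set $T$ at the start of the iteration), $x\le t$, $s\in S$; then remove all elements greater than $d_i$. * Otherwise the iteration is vacuous. Return $P-\max T$. The parameter $\delta$ enters only through the integer threshold $\lfloor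 P^{1-\delta}\rfloor$, which is given to the program along with the jobs. A program *implements* $\mathrm{Solve}$ if it outputs, for each non-vacuous iteration in order, its index and the set $T$ after it (size, then elements in increasing order), and at the end the returned value. **Lemma.** Let $\alpha\in\mathbb R$, and suppose that max-min-skewed-convolutions of vectors of size $N$ can be computed in $\tilde O(N^\alpha)$ time. Then: 1. There is one program that implements $\mathrm{Solve}$ and whose running time is $\tilde O\big((P^{(1-\delta)\alpha}+P)\cdot P^{\delta}\big)$ for every fixed $\delta\in(0,1)$. For $\alpha>1$ and $\delta=1-1/\alpha$ its running time is $\tilde O(P^{2-1/\alpha})$. 2. If $\alpha>1$ is rational, then $1||\sum p_jU_j$ (the input being only the jobs, the output the minimum total processing time of the tardy jobs) can be solved in $\tilde O(P^{2-1/\alpha})$ time. 3. In particular, if $\alpha=5/3$ (the exponent due to Klein et al.), then $1||\sum p_jU_j$ can be solved in $\tilde O(P^{7/5})$ time. -/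

import Mathlib

open scoped Pointwise

noncomputable section

/-! ### The machine model: a random access machine with logarithmic cost

A program has integer registers and finitely many named, zero-initialised arrays of integers with
random access.  Every operation, multiplication and division included, is charged the bit lengths
of its operands (the logarithmic cost criterion of Aho, Hopcroft and Ullman). -/

namespace RAM

/-- The length `⌊log₂ |z|⌋ + 1` of an integer, and `1` for `z = 0`. -/
def len (z : ℤ) : ℕ := Nat.log 2 z.natAbs + 1

/-- The contents of the registers `reg r` and of the cells `mem a i` of the arrays `a`. -/
structure State where
  reg : ℕ → ℤ
  mem : ℕ → ℕ → ℤ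

/-- Integer expressions. -/
inductive Expr : Type
  | const (z : ℤ)
  | reg (r : ℕ)
  | load (a : ℕ) (i : Expr)
  | add (x y : Expr)
  | sub (x y : Expr)
  | mul (x y : Expr)
  | div (x y : Expr)
  | le (x y : Expr)

/-- The value of an expression.  A negative address is read as `0`, division rounds down for a
positive divisor, and a comparison has the value `1` or `0`. -/
def Expr.eval (s : State) : Expr → ℤ
  | .const z => z
  | .reg r => s.reg r
  | .load a i => s.mem a (i.eval s).toNat
  | .add x y => x.eval s + y.eval s
  | .sub x y => x.eval s - y.eval s
  | .mul x y => x.eval s * y.eval s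
  | .div x y => x.eval s / y.eval s
  | .le x y => if x.eval s ≤ y.eval s then 1 else 0

/-- The logarithmic cost of evaluating an expression. -/
def Expr.cost (s : State) : Expr → ℕ
  | .const z => len z
  | .reg r => len (s.reg r)
  | .load a i => i.cost s + len (i.eval s) + len (s.mem a (i.eval s).toNat)
  | .add x y => x.cost s + y.cost s + len (x.eval s) + len (y.eval s)
  | .sub x y => x.cost s + y.cost s + len (x.eval s) + len (y.eval s)
  | .mul x y => x.cost s + y.cost s + len (x.eval s) + len (y.eval s)
  | .div x y => x.cost s + y.cost s + len (x.eval s) + len (y.eval s)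
  | .le x y => x.cost s + y.cost s + len (x.eval s) + len (y.eval s)

/-- Programs.  `branch` and `loop` test whether an expression is non-zero.
`call body src n dst r` is a call by value of the subroutine `body`, on a memory of its own: the
first `n` cells of the array `src` are its input, its output is copied to the initial cells of the
array `dst`, and the length of the output to the register `r`. -/
inductive Cmd : Type
  | skip
  | assign (r : ℕ) (e : Expr)
  | store (a : ℕ) (i e : Expr)
  | seq (c₁ c₂ : Cmd)
  | branch (e : Expr) (c₁ c₂ : Cmd)
  | loop (e : Expr) (c : Cmd)
  | call (body : Cmd) (src : ℕ) (n : Expr) (dst r : ℕ)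

/-- Memory at the start of a run: the input is in array `0`, its length in register `0`, and
everything else is `0`. -/
def State.init (l : List ℤ) : State where
  reg := fun r => if r = 0 then (l.length : ℤ) else 0
  mem := fun a i => if a = 0 then l.getD i 0 else 0

/-- The first `n` cells of the array `a`. -/
def State.read (s : State) (a n : ℕ) : List ℤ := (List.range n).map (s.mem a)

/-- The output of a run is in array `0`, and its length in register `0`. -/
def State.output (s : State) : List ℤ := s.read 0 (s.reg 0).toNat

def State.setReg (s : State) (r : ℕ) (z : ℤ) : State where
  reg := Function.update s.reg r z
  mem := s.mem

def State.setMem (s : State) (a i : ℕ) (z : ℤ) : State where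
  reg := s.reg
  mem := Function.update s.mem a (Function.update (s.mem a) i z)

/-- Write the list `l` to the initial cells of the array `a`. -/
def State.write (s : State) (a : ℕ) (l : List ℤ) : State where
  reg := s.reg
  mem := Function.update s.mem a (fun i => l.getD i (s.mem a i))

/-- The cost of copying a list, cell by cell. -/
def copyCost (l : List ℤ) : ℕ := (l.map (fun z => len z + len (l.length : ℤ))).sum

/-- `Exec c s s' t`: started in `s`, the program `c` halts in `s'`, and its cost is `t`. -/
inductive Exec : Cmd → State → State → ℕ → Prop
  | skip (s : State) : Exec .skip s s 1
  | assign (s : State) (r : ℕ) (e : Expr) :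
      Exec (.assign r e) s (s.setReg r (e.eval s)) (e.cost s + len (e.eval s))
  | store (s : State) (a : ℕ) (i e : Expr) :
      Exec (.store a i e) s (s.setMem a (i.eval s).toNat (e.eval s))
        (i.cost s + e.cost s + len (i.eval s) + len (e.eval s))
  | seq {c₁ c₂ : Cmd} {s s₁ s₂ : State} {t₁ t₂ : ℕ} (h₁ : Exec c₁ s s₁ t₁)
      (h₂ : Exec c₂ s₁ s₂ t₂) : Exec (.seq c₁ c₂) s s₂ (t₁ + t₂)
  | branchTrue {e : Expr} {c₁ c₂ : Cmd} {s s' : State} {t : ℕ} (he : e.eval s ≠ 0)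
      (h : Exec c₁ s s' t) : Exec (.branch e c₁ c₂) s s' (e.cost s + len (e.eval s) + t)
  | branchFalse {e : Expr} {c₁ c₂ : Cmd} {s s' : State} {t : ℕ} (he : e.eval s = 0)
      (h : Exec c₂ s s' t) : Exec (.branch e c₁ c₂) s s' (e.cost s + len (e.eval s) + t)
  | loopDone {e : Expr} {c : Cmd} {s : State} (he : e.eval s = 0) :
      Exec (.loop e c) s s (e.cost s + len (e.eval s))
  | loopStep {e : Expr} {c : Cmd} {s s₁ s₂ : State} {t₁ t₂ : ℕ} (he : e.eval s ≠ 0)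
      (h₁ : Exec c s s₁ t₁) (h₂ : Exec (.loop e c) s₁ s₂ t₂) :
      Exec (.loop e c) s s₂ (e.cost s + len (e.eval s) + t₁ + t₂)
  | call {body : Cmd} {src : ℕ} {n : Expr} {dst r : ℕ} {s s' : State} {t : ℕ}
      (h : Exec body (State.init (s.read src (n.eval s).toNat)) s' t) :
      Exec (.call body src n dst r) s
        ((s.write dst s'.output).setReg r (s'.output.length : ℤ))
        (n.cost s + len (n.eval s) + copyCost (s.read src (n.eval s).toNat) + t
          + copyCost s'.output + len (s'.output.length : ℤ))

/-- On the given input the program halts with the given output, at cost `t`. -/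
def Runs (c : Cmd) (input output : List ℤ) (t : ℕ) : Prop :=
  ∃ s : State, Exec c (State.init input) s t ∧ s.output = output

/-- The magnitude of an input: its length plus the sum of its absolute values. -/
def magnitude (l : List ℤ) : ℕ := l.length + (l.map Int.natAbs).sum

/-- The program computes `out x` from `inp x` for all `x`, in time `Õ(bound x)`, where `Õ` hides a
constant factor and a power of the logarithm of the magnitude of the input. -/
def ComputesInSoftO {ι : Type} (c : Cmd) (inp out : ι → List ℤ) (bound : ι → ℝ) : Prop :=
  ∃ C k : ℕ, ∀ x : ι, ∃ t : ℕ, Runs c (inp x) (out x) t ∧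
    (t : ℝ) ≤ C * bound x * Real.logb 2 ((magnitude (inp x) : ℝ) + 2) ^ k

end RAM

/-! ### Max-min-skewed-convolution -/

/-- Two integer vectors `A[0..n]` and `B[0..n]` (only these entries matter). -/
structure ConvInput where
  n : ℕ
  A : ℕ → ℤ
  B : ℕ → ℤ

namespace ConvInput

/-- `C[k] = max_{i = max(0, k - n)}^{min(k, n)} min(A[i], B[k - i] + k)`, for `0 ≤ k ≤ 2n`. -/
def conv (x : ConvInput) (k : ℕ) : ℤ :=
  sSup ((fun i : ℕ => min (x.A i) (x.B (k - i) + k)) '' Set.Icc (k - x.n) (min k x.n))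

def input (x : ConvInput) : List ℤ :=
  (List.range (x.n + 1)).map x.A ++ (List.range (x.n + 1)).map x.B

def output (x : ConvInput) : List ℤ := (List.range (2 * x.n + 1)).map x.conv

end ConvInput

/-- Max-min-skewed-convolutions of vectors of size `N` can be computed in time `Õ(N ^ α)`. -/
def MMSConvInTime (α : ℝ) : Prop :=
  ∃ c : RAM.Cmd, RAM.ComputesInSoftO c ConvInput.input ConvInput.output
    (fun x => ((x.n : ℝ) + 1) ^ α)

/-! ### Minimum total processing time of tardy jobs -/

/-- A non-empty set of jobs with positive processing times `p` and positive due dates `e`. -/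
structure Instance where
  n : ℕ
  p : Fin n → ℕ
  e : Fin n → ℕ
  n_pos : 0 < n
  p_pos : ∀ j, 0 < p j
  e_pos : ∀ j, 0 < e j

namespace Instance

variable (J : Instance)

/-- The total processing time. -/
def P : ℕ := ∑ j, J.p j

/-- The completion time of job `j` if the jobs are run in the order `σ`. -/
def completion (σ : Equiv.Perm (Fin J.n)) (j : Fin J.n) : ℕ :=
  ∑ i ∈ Finset.univ.filter (fun i => σ i ≤ σ j), J.p i

/-- The total processing time of the tardy jobs if the jobs are run in the order `σ`. -/
def tardyTime (σ : Equiv.Perm (Fin J.n)) : ℕ :=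
  ∑ j ∈ Finset.univ.filter (fun j => J.e j < J.completion σ j), J.p j

/-- The minimum total processing time of tardy jobs. -/
def minTardyTime : ℕ := Finset.univ.inf' Finset.univ_nonempty J.tardyTime

/-- The jobs as a list `p₁, e₁, p₂, e₂, …`. -/
def encode : List ℤ := (List.ofFn (fun j => [(J.p j : ℤ), (J.e j : ℤ)])).flatten

/-! #### Due dates and bundles -/

/-- The distinct due dates in increasing order. -/
def dueDates : List ℕ := (Finset.univ.image J.e).sort (· ≤ ·)

/-- The number of distinct due dates. -/
def numDue : ℕ := J.dueDates.length

/-- The `k`-th due date, for `1 ≤ k ≤ numDue`, and `0` for `k = 0`. -/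
def d (k : ℕ) : ℕ := if k = 0 then 0 else J.dueDates.getD (k - 1) 0

/-- The jobs whose due date is the `i`-th one for some `k ≤ i ≤ m`. -/
def jobsIn (k m : ℕ) : Finset (Fin J.n) :=
  Finset.univ.filter (fun j => ∃ i ∈ Finset.Icc k m, J.e j = J.d i)

/-- The total processing time of the jobs with due dates `k, …, m`. -/
def load (k m : ℕ) : ℕ := ∑ j ∈ J.jobsIn k m, J.p j

/-- The due date `k` is red. -/
def Red (δ : ℝ) (k : ℕ) : Prop := (J.P : ℝ) ^ (1 - δ) < J.load k k

/-- The smallest `k ≤ m` such that none of the due dates `k, …, m` is red and the jobs with these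
due dates have total processing time at most `P ^ (1 - δ)`. -/
def bundleStart (δ : ℝ) (m : ℕ) : ℕ :=
  sInf {k | 1 ≤ k ∧ k ≤ m ∧ (∀ i ∈ Finset.Icc k m, ¬ J.Red δ i) ∧
    (J.load k m : ℝ) ≤ (J.P : ℝ) ^ (1 - δ)}

theorem bundleStart_le (δ : ℝ) (m : ℕ) : J.bundleStart δ m ≤ m := by
  unfold bundleStart
  rcases Set.eq_empty_or_nonempty {k | 1 ≤ k ∧ k ≤ m ∧ (∀ i ∈ Finset.Icc k m, ¬ J.Red δ i) ∧
    (J.load k m : ℝ) ≤ (J.P : ℝ) ^ (1 - δ)} with h | h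
  · rw [h, Nat.sInf_empty]
    exact Nat.zero_le _
  · exact (Nat.sInf_mem h).2.1

open Classical in
/-- The bundles `(k, m)` (with start `k` and end `m`) that arise if the due dates `m, m - 1, …, 1`
are still to be coloured: a red due date is passed over, and otherwise the last uncoloured due date
is the end of a bundle. -/
def bundlesUpTo (δ : ℝ) : ℕ → List (ℕ × ℕ)
  | 0 => []
  | m + 1 =>
    if J.Red δ (m + 1) then bundlesUpTo δ m
    else (J.bundleStart δ (m + 1), m + 1) :: bundlesUpTo δ (J.bundleStart δ (m + 1) - 1)
termination_by m => m
decreasing_by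
  · exact Nat.lt_succ_self m
  · have h := J.bundleStart_le δ (m + 1)
    omega

/-- All bundles. -/
def bundles (δ : ℝ) : List (ℕ × ℕ) := J.bundlesUpTo δ J.numDue

/-! #### The algorithm -/

/-- The sums of the subsets of the multiset of processing times of the jobs with due date `i`. -/
def subsetSums (i : ℕ) : Finset ℕ :=
  (J.jobsIn i i).powerset.image (fun Z => ∑ j ∈ Z, J.p j)

/-- The jobs in `Z` can be run one after another from time `t` on so that none of them is tardy. -/
def FeasibleFrom (Z : Finset (Fin J.n)) (t : ℕ) : Prop :=
  ∃ σ : Equiv.Perm (Fin J.n), ∀ j ∈ Z, t + ∑ i ∈ Z.filter (fun i => σ i ≤ σ j), J.p i ≤ J.e j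

/-- The entry `x` of the vector `M(I)`, `I = {k, …, m}`: the latest time from which some set of
jobs in `J_I` with total processing time `x` can be scheduled feasibly, and `-∞` if there is none.
(The empty set can start arbitrarily late, so that the entry `0` is `+∞`.) -/
def M (k m x : ℕ) : EReal :=
  sSup ((fun t : ℕ => (t : EReal)) ''
    {t | ∃ Z ⊆ J.jobsIn k m, ∑ j ∈ Z, J.p j = x ∧ J.FeasibleFrom Z t})

end Instance

/-- The elements of `T` that are at most `t`. -/
def pref (T : Finset ℕ) (t : ℤ) : Finset ℕ := T.filter (fun x => (x : ℤ) ≤ t)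

/-- The elements of `T` that are greater than `t`. -/
def suff (T : Finset ℕ) (t : ℤ) : Finset ℕ := T.filter (fun x => t < (x : ℤ))

namespace Instance

variable (J : Instance)

/-- The iteration for a red due date. -/
def redStep (i : ℕ) (T : Finset ℕ) : Finset ℕ :=
  (T + J.subsetSums i).filter (fun x => x ≤ J.d i)

open Classical in
/-- The iteration for the end `i` of a bundle with start `k`. -/
def bundleStep (k i : ℕ) (T : Finset ℕ) : Finset ℕ :=
  let t : ℤ := (J.d k : ℤ) - J.load k i
  let S : Finset ℕ := (Finset.range (J.load k i + 1)).filter (fun x => J.M k i x ≠ ⊥)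
  let T₁ : Finset ℕ := if 0 ≤ t then T ∪ (pref T t + S) else T
  let M' : ℕ → EReal := fun x => if x < J.d k ∧ x ∈ suff T t then 0 else ⊥
  let C : ℕ → EReal := fun y =>
    (Finset.range (y + 1)).sup (fun x => min (M' x) (J.M k i (y - x) - (x : EReal)))
  let T₂ : Finset ℕ := (Finset.range (J.d k + J.load k i)).filter (fun y => C y = 0)
  (T₁ ∪ T₂).filter (fun x => x ≤ J.d i)

/-- The iteration `i` is not vacuous: the due date `i` is red or the end of a bundle. -/
def Active (δ : ℝ) (i : ℕ) : Prop :=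
  J.Red δ i ∨ (J.bundleStart δ i, i) ∈ J.bundles δ

open Classical in
/-- The set `T` of the algorithm `Solve` after the iterations `1, …, i`. -/
def solveT (δ : ℝ) : ℕ → Finset ℕ
  | 0 => {0}
  | i + 1 =>
    if J.Red δ (i + 1) then J.redStep (i + 1) (solveT δ i)
    else if (J.bundleStart δ (i + 1), i + 1) ∈ J.bundles δ then
      J.bundleStep (J.bundleStart δ (i + 1)) (i + 1) (solveT δ i)
    else solveT δ i

/-- The value `P - max T` that `Solve` returns. -/
def solveValue (δ : ℝ) : ℤ := (J.P : ℤ) - ((J.solveT δ J.numDue).sup id : ℕ)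

/-- The input of `Solve`: the threshold `⌊P ^ (1 - δ)⌋` for the colouring, then the jobs. -/
def solveInput (δ : ℝ) : List ℤ := (⌊(J.P : ℝ) ^ (1 - δ)⌋₊ : ℤ) :: J.encode

open Classical in
/-- The output of a run of `Solve`: for each non-vacuous iteration `i`, in order, the number `i`,
the size of the set `T` after the iteration and its elements in increasing order; and at the end
the returned value. -/
def solveTrace (δ : ℝ) : List ℤ :=
  ((List.range' 1 J.numDue).filter (fun i => J.Active δ i)).flatMap
    (fun i : ℕ => (i : ℤ) :: ((J.solveT δ i).card : ℤ) ::
      ((J.solveT δ i).sort (· ≤ ·)).map (fun x : ℕ => (x : ℤ)))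
  ++ [J.solveValue δ]

end Instance

/-- The problem `1 || Σ p_j U_j` can be solved in time `Õ(P ^ β)`. -/
def TardyInTime (β : ℝ) : Prop :=
  ∃ c : RAM.Cmd, RAM.ComputesInSoftO c Instance.encode
    (fun J => [(J.minTardyTime : ℤ)]) (fun J => (J.P : ℝ) ^ β)

end

/-!
Sort the jobs by due dates. By the earliest-due-date rule (`Instance.feasibleFrom_iff`), a set of
jobs can be run on time if and only if it can be run on time in this order, so the possible total
processing times of sets of jobs without tardiness can be computed by adding the jobs due date by
due date; the maximum of these totals determines the optimum (`Instance.solveValue_eq`). `Solve`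
treats a whole block of due dates at once, a bundle or a red due date. After each block its set `T`
is the set of the totals for all jobs up to this block (`Instance.SortedJobs.solveT_prevEnd`). For
a red due date this needs a sumset only, since all jobs of the block have the same due date. For a
bundle with first due date `d_k` and load `P_I`, an element `x ≤ d_k - P_I` of `T` can be followed
by every feasible set of jobs of the bundle, which is again a sumset; the other elements of `T` lie
in a window of length `P_I`, where a skewed convolution with the vector `M(I)` of latest starting
times decides (`RAM.bundle_iff`). The vector `M(I)` itself is computed from the single jobs by
skewed convolutions along a balanced tree, and so are subset sums by sumsets (`RAM.treeOf_runs`).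

The program is written out in the machine model. Its routines are isolated by calls and verified by
a calculus of weakest preconditions with budgets (`RAM.wp`): a budget counts multiples of the word
length `lg X`, where `X` bounds the contents of the memory, and a loop rule with a decreasing
budget proves termination and the running time together. Sumsets are products of 0-1 polynomials,
and these are obtained from one multiplication of long integers (`RAM.kron_runs`), which the
logarithmic cost criterion charges by the length only.

For the running time, two consecutive blocks together have a load above the threshold `P ^ (1 -
δ)`, so there are at most `3 * P ^ δ` blocks (`Instance.SortedJobs.length_blocks_le`); each of them
costs `Õ(P)` for sumsets and for the output of `T`. The convolutions are of size at most about `2 *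
P ^ (1 - δ)`, and their sizes add up to `Õ(P)`; with `β = max α 1` they cost `Õ(P * P ^ ((1 - δ) *
(β - 1)))`, which is within the bound (`RAM.exists_solve_bound`). All constants are independent of
`δ`. If `α = a / b` is rational, the threshold `⌊P ^ (b / a)⌋` for `δ = 1 - 1 / α` is the largest
`θ` with `θ ^ a ≤ P ^ b`, and a program can find it from the jobs alone (`RAM.tardyInTime`).
-/

namespace RAM

/-! ### Cost bounds and a weakest-precondition calculus -/

/-- The bit length of integers of absolute value at most `X`. -/
def lg (X : ℕ) : ℕ := Nat.log 2 X + 1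

theorem one_le_lg (X : ℕ) : 1 ≤ lg X := Nat.le_add_left _ _

theorem lg_mono {X Y : ℕ} (h : X ≤ Y) : lg X ≤ lg Y :=
  Nat.add_le_add_right (Nat.log_mono_right h) 1

theorem one_le_len (z : ℤ) : 1 ≤ len z := Nat.le_add_left _ _

theorem len_le_lg {z : ℤ} {X : ℕ} (h : z.natAbs ≤ X) : len z ≤ lg X := lg_mono h

theorem len_mono {x y : ℤ} (h : x.natAbs ≤ y.natAbs) : len x ≤ len y := lg_mono h

theorem natAbs_lt_two_pow_len (z : ℤ) : z.natAbs < 2 ^ len z :=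
  Nat.lt_pow_succ_log_self Nat.one_lt_two _

theorem len_le_of_lt {z : ℤ} {k : ℕ} (hk : 0 < k) (h : z.natAbs < 2 ^ k) : len z ≤ k :=
  Nat.log_lt_of_lt_pow' hk.ne' h

theorem len_le_natAbs (z : ℤ) : len z ≤ z.natAbs + 1 :=
  Nat.add_le_add_right (Nat.log_le_self _ _) 1

theorem len_mul_le (x y : ℤ) : len (x * y) ≤ len x + len y := by
  apply len_le_of_lt (by have := one_le_len x; omega)
  rw [Int.natAbs_mul, pow_add]
  exact Nat.mul_lt_mul'' (natAbs_lt_two_pow_len x) (natAbs_lt_two_pow_len y)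

theorem natAbs_lt_of_add_bound {x y z : ℤ} (h : z.natAbs ≤ x.natAbs + y.natAbs) :
    len z ≤ len x + len y := by
  have hx := one_le_len x
  have hy := one_le_len y
  apply len_le_of_lt (by omega)
  have h1 := natAbs_lt_two_pow_len x
  have h2 := natAbs_lt_two_pow_len y
  rw [pow_add]
  have h3 : 2 ≤ 2 ^ len x := Nat.le_self_pow (by omega) 2
  have h4 : 2 ≤ 2 ^ len y := Nat.le_self_pow (by omega) 2
  nlinarith

theorem len_add_le (x y : ℤ) : len (x + y) ≤ len x + len y :=
  natAbs_lt_of_add_bound (Int.natAbs_add_le x y)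

theorem len_sub_le (x y : ℤ) : len (x - y) ≤ len x + len y :=
  natAbs_lt_of_add_bound (Int.natAbs_sub_le x y)

theorem len_div_le (x y : ℤ) : len (x / y) ≤ len x :=
  len_mono (Int.natAbs_ediv_le_natAbs x y)

/-- All registers and memory cells have absolute value at most `X`. -/
def Bdd (X : ℕ) (s : State) : Prop :=
  (∀ r, (s.reg r).natAbs ≤ X) ∧ ∀ a i, (s.mem a i).natAbs ≤ X

/-- A bound, in multiples of the word length, for the length of the value of an expression. -/
def Expr.L : Expr → ℕ
  | .const z => z.natAbs + 1
  | .reg _ => 1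
  | .load _ _ => 1
  | .add x y => x.L + y.L
  | .sub x y => x.L + y.L
  | .mul x y => x.L + y.L
  | .div x _ => x.L
  | .le _ _ => 1

/-- A bound, in multiples of the word length, for the cost of evaluating an expression. -/
def Expr.K : Expr → ℕ
  | .const z => z.natAbs + 1
  | .reg _ => 1
  | .load _ i => i.K + i.L + 1
  | .add x y => x.K + y.K + x.L + y.L
  | .sub x y => x.K + y.K + x.L + y.L
  | .mul x y => x.K + y.K + x.L + y.L
  | .div x y => x.K + y.K + x.L + y.L
  | .le x y => x.K + y.K + x.L + y.L

/-- A bound, in multiples of the word length, for evaluating an expression and using its value. -/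
def Expr.C (e : Expr) : ℕ := e.K + e.L

theorem Expr.len_eval_le {X : ℕ} {s : State} (hs : Bdd X s) (e : Expr) :
    len (e.eval s) ≤ e.L * lg X := by
  have h1 := one_le_lg X
  induction e with
  | const z =>
    have := len_le_natAbs z
    simp only [Expr.eval, Expr.L]
    nlinarith
  | reg r => simpa [Expr.eval, Expr.L] using len_le_lg (hs.1 r)
  | load a i _ => simpa [Expr.eval, Expr.L] using len_le_lg (hs.2 a _)
  | add x y hx hy =>
    have := len_add_le (x.eval s) (y.eval s)
    simp only [Expr.eval, Expr.L]; nlinarith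
  | sub x y hx hy =>
    have := len_sub_le (x.eval s) (y.eval s)
    simp only [Expr.eval, Expr.L]; nlinarith
  | mul x y hx hy =>
    have := len_mul_le (x.eval s) (y.eval s)
    simp only [Expr.eval, Expr.L]; nlinarith
  | div x y hx hy =>
    have := len_div_le (x.eval s) (y.eval s)
    simp only [Expr.eval, Expr.L]; omega
  | le x y _ _ =>
    simp only [Expr.eval, Expr.L, one_mul]
    split_ifs <;> simpa [len] using h1

theorem Expr.cost_le {X : ℕ} {s : State} (hs : Bdd X s) (e : Expr) :
    e.cost s ≤ e.K * lg X := by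
  have h1 := one_le_lg X
  induction e with
  | const z => exact Expr.len_eval_le hs (.const z)
  | reg r => exact Expr.len_eval_le hs (.reg r)
  | load a i hi =>
    have h2 := Expr.len_eval_le hs i
    have h3 := len_le_lg (hs.2 a (i.eval s).toNat)
    simp only [Expr.cost, Expr.K]; nlinarith
  | add x y hx hy | sub x y hx hy | mul x y hx hy | div x y hx hy | le x y hx hy =>
    have h2 := Expr.len_eval_le hs x
    have h3 := Expr.len_eval_le hs y
    simp only [Expr.cost, Expr.K]; nlinarith

theorem Expr.cost_add_len_le {X : ℕ} {s : State} (hs : Bdd X s) (e : Expr) :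
    e.cost s + len (e.eval s) ≤ e.C * lg X := by
  have h1 := e.cost_le hs
  have h2 := e.len_eval_le hs
  rw [Expr.C, add_mul]; omega

theorem Expr.one_le_L (e : Expr) : 1 ≤ e.L := by
  induction e <;> simp only [Expr.L] <;> omega

theorem Expr.one_le_C (e : Expr) : 1 ≤ e.C := by
  have := e.one_le_L; unfold Expr.C; omega

/-- The registers a program may change. -/
def Cmd.wregs : Cmd → List ℕ
  | .skip => []
  | .assign r _ => [r]
  | .store _ _ _ => []
  | .seq c₁ c₂ => c₁.wregs ++ c₂.wregs
  | .branch _ c₁ c₂ => c₁.wregs ++ c₂.wregs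
  | .loop _ c => c.wregs
  | .call _ _ _ _ r => [r]

/-- The arrays a program may change. -/
def Cmd.warrs : Cmd → List ℕ
  | .skip => []
  | .assign _ _ => []
  | .store a _ _ => [a]
  | .seq c₁ c₂ => c₁.warrs ++ c₂.warrs
  | .branch _ c₁ c₂ => c₁.warrs ++ c₂.warrs
  | .loop _ c => c.warrs
  | .call _ _ _ dst _ => [dst]

/-- The states `s` and `s'` differ at most in the registers `R` and the arrays `A`. -/
structure Fr (R A : List ℕ) (s s' : State) : Prop where
  reg : ∀ r, r ∉ R → s'.reg r = s.reg r
  mem : ∀ a, a ∉ A → s'.mem a = s.mem a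

theorem Fr.refl (R A : List ℕ) (s : State) : Fr R A s s := ⟨fun _ _ => rfl, fun _ _ => rfl⟩

theorem Fr.trans {R A : List ℕ} {s₁ s₂ s₃ : State} (h : Fr R A s₁ s₂) (h' : Fr R A s₂ s₃) :
    Fr R A s₁ s₃ :=
  ⟨fun r hr => (h'.reg r hr).trans (h.reg r hr), fun a ha => (h'.mem a ha).trans (h.mem a ha)⟩

theorem Fr.mono {R A R' A' : List ℕ} {s₁ s₂ : State} (h : Fr R A s₁ s₂) (hR : R ⊆ R')
    (hA : A ⊆ A') : Fr R' A' s₁ s₂ :=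
  ⟨fun r hr => h.reg r (fun h' => hr (hR h')), fun a ha => h.mem a (fun h' => ha (hA h'))⟩

@[simp] theorem setReg_reg (s : State) (r r' : ℕ) (z : ℤ) :
    (s.setReg r z).reg r' = if r' = r then z else s.reg r' := by
  simp [State.setReg, Function.update_apply]

@[simp] theorem setReg_mem (s : State) (r : ℕ) (z : ℤ) : (s.setReg r z).mem = s.mem := rfl

@[simp] theorem setMem_reg (s : State) (a i : ℕ) (z : ℤ) : (s.setMem a i z).reg = s.reg := rfl

theorem setMem_mem (s : State) (a i b j : ℕ) (z : ℤ) :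
    (s.setMem a i z).mem b j = if b = a ∧ j = i then z else s.mem b j := by
  by_cases h : b = a
  · subst h; simp [State.setMem, Function.update_apply]
  · simp [State.setMem, h]

theorem setMem_mem_ne (s : State) (a i b : ℕ) (z : ℤ) (h : b ≠ a) :
    (s.setMem a i z).mem b = s.mem b := by
  simp [State.setMem, h]

@[simp] theorem write_reg (s : State) (a : ℕ) (l : List ℤ) : (s.write a l).reg = s.reg := rfl

theorem write_mem_ne (s : State) (a b : ℕ) (l : List ℤ) (h : b ≠ a) :
    (s.write a l).mem b = s.mem b := by
  simp [State.write, h]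

theorem write_mem_self (s : State) (a : ℕ) (l : List ℤ) (i : ℕ) :
    (s.write a l).mem a i = l.getD i (s.mem a i) := by
  simp [State.write]

theorem Exec.fr {c : Cmd} {s s' : State} {t : ℕ} (h : Exec c s s' t) :
    Fr c.wregs c.warrs s s' := by
  induction h with
  | skip s => exact Fr.refl _ _ _
  | assign s r e =>
    exact ⟨fun r' hr => by simp [Cmd.wregs] at hr; simp [hr], fun _ _ => rfl⟩
  | store s a i e =>
    exact ⟨fun r' hr => rfl, fun b hb => by
      simp [Cmd.warrs] at hb; exact setMem_mem_ne _ _ _ _ _ hb⟩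
  | seq h₁ h₂ ih₁ ih₂ =>
    exact (ih₁.mono (List.subset_append_left _ _) (List.subset_append_left _ _)).trans
      (ih₂.mono (List.subset_append_right _ _) (List.subset_append_right _ _))
  | branchTrue he h ih =>
    exact ih.mono (List.subset_append_left _ _) (List.subset_append_left _ _)
  | branchFalse he h ih =>
    exact ih.mono (List.subset_append_right _ _) (List.subset_append_right _ _)
  | loopDone he => exact Fr.refl _ _ _
  | loopStep he h₁ h₂ ih₁ ih₂ => exact ih₁.trans ih₂
  | call h ih =>
    exact ⟨fun r' hr => by simp [Cmd.wregs] at hr; simp [hr], fun b hb => by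
      simp [Cmd.warrs] at hb; simp [write_mem_ne _ _ _ _ hb]⟩

theorem Bdd.setReg {X : ℕ} {s : State} (hs : Bdd X s) {r : ℕ} {z : ℤ} (hz : z.natAbs ≤ X) :
    Bdd X (s.setReg r z) := by
  refine ⟨fun r' => ?_, hs.2⟩
  rw [setReg_reg]; split_ifs
  · exact hz
  · exact hs.1 r'

theorem Bdd.setMem {X : ℕ} {s : State} (hs : Bdd X s) {a i : ℕ} {z : ℤ} (hz : z.natAbs ≤ X) :
    Bdd X (s.setMem a i z) := by
  refine ⟨hs.1, fun b j => ?_⟩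
  rw [setMem_mem]; split_ifs
  · exact hz
  · exact hs.2 b j

theorem Bdd.write {X : ℕ} {s : State} (hs : Bdd X s) {a : ℕ} {l : List ℤ}
    (hl : ∀ z ∈ l, z.natAbs ≤ X) : Bdd X (s.write a l) := by
  refine ⟨hs.1, fun b j => ?_⟩
  by_cases h : b = a
  · subst h
    rw [write_mem_self, List.getD_eq_getElem?_getD]
    by_cases hj : j < l.length
    · simpa [List.getElem?_eq_getElem hj] using hl _ (List.getElem_mem hj)
    · simpa [List.getElem?_eq_none (not_lt.mp hj)] using hs.2 b j
  · rw [write_mem_ne _ _ _ _ h]; exact hs.2 b j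

/-- Started in `s`, all of whose contents are bounded by `X`, the program `c` halts at cost at most
`b * lg X` in a state with contents bounded by `X` and with the property `Q`. -/
def wp (X : ℕ) (c : Cmd) (s : State) (b : ℕ) (Q : State → Prop) : Prop :=
  Bdd X s → ∃ s' t, Exec c s s' t ∧ t ≤ b * lg X ∧ Bdd X s' ∧ Q s'

variable {X : ℕ} {s : State} {Q Q' : State → Prop} {c c₁ c₂ : Cmd} {b b' b₁ b₂ : ℕ}

theorem wp.le (h : wp X c s b Q) (hb : b ≤ b') : wp X c s b' Q := fun hs => by
  obtain ⟨s', t, h1, h2, h3⟩ := h hs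
  exact ⟨s', t, h1, h2.trans (Nat.mul_le_mul_right _ hb), h3⟩

theorem wp.imp (h : wp X c s b Q)
    (hQ : ∀ s', Bdd X s' → Fr c.wregs c.warrs s s' → Q s' → Q' s') : wp X c s b Q' := fun hs => by
  obtain ⟨s', t, h1, h2, h3, h4⟩ := h hs
  exact ⟨s', t, h1, h2, h3, hQ s' h3 h1.fr h4⟩

theorem wp_bdd (h : Bdd X s → wp X c s b Q) : wp X c s b Q := fun hs => h hs hs

theorem wp_skip (hQ : Q s) : wp X .skip s 1 Q := fun hs =>
  ⟨s, 1, .skip s, by have := one_le_lg X; omega, hs, hQ⟩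

theorem wp_seq (h : wp X c₁ s b₁ (fun s₁ => wp X c₂ s₁ b₂ Q)) :
    wp X (.seq c₁ c₂) s (b₁ + b₂) Q := fun hs => by
  obtain ⟨s₁, t₁, h1, h2, h3, h4⟩ := h hs
  obtain ⟨s₂, t₂, h5, h6, h7, h8⟩ := h4 h3
  exact ⟨s₂, t₁ + t₂, .seq h1 h5, by rw [add_mul]; omega, h7, h8⟩

theorem wp_assign {r : ℕ} {e : Expr} (he : Bdd X s → (e.eval s).natAbs ≤ X)
    (hQ : Q (s.setReg r (e.eval s))) : wp X (.assign r e) s e.C Q := fun hs =>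
  ⟨_, _, .assign s r e, e.cost_add_len_le hs, hs.setReg (he hs), hQ⟩

/-- The rule for assignments with the value `v` of the expression made explicit. -/
theorem wp_set {r : ℕ} {e : Expr} (v : ℤ) (hv : e.eval s = v) (hX : v.natAbs ≤ X)
    (hQ : Q (s.setReg r v)) : wp X (.assign r e) s e.C Q := by
  subst hv; exact wp_assign (fun _ => hX) hQ

theorem wp_store {a : ℕ} {i e : Expr} (he : Bdd X s → (e.eval s).natAbs ≤ X)
    (hQ : Q (s.setMem a (i.eval s).toNat (e.eval s))) :
    wp X (.store a i e) s (i.C + e.C) Q := fun hs =>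
  ⟨_, _, .store s a i e, by
    have h1 := e.cost_add_len_le hs
    have h2 := i.cost_add_len_le hs
    rw [add_mul]; omega, hs.setMem (he hs), hQ⟩

theorem wp_branch {e : Expr} (h₁ : e.eval s ≠ 0 → wp X c₁ s b Q)
    (h₂ : e.eval s = 0 → wp X c₂ s b Q) : wp X (.branch e c₁ c₂) s (e.C + b) Q := fun hs => by
  have h0 := e.cost_add_len_le hs
  by_cases he : e.eval s = 0
  · obtain ⟨s', t, h1, h2, h3⟩ := h₂ he hs
    exact ⟨s', _, .branchFalse he h1, by rw [add_mul]; omega, h3⟩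
  · obtain ⟨s', t, h1, h2, h3⟩ := h₁ he hs
    exact ⟨s', _, .branchTrue he h1, by rw [add_mul]; omega, h3⟩

theorem wp_branch_pos {e : Expr} (he : e.eval s ≠ 0) (h : wp X c₁ s b Q) :
    wp X (.branch e c₁ c₂) s (e.C + b) Q := wp_branch (fun _ => h) (fun h' => absurd h' he)

theorem wp_branch_neg {e : Expr} (he : e.eval s = 0) (h : wp X c₂ s b Q) :
    wp X (.branch e c₁ c₂) s (e.C + b) Q := wp_branch (fun h' => absurd he h') (fun _ => h)

/-- The rule for loops.  The invariant `I b` says what is true when the budget `b` is left for the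
rest of the loop; the budget decreases and hence also shows termination. -/
theorem wp_while {e : Expr} (I : ℕ → State → Prop)
    (hI : ∀ b s, Bdd X s → I b s → (e.eval s = 0 ∧ e.C ≤ b ∧ Q s) ∨
      (e.eval s ≠ 0 ∧ ∃ b₁ b₂, e.C + b₁ + b₂ ≤ b ∧ wp X c s b₁ (fun s' => I b₂ s'))) :
    ∀ b s, I b s → wp X (.loop e c) s b Q := by
  intro b
  induction b using Nat.strong_induction_on with
  | _ b ih =>
    intro s hIs hs
    have hc := e.cost_add_len_le hs
    rcases hI b s hs hIs with ⟨h1, h2, h3⟩ | ⟨h1, b₁, b₂, h2, h3⟩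
    · exact ⟨s, _, .loopDone h1, hc.trans (Nat.mul_le_mul_right _ h2), hs, h3⟩
    · obtain ⟨s₁, t₁, h4, h5, h6, h7⟩ := h3 hs
      have := e.one_le_C
      obtain ⟨s₂, t₂, h8, h9, h10⟩ := ih b₂ (by omega) s₁ h7 h6
      refine ⟨s₂, _, .loopStep h1 h4 h8, ?_, h10⟩
      have := Nat.mul_le_mul_right (lg X) h2
      rw [add_mul, add_mul] at this
      omega

theorem wp_while_step {k : ℕ} {I : ℕ → State → Prop} (b₂ : ℕ)
    (h : wp X c s b₁ (fun s' => I b₂ s')) (hb : k + b₁ + b₂ ≤ b) :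
    ∃ b₁ b₂, k + b₁ + b₂ ≤ b ∧ wp X c s b₁ (fun s' => I b₂ s') := ⟨_, _, hb, h⟩

/-! ### Lists in arrays -/

/-- The entries of a list, continued by `0`. -/
def nth (l : List ℤ) (i : ℕ) : ℤ := l.getD i 0

theorem nth_of_lt {l : List ℤ} {i : ℕ} (h : i < l.length) : nth l i = l[i] := by
  simp [nth, h]

theorem nth_of_le {l : List ℤ} {i : ℕ} (h : l.length ≤ i) : nth l i = 0 := by
  simp [nth, h]

@[simp] theorem nth_cons_zero (x : ℤ) (l : List ℤ) : nth (x :: l) 0 = x := rfl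

@[simp] theorem nth_cons_succ (x : ℤ) (l : List ℤ) (i : ℕ) : nth (x :: l) (i + 1) = nth l i := rfl

theorem nth_append_left {l l' : List ℤ} {i : ℕ} (h : i < l.length) :
    nth (l ++ l') i = nth l i := by
  simp [nth, List.getElem?_append_left h]

theorem nth_append_right {l l' : List ℤ} {i : ℕ} (h : l.length ≤ i) :
    nth (l ++ l') i = nth l' (i - l.length) := by
  simp [nth, List.getElem?_append_right h]

theorem nth_append_add (l l' : List ℤ) (i : ℕ) : nth (l ++ l') (l.length + i) = nth l' i := by
  rw [nth_append_right (by omega), Nat.add_sub_cancel_left]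

theorem nth_map_range (f : ℕ → ℤ) {n i : ℕ} (h : i < n) : nth ((List.range n).map f) i = f i := by
  rw [nth_of_lt (by simpa using h)]; simp

theorem nth_mem_or (l : List ℤ) (i : ℕ) : nth l i ∈ l ∨ nth l i = 0 := by
  rcases lt_or_ge i l.length with h | h
  · left; rw [nth_of_lt h]; exact List.getElem_mem h
  · right; exact nth_of_le h

theorem natAbs_nth_le {l : List ℤ} (h : ∀ z ∈ l, z.natAbs ≤ X) (i : ℕ) : (nth l i).natAbs ≤ X := by
  rcases nth_mem_or l i with h' | h'
  · exact h _ h'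
  · simp [h']

theorem map_range_nth (l : List ℤ) : (List.range l.length).map (nth l) = l := by
  apply List.ext_getElem (by simp)
  intro i h1 h2
  simp [nth_of_lt h2]

theorem range_map_append (f : ℕ → ℤ) (m n : ℕ) : (List.range (m + n)).map f =
    (List.range m).map f ++ (List.range n).map (fun i => f (m + i)) := by
  rw [List.range_add]; simp [Function.comp_def]

/-- The array `a` starts with the list `l`. -/
def Has (s : State) (a : ℕ) (l : List ℤ) : Prop := ∀ i < l.length, s.mem a i = nth l i

theorem Has.nil (s : State) (a : ℕ) : Has s a [] := fun i hi => by simp at hi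

theorem Has.of_mem_eq {s s' : State} {a : ℕ} {l : List ℤ} (h : Has s a l)
    (hm : s'.mem a = s.mem a) : Has s' a l := fun i hi => by rw [hm]; exact h i hi

theorem has_of_mem_eq_nth {s : State} {a : ℕ} {l : List ℤ} (h : s.mem a = nth l) : Has s a l :=
  fun i _ => by rw [h]

@[simp] theorem has_setReg {s : State} {r : ℕ} {z : ℤ} {a : ℕ} {l : List ℤ} :
    Has (s.setReg r z) a l ↔ Has s a l := Iff.rfl

theorem Has.setMem_ne {s : State} {a b i : ℕ} {l : List ℤ} {z : ℤ} (h : Has s a l) (hb : a ≠ b) :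
    Has (s.setMem b i z) a l := h.of_mem_eq (setMem_mem_ne _ _ _ _ _ hb)

theorem Has.push {s : State} {a : ℕ} {l : List ℤ} {z : ℤ} (h : Has s a l) :
    Has (s.setMem a l.length z) a (l ++ [z]) := fun i hi => by
  rw [setMem_mem]
  simp only [List.length_append, List.length_singleton] at hi
  split_ifs with h'
  · rw [h'.2, nth_append_right le_rfl]; simp
  · have : i < l.length := by simp at h'; omega
    rw [nth_append_left this, h i this]

/-- Overwriting an entry of a list. -/
theorem Has.set {s : State} {a : ℕ} {l l' : List ℤ} {x z : ℤ} (h : Has s a (l ++ x :: l')) :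
    Has (s.setMem a l.length z) a (l ++ z :: l') := fun i hi => by
  rw [setMem_mem]
  split_ifs with h'
  · rw [h'.2, nth_append_right le_rfl]; simp
  · have h2 := h i (by simpa using hi)
    simp at h'
    rw [h2]
    rcases lt_or_gt_of_ne h' with h3 | h3
    · rw [nth_append_left h3, nth_append_left h3]
    · obtain ⟨k, rfl⟩ := Nat.exists_eq_add_of_lt h3
      rw [add_assoc, nth_append_add, nth_append_add]; simp

theorem has_write (s : State) (a : ℕ) (l : List ℤ) : Has (s.write a l) a l := fun i hi => by
  rw [write_mem_self]; simp [nth, hi]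

theorem Has.read {s : State} {a : ℕ} {l : List ℤ} (h : Has s a l) : s.read a l.length = l := by
  unfold State.read
  conv_rhs => rw [← map_range_nth l]
  exact List.map_congr_left fun i hi => h i (List.mem_range.mp hi)

theorem Has.read' {s : State} {a n : ℕ} {l : List ℤ} (h : Has s a l) (hn : n = l.length) :
    s.read a n = l := hn ▸ h.read

theorem init_mem_zero (l : List ℤ) : (State.init l).mem 0 = nth l := by
  funext i; simp [State.init, nth]

theorem init_mem_ne (l : List ℤ) {a : ℕ} (h : a ≠ 0) : (State.init l).mem a = fun _ => 0 := by
  funext i; simp [State.init, h]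

theorem init_reg_zero (l : List ℤ) : (State.init l).reg 0 = l.length := by simp [State.init]

theorem init_reg_ne (l : List ℤ) {r : ℕ} (h : r ≠ 0) : (State.init l).reg r = 0 := by
  simp [State.init, h]

theorem bdd_init {l : List ℤ} (hl : ∀ z ∈ l, z.natAbs ≤ X) (hn : l.length ≤ X) :
    Bdd X (State.init l) := by
  refine ⟨fun r => ?_, fun a i => ?_⟩
  · by_cases h : r = 0
    · subst h; rw [init_reg_zero]; simpa using hn
    · rw [init_reg_ne _ h]; simp
  · by_cases h : a = 0
    · subst h; rw [init_mem_zero]; exact natAbs_nth_le hl i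
    · rw [init_mem_ne _ h]; simp

/-- On the input `l` the program `c` halts with output `out`, at cost at most `b`. -/
def RunsIn (c : Cmd) (l out : List ℤ) (b : ℕ) : Prop := ∃ t ≤ b, Runs c l out t

theorem RunsIn.le {l out : List ℤ} (h : RunsIn c l out b) (hb : b ≤ b') : RunsIn c l out b' := by
  obtain ⟨t, h1, h2⟩ := h
  exact ⟨t, h1.trans hb, h2⟩

theorem RunsIn.of_wp {l out : List ℤ} (hl : ∀ z ∈ l, z.natAbs ≤ X) (hn : l.length ≤ X)
    (h : wp X c (State.init l) b (fun s => s.output = out)) : RunsIn c l out (b * lg X) := by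
  obtain ⟨s', t, h1, h2, -, h3⟩ := h (bdd_init hl hn)
  exact ⟨t, h2, s', h1, h3⟩

theorem copyCost_le {l : List ℤ} (hl : ∀ z ∈ l, z.natAbs ≤ X) (hn : l.length ≤ X) :
    copyCost l ≤ 2 * l.length * lg X := by
  have : ∀ x ∈ l.map (fun z => len z + len (l.length : ℤ)), x ≤ 2 * lg X := by
    intro x hx
    obtain ⟨z, hz, rfl⟩ := List.mem_map.mp hx
    have h1 := len_le_lg (hl z hz)
    have h2 : len (l.length : ℤ) ≤ lg X := len_le_lg (by simpa using hn)
    omega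
  have h := List.sum_le_card_nsmul _ _ this
  simp only [List.length_map, smul_eq_mul] at h
  unfold copyCost
  calc _ ≤ _ := h
    _ = _ := by ring

/-- The rule for calls.  The cost of the routine is an arbitrary multiple of the word length of the
caller, so the routine may use numbers beyond the bound `X` for the memory of the caller. -/
theorem wp_call {body : Cmd} {src dst r : ℕ} {n : Expr} {l out : List ℤ} {b : ℕ}
    (hl : Has s src l) (hn : n.eval s = l.length) (hlX : l.length ≤ X)
    (hr : RunsIn body l out (b * lg X)) (hout : ∀ z ∈ out, z.natAbs ≤ X) (hoX : out.length ≤ X)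
    (hQ : Has ((s.write dst out).setReg r out.length) dst out →
      Q ((s.write dst out).setReg r out.length)) :
    wp X (.call body src n dst r) s (b + n.C + 2 * l.length + 2 * out.length + 1) Q := fun hs => by
  obtain ⟨t, ht, s', hs', rfl⟩ := hr
  have hread : s.read src (n.eval s).toNat = l := by rw [hn, Int.toNat_natCast]; exact hl.read
  have hlb : ∀ z ∈ l, z.natAbs ≤ X := by
    intro z hz
    rw [← hread] at hz
    obtain ⟨i, -, rfl⟩ := List.mem_map.mp hz
    exact hs.2 _ _
  refine ⟨_, _, Exec.call (src := src) (n := n) (dst := dst) (r := r) (s := s)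
    (by rw [hread]; exact hs'), ?_, ?_, hQ ?_⟩
  · rw [hread]
    have h1 := copyCost_le hlb hlX
    have h2 := copyCost_le hout hoX
    have h3 := n.cost_add_len_le hs
    have h4 : len (s'.output.length : ℤ) ≤ lg X := len_le_lg (by simpa using hoX)
    simp only [add_mul, one_mul]
    omega
  · exact (hs.write hout).setReg (by simpa using hoX)
  · rw [has_setReg]; exact has_write _ _ _

/-! ### Derived commands -/

/-- Append the value of `e` to the list in the array `a`, whose length is in the register `q`. -/
def push (a q : ℕ) (e : Expr) : Cmd :=
  .seq (.store a (.reg q) e) (.assign q (.add (.reg q) (.const 1)))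

/-- `for j = 0, …, N - 1 do c`. -/
def For (j : ℕ) (N : Expr) (c : Cmd) : Cmd :=
  .seq (.assign j (.const 0)) (.loop (.le (.add (.reg j) (.const 1)) N)
    (.seq c (.assign j (.add (.reg j) (.const 1)))))

/-- Append the values of `e` for `j = 0, …, N - 1`. -/
def tab (j a q : ℕ) (N e : Expr) : Cmd := For j N (push a q e)

/-- Return the list in the array `a`, whose length is in the register `q`. -/
def ret (a q : ℕ) : Cmd := .call .skip a (.reg q) 0 0

theorem wp_push {a q : ℕ} {e : Expr} {l : List ℤ} (hl : Has s a l) (hq : s.reg q = l.length)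
    (hX : l.length + 1 ≤ X) (he : Bdd X s → (e.eval s).natAbs ≤ X)
    (hQ : Has ((s.setMem a l.length (e.eval s)).setReg q (l.length + 1 : ℕ)) a
        (l ++ [e.eval s]) → Q ((s.setMem a l.length (e.eval s)).setReg q (l.length + 1 : ℕ))) :
    wp X (push a q e) s (e.C + 11) Q := by
  have h := wp_seq (wp_store (a := a) (i := .reg q) he
    (wp_assign (X := X) (r := q) (e := .add (.reg q) (.const 1)) (Q := Q) (fun _ => ?_) ?_))
  · refine h.le ?_
    simp only [Expr.C, Expr.K, Expr.L, Int.natAbs_one]; omega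
  · simp only [Expr.eval, setMem_reg, hq]; omega
  · simp only [Expr.eval, setMem_reg, hq, Int.toNat_natCast]
    have := hQ (has_setReg.mpr hl.push)
    simpa using this

/-- The rule for appending with the value `v` of the expression made explicit. -/
theorem wp_pushv {a q : ℕ} {e : Expr} {l : List ℤ} (v : ℤ) (hl : Has s a l)
    (hq : s.reg q = l.length) (hX : l.length + 1 ≤ X) (hv : e.eval s = v) (hvX : v.natAbs ≤ X)
    (hQ : Has ((s.setMem a l.length v).setReg q (l.length + 1 : ℕ)) a (l ++ [v]) →
      Q ((s.setMem a l.length v).setReg q (l.length + 1 : ℕ))) :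
    wp X (push a q e) s (e.C + 11) Q := by
  subst hv; exact wp_push hl hq hX (fun _ => hvX) hQ

/-- The rule for bounded loops, with an invariant `I i` and a budget `b i` for the pass `i`. -/
theorem wp_for {j : ℕ} {N : Expr} (n : ℕ) (I : ℕ → State → Prop) (b : ℕ → ℕ)
    (hj : j ∉ c.wregs) (hn : n ≤ X)
    (hN : ∀ i ≤ n, ∀ s', Fr (j :: c.wregs) c.warrs s s' → I i s' → N.eval s' = n)
    (h0 : I 0 (s.setReg j 0))
    (hstep : ∀ i < n, ∀ s', Bdd X s' → Fr (j :: c.wregs) c.warrs s s' → s'.reg j = i → I i s' →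
      wp X c s' (b i) (fun s'' => I (i + 1) (s''.setReg j (i + 1 : ℕ))))
    (hQ : ∀ s', Bdd X s' → Fr (j :: c.wregs) c.warrs s s' → s'.reg j = n → I n s' → Q s') :
    wp X (For j N c) s ((∑ i ∈ Finset.range n, b i) + (n + 1) * (N.C + 21)) Q := by
  set J : ℕ → State → Prop := fun B s' => ∃ i, i ≤ n ∧
    B = (∑ k ∈ Finset.Ico i n, b k) + (n - i + 1) * (N.C + 19) ∧
    Fr (j :: c.wregs) c.warrs s s' ∧ s'.reg j = i ∧ I i s' with hJ
  have hcond : ∀ (i : ℕ) (s' : State), s'.reg j = (i : ℤ) → N.eval s' = n →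
      (Expr.le (.add (.reg j) (.const 1)) N).eval s' = if i < n then 1 else 0 := by
    intro i s' h1 h2
    simp only [Expr.eval, h1, h2]
    congr 1
    exact propext (by omega)
  have hC : (Expr.le (.add (.reg j) (.const 1)) N).C = N.C + 10 := by
    simp only [Expr.C, Expr.K, Expr.L, Int.natAbs_one]; omega
  have hC' : (Expr.add (.reg j) (.const 1)).C = 9 := by
    simp only [Expr.C, Expr.K, Expr.L, Int.natAbs_one]
  have hmain := wp_while (X := X) (Q := Q) (c := .seq c (.assign j (.add (.reg j) (.const 1))))
    (e := .le (.add (.reg j) (.const 1)) N) J (by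
      rintro B s' hb ⟨i, hi, rfl, hF, hji, hI⟩
      rw [hC, hcond i s' hji (hN i hi s' hF hI)]
      rcases hi.lt_or_eq with hi' | rfl
      · right
        refine ⟨by simp [hi'], b i + 9, (∑ k ∈ Finset.Ico (i + 1) n, b k) +
          (n - (i + 1) + 1) * (N.C + 19), ?_, ?_⟩
        · rw [Finset.sum_eq_sum_Ico_succ_bot hi']
          obtain ⟨d, rfl⟩ := Nat.exists_eq_add_of_lt hi'
          have h1 : i + d + 1 - i = d + 1 := by omega
          have h2 : i + d + 1 - (i + 1) = d := by omega
          rw [h1, h2]; nlinarith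
        · rw [← hC']
          refine wp_seq ((hstep i hi' s' hb hF hji hI).imp fun s₁ hb₁ hF₁ hI₁ => ?_)
          have hr : s₁.reg j = i := by rw [hF₁.reg j hj, hji]
          have hv : (Expr.add (.reg j) (.const 1)).eval s₁ = ((i + 1 : ℕ) : ℤ) := by
            simp [Expr.eval, hr]
          refine wp_assign (fun _ => by rw [hv]; omega) ?_
          rw [hv]
          refine ⟨i + 1, hi', rfl, ?_, by simp, hI₁⟩
          refine hF.trans (Fr.trans (hF₁.mono (List.subset_cons_self _ _) (List.Subset.refl _)) ?_)
          refine ⟨fun r hr => ?_, fun _ _ => rfl⟩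
          have : r ≠ j := fun h => hr (by simp [h])
          simp [this]
      · left
        refine ⟨by simp, by simp, hQ s' hb hF hji hI⟩)
  have h := wp_seq (b₂ := (∑ k ∈ Finset.Ico 0 n, b k) + (n - 0 + 1) * (N.C + 19)) (Q := Q)
    (wp_assign (X := X) (s := s) (r := j) (e := .const 0) (fun _ => by simp [Expr.eval])
      (hmain _ _ ⟨0, by omega, rfl, ?_, by simp [Expr.eval], by simpa [Expr.eval] using h0⟩))
  · refine h.le ?_
    simp only [Expr.C, Expr.K, Expr.L, Int.natAbs_zero, Nat.Ico_zero_eq_range, Nat.sub_zero]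
    nlinarith
  · refine ⟨fun r hr => ?_, fun _ _ => rfl⟩
    have : r ≠ j := fun h => hr (by simp [h])
    simp [this]

theorem wp_tab {j a q : ℕ} {N e : Expr} (n : ℕ) (g : ℕ → ℤ) {l : List ℤ} (hjq : j ≠ q)
    (hl : Has s a l) (hq : s.reg q = l.length) (hX : l.length + n ≤ X)
    (hN : ∀ s', Fr [j, q] [a] s s' → N.eval s' = n)
    (he : ∀ i < n, ∀ s', Bdd X s' → Fr [j, q] [a] s s' → s'.reg j = i →
      e.eval s' = g i ∧ (g i).natAbs ≤ X)
    (hQ : ∀ s', Fr [j, q] [a] s s' → s'.reg q = (l.length + n : ℕ) →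
      Has s' a (l ++ (List.range n).map g) → Q s') :
    wp X (tab j a q N e) s (n * (e.C + 11) + (n + 1) * (N.C + 21)) Q := by
  have hmono : ∀ {s'}, Fr (j :: (push a q e).wregs) (push a q e).warrs s s' → Fr [j, q] [a] s s' :=
    fun h => h.mono (by simp [push, Cmd.wregs]) (by simp [push, Cmd.warrs])
  refine (wp_for n (fun i s' => s'.reg q = (l.length + i : ℕ) ∧
    Has s' a (l ++ (List.range i).map g)) (fun _ => e.C + 11) ?_ (by omega) ?_ ?_ ?_ ?_).le ?_
  · simpa [push, Cmd.wregs] using hjq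
  · intro i _ s' hF _; exact hN s' (hmono hF)
  · simpa [hjq.symm, hq] using hl
  · rintro i hi s' hb hF hji ⟨h1, h2⟩
    obtain ⟨h3, h4⟩ := he i hi s' hb (hmono hF) hji
    refine wp_push h2 (by simpa using h1) (by simp; omega) (fun _ => by rw [h3]; exact h4) ?_
    intro h5
    refine ⟨by simp [hjq.symm]; ring, ?_⟩
    rw [h3] at h5
    rw [h3, has_setReg, List.range_succ, List.map_append, ← List.append_assoc]
    exact h5
  · rintro s' hb hF hji ⟨h1, h2⟩
    exact hQ s' (hmono hF) h1 h2
  · simp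

theorem wp_ret {a q : ℕ} {l : List ℤ} (hl : Has s a l) (hq : s.reg q = l.length)
    (hX : l.length ≤ X) (hQ : ∀ s', s'.output = l → Q s') :
    wp X (ret a q) s (4 * l.length + 4) Q := wp_bdd fun hs => by
  have hlb : ∀ z ∈ l, z.natAbs ≤ X := by
    intro z hz
    obtain ⟨i, hi, rfl⟩ := List.getElem_of_mem hz
    rw [← nth_of_lt hi, ← hl i hi]; exact hs.2 _ _
  refine (wp_call (b := 1) (out := l) hl (by simpa [Expr.eval] using hq) hX ?_ hlb hX
    fun h => hQ _ ?_).le ?_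
  · refine ⟨1, by have := one_le_lg X; omega, _, .skip _, ?_⟩
    rw [State.output, init_reg_zero]
    exact (has_of_mem_eq_nth (init_mem_zero l)).read' (by simp)
  · rw [State.output]; exact h.read' (by simp)
  · simp only [Expr.C, Expr.K, Expr.L]; omega

/-! ### Iterated calls -/

/-- The list `l` is stored like the input of a run. -/
def At (s : State) (l : List ℤ) : Prop := s.reg 0 = l.length ∧ Has s 0 l

theorem at_init (l : List ℤ) : At (State.init l) l :=
  ⟨init_reg_zero l, has_of_mem_eq_nth (init_mem_zero l)⟩

theorem At.output {l : List ℤ} (h : At s l) : s.output = l :=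
  h.2.read' (by rw [h.1, Int.toNat_natCast])

theorem len_le_copyCost {l : List ℤ} {z : ℤ} (hz : z ∈ l) :
    len z + len (l.length : ℤ) ≤ copyCost l :=
  List.single_le_sum (by simp) _ (List.mem_map.mpr ⟨z, hz, rfl⟩)

/-- Apply the routine `c` to the list at hand as long as the first entry of the list is not `0`. -/
def iter (c : Cmd) : Cmd := .loop (.load 0 (.const 0)) (.call c 0 (.reg 0) 0 0)

/-- Iterated calls halt if `I j l` says that at most `j` further calls are due for the list `l`.
The costs are those of the calls, without any common bound for the numbers involved. -/
theorem iter_exec {c : Cmd} (I : ℕ → List ℤ → Prop) (T C : ℕ)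
    (hI : ∀ j l, I j l → l ≠ [] ∧ copyCost l ≤ C ∧ (nth l 0 = 0 ∨ (nth l 0 ≠ 0 ∧
      ∃ j' l', j = j' + 1 ∧ I j' l' ∧ RunsIn c l l' T))) :
    ∀ j l s, I j l → At s l → ∃ s' t l' j', Exec (iter c) s s' t ∧ At s' l' ∧ I j' l' ∧
      nth l' 0 = 0 ∧ t ≤ j * (T + 6 * C) + 3 * C := by
  intro j
  induction j with
  | zero =>
    intro l s hl hs
    obtain ⟨h1, h2, h3⟩ := hI 0 l hl
    rcases h3 with h3 | ⟨-, j', l', h, -⟩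
    · obtain ⟨x, l, rfl⟩ := List.exists_cons_of_ne_nil h1
      have h4 := len_le_copyCost (List.mem_cons_self (a := x) (l := l))
      have h5 := one_le_len ((x :: l).length : ℤ)
      have h6 : s.mem 0 0 = x := hs.2 0 (by simp)
      refine ⟨s, _, _, 0, .loopDone (by simpa [Expr.eval, h6] using h3), hs, hl, h3, ?_⟩
      simp only [Expr.eval, Expr.cost, Int.toNat_zero, h6]
      have : len 0 = 1 := by simp [len]
      have := one_le_len x
      omega
    · omega
  | succ j ih =>
    intro l s hl hs
    obtain ⟨h1, h2, h3⟩ := hI (j + 1) l hl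
    obtain ⟨x, l, rfl⟩ := List.exists_cons_of_ne_nil h1
    have h4 := len_le_copyCost (List.mem_cons_self (a := x) (l := l))
    have h5 := one_le_len ((x :: l).length : ℤ)
    have h6 : s.mem 0 0 = x := hs.2 0 (by simp)
    have h7 : len 0 = 1 := by simp [len]
    have h8 := one_le_len x
    rcases h3 with h3 | ⟨h3, j', l', h, hIl, t, ht, s₁, hs₁, ho⟩
    · refine ⟨s, _, _, j + 1, .loopDone (by simpa [Expr.eval, h6] using h3), hs, hl, h3, ?_⟩
      simp only [Expr.eval, Expr.cost, Int.toNat_zero, h6]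
      nlinarith
    · obtain rfl : j = j' := by omega
      have hn : (Expr.reg 0).eval s = ((x :: l).length : ℤ) := hs.1
      have hread : s.read 0 ((Expr.reg 0).eval s).toNat = x :: l :=
        hs.2.read' (by rw [hn, Int.toNat_natCast])
      have hcall := Exec.call (src := 0) (n := .reg 0) (dst := 0) (r := 0) (s := s)
        (by rw [hread]; exact hs₁)
      rw [hread, ho] at hcall
      obtain ⟨s₂, t₂, l₂, j₂, h9, h10, h11, h12, h13⟩ := ih l'
        ((s.write 0 l').setReg 0 l'.length) hIl ⟨by simp, has_setReg.mpr (has_write _ _ _)⟩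
      refine ⟨s₂, _, l₂, j₂, .loopStep (by simpa [Expr.eval, h6] using h3) hcall h9, h10, h11,
        h12, ?_⟩
      obtain ⟨h14, h15, -⟩ := hI j l' hIl
      obtain ⟨y, l', rfl⟩ := List.exists_cons_of_ne_nil h14
      have h16 := len_le_copyCost (List.mem_cons_self (a := y) (l := l'))
      have hc0 : (Expr.load 0 (.const 0)).cost s = 2 + len x := by
        simp [Expr.cost, Expr.eval, h6, h7]
      have he0 : (Expr.load 0 (.const 0)).eval s = x := by simp [Expr.eval, h6]
      have hc1 : (Expr.reg 0).cost s = len ((x :: l).length : ℤ) := by simp [Expr.cost, hs.1]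
      rw [hc0, he0, hc1, hn]
      have := one_le_len y
      nlinarith

/-! ### Merging a list of vectors pairwise -/

/-- A vector preceded by its length. -/
def seg (v : List ℤ) : List ℤ := (v.length : ℤ) :: v

@[simp] theorem length_seg (v : List ℤ) : (seg v).length = v.length + 1 := rfl

theorem toNat_add_cast (a b : ℕ) : ((a : ℤ) + b).toNat = a + b := by omega

theorem nth_mid_seg (p v q : List ℤ) : nth (p ++ (seg v ++ q)) p.length = v.length := by
  rw [nth_append_right le_rfl, Nat.sub_self]; rfl

theorem map_nth_mid (p v q : List ℤ) :
    (List.range v.length).map (fun i => nth (p ++ (v ++ q)) (p.length + i)) = v := by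
  conv_rhs => rw [← map_range_nth v]
  apply List.map_congr_left
  intro i hi
  rw [nth_append_add, nth_append_left (List.mem_range.mp hi)]

/-- One round of merging: the input is the number of vectors minus `1`, then the vectors with their
lengths; adjacent vectors are merged by the routine `op`.  Register `2` is the reading position, the
registers `3` and `4` are the ends of the next two vectors, and array `1` collects the output. -/
def level (op : Cmd) : Cmd :=
  .seq (push 1 1 (.div (.load 0 (.const 0)) (.const 2))) <|
  .seq (.assign 2 (.const 1)) <|
  .seq (.loop (.le (.add (.reg 2) (.const 1)) (.reg 0)) <|
    .seq (.assign 3 (.add (.add (.reg 2) (.const 1)) (.load 0 (.reg 2)))) <|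
    .branch (.le (.add (.reg 3) (.const 1)) (.reg 0))
      (.seq (.assign 4 (.add (.add (.reg 3) (.const 1)) (.load 0 (.reg 3)))) <|
       .seq (.assign 6 (.const 0)) <|
       .seq (tab 5 2 6 (.sub (.reg 4) (.reg 2)) (.load 0 (.add (.reg 2) (.reg 5)))) <|
       .seq (.call op 2 (.reg 6) 3 7) <|
       .seq (push 1 1 (.reg 7)) <|
       .seq (tab 5 1 1 (.reg 7) (.load 3 (.reg 5)))
         (.assign 2 (.reg 4)))
      (.seq (tab 5 1 1 (.sub (.reg 3) (.reg 2)) (.load 0 (.add (.reg 2) (.reg 5))))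
         (.assign 2 (.reg 3))))
    (ret 1 1)

/-- Merge all vectors of a list, in rounds. -/
def treeOf (op : Cmd) : Cmd := iter (level op)

/-- The routine `op` merges two vectors that represent lists of objects (in the sense of `Rep`)
into a vector for the concatenation, as long as this is a sublist of `all`.  Its cost is linear up
to the factor `G`. -/
structure MergeOp {ζ : Type} (op : Cmd) (G X : ℕ) (Rep : List ℤ → List ζ → Prop)
    (all : List ζ) : Prop where
  merge : ∀ a b z w, Rep a z → Rep b w → (z ++ w).Sublist all → a.length + b.length + 2 ≤ X →
    ∃ out, RunsIn op (seg a ++ seg b) out ((a.length + b.length + 2) * G * lg X) ∧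
      Rep out (z ++ w) ∧ out.length ≤ a.length + b.length
  bound : ∀ a z, Rep a z → z.Sublist all → ∀ x ∈ a, x.natAbs ≤ X

theorem length_le_of_flatMap {vs : List (List ℤ)} : vs.length ≤ (vs.flatMap seg).length := by
  induction vs with
  | nil => simp
  | cons v vs ih => simp only [List.flatMap_cons, List.length_append, length_seg,
      List.length_cons]; omega

theorem MergeOp.bound_flatMap {ζ : Type} {op : Cmd} {G X : ℕ} {Rep : List ℤ → List ζ → Prop}
    {all : List ζ} (h : MergeOp op G X Rep all) {vs : List (List ℤ)} {zs : List (List ζ)}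
    (hvz : List.Forall₂ Rep vs zs) (hz : zs.flatten.Sublist all)
    (hX : (vs.flatMap seg).length ≤ X) : ∀ x ∈ vs.flatMap seg, x.natAbs ≤ X := by
  induction hvz with
  | nil => simp
  | @cons v z vs zs h1 _ ih =>
    rw [List.flatMap_cons, List.length_append, length_seg] at hX
    rw [List.flatten_cons] at hz
    intro x hx
    rw [List.flatMap_cons, List.mem_append] at hx
    rcases hx with hx | hx
    · rcases List.mem_cons.mp hx with rfl | hx
      · simp; omega
      · exact h.bound _ _ h1 ((List.sublist_append_left _ _).trans hz) _ hx
    · exact ih ((List.sublist_append_right _ _).trans hz) (by omega) x hx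

set_option maxHeartbeats 1000000 in
/-- One round of merging has linear cost and halves the number of vectors. -/
theorem level_runs {ζ : Type} {op : Cmd} {G X : ℕ} {Rep : List ℤ → List ζ → Prop}
    {all : List ζ} (h : MergeOp op G X Rep all) {vs : List (List ℤ)} {zs : List (List ζ)}
    (hvs : vs ≠ []) (hvz : List.Forall₂ Rep vs zs) (hz : zs.flatten.Sublist all)
    (hX : 2 * (vs.flatMap seg).length + 4 ≤ X) :
    ∃ (vs' : List (List ℤ)) (zs' : List (List ζ)), List.Forall₂ Rep vs' zs' ∧
      zs'.flatten = zs.flatten ∧ (vs'.flatMap seg).length ≤ (vs.flatMap seg).length ∧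
      vs'.length = (vs.length + 1) / 2 ∧
      RunsIn (level op) (((vs.length : ℤ) - 1) :: vs.flatMap seg)
        (((vs'.length : ℤ) - 1) :: vs'.flatMap seg)
        ((vs.flatMap seg).length * (G + 300) * lg X) := by
  set l : List ℤ := ((vs.length : ℤ) - 1) :: vs.flatMap seg with hl
  set N := (vs.flatMap seg).length with hN
  set S := vs.length with hS
  have hSpos : 0 < S := List.length_pos_iff.mpr hvs
  have hSN : S ≤ N := length_le_of_flatMap
  have hlen : l.length = N + 1 := by simp [hl, hN]
  have hlb : ∀ x ∈ l, x.natAbs ≤ X := by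
    intro x hx
    rcases List.mem_cons.mp hx with rfl | hx
    · omega
    · exact h.bound_flatMap hvz hz (by omega) x hx
  -- The output is only known after the run, so the postcondition of the run records it.
  set Post : State → Prop := fun s => ∃ (vs' : List (List ℤ)) (zs' : List (List ζ)),
      List.Forall₂ Rep vs' zs' ∧
      zs'.flatten = zs.flatten ∧ (vs'.flatMap seg).length ≤ N ∧
      vs'.length = (S + 1) / 2 ∧ s.output = (((vs'.length : ℤ) - 1) :: vs'.flatMap seg) with hPost
  have hhdr : ((S : ℤ) - 1) / 2 = (((S + 1) / 2 : ℕ) : ℤ) - 1 := by omega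
  suffices hwp : wp X (level op) (State.init l) (N * (G + 300)) Post by
    obtain ⟨s', t, h1, h2, -, vs', zs', h3, h4, h5, h6, h7⟩ :=
      hwp (bdd_init hlb (by omega))
    exact ⟨vs', zs', h3, h4, h5, h6, t, h2, s', h1, h7⟩
  have hb0 : Bdd X (State.init l) := bdd_init hlb (by omega)
  -- The vectors before the reading position have been merged to `outs`; `rest` is left.
  set Inv : ℕ → State → Prop := fun B s => ∃ (pre : List ℤ) (rest : List (List ℤ))
    (zr : List (List ζ)) (outs : List (List ℤ)) (zo : List (List ζ)),
    l = pre ++ rest.flatMap seg ∧ List.Forall₂ Rep rest zr ∧ List.Forall₂ Rep outs zo ∧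
    zo.flatten ++ zr.flatten = zs.flatten ∧
    (outs.flatMap seg).length + (rest.flatMap seg).length ≤ N ∧
    outs.length + (rest.length + 1) / 2 = (S + 1) / 2 ∧
    s.mem 0 = nth l ∧ s.reg 0 = l.length ∧ s.reg 2 = pre.length ∧
    Has s 1 (((S : ℤ) - 1) / 2 :: outs.flatMap seg) ∧
    s.reg 1 = ((outs.flatMap seg).length + 1 : ℕ) ∧
    B = (rest.flatMap seg).length * (G + 220) + 15 with hInv
  unfold level
  refine wp.le (b := 40 + (4 + (N * (G + 220) + 15 + (4 * (N + 1) + 4))))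
    ?_ (by nlinarith)
  apply wp_seq; refine (wp.le (wp_pushv (l := [])
    (((S : ℤ) - 1) / 2) (Has.nil _ _) (by simp [init_reg_ne]) (by rw [List.length_nil]; omega)
    (by simp [Expr.eval, init_mem_zero, hl]) (by omega) fun h1 => ?_)
      (by simp [Expr.C, Expr.K, Expr.L]))
  apply wp_seq; refine (wp_set 1 (by simp [Expr.eval]) (by simp; omega) ?_)
  apply wp_seq; refine (wp_while Inv ?_ _ _ ?_)
  · rintro B s hbs ⟨pre, rest, zr, outs, zo, hpre, hrz, hoz, hfl, hlen', hcnt, hm0, hr0, hr2, hm1,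
      hr1, rfl⟩
    have hprelen : N + 1 = pre.length + (rest.flatMap seg).length := by
      rw [← hlen, hpre, List.length_append]
    have hcost : (Expr.le (.add (.reg 2) (.const 1)) (.reg 0)).C = 12 := by
      simp [Expr.C, Expr.K, Expr.L]
    rw [hcost]
    rcases hrz with _ | ⟨hv1, hrz⟩
    · left
      refine ⟨?_, by simp, ?_⟩
      · simp only [Expr.eval, hr2, hr0, hlen]
        rw [if_neg]
        simp at hprelen; omega
      · refine wp.le (wp_ret hm1 (by rw [hr1, List.length_cons])
          (by rw [List.length_cons]; omega) fun s' hs' => ?_) (by rw [List.length_cons]; omega)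
        refine ⟨outs, zo, hoz, by simpa using hfl, by simpa using hlen', by simpa using hcnt, ?_⟩
        rw [hs', hhdr]; congr 2; simp at hcnt; omega
    · rename_i v z rest zr
      right
      set R := (rest.flatMap seg).length with hR
      have hnv : nth l pre.length = v.length := by
        rw [hpre, List.flatMap_cons]; exact nth_mid_seg _ _ _
      have hlv : ((v :: rest).flatMap seg).length = v.length + 1 + R := by simp [hR]
      rw [hlv] at hprelen hlen' ⊢
      refine ⟨?_, ?_⟩
      · simp only [Expr.eval, hr2, hr0, hlen]
        rw [if_pos (by omega)]; decide
      have hset3 : (Expr.add (.add (.reg 2) (.const 1)) (.load 0 (.reg 2))).eval s =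
          ((pre.length + 1 + v.length : ℕ) : ℤ) := by simp [Expr.eval, hr2, hm0, hnv]
      rcases hrz with _ | ⟨hw1, hrz⟩
      rotate_left
      · rename_i w z2 rest zr
        set R' := (rest.flatMap seg).length with hR'
        have hlw : R = w.length + 1 + R' := by simp [hR, hR']
        have hpre2 : l = pre ++ (seg v ++ seg w) ++ rest.flatMap seg := by
          rw [hpre]; simp
        have hnw : nth l (pre.length + 1 + v.length) = w.length := by
          have := nth_mid_seg (pre ++ seg v) w (rest.flatMap seg)
          rw [← this, hpre2]
          congr 1 <;> simp; omega
        have hsub : (z ++ z2).Sublist all := by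
          refine List.Sublist.trans ?_ hz
          rw [← hfl]
          simp only [List.flatten_cons, ← List.append_assoc]
          refine List.Sublist.trans ?_ (List.sublist_append_left _ _)
          rw [List.append_assoc]
          exact List.sublist_append_right _ _
        obtain ⟨out, hrun, hrep, hol⟩ := h.merge v w z z2 hv1 hw1 hsub (by omega)
        apply wp_while_step (I := Inv) (R' * (G + 220) + 15)
        apply wp_seq; refine (wp_set _ hset3 (by omega) ?_)
        apply wp_branch_pos
        · simp [Expr.eval, hr0, hlen]; omega
        apply wp_seq; refine (wp_set ((pre.length + (v.length + 1 + (w.length + 1)) : ℕ) : ℤ)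
          ?_ (by omega) ?_)
        · simp only [Expr.eval, setReg_reg, setReg_mem, hm0, if_true, Int.toNat_natCast, hnw]
          push_cast; ring
        apply wp_seq; refine (wp_set 0 (by simp [Expr.eval]) (by simp) ?_)
        apply wp_seq; refine (wp_tab (l := []) (v.length + 1 + (w.length + 1))
          (fun i => nth l (pre.length + i)) (by decide) (Has.nil _ _) (by simp) (by simp; omega)
          ?_ ?_ ?_)
        · intro s' hF
          simp only [Expr.eval, hF.reg 4 (by decide), hF.reg 2 (by decide)]
          simp [hr2]
        · intro i hi s' hbs' hF h5
          refine ⟨?_, natAbs_nth_le hlb _⟩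
          simp only [Expr.eval, hF.mem 0 (by decide), hF.reg 2 (by decide), h5]
          simp [hr2, hm0, toNat_add_cast]
        intro s2 hF2 hr6 hm2
        have hvw : (List.range (v.length + 1 + (w.length + 1))).map
            (fun i => nth l (pre.length + i)) = seg v ++ seg w := by
          have := map_nth_mid pre (seg v ++ seg w) (rest.flatMap seg)
          rw [← List.append_assoc, ← hpre2] at this
          simpa using this
        rw [hvw, List.nil_append] at hm2
        apply wp_seq; refine (wp.le (b' := (v.length + w.length + 2) * (G + 4) + 8)
          (wp_call hm2 (by simp [Expr.eval, hr6]) (by simp; omega) hrun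
          (h.bound _ _ hrep hsub) (by omega) fun h3 => ?_)
          (by simp only [Expr.C, Expr.K, Expr.L, List.length_append, length_seg]; nlinarith))
        have e1 : s2.mem 0 = nth l := by rw [hF2.mem 0 (by decide)]; simpa using hm0
        have e2 : s2.reg 0 = l.length := by rw [hF2.reg 0 (by decide)]; simpa using hr0
        have e3 : s2.reg 4 = (pre.length + (v.length + 1 + (w.length + 1)) : ℕ) := by
          rw [hF2.reg 4 (by decide)]; simp
        have e4 : Has s2 1 (((S : ℤ) - 1) / 2 :: outs.flatMap seg) :=
          hm1.of_mem_eq (by rw [hF2.mem 1 (by decide)]; simp)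
        have e5 : s2.reg 1 = ((outs.flatMap seg).length + 1 : ℕ) := by
          rw [hF2.reg 1 (by decide)]; simpa using hr1
        apply wp_seq; refine (wp_pushv (out.length : ℤ) (l := ((S : ℤ) - 1) / 2 :: outs.flatMap seg)
          (e4.of_mem_eq (by rw [setReg_mem, write_mem_ne _ _ _ _ (by decide)]))
          (by simp [e5]) (by rw [List.length_cons]; omega) (by simp [Expr.eval]) (by simp; omega) fun h1' => ?_)
        apply wp_seq; refine (wp.le (b' := (v.length + w.length + 1) * 38)
          (wp_tab out.length (nth out) (by decide) h1' (by simp)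
          (by simp only [List.length_cons, List.length_append, List.length_nil]; omega)
          ?_ ?_ ?_) (by simp only [Expr.C, Expr.K, Expr.L]; omega))
        · intro s' hF
          simp only [Expr.eval, hF.reg 7 (by decide)]
          simp
        · intro i hi s' hbs' hF h5
          refine ⟨?_, natAbs_nth_le (h.bound _ _ hrep hsub) _⟩
          simp only [Expr.eval, hF.mem 3 (by decide), h5]
          have := h3 i hi
          rw [setReg_mem] at this
          rw [setReg_mem, setMem_mem_ne _ _ _ _ _ (by decide), setReg_mem, Int.toNat_natCast, this]
        intro s3 hF3 hr1' hm1'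
        rw [map_range_nth] at hm1'
        have f1 : s3.mem 0 = nth l := by
          rw [hF3.mem 0 (by decide), setReg_mem, setMem_mem_ne _ _ _ _ _ (by decide), setReg_mem,
            write_mem_ne _ _ _ _ (by decide), e1]
        refine wp_set ((pre.length + (v.length + 1 + (w.length + 1)) : ℕ) : ℤ) ?_ (by omega) ?_
        · simp only [Expr.eval, hF3.reg 4 (by decide)]
          simp [e3]
        refine ⟨pre ++ (seg v ++ seg w), rest, zr, outs ++ [out], zo ++ [z ++ z2], hpre2, hrz,
          List.rel_append hoz (List.Forall₂.cons hrep List.Forall₂.nil), ?_, ?_, ?_, f1, ?_, ?_,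
          ?_, ?_, rfl⟩
        · rw [← hfl]; simp
        · simp only [List.length_cons, List.length_append, List.length_nil, length_seg,
            List.flatMap_append, List.flatMap_cons, List.flatMap_nil] at *
          omega
        · simp at hcnt ⊢; omega
        · simp [hF3.reg 0 (by decide), e2]
        · rw [setReg_reg, if_pos rfl]; push_cast [List.length_append, length_seg]; ring
        · simpa [seg] using hm1'
        · simp [hr1']; ring
        simp only [Expr.C, Expr.K, Expr.L, hlw]; norm_num; nlinarith
      · apply wp_while_step (I := Inv) (0 * (G + 220) + 15)
        apply wp_seq; refine (wp_set _ hset3 (by omega) ?_)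
        apply wp_branch_neg
        · simp at hR; simp [Expr.eval, hr0, hlen]; omega
        apply wp_seq; refine (wp_tab (v.length + 1)
          (fun i => nth l (pre.length + i)) (by decide) (has_setReg.mpr hm1) (by simp [hr1])
          (by rw [List.length_cons]; omega) ?_ ?_ ?_)
        · intro s' hF
          simp only [Expr.eval, hF.reg 3 (by decide), hF.reg 2 (by decide)]
          simp [hr2]; ring
        · intro i hi s' hbs' hF h5
          refine ⟨?_, natAbs_nth_le hlb _⟩
          simp only [Expr.eval, hF.mem 0 (by decide), hF.reg 2 (by decide), h5]
          simp [hr2, hm0, toNat_add_cast]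
        intro s2 hF2 hr1' hm1'
        have hvw : (List.range (v.length + 1)).map (fun i => nth l (pre.length + i)) = seg v := by
          have := map_nth_mid pre (seg v) []
          rw [hpre]; simpa using this
        rw [hvw] at hm1'
        refine wp_set ((pre.length + 1 + v.length : ℕ) : ℤ) ?_ (by omega) ?_
        · simp only [Expr.eval, hF2.reg 3 (by decide)]; simp
        refine ⟨pre ++ seg v, [], [], outs ++ [v], zo ++ [z], by rw [hpre]; simp,
          List.Forall₂.nil, List.rel_append hoz (List.Forall₂.cons hv1 List.Forall₂.nil), ?_, ?_,
          ?_, ?_, ?_, ?_, ?_, ?_, rfl⟩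
        · rw [← hfl]; simp
        · simp only [List.length_cons, List.length_append, List.length_nil, length_seg,
            List.flatMap_append, List.flatMap_cons, List.flatMap_nil] at *
          omega
        · simp at hcnt ⊢; omega
        · rw [setReg_mem, hF2.mem 0 (by decide)]; simpa using hm0
        · simp [hF2.reg 0 (by decide), hr0]
        · rw [setReg_reg, if_pos rfl]; push_cast [List.length_append, length_seg]; ring
        · simpa [seg] using hm1'
        · simp [hr1']; ring
        simp only [Expr.C, Expr.K, Expr.L]; norm_num; nlinarith
  · refine ⟨[(S : ℤ) - 1], vs, zs, [], [], by simp [hl], hvz, List.Forall₂.nil, by simp,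
        by simp [hN],
      by simp [hS], ?_, ?_, ?_, ?_, ?_, rfl⟩
    · simp [setMem_mem_ne, init_mem_zero]
    · simp [init_reg_zero]
    · simp
    · simpa using h1
    · simp

/-- The logarithmic number of rounds adds a factor `lg X` to the linear cost of a round. -/
theorem treeOf_runs {ζ : Type} {op : Cmd} {G X : ℕ} {Rep : List ℤ → List ζ → Prop}
    {all : List ζ} (h : MergeOp op G X Rep all) {vs : List (List ℤ)} {zs : List (List ζ)}
    (hvs : vs ≠ []) (hvz : List.Forall₂ Rep vs zs) (hz : zs.flatten = all)
    (hX : 2 * (vs.flatMap seg).length + 4 ≤ X) :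
    ∃ v, Rep v all ∧ v.length < (vs.flatMap seg).length ∧
      RunsIn (treeOf op) (((vs.length : ℤ) - 1) :: vs.flatMap seg) (0 :: seg v)
        (lg X * ((vs.flatMap seg).length * (G + 350) * lg X)) := by
  set N := (vs.flatMap seg).length with hN
  have hSN : vs.length ≤ N := length_le_of_flatMap
  have hN1 : 1 ≤ N := le_trans (List.length_pos_iff.mpr hvs) hSN
  obtain ⟨s', t, l', j', h1, h2, ⟨vs', zs', h3, h4, h5, h6, h7, -⟩, h8, h9⟩ :=
      iter_exec (c := level op)
    (fun j l => ∃ (vs' : List (List ℤ)) (zs' : List (List ζ)), vs' ≠ [] ∧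
      List.Forall₂ Rep vs' zs' ∧ zs'.flatten = all ∧ (vs'.flatMap seg).length ≤ N ∧
      l = ((vs'.length : ℤ) - 1) :: vs'.flatMap seg ∧ vs'.length ≤ 2 ^ j)
    (N * (G + 300) * lg X) (2 * (N + 1) * lg X) (by
      rintro j l ⟨vs', zs', h3, h4, h5, h6, rfl, h8⟩
      have h9 : vs'.length ≤ (vs'.flatMap seg).length := length_le_of_flatMap
      have hpos : 0 < vs'.length := List.length_pos_iff.mpr h3
      refine ⟨by simp, ?_, ?_⟩
      · refine (copyCost_le (X := X) ?_ (by rw [List.length_cons]; omega)).trans ?_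
        · intro z hz'
          rcases List.mem_cons.mp hz' with rfl | hz'
          · omega
          · exact h.bound_flatMap h4 (by rw [h5]) (by omega) z hz'
        · rw [List.length_cons]; gcongr
      · rw [nth_cons_zero]
        rcases Nat.lt_or_ge 1 vs'.length with h10 | h10
        · right
          refine ⟨by omega, ?_⟩
          rcases j with _ | j
          · rw [pow_zero] at h8; omega
          obtain ⟨ws, zs₂, h11, h12, h13, h14, h15⟩ := level_runs h h3 h4 (by rw [h5]) (by omega)
          refine ⟨j, _, rfl, ⟨ws, zs₂, ?_, h11, h12.trans h5, h13.trans h6, rfl, ?_⟩,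
            h15.le ?_⟩
          · rw [← List.length_pos_iff]; omega
          · rw [pow_succ] at h8; omega
          · gcongr
        · left; omega)
    (lg X) _ (State.init (((vs.length : ℤ) - 1) :: vs.flatMap seg))
    ⟨vs, zs, hvs, hvz, hz, le_rfl, rfl, (Nat.lt_pow_succ_log_self Nat.one_lt_two _).le.trans
      (Nat.pow_le_pow_right (by omega) (lg_mono (by omega)))⟩ (at_init _)
  subst h7
  rw [nth_cons_zero] at h8
  obtain ⟨v, rfl⟩ := List.length_eq_one_iff.mp (show vs'.length = 1 by omega)
  obtain ⟨z, rfl⟩ := List.length_eq_one_iff.mp (show zs'.length = 1 by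
    rw [← h4.length_eq, List.length_singleton])
  rcases h4 with _ | ⟨h4, -⟩
  simp at h5 h6
  subst h5
  refine ⟨v, h4, h6, t, ?_, s', h1, ?_⟩
  · refine h9.trans ?_
    have hl := one_le_lg X
    have : 6 * (N + 1) * lg X ≤ lg X * (12 * N * lg X) := by
      have : 6 * (N + 1) * lg X ≤ 12 * N * lg X * 1 := by
        rw [mul_one]; exact Nat.mul_le_mul_right _ (by omega)
      calc _ ≤ _ := this
        _ ≤ 12 * N * lg X * lg X := by gcongr
        _ = _ := by ring
    have h2 : lg X * (N * (G + 300) * lg X + 6 * (2 * (N + 1) * lg X)) ≤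
        lg X * (N * (G + 324) * lg X) := by
      gcongr lg X * ?_
      have : 6 * (2 * (N + 1)) * lg X ≤ 24 * N * lg X :=
        Nat.mul_le_mul_right _ (by omega)
      nlinarith
    calc _ ≤ lg X * (N * (G + 324) * lg X) + lg X * (12 * N * lg X) := by
          refine Nat.add_le_add h2 (le_trans (le_of_eq (by ring)) this)
      _ ≤ _ := by
          rw [← mul_add]; gcongr lg X * ?_
          rw [← add_mul]; gcongr ?_ * _
          nlinarith
  · rw [h2.output]; simp

/-! ### Squaring 0-1 polynomials by integer multiplication -/

/-- The list `f 0, …, f (n - 1)`. -/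
def tl (n : ℕ) (f : ℕ → ℕ) : List ℤ := (List.range n).map (fun i => (f i : ℤ))

@[simp] theorem length_tl (n : ℕ) (f : ℕ → ℕ) : (tl n f).length = n := by simp [tl]

theorem nth_tl {n i : ℕ} (f : ℕ → ℕ) (h : i < n) : nth (tl n f) i = f i :=
  nth_map_range (fun i => (f i : ℤ)) h

theorem nth_tl' {n : ℕ} {f : ℕ → ℕ} (hf : ∀ i, n ≤ i → f i = 0) (i : ℕ) :
    nth (tl n f) i = f i := by
  rcases lt_or_ge i n with h | h
  · exact nth_tl f h
  · rw [nth_of_le (by simpa using h), hf i h]; rfl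

theorem tl_bound {n X : ℕ} {f : ℕ → ℕ} (hf : ∀ i, f i ≤ X) : ∀ z ∈ tl n f, z.natAbs ≤ X := by
  intro z hz
  obtain ⟨i, -, rfl⟩ := List.mem_map.mp hz
  simpa using hf i

/-- Digits in the base `B` are combined to digits in the base `B * B`.  The input is the number of
digits minus `1`, the base, and the digits. -/
def packLevel : Cmd :=
  .seq (push 1 1 (.div (.load 0 (.const 0)) (.const 2))) <|
  .seq (push 1 1 (.mul (.load 0 (.const 1)) (.load 0 (.const 1)))) <|
  .seq (tab 2 1 1 (.add (.div (.load 0 (.const 0)) (.const 2)) (.const 1))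
    (.add (.load 0 (.add (.const 2) (.mul (.const 2) (.reg 2))))
      (.mul (.load 0 (.const 1)) (.load 0 (.add (.const 3) (.mul (.const 2) (.reg 2)))))))
    (ret 1 1)

theorem packLevel_runs {X c B : ℕ} {f : ℕ → ℕ} (hf0 : ∀ i, c < i → f i = 0) (hfB : ∀ i, f i < B)
    (hX : B * B ≤ X) (hcX : c + 3 ≤ X) :
    RunsIn packLevel (c :: B :: tl (c + 1) f)
      ((c / 2 : ℕ) :: ((B * B : ℕ) : ℤ) :: tl (c / 2 + 1) (fun i => f (2 * i) + B * f (2 * i + 1)))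
      ((200 * c + 500) * lg X) := by
  set l : List ℤ := c :: B :: tl (c + 1) f with hl
  have hB : B ≤ X := le_trans (by nlinarith [hfB 0]) hX
  have hnl : ∀ i, nth l (2 + i) = f i := by
    intro i
    rw [add_comm, hl, nth_cons_succ, nth_cons_succ, nth_tl' (fun i hi => hf0 i hi)]
  have h0 : nth l 0 = c := rfl
  have h1 : nth l 1 = B := rfl
  have hfX : ∀ i, f (2 * i) + B * f (2 * i + 1) ≤ X := by
    intro i
    have h3 := hfB (2 * i)
    have h4 := hfB (2 * i + 1)
    have : B * f (2 * i + 1) ≤ B * (B - 1) := Nat.mul_le_mul_left _ (by omega)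
    rw [Nat.mul_sub, mul_one] at this
    have : B ≤ B * B := by nlinarith
    omega
  refine RunsIn.of_wp ?_ (by simp [hl]; omega) ?_
  · intro z hz
    rcases List.mem_cons.mp hz with rfl | hz
    · simp; omega
    rcases List.mem_cons.mp hz with rfl | hz
    · simpa using hB
    · exact tl_bound (fun i => (hfB i).le.trans hB) z hz
  have hm : (State.init l).mem 0 = nth l := init_mem_zero l
  unfold packLevel
  apply wp.le
  · apply wp_seq
    refine wp_pushv (l := []) (c / 2 : ℕ) (Has.nil _ _) (by simp [init_reg_ne])
      (by simp; omega) (by simp [Expr.eval, hm, h0]) (by omega) fun h2 => ?_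
    apply wp_seq
    refine wp_pushv (B * B : ℕ) h2 (by simp) (by simp; omega)
      (by simp [Expr.eval, hm, h1, setMem_mem_ne]) (by omega) fun h3 => ?_
    apply wp_seq
    refine wp_tab (c / 2 + 1) (fun i => ((f (2 * i) + B * f (2 * i + 1) : ℕ) : ℤ)) (by decide) h3
      (by simp) (by simp; omega) ?_ ?_ ?_
    · intro s' hF
      have hm' : s'.mem 0 = nth l := by
        rw [hF.mem 0 (by decide)]; simp [setMem_mem_ne, hm]
      simp [Expr.eval, hm', h0]
    · intro i hi s' hb hF h2
      have hm' : s'.mem 0 = nth l := by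
        rw [hF.mem 0 (by decide)]; simp [setMem_mem_ne, hm]
      refine ⟨?_, by rw [Int.natAbs_natCast]; exact hfX i⟩
      have e1 : ((2 : ℤ) + 2 * (i : ℤ)).toNat = 2 + 2 * i := by omega
      have e2 : ((3 : ℤ) + 2 * (i : ℤ)).toNat = 2 + (2 * i + 1) := by omega
      simp [Expr.eval, hm', h2, e1, e2, hnl, h1]
    · intro s' hF h4 h5
      refine wp_ret h5 (by simp [h4]; ring) (by simp; omega) fun s₂ hs₂ => ?_
      rw [hs₂]; rfl
  · simp only [Expr.C, Expr.K, Expr.L]; simp; omega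

/-- Digits in the base `b ^ 2 ^ l` are split into digits in the base `b ^ 2 ^ (l - 1)`.  The input
is `l`, `b` and the digits. -/
def unpackLevel : Cmd :=
  .seq (.assign 3 (.load 0 (.const 1))) <|
  .seq (For 4 (.sub (.load 0 (.const 0)) (.const 1)) (.assign 3 (.mul (.reg 3) (.reg 3)))) <|
  .seq (push 1 1 (.sub (.load 0 (.const 0)) (.const 1))) <|
  .seq (push 1 1 (.load 0 (.const 1))) <|
  .seq (tab 2 1 1 (.mul (.const 2) (.sub (.reg 0) (.const 2)))
    (.add
      (.mul (.sub (.const 1) (.sub (.reg 2) (.mul (.const 2) (.div (.reg 2) (.const 2)))))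
        (.sub (.load 0 (.add (.const 2) (.div (.reg 2) (.const 2))))
          (.mul (.reg 3) (.div (.load 0 (.add (.const 2) (.div (.reg 2) (.const 2)))) (.reg 3)))))
      (.mul (.sub (.reg 2) (.mul (.const 2) (.div (.reg 2) (.const 2))))
        (.div (.load 0 (.add (.const 2) (.div (.reg 2) (.const 2)))) (.reg 3)))))
    (ret 1 1)

theorem unpackLevel_runs {X c b l : ℕ} {f : ℕ → ℕ} (hfX : ∀ i, f i ≤ X) (hb : 1 ≤ b)
    (hX : b ^ 2 ^ l ≤ X) (hcX : 2 * c + 3 + l ≤ X) :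
    RunsIn unpackLevel (((l + 1 : ℕ) : ℤ) :: b :: tl c f)
      (l :: b :: tl (2 * c)
        (fun i => if i % 2 = 0 then f (i / 2) % b ^ 2 ^ l else f (i / 2) / b ^ 2 ^ l))
      ((500 * c + 200 * l + 500) * lg X) := by
  set L : List ℤ := ((l + 1 : ℕ) : ℤ) :: b :: tl c f with hL
  have hpow : ∀ i ≤ l, b ^ 2 ^ i ≤ X := fun i hi =>
    (Nat.pow_le_pow_right hb (Nat.pow_le_pow_right (by omega) hi)).trans hX
  have hbX : b ≤ X := by simpa using hpow 0 (by omega)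
  have hnl : ∀ i < c, nth L (2 + i) = f i := by
    intro i hi
    rw [add_comm, hL, nth_cons_succ, nth_cons_succ, nth_tl _ hi]
  have h0 : nth L 0 = l + 1 := by simp [hL]
  have h1 : nth L 1 = b := rfl
  refine RunsIn.of_wp ?_ (by simp [hL]; omega) ?_
  · intro z hz
    rcases List.mem_cons.mp hz with rfl | hz
    · simp; omega
    rcases List.mem_cons.mp hz with rfl | hz
    · simpa using hbX
    · exact tl_bound hfX z hz
  have hm : (State.init L).mem 0 = nth L := init_mem_zero L
  unfold unpackLevel
  apply wp.le
  · apply wp_seq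
    refine wp_set (b : ℤ) (by simp [Expr.eval, hm, h1]) (by simpa using hbX) ?_
    apply wp_seq
    refine wp_for l (fun i s' => s'.reg 3 = ((b ^ 2 ^ i : ℕ) : ℤ)) (fun _ => 6) (by decide)
      (by omega) ?_ (by simp) ?_ ?_
    · intro i _ s' hF _
      simp [Expr.eval, hF.mem 0 (by decide), hm, h0]
    · intro i hi s' _ _ _ h3
      refine wp_set ((b ^ 2 ^ (i + 1) : ℕ) : ℤ) ?_ ?_ ?_
      · simp only [Expr.eval, h3]; push_cast; rw [pow_succ, pow_mul, sq]
      · rw [Int.natAbs_natCast]; exact hpow _ hi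
      · simp
    intro s₁ _ hF1 _ h3
    have hm1 : s₁.mem 0 = nth L := by rw [hF1.mem 0 (by decide)]; simp [hm]
    have hr0 : s₁.reg 0 = c + 2 := by
      rw [hF1.reg 0 (by decide)]; simp [init_reg_zero, hL]; ring
    apply wp_seq
    refine wp_pushv (l := []) (l : ℤ) (Has.nil _ _)
      (by rw [hF1.reg 1 (by decide)]; simp [init_reg_ne])
      (by simp; omega) (by simp [Expr.eval, hm1, h0]) (by simp; omega) fun h4 => ?_
    apply wp_seq
    refine wp_pushv (b : ℤ) h4 (by simp) (by simp; omega)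
      (by simp [Expr.eval, hm1, h1, setMem_mem_ne]) (by simpa using hbX) fun h5 => ?_
    apply wp_seq
    refine wp_tab (2 * c) (fun i => ((if i % 2 = 0 then f (i / 2) % b ^ 2 ^ l
        else f (i / 2) / b ^ 2 ^ l : ℕ) : ℤ)) (by decide) h5
      (by simp) (by simp; omega) ?_ ?_ ?_
    · intro s' hF
      simp [Expr.eval, hF.reg 0 (by decide), hr0]
    · intro i hi s' hb' hF h2
      have hm' : s'.mem 0 = nth L := by
        rw [hF.mem 0 (by decide)]; simp [setMem_mem_ne, hm1]
      have hr3 : s'.reg 3 = ((b ^ 2 ^ l : ℕ) : ℤ) := by rw [hF.reg 3 (by decide)]; simpa using h3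
      refine ⟨?_, ?_⟩
      · have e1 : ((2 : ℤ) + (i : ℤ) / 2).toNat = 2 + i / 2 := by omega
        simp only [Expr.eval, hm', h2, hr3, e1, hnl (i / 2) (by omega)]
        rcases Nat.mod_two_eq_zero_or_one i with h6 | h6
        · have e2 : (i : ℤ) - 2 * ((i : ℤ) / 2) = 0 := by omega
          rw [e2, if_pos h6, Int.natCast_emod, Int.emod_def]; ring
        · have e2 : (i : ℤ) - 2 * ((i : ℤ) / 2) = 1 := by omega
          rw [e2, if_neg (by omega), Int.natCast_ediv]; ring
      · rw [Int.natAbs_natCast]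
        split_ifs
        · exact (Nat.mod_le _ _).trans (hfX _)
        · exact (Nat.div_le_self _ _).trans (hfX _)
    · intro s' hF h6 h7
      refine wp_ret h7 (by simp [h6]; ring) (by simp; omega) fun s₂ hs₂ => ?_
      rw [hs₂]; rfl
  · simp only [Expr.C, Expr.K, Expr.L]; simp; omega

theorem sum_range_two_mul (n : ℕ) (g : ℕ → ℕ) :
    ∑ i ∈ Finset.range (2 * n), g i = ∑ i ∈ Finset.range n, (g (2 * i) + g (2 * i + 1)) := by
  induction n with
  | zero => simp
  | succ n ih => rw [Nat.mul_succ, Finset.sum_range_succ, Finset.sum_range_succ, ih,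
      Finset.sum_range_succ, add_assoc]

theorem pack_sum {c B : ℕ} {f : ℕ → ℕ} (hf0 : ∀ i, c < i → f i = 0) :
    ∑ i ∈ Finset.range (c / 2 + 1), (f (2 * i) + B * f (2 * i + 1)) * (B * B) ^ i =
      ∑ i ∈ Finset.range (c + 1), f i * B ^ i := by
  have h1 : ∑ i ∈ Finset.range (2 * (c / 2 + 1)), f i * B ^ i =
      ∑ i ∈ Finset.range (c + 1), f i * B ^ i := by
    symm
    apply Finset.sum_subset
    · intro i hi; simp at hi ⊢; omega
    · intro i _ hi
      rw [hf0 i (by simpa using hi), zero_mul]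
  rw [← h1, sum_range_two_mul]
  apply Finset.sum_congr rfl
  intro i _
  rw [← sq, ← pow_mul, pow_succ]; ring

/-- The digits of `Z` in the base `B`. -/
def dig (Z B i : ℕ) : ℕ := Z / B ^ i % B

/-- The digits in the base `B` are the lower and upper halves of those in the base `B * B`. -/
theorem dig_split (Z B i : ℕ) : dig Z B i =
    if i % 2 = 0 then dig Z (B * B) (i / 2) % B else dig Z (B * B) (i / 2) / B := by
  unfold dig
  rw [← sq, ← pow_mul]
  split_ifs with h
  · rw [show 2 * (i / 2) = i by omega, sq, Nat.mod_mul_left_mod]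
  · rw [sq, Nat.mod_mul_right_div_self, Nat.div_div_eq_div_mul, ← pow_succ,
      show 2 * (i / 2) + 1 = i by omega]

theorem sum_digits_lt {n B : ℕ} {f : ℕ → ℕ} (hf : ∀ i, f i < B) :
    ∑ i ∈ Finset.range n, f i * B ^ i < B ^ n := by
  induction n with
  | zero => simp
  | succ n ih =>
    rw [Finset.sum_range_succ, pow_succ]
    have := hf n
    have h2 : f n * B ^ n ≤ (B - 1) * B ^ n := Nat.mul_le_mul_right _ (by omega)
    rw [Nat.sub_mul, one_mul] at h2
    have h3 : B ^ n ≤ B * B ^ n := Nat.le_mul_of_pos_left _ (by omega)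
    rw [mul_comm (B ^ n) B]
    omega

theorem dig_sum {n B k : ℕ} {f : ℕ → ℕ} (hf : ∀ i, f i < B) (hf0 : ∀ i, n ≤ i → f i = 0) :
    dig (∑ i ∈ Finset.range n, f i * B ^ i) B k = f k := by
  have hB : 0 < B := (Nat.zero_le _).trans_lt (hf 0)
  obtain ⟨m, hm⟩ : ∃ m, ∑ i ∈ Finset.range n, f i * B ^ i =
      (∑ i ∈ Finset.range k, f i * B ^ i) + B ^ k * (f k + B * m) := by
    have h1 : ∑ i ∈ Finset.range n, f i * B ^ i = ∑ i ∈ Finset.range (k + (n + 1)), f i * B ^ i :=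
        by
      apply Finset.sum_subset
      · intro i hi; simp at hi ⊢; omega
      · intro i _ hi
        rw [hf0 i (by simpa using hi), zero_mul]
    refine ⟨∑ i ∈ Finset.range n, f (k + 1 + i) * B ^ i, ?_⟩
    rw [h1, Finset.sum_range_add, Finset.sum_range_succ', mul_add, Finset.mul_sum, Finset.mul_sum]
    congr 1
    rw [add_comm]
    congr 1
    · simp [mul_comm]
    · apply Finset.sum_congr rfl
      intro i _
      rw [show k + (i + 1) = k + 1 + i by omega, pow_add, pow_add, pow_one]; ring
  unfold dig
  rw [hm, Nat.add_mul_div_left _ _ (pow_pos hB k), Nat.div_eq_of_lt (sum_digits_lt hf), zero_add,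
    Nat.add_mul_mod_self_left, Nat.mod_eq_of_lt (hf k)]

theorem lg_pow_le {b k X : ℕ} (hk : 0 < k) (h : X ≤ b ^ k) : lg X ≤ k * lg b := by
  have h1 : b < 2 ^ lg b := Nat.lt_pow_succ_log_self Nat.one_lt_two _
  apply Nat.succ_le_of_lt
  apply Nat.log_lt_of_lt_pow' (by have := one_le_lg b; positivity)
  calc X ≤ b ^ k := h
    _ < (2 ^ lg b) ^ k := Nat.pow_lt_pow_left h1 hk.ne'
    _ = _ := by rw [← pow_mul, mul_comm]

/-- The coefficients of the square of the polynomial with coefficients `f`. -/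
def sqc (f : ℕ → ℕ) (k : ℕ) : ℕ := ∑ p ∈ Finset.HasAntidiagonal.antidiagonal k, f p.1 * f p.2

theorem sqc_eq_zero {n k : ℕ} {f : ℕ → ℕ} (hf0 : ∀ i, n ≤ i → f i = 0) (hk : 2 * n ≤ k) :
    sqc f k = 0 := by
  apply Finset.sum_eq_zero
  intro p hp
  rw [Finset.HasAntidiagonal.mem_antidiagonal] at hp
  rcases le_or_gt n p.1 with h | h
  · rw [hf0 _ h, zero_mul]
  · rw [hf0 p.2 (by omega), mul_zero]

theorem sqc_le {n k : ℕ} {f : ℕ → ℕ} (hf1 : ∀ i, f i ≤ 1) (hf0 : ∀ i, n ≤ i → f i = 0) :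
    sqc f k ≤ n := by
  unfold sqc
  rw [Finset.Nat.sum_antidiagonal_eq_sum_range_succ (fun i j => f i * f j)]
  calc _ ≤ ∑ i ∈ Finset.range k.succ, f i :=
        Finset.sum_le_sum fun i _ => (Nat.mul_le_mul_left _ (hf1 _)).trans_eq (mul_one _)
    _ ≤ ∑ i ∈ Finset.range k.succ, if i < n then 1 else 0 := by
        apply Finset.sum_le_sum
        intro i _
        split_ifs with h
        · exact hf1 i
        · exact (hf0 i (by omega)).le
    _ ≤ n := by
        rw [← Finset.sum_filter, Finset.sum_const, smul_eq_mul, mul_one]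
        calc _ ≤ (Finset.range n).card := Finset.card_le_card fun i hi => by simp at hi ⊢; omega
          _ = n := Finset.card_range n

/-- The square of the value of a polynomial at `b` is the value of its square. -/
theorem sq_sum_eq {n b : ℕ} {f : ℕ → ℕ} (hf0 : ∀ i, n ≤ i → f i = 0) :
    (∑ i ∈ Finset.range n, f i * b ^ i) * (∑ i ∈ Finset.range n, f i * b ^ i) =
      ∑ k ∈ Finset.range (2 * n), sqc f k * b ^ k := by
  rcases n.eq_zero_or_pos with rfl | hn
  · simp
  set p : Polynomial ℕ := ∑ i ∈ Finset.range n, Polynomial.monomial i (f i) with hp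
  have hc : ∀ i, p.coeff i = f i := by
    intro i
    rw [hp, Polynomial.finsetSum_coeff]
    simp only [Polynomial.coeff_monomial]
    rw [Finset.sum_ite_eq' (Finset.range n) i f]
    split_ifs with h
    · rfl
    · rw [hf0 i (by simpa using h)]
  have he : p.eval b = ∑ i ∈ Finset.range n, f i * b ^ i := by
    rw [hp, Polynomial.eval_finsetSum]; simp
  have hd : p.natDegree < n := by
    have : p.natDegree ≤ n - 1 :=
      Polynomial.natDegree_le_iff_coeff_eq_zero.mpr fun N hN => by rw [hc, hf0 N (by omega)]
    omega
  have hd2 : (p * p).natDegree < 2 * n := by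
    have := Polynomial.natDegree_mul_le (p := p) (q := p)
    omega
  rw [← he, ← Polynomial.eval_mul, Polynomial.eval_eq_sum_range' hd2]
  apply Finset.sum_congr rfl
  intro k _
  rw [Polynomial.coeff_mul]
  simp only [hc]; rfl

/-- A polynomial with coefficients 0 and 1 is squared by one multiplication of integers, namely by
squaring its value at `b`.  Packing the coefficients into this value and unpacking the digits of
the square are done in rounds that double or halve the length of the digits: in each round all
numbers together have the same length up to a constant factor, so that the cost is almost linear.
The input is the degree bound, `b` and the coefficients; the coefficients of the square follow two
header cells of the output. -/
def kron : Cmd :=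
  .seq (.seq (.assign 3 (.add (.load 0 (.const 0)) (.const 1))) <|
    .seq (.assign 4 (.load 0 (.const 1))) <|
    .seq (.assign 6 (.const 1))
    (.loop (.le (.add (.reg 6) (.const 1)) (.mul (.const 2) (.reg 3)))
      (.seq (.assign 6 (.add (.reg 6) (.reg 6))) (.assign 5 (.add (.reg 5) (.const 1)))))) <|
  .seq (iter packLevel) <|
  .seq (.store 0 (.const 0) (.reg 5)) <|
  .seq (.store 0 (.const 1) (.reg 4)) <|
  .seq (.store 0 (.const 2) (.mul (.load 0 (.const 2)) (.load 0 (.const 2))))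
    (iter unpackLevel)

/-- The rounds of combining digits end with the value `Z` of the polynomial. -/
theorem pack_exec {c b Z : ℕ} {f : ℕ → ℕ} (hb : c + 2 ≤ b) (hf0 : ∀ i, c < i → f i = 0)
    (hfb : ∀ i, f i < b) (hZ : ∑ i ∈ Finset.range (c + 1), f i * b ^ i = Z) {s : State}
    (hs : At s (c :: b :: tl (c + 1) f)) :
    ∃ s' t, ∃ B : ℕ, Exec (iter packLevel) s s' t ∧ At s' [0, (B : ℤ), (Z : ℤ)] ∧
      t ≤ 1700 * (c + 1) * lg b ^ 2 := by
  have hlgb := one_le_lg b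
  obtain ⟨s', t, l', j', h1, h2, ⟨e, c', f', rfl, h4, h5, h6, h7, h8, h9⟩, h10, h11⟩ :=
    iter_exec (c := packLevel)
    (fun j l => ∃ (e c' : ℕ) (f' : ℕ → ℕ), l = (c' : ℤ) :: ((b ^ 2 ^ e : ℕ) : ℤ) :: tl (c' + 1) f' ∧
      (∀ i, c' < i → f' i = 0) ∧ (∀ i, f' i < b ^ 2 ^ e) ∧
      ∑ i ∈ Finset.range (c' + 1), f' i * (b ^ 2 ^ e) ^ i = Z ∧ c' * 2 ^ e ≤ c ∧
      2 ^ e ≤ 2 * c + 1 ∧ c' < 2 ^ j)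
    (1400 * (c + 1) * lg b) (28 * (c + 1) * lg b) (by
      rintro j l ⟨e, c', f', rfl, h4, h5, h6, h7, h8, h9⟩
      have hc' : c' ≤ c := le_trans (Nat.le_mul_of_pos_right _ (by positivity)) h7
      have hX2 : b * b ≤ b ^ 2 ^ (e + 1) := by
        rw [← sq]
        exact Nat.pow_le_pow_right (by omega) (Nat.le_self_pow (by omega) 2)
      have hX3 : c' + 3 ≤ b ^ 2 ^ (e + 1) := by
        refine le_trans ?_ hX2
        nlinarith
      have hlg : lg (b ^ 2 ^ (e + 1)) ≤ 2 ^ (e + 1) * lg b := lg_pow_le (by positivity) le_rfl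
      have hbe : b ^ 2 ^ e ≤ b ^ 2 ^ (e + 1) :=
        Nat.pow_le_pow_right (by omega) (Nat.pow_le_pow_right (by omega) (by omega))
      refine ⟨by simp, ?_, ?_⟩
      · refine (copyCost_le (X := b ^ 2 ^ (e + 1)) ?_ (by simp; omega)).trans ?_
        · intro z hz
          rcases List.mem_cons.mp hz with rfl | hz
          · simp; omega
          rcases List.mem_cons.mp hz with rfl | hz
          · simpa using hbe
          · exact tl_bound (fun i => (h5 i).le.trans hbe) z hz
        · simp only [List.length_cons, length_tl]
          calc 2 * (c' + 1 + 1 + 1) * lg (b ^ 2 ^ (e + 1))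
              ≤ 2 * (c' + 1 + 1 + 1) * (2 ^ (e + 1) * lg b) := Nat.mul_le_mul_left _ hlg
            _ = 4 * (c' * 2 ^ e + 3 * 2 ^ e) * lg b := by rw [pow_succ]; ring
            _ ≤ 28 * (c + 1) * lg b := Nat.mul_le_mul_right _ (by omega)
      · rw [nth_cons_zero]
        rcases Nat.eq_zero_or_pos c' with h10 | h10
        · left; omega
        right
        refine ⟨by omega, ?_⟩
        rcases j with _ | j
        · rw [pow_zero] at h9; omega
        have hBB : b ^ 2 ^ e * b ^ 2 ^ e = b ^ 2 ^ (e + 1) := by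
          rw [← pow_add, pow_succ, mul_two]
        have h2e : 2 ^ e ≤ c := le_trans (Nat.le_mul_of_pos_left _ h10) h7
        refine ⟨j, _, rfl, ⟨e + 1, c' / 2, _, by rw [← hBB], ?_, ?_, ?_, ?_, ?_, ?_⟩,
          (packLevel_runs (X := b ^ 2 ^ (e + 1)) h4 h5 hBB.le hX3).le ?_⟩
        · intro i hi
          rw [h4 _ (by omega), h4 _ (by omega)]; simp
        · intro i
          have h11 := h5 (2 * i)
          have h12 := h5 (2 * i + 1)
          rw [← hBB]
          have h13 : b ^ 2 ^ e * f' (2 * i + 1) ≤ b ^ 2 ^ e * (b ^ 2 ^ e - 1) :=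
            Nat.mul_le_mul_left _ (by omega)
          rw [Nat.mul_sub, mul_one] at h13
          have : b ^ 2 ^ e ≤ b ^ 2 ^ e * b ^ 2 ^ e := Nat.le_mul_of_pos_left _ (by omega)
          omega
        · rw [← hBB, pack_sum h4, h6]
        · refine le_trans ?_ h7
          rw [pow_succ]
          calc _ = c' / 2 * 2 * 2 ^ e := by ring
            _ ≤ _ := Nat.mul_le_mul_right _ (by omega)
        · rw [pow_succ]; omega
        · rw [pow_succ] at h9; omega
        · calc (200 * c' + 500) * lg (b ^ 2 ^ (e + 1))
              ≤ 700 * c' * (2 ^ (e + 1) * lg b) := Nat.mul_le_mul (by omega) hlg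
            _ = 1400 * (c' * 2 ^ e) * lg b := by rw [pow_succ]; ring
            _ ≤ _ := Nat.mul_le_mul_right _ (by omega))
    (lg b) _ s ⟨0, c, f, by simp, hf0, by simpa using hfb, by simpa using hZ, by simp, by omega,
      lt_of_lt_of_le (by omega) (Nat.lt_pow_succ_log_self Nat.one_lt_two b).le⟩ hs
  rw [nth_cons_zero] at h10
  obtain rfl : c' = 0 := by omega
  simp at h6
  refine ⟨s', t, b ^ 2 ^ e, h1, ?_, h11.trans ?_⟩
  · simpa [tl, h6] using h2
  · have h3 : 3 * (28 * (c + 1) * lg b) ≤ 84 * (c + 1) * lg b * lg b := by nlinarith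
    calc _ ≤ lg b * (1400 * (c + 1) * lg b + 6 * (28 * (c + 1) * lg b)) +
          84 * (c + 1) * lg b * lg b := Nat.add_le_add_left h3 _
      _ = 1652 * ((c + 1) * lg b ^ 2) := by ring
      _ ≤ 1700 * ((c + 1) * lg b ^ 2) := Nat.mul_le_mul_right _ (by omega)
      _ = _ := by ring

/-- The rounds of splitting digits lead from the number `Z` to its digits in the base `b`. -/
theorem unpack_exec {c b h Z : ℕ} (hb : c + 2 ≤ b) (hh : 2 ^ h ≤ 4 * (c + 1))
    (hZ : Z < b ^ 2 ^ h) {s : State} (hs : At s [(h : ℤ), (b : ℤ), (Z : ℤ)]) :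
    ∃ s' t, Exec (iter unpackLevel) s s' t ∧ At s' (0 :: b :: tl (2 ^ h) (dig Z b)) ∧
      t ≤ 133000 * (c + 1) * lg b ^ 3 := by
  have hlgb := one_le_lg b
  have hhlt : h < 2 ^ h := Nat.lt_two_pow_self
  have hhb : h ≤ 3 * lg b := by
    have h1 : b < 2 ^ lg b := Nat.lt_pow_succ_log_self Nat.one_lt_two _
    have : 2 ^ h < 2 ^ (lg b + 2) := by rw [pow_add]; omega
    have := (Nat.pow_lt_pow_iff_right (by omega)).mp this
    omega
  have hb5 : 16 * b ≤ b ^ 5 := by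
    have : 2 ^ 4 ≤ b ^ 4 := Nat.pow_le_pow_left (by omega) 4
    rw [pow_succ b 4]; exact Nat.mul_le_mul_right _ this
  obtain ⟨s', t, l', j', h1, h2, ⟨h3, rfl⟩, h5, h6⟩ :=
    iter_exec (c := unpackLevel)
    (fun j l => j ≤ h ∧ l = (j : ℤ) :: (b : ℤ) :: tl (2 ^ (h - j)) (dig Z (b ^ 2 ^ j)))
    (43200 * (c + 1) * lg b ^ 2) (120 * (c + 1) * lg b) (by
      rintro j l ⟨h3, rfl⟩
      have h2pow : 2 ^ (h - j) * 2 ^ j = 2 ^ h := by rw [← pow_add]; congr 1; omega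
      have h2j : 1 ≤ 2 ^ j := Nat.one_le_two_pow
      have h2hj : 1 ≤ 2 ^ (h - j) := Nat.one_le_two_pow
      have h2le : 2 ^ (h - j) ≤ 2 ^ h := Nat.pow_le_pow_right (by omega) (by omega)
      have hb5' : b ^ 5 ≤ b ^ (2 ^ j + 4) := Nat.pow_le_pow_right (by omega) (by omega)
      have hdig : ∀ i, dig Z (b ^ 2 ^ j) i < b ^ 2 ^ j := fun i => Nat.mod_lt _ (by
        have : 0 < b := by omega
        positivity)
      have hX : b ^ 2 ^ j ≤ b ^ (2 ^ j + 4) := Nat.pow_le_pow_right (by omega) (by omega)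
      have hlg : lg (b ^ (2 ^ j + 4)) ≤ (2 ^ j + 4) * lg b := lg_pow_le (by omega) le_rfl
      refine ⟨by simp, ?_, ?_⟩
      · refine (copyCost_le (X := b ^ (2 ^ j + 4)) ?_ (by simp; omega)).trans ?_
        · intro z hz
          rcases List.mem_cons.mp hz with rfl | hz
          · simp; omega
          rcases List.mem_cons.mp hz with rfl | hz
          · simp; omega
          · exact tl_bound (fun i => (hdig i).le.trans hX) z hz
        · simp only [List.length_cons, length_tl]
          calc 2 * (2 ^ (h - j) + 1 + 1) * lg (b ^ (2 ^ j + 4))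
              ≤ (6 * 2 ^ (h - j)) * (5 * 2 ^ j * lg b) :=
                Nat.mul_le_mul (by omega) (hlg.trans (Nat.mul_le_mul_right _ (by omega)))
            _ = 30 * (2 ^ (h - j) * 2 ^ j) * lg b := by ring
            _ ≤ 120 * (c + 1) * lg b := Nat.mul_le_mul_right _ (by omega)
      · rw [nth_cons_zero]
        rcases j with _ | j
        · left; simp
        right
        refine ⟨by omega, j, _, rfl, ⟨by omega, rfl⟩, ?_⟩
        have hrun := unpackLevel_runs (X := b ^ (2 ^ (j + 1) + 4)) (c := 2 ^ (h - (j + 1)))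
          (l := j) (f := dig Z (b ^ 2 ^ (j + 1)))
          (fun i => (hdig i).le.trans hX) (b := b) (by omega)
          (Nat.pow_le_pow_right (by omega) (by
            have : 2 ^ j ≤ 2 ^ (j + 1) := Nat.pow_le_pow_right (by omega) (by omega)
            omega))
          (by omega)
        have e1 : 2 * 2 ^ (h - (j + 1)) = 2 ^ (h - j) := by
          rw [← pow_succ']; congr 1; omega
        have e2 : (fun i => if i % 2 = 0 then dig Z (b ^ 2 ^ (j + 1)) (i / 2) % b ^ 2 ^ j
            else dig Z (b ^ 2 ^ (j + 1)) (i / 2) / b ^ 2 ^ j) = dig Z (b ^ 2 ^ j) := by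
          funext i
          rw [dig_split Z (b ^ 2 ^ j) i, ← pow_add, ← mul_two, ← pow_succ]
        rw [e1, e2] at hrun
        refine hrun.le ?_
        have hj : 2 ≤ 2 ^ (j + 1) := Nat.le_self_pow (by omega) 2
        calc (500 * 2 ^ (h - (j + 1)) + 200 * j + 500) * lg (b ^ (2 ^ (j + 1) + 4))
            ≤ (1200 * h * 2 ^ (h - (j + 1))) * (3 * 2 ^ (j + 1) * lg b) := by
              apply Nat.mul_le_mul
              · have : h ≤ h * 2 ^ (h - (j + 1)) := Nat.le_mul_of_pos_right _ (by omega)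
                have : 2 ^ (h - (j + 1)) ≤ h * 2 ^ (h - (j + 1)) :=
                  Nat.le_mul_of_pos_left _ (by omega)
                rw [mul_assoc]
                omega
              · exact hlg.trans (Nat.mul_le_mul_right _ (by omega))
          _ = 3600 * h * (2 ^ (h - (j + 1)) * 2 ^ (j + 1)) * lg b := by ring
          _ ≤ 3600 * (3 * lg b) * (4 * (c + 1)) * lg b := by
              rw [h2pow]; gcongr
          _ = _ := by ring)
    h _ s ⟨le_rfl, rfl⟩ (by
      have : dig Z (b ^ 2 ^ h) 0 = Z := by simp [dig, Nat.mod_eq_of_lt hZ]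
      simpa [tl, this] using hs)
  rw [nth_cons_zero] at h5
  obtain rfl : j' = 0 := by omega
  refine ⟨s', t, h1, by simpa using h2, h6.trans ?_⟩
  have h3 : 3 * (120 * (c + 1) * lg b) ≤ 360 * (c + 1) * lg b * lg b * lg b := by
    have : 360 * (c + 1) * lg b * 1 * 1 ≤ 360 * (c + 1) * lg b * lg b * lg b := by gcongr
    linarith
  calc _ ≤ 3 * lg b * (43200 * (c + 1) * lg b ^ 2 + 6 * (120 * (c + 1) * lg b) * lg b) +
        360 * (c + 1) * lg b * lg b * lg b :=
          Nat.add_le_add (Nat.mul_le_mul hhb (Nat.add_le_add_left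
            (Nat.le_mul_of_pos_right _ hlgb) _)) h3
    _ = 132120 * ((c + 1) * lg b ^ 3) := by ring
    _ ≤ 133000 * ((c + 1) * lg b ^ 3) := Nat.mul_le_mul_right _ (by omega)
    _ = _ := by ring

/-- All coefficients of the square are below the base `b = c + 2`, so they are the digits of the
square of the value at `b`. -/
theorem kron_runs {c b : ℕ} {f : ℕ → ℕ} (hb : b = c + 2) (hf1 : ∀ i, f i ≤ 1)
    (hf0 : ∀ i, c < i → f i = 0) :
    ∃ m, 2 * (c + 1) ≤ m ∧ m ≤ 4 * (c + 1) ∧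
      RunsIn kron (c :: b :: tl (c + 1) f) (0 :: b :: tl m (sqc f))
        (140000 * (c + 1) * lg b ^ 3) := by
  set l : List ℤ := c :: b :: tl (c + 1) f with hl
  have hlgb := one_le_lg b
  have hfb : ∀ i, f i < b := fun i => (hf1 i).trans_lt (by omega)
  obtain ⟨Z, hZ⟩ : ∃ Z, ∑ i ∈ Finset.range (c + 1), f i * b ^ i = Z := ⟨_, rfl⟩
  have hZb : Z < b ^ (c + 1) := hZ ▸ sum_digits_lt hfb
  -- The number `h` of rounds of splitting digits is computed by repeated doubling.
  have hwp : wp (4 * b) (.seq (.assign 3 (.add (.load 0 (.const 0)) (.const 1))) <|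
      .seq (.assign 4 (.load 0 (.const 1))) <| .seq (.assign 6 (.const 1))
      (.loop (.le (.add (.reg 6) (.const 1)) (.mul (.const 2) (.reg 3)))
        (.seq (.assign 6 (.add (.reg 6) (.reg 6))) (.assign 5 (.add (.reg 5) (.const 1))))))
      (State.init l) (400 * (c + 1))
      (fun s => At s l ∧ s.reg 4 = b ∧ ∃ h : ℕ, s.reg 5 = h ∧ 2 * (c + 1) ≤ 2 ^ h ∧
        2 ^ h ≤ 4 * (c + 1)) := by
    apply wp.le
    · apply wp_seq
      refine wp_set ((c + 1 : ℕ) : ℤ) (by simp [Expr.eval, init_mem_zero, hl])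
        (by rw [Int.natAbs_natCast]; omega) ?_
      apply wp_seq
      refine wp_set (b : ℤ) (by simp [Expr.eval, init_mem_zero, hl])
        (by rw [Int.natAbs_natCast]; omega) ?_
      apply wp_seq
      refine wp_set 1 (by simp [Expr.eval]) (by simp; omega) ?_
      refine wp_while (fun B s => ∃ h : ℕ, At s l ∧ s.reg 3 = ((c + 1 : ℕ) : ℤ) ∧ s.reg 4 = b ∧
        s.reg 5 = h ∧ s.reg 6 = ((2 ^ h : ℕ) : ℤ) ∧ 2 ^ h ≤ 4 * (c + 1) ∧ h ≤ 4 * (c + 1) ∧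
        B = (4 * (c + 1) - h) * 50 + 50) ?_ (200 * (c + 1) + 50) _ ?_
      · rintro B s hs ⟨h, h1, h2, h3, h4, h5, h6, h7, rfl⟩
        rcases le_or_gt (2 * (c + 1)) (2 ^ h) with h8 | h8
        · left
          refine ⟨?_, ?_, h1, h3, h, h4, h8, h6⟩
          · simp only [Expr.eval, h5, h2]; rw [if_neg]; omega
          · simp [Expr.C, Expr.K, Expr.L]
        · right
          have h9 : h < 2 ^ h := Nat.lt_two_pow_self
          refine ⟨?_, ?_⟩
          · simp only [Expr.eval, h5, h2]; rw [if_pos (by omega)]; simp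
          apply wp_while_step (I := fun B s => ∃ h : ℕ, At s l ∧ s.reg 3 = ((c + 1 : ℕ) : ℤ) ∧
            s.reg 4 = b ∧ s.reg 5 = h ∧ s.reg 6 = ((2 ^ h : ℕ) : ℤ) ∧ 2 ^ h ≤ 4 * (c + 1) ∧
            h ≤ 4 * (c + 1) ∧ B = (4 * (c + 1) - h) * 50 + 50)
            ((4 * (c + 1) - (h + 1)) * 50 + 50)
          · apply wp_seq
            refine wp_set ((2 ^ (h + 1) : ℕ) : ℤ) ?_ ?_ ?_
            · simp only [Expr.eval, h5]; push_cast; ring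
            · rw [Int.natAbs_natCast, pow_succ]; omega
            refine wp_set ((h + 1 : ℕ) : ℤ) (by simp [Expr.eval, h4])
              (by rw [Int.natAbs_natCast]; omega) ?_
            exact ⟨h + 1, by simpa [At] using h1, by simpa using h2, by simpa using h3, by simp,
              by simp, by rw [pow_succ]; omega, by omega, rfl⟩
          · simp [Expr.C, Expr.K, Expr.L]; omega
      · exact ⟨0, by simpa [At] using at_init l, by simp, by simp, by simp [init_reg_ne], by simp,
          by simp; omega, by omega, by omega⟩
    · simp [Expr.C, Expr.K, Expr.L]; omega
  have hb2 : 4 * b ≤ b ^ 3 := by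
    have : 2 ^ 2 ≤ b ^ 2 := Nat.pow_le_pow_left (by omega) 2
    rw [pow_succ b 2]; exact Nat.mul_le_mul_right _ this
  obtain ⟨s₁, t₁, e1, ht1, -, hs1, hr4, h, hr5, hh1, hh2⟩ := hwp (bdd_init (by
      intro z hz
      rcases List.mem_cons.mp hz with rfl | hz
      · simp; omega
      rcases List.mem_cons.mp hz with rfl | hz
      · simp; omega
      · exact tl_bound (fun i => (hfb i).le.trans (by omega)) z hz) (by simp [hl]; omega))
  obtain ⟨s₂, t₂, B, e2, hs2, ht2⟩ := pack_exec (by omega) hf0 hfb hZ hs1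
  have hr4' : s₂.reg 4 = b := by rw [e2.fr.reg 4 (by decide), hr4]
  have hr5' : s₂.reg 5 = h := by rw [e2.fr.reg 5 (by decide), hr5]
  have hm2 : s₂.mem 0 2 = Z := hs2.2 2 (by simp)
  have e3 := Exec.store s₂ 0 (.const 0) (.reg 5)
  set s₃ := s₂.setMem 0 (Expr.eval s₂ (.const 0)).toNat (Expr.eval s₂ (.reg 5)) with hs₃
  have e4 := Exec.store s₃ 0 (.const 1) (.reg 4)
  set s₄ := s₃.setMem 0 (Expr.eval s₃ (.const 1)).toNat (Expr.eval s₃ (.reg 4)) with hs₄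
  have e5 := Exec.store s₄ 0 (.const 2) (.mul (.load 0 (.const 2)) (.load 0 (.const 2)))
  set s₅ := s₄.setMem 0 (Expr.eval s₄ (.const 2)).toNat
    (Expr.eval s₄ (.mul (.load 0 (.const 2)) (.load 0 (.const 2)))) with hs₅
  have hm4 : s₄.mem 0 2 = Z := by simp [hs₄, hs₃, setMem_mem, Expr.eval, hm2]
  have hs5 : At s₅ [(h : ℤ), (b : ℤ), ((Z * Z : ℕ) : ℤ)] := by
    refine ⟨by rw [hs₅, setMem_reg, hs₄, setMem_reg, hs₃, setMem_reg]; simpa using hs2.1, ?_⟩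
    intro i hi
    have : i < 3 := by simpa using hi
    interval_cases i
    · simp [hs₅, hs₄, hs₃, setMem_mem, Expr.eval, hr5']
    · simp [hs₅, hs₄, hs₃, setMem_mem, Expr.eval, hr4']
    · simp [hs₅, setMem_mem, Expr.eval, hm4]
  have hZZ : Z * Z < b ^ 2 ^ h := by
    calc Z * Z < b ^ (c + 1) * b ^ (c + 1) := Nat.mul_lt_mul'' hZb hZb
      _ = b ^ (2 * (c + 1)) := by rw [← pow_add]; congr 1; ring
      _ ≤ _ := Nat.pow_le_pow_right (by omega) hh1
  obtain ⟨s₆, t₆, e6, hs6, ht6⟩ := unpack_exec (by omega) hh2 hZZ hs5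
  have hdig : dig (Z * Z) b = sqc f := by
    funext k
    rw [← hZ, sq_sum_eq (fun i hi => hf0 i (by omega))]
    exact dig_sum (fun i => (sqc_le hf1 (fun i hi => hf0 i (by omega))).trans_lt
      (show c + 1 < b by omega)) (fun i hi => sqc_eq_zero (fun i hi => hf0 i (by omega)) hi)
  rw [hdig] at hs6
  refine ⟨2 ^ h, hh1, hh2, _, ?_, s₆, .seq e1 (.seq e2 (.seq e3 (.seq e4 (.seq e5 e6)))), ?_⟩
  · have hlgX : lg (4 * b) ≤ 3 * lg b := lg_pow_le (by omega) hb2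
    have l1 : len (h : ℤ) ≤ 3 * lg b := by
      refine le_trans (len_le_lg (X := 4 * b) ?_) hlgX
      have h9 : h < 2 ^ h := Nat.lt_two_pow_self
      rw [Int.natAbs_natCast]; omega
    have l2 : len (b : ℤ) ≤ lg b := len_le_lg (by simp)
    have l3 : len (Z : ℤ) ≤ (c + 1) * lg b := by
      refine le_trans (len_le_lg (X := b ^ (c + 1)) ?_) (lg_pow_le (by omega) le_rfl)
      rw [Int.natAbs_natCast]; omega
    have l4 : len ((Z : ℤ) * Z) ≤ 2 * ((c + 1) * lg b) := by
      have := len_mul_le (Z : ℤ) Z; omega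
    have l5 : len 0 = 1 := by simp [len]
    have l6 : len 1 = 1 := by simp [len]
    have l7 : len 2 = 2 := rfl
    have n2 : (2 : ℤ).toNat = 2 := rfl
    have hr4'' : s₃.reg 4 = b := by rw [hs₃, setMem_reg, hr4']
    have l8 : lg b ≤ (c + 1) * lg b := Nat.le_mul_of_pos_left _ (by omega)
    have l9 : t₁ ≤ 1200 * ((c + 1) * lg b) := by
      calc t₁ ≤ 400 * (c + 1) * lg (4 * b) := ht1
        _ ≤ 400 * (c + 1) * (3 * lg b) := Nat.mul_le_mul_left _ hlgX
        _ = _ := by ring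
    simp only [Expr.cost, Expr.eval, n2, hr5', hr4'', hm4, l5, l6, l7]
    have l10 : (c + 1) * lg b ≤ (c + 1) * lg b ^ 3 :=
      Nat.mul_le_mul_left _ (Nat.le_self_pow (by omega) _)
    have l11 : 1700 * (c + 1) * lg b ^ 2 ≤ 1700 * ((c + 1) * lg b ^ 3) := by
      rw [mul_assoc]
      exact Nat.mul_le_mul_left _ (Nat.mul_le_mul_left _ (Nat.pow_le_pow_right (by omega)
        (by omega)))
    rw [mul_assoc] at ht6 ⊢
    omega
  · rw [hs6.output]

/-! ### Sumsets -/

theorem lg_mul_le (a b : ℕ) : lg (a * b) ≤ lg a + lg b := by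
  have h1 : a < 2 ^ lg a := Nat.lt_pow_succ_log_self Nat.one_lt_two _
  have h2 : b < 2 ^ lg b := Nat.lt_pow_succ_log_self Nat.one_lt_two _
  have h3 := one_le_lg a
  refine Nat.log_lt_of_lt_pow' (by omega) ?_
  rw [pow_add]
  exact Nat.mul_lt_mul'' h1 h2

theorem lg_sixteen_mul_le (X : ℕ) : lg (16 * X) ≤ 6 * lg X := by
  have h1 := lg_mul_le 16 X
  have h2 : lg 16 = 5 := by
    have : Nat.log 2 16 = 4 := by decide
    simp [lg, this]
  have := one_le_lg X
  omega

/-- The sumset of two sets of numbers, given as vectors whose positive entries mark the elements.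
The product of the two polynomials is read off the square of one polynomial, whose coefficients are
the marks of the first set, a gap and the marks of the second set. -/
def sumset : Cmd :=
  .seq (.assign 3 (.load 0 (.const 0))) <|
  .seq (.assign 4 (.load 0 (.add (.reg 3) (.const 1)))) <|
  .seq (.assign 5 (.add (.reg 3) (.reg 4))) <|
  .seq (push 1 1 (.sub (.add (.reg 5) (.reg 5)) (.const 1))) <|
  .seq (push 1 1 (.add (.add (.reg 5) (.reg 5)) (.const 1))) <|
  .seq (tab 2 1 1 (.reg 3) (.le (.const 1) (.load 0 (.add (.const 1) (.reg 2))))) <|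
  .seq (tab 2 1 1 (.reg 5) (.const 0)) <|
  .seq (tab 2 1 1 (.reg 4) (.le (.const 1) (.load 0 (.add (.add (.reg 3) (.const 2)) (.reg 2))))) <|
  .seq (.call kron 1 (.reg 1) 2 6) <|
  .seq (tab 2 3 7 (.sub (.reg 5) (.const 1))
    (.le (.const 1) (.load 2 (.add (.add (.add (.reg 3) (.reg 5)) (.const 2)) (.reg 2)))))
  (ret 3 7)

/-- The concatenation of the marks `a`, a gap and the marks `b`. -/
def marks (a b : List ℤ) (i : ℕ) : ℕ :=
  if 0 < nth a i ∨ (2 * a.length + b.length ≤ i ∧ 0 < nth b (i - (2 * a.length + b.length)))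
  then 1 else 0

theorem marks_le (a b : List ℤ) (i : ℕ) : marks a b i ≤ 1 := by unfold marks; split_ifs <;> omega

theorem lt_of_nth_pos {l : List ℤ} {i : ℕ} (h : 0 < nth l i) : i < l.length := by
  by_contra h'
  rw [nth_of_le (by omega)] at h; omega

theorem marks_eq_zero {a b : List ℤ} {i : ℕ} (h : 2 * (a.length + b.length) ≤ i) :
    marks a b i = 0 := by
  unfold marks
  rw [if_neg]
  rintro (h1 | ⟨-, h1⟩)
  · have := lt_of_nth_pos h1; omega
  · have := lt_of_nth_pos h1; omega

/-- In the square of `A + x ^ M * B` with `M = 2 * a.length + b.length`, the coefficients from `M`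
on are those of `2 * A * B`, since `A ^ 2` has a degree below `M` and `x ^ (2 * M) * B ^ 2` starts
late. -/
theorem sqc_marks {a b : List ℤ} {k : ℕ} (hk : k < a.length + b.length) :
    1 ≤ sqc (marks a b) (2 * a.length + b.length + k) ↔
      ∃ i j, i + j = k ∧ 0 < nth a i ∧ 0 < nth b j := by
  have key : ∀ i, 0 < marks a b i ↔ 0 < nth a i ∨ (2 * a.length + b.length ≤ i ∧
      0 < nth b (i - (2 * a.length + b.length))) := by
    intro i; unfold marks; split_ifs with h <;> simp [h]
  rw [Nat.one_le_iff_ne_zero, sqc, Ne, Finset.sum_eq_zero_iff]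
  push Not
  constructor
  · rintro ⟨⟨u, v⟩, h1, h2⟩
    rw [Finset.HasAntidiagonal.mem_antidiagonal] at h1
    simp only [ne_eq, mul_eq_zero, not_or, ← Nat.pos_iff_ne_zero, key] at h1 h2
    obtain ⟨h2 | ⟨h2, h2'⟩, h3 | ⟨h3, h3'⟩⟩ := h2
    · have := lt_of_nth_pos h2; have := lt_of_nth_pos h3; omega
    · exact ⟨u, _, by omega, h2, h3'⟩
    · exact ⟨v, _, by omega, h3, h2'⟩
    · omega
  · rintro ⟨i, j, rfl, h1, h2⟩
    refine ⟨(i, 2 * a.length + b.length + j), ?_, ?_⟩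
    · rw [Finset.HasAntidiagonal.mem_antidiagonal]; ring
    · simp only [ne_eq, mul_eq_zero, not_or, ← Nat.pos_iff_ne_zero, key]
      exact ⟨.inl h1, .inr ⟨by omega, by simpa using h2⟩⟩

theorem tl_marks (a b : List ℤ) : tl (2 * (a.length + b.length)) (marks a b) =
    (List.range a.length).map (fun i => if 1 ≤ nth a i then 1 else 0) ++
    (List.range (a.length + b.length)).map (fun _ => (0 : ℤ)) ++
    (List.range b.length).map (fun i => if 1 ≤ nth b i then 1 else 0) := by
  have e : 2 * (a.length + b.length) = a.length + (a.length + b.length) + b.length := by ring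
  rw [tl, e, range_map_append, range_map_append]
  have hb : ∀ i, (if 1 ≤ nth b i then (1 : ℤ) else 0) =
      (marks a b (a.length + (a.length + b.length) + i) : ℤ) := by
    intro i
    unfold marks
    rw [nth_of_le (l := a) (by omega)]
    have : a.length + (a.length + b.length) + i - (2 * a.length + b.length) = i := by omega
    rw [this]
    by_cases h : 1 ≤ nth b i
    · rw [if_pos h, if_pos (.inr ⟨by omega, by omega⟩)]; rfl
    · rw [if_neg h, if_neg (by omega)]; rfl
  congr 1
  · congr 1
    · apply List.map_congr_left
      intro i hi
      have hi := List.mem_range.mp hi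
      unfold marks
      by_cases h : 1 ≤ nth a i
      · rw [if_pos h, if_pos (.inl (by omega))]; rfl
      · rw [if_neg h, if_neg (by omega)]; rfl
    · apply List.map_congr_left
      intro i hi
      have hi := List.mem_range.mp hi
      unfold marks
      rw [nth_of_le (l := a) (by omega), if_neg (by omega)]; rfl
  · exact List.map_congr_left fun i _ => (hb i).symm

theorem sumset_runs {X : ℕ} {a b : List ℤ} (ha : a ≠ []) (hb : b ≠ [])
    (haX : ∀ z ∈ a, z.natAbs ≤ X) (hbX : ∀ z ∈ b, z.natAbs ≤ X)
    (hX : a.length + b.length + 2 ≤ X) :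
    ∃ out, RunsIn sumset (seg a ++ seg b) out
        ((a.length + b.length + 2) * (100000000 * lg X ^ 2) * lg X) ∧
      out.length + 1 = a.length + b.length ∧ (∀ z ∈ out, z = 0 ∨ z = 1) ∧
      ∀ k, 0 < nth out k ↔ ∃ i j, i + j = k ∧ 0 < nth a i ∧ 0 < nth b j := by
  set m := a.length with hm
  set n := b.length with hn
  have hm1 : 1 ≤ m := List.length_pos_iff.mpr ha
  have hn1 : 1 ≤ n := List.length_pos_iff.mpr hb
  obtain ⟨r, hr1, hr2, hr⟩ := kron_runs (c := 2 * (m + n) - 1) (b := 2 * (m + n) + 1)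
    (f := marks a b) (by omega) (marks_le a b) (fun i hi => marks_eq_zero (by omega))
  have ec : 2 * (m + n) - 1 + 1 = 2 * (m + n) := by omega
  rw [ec] at hr hr1 hr2
  set g : ℕ → ℤ := fun k => if 1 ≤ sqc (marks a b) (2 * m + n + k) then 1 else 0 with hg
  refine ⟨(List.range (m + n - 1)).map g, ?_, by simp; omega, ?_, ?_⟩
  · have hlg := lg_sixteen_mul_le X
    set l := seg a ++ seg b with hl
    have h0 : nth l 0 = m := by rw [hl, nth_append_left (by simp)]; rfl
    have h1 : ∀ i, i < m → nth l (1 + i) = nth a i := by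
      intro i hi
      rw [hl, nth_append_left (by simp; omega), add_comm]; rfl
    have h2 : ∀ i, nth l (m + 1 + i) = nth (seg b) i := by
      intro i; exact nth_append_add (seg a) (seg b) i
    have h3 : nth l (m + 1) = n := by rw [← add_zero (m + 1), h2]; rfl
    have h4 : ∀ i, nth l (m + 2 + i) = nth b i := by
      intro i
      have := h2 (i + 1)
      rw [show m + 2 + i = m + 1 + (i + 1) by ring, this]; rfl
    have hlb : ∀ z ∈ l, z.natAbs ≤ 16 * X := by
      intro z hz
      rcases List.mem_append.mp hz with hz | hz <;> rcases List.mem_cons.mp hz with rfl | hz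
      · rw [Int.natAbs_natCast]; omega
      · have := haX z hz; omega
      · rw [Int.natAbs_natCast]; omega
      · have := hbX z hz; omega
    have hsq : ∀ i, sqc (marks a b) i ≤ 16 * X := fun i =>
      (sqc_le (marks_le a b) (fun i hi => marks_eq_zero hi)).trans (by omega)
    have hrun : RunsIn sumset l ((List.range (m + n - 1)).map g)
        ((140000 * (2 * (m + n)) * lg (16 * X) ^ 2 + 1000 * (m + n)) * lg (16 * X)) := by
      refine RunsIn.of_wp hlb (by simp [hl]; omega) ?_
      have hmem : (State.init l).mem 0 = nth l := init_mem_zero l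
      unfold sumset
      apply wp.le
      · apply wp_seq
        refine wp_set (m : ℤ) (by simp [Expr.eval, hmem, h0]) (by omega) ?_
        apply wp_seq
        refine wp_set (n : ℤ) ?_ (by omega) ?_
        · have : ((m : ℤ) + 1).toNat = m + 1 := by omega
          simp [Expr.eval, hmem, this, h3]
        apply wp_seq
        refine wp_set ((m + n : ℕ) : ℤ) (by simp [Expr.eval]) (by omega) ?_
        apply wp_seq
        refine wp_pushv (l := []) ((2 * (m + n) - 1 : ℕ) : ℤ) (Has.nil _ _)
          (by simp [init_reg_ne]) (by simp; omega) (by simp [Expr.eval]; omega) (by omega)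
              fun i1 => ?_
        apply wp_seq
        refine wp_pushv ((2 * (m + n) + 1 : ℕ) : ℤ) i1 (by simp) (by simp; omega)
          (by simp [Expr.eval]; omega) (by omega) fun i2 => ?_
        apply wp_seq
        refine wp_tab m (fun i => if 1 ≤ nth a i then 1 else 0) (by decide) i2 (by simp)
          (by simp; omega) ?_ ?_ ?_
        · intro s' hF
          rw [Expr.eval, hF.reg 3 (by decide)]; simp
        · intro i hi s' hB hF hj
          refine ⟨?_, by split_ifs <;> simp; omega⟩
          have : s'.mem 0 = nth l := by
            rw [hF.mem 0 (by decide)]; simp [setMem_mem_ne, hmem]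
          have e1 : ((1 : ℤ) + (i : ℤ)).toNat = 1 + i := by omega
          simp [Expr.eval, this, hj, e1, h1 i hi]
        intro s1 hF1 hq1 hs1
        apply wp_seq
        refine wp_tab (m + n) (fun i => 0) (by decide) hs1 (by rw [hq1]; simp; ring)
          (by simp; omega) ?_ ?_ ?_
        · intro s' hF
          rw [Expr.eval, hF.reg 5 (by decide), hF1.reg 5 (by decide)]; simp
        · intro i hi s' hB hF hj
          exact ⟨by simp [Expr.eval], by simp⟩
        intro s2 hF2 hq2 hs2
        apply wp_seq
        refine wp_tab n (fun i => if 1 ≤ nth b i then 1 else 0) (by decide)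
            hs2 (by rw [hq2]; simp; ring)
          (by simp; omega) ?_ ?_ ?_
        · intro s' hF
          rw [Expr.eval, hF.reg 4 (by decide), hF2.reg 4 (by decide), hF1.reg 4 (by decide)]; simp
        · intro i hi s' hB hF hj
          refine ⟨?_, by split_ifs <;> simp; omega⟩
          have : s'.mem 0 = nth l := by
            rw [hF.mem 0 (by decide), hF2.mem 0 (by decide), hF1.mem 0 (by decide)]
            simp [setMem_mem_ne, hmem]
          have h3r : s'.reg 3 = m := by
            rw [hF.reg 3 (by decide), hF2.reg 3 (by decide), hF1.reg 3 (by decide)]; simp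
          have e1 : ((m : ℤ) + 2 + (i : ℤ)).toNat = m + 2 + i := by omega
          simp [Expr.eval, this, hj, h3r, e1, h4 i]
        intro s3 hF3 hq3 hs3
        have hmarks : Has s3 1 (((2 * (m + n) - 1 : ℕ) : ℤ) :: ((2 * (m + n) + 1 : ℕ) : ℤ) ::
            tl (2 * (m + n)) (marks a b)) := by
          rw [tl_marks]; simpa using hs3
        apply wp_seq
        refine wp_call (b := 140000 * (2 * (m + n)) * lg (16 * X) ^ 2) hmarks
          (by simp [Expr.eval, hq3]; omega) (by simp; omega) (hr.le ?_) ?_ (by simp; omega)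
          fun h5 => ?_
        · rw [mul_assoc (140000 * _), ← pow_succ]
          gcongr
          · exact lg_mono (by omega)
        · intro z hz
          rcases List.mem_cons.mp hz with rfl | hz
          · simp
          rcases List.mem_cons.mp hz with rfl | hz
          · rw [Int.natAbs_natCast]; omega
          exact tl_bound hsq z hz
        have hreg : ∀ r, r ∈ [3, 4, 5, 7] → s3.reg r = if r = 3 then (m : ℤ) else if r = 4 then n
            else if r = 5 then ((m + n : ℕ) : ℤ) else 0 := by
          intro r hr
          have : r ∉ [2, 1] := by
            simp only [List.mem_cons, List.not_mem_nil, or_false] at hr ⊢; omega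
          rw [hF3.reg r this, hF2.reg r this, hF1.reg r this]
          simp only [List.mem_cons, List.not_mem_nil, or_false] at hr
          rcases hr with rfl | rfl | rfl | rfl <;> simp [init_reg_ne]
        apply wp_seq
        refine wp_tab (l := []) (m + n - 1) g (by decide) (Has.nil _ _) ?_
          (by simp; omega) ?_ ?_ ?_
        · simp [hreg 7 (by decide)]
        · intro s' hF
          simp only [Expr.eval]
          rw [hF.reg 5 (by decide)]
          simp [hreg 5 (by decide)]; omega
        · intro i hi s' hB hF hj
          refine ⟨?_, by simp only [hg]; split_ifs <;> simp; omega⟩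
          have e3 : s'.reg 3 = m := by rw [hF.reg 3 (by decide)]; simp [hreg 3 (by decide)]
          have e5 : s'.reg 5 = ((m + n : ℕ) : ℤ) := by
            rw [hF.reg 5 (by decide)]; simp [hreg 5 (by decide)]
          have e6 : s'.mem 2 (2 * m + n + i + 2) = sqc (marks a b) (2 * m + n + i) := by
            rw [hF.mem 2 (by decide)]
            rw [h5 _ (by simp; omega), nth_cons_succ, nth_cons_succ, nth_tl _ (by omega)]
          have e7 : ((m : ℤ) + ((m : ℤ) + (n : ℤ)) + 2 + (i : ℤ)).toNat = 2 * m + n + i + 2 := by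
            omega
          simp [Expr.eval, e3, e5, hj, e7, e6, hg]
        intro s4 hF4 hq4 hs4
        refine wp_ret (l := (List.range (m + n - 1)).map g) (by simpa using hs4)
          (by simpa using hq4) (by simp; omega) fun s' hs' => hs'
      · simp [Expr.C, Expr.K, Expr.L]; omega
    refine hrun.le ?_
    have hpos := one_le_lg X
    have h5 : 1000 * (m + n) ≤ 1000 * (m + n) * lg X ^ 2 :=
      Nat.le_mul_of_pos_right _ (by positivity)
    calc _ ≤ (140000 * (2 * (m + n)) * (6 * lg X) ^ 2 + 1000 * (m + n) * lg X ^ 2) *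
            (6 * lg X) :=
          Nat.mul_le_mul (Nat.add_le_add (by gcongr) h5) hlg
      _ = (m + n) * (60486000 * lg X ^ 2) * lg X := by ring
      _ ≤ _ := Nat.mul_le_mul_right _ (Nat.mul_le_mul (by omega)
          (Nat.mul_le_mul_right _ (by omega)))
  · intro z hz
    obtain ⟨k, -, rfl⟩ := List.mem_map.mp hz
    simp only [hg]; split_ifs <;> simp
  · intro k
    rcases lt_or_ge k (m + n - 1) with hk | hk
    · rw [nth_map_range _ hk, ← sqc_marks (by omega)]
      simp only [hg]; split_ifs with h <;> simp [h, ← hm, ← hn]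
    · rw [nth_of_le (by simpa using hk)]
      simp only [lt_irrefl, false_iff, not_exists, not_and]
      intro i j hij h1 h2
      have := lt_of_nth_pos h1; have := lt_of_nth_pos h2; omega

/-! ### Combining latest starting times by a skewed convolution -/

/-- The skewed convolution for vectors `a`, `b` of arbitrary positive lengths `m`, `n`, computed by
the routine `c` for max-min-skewed-convolutions: the entry `k` is the maximum of
`min (a i) (b j - i)` over `i + j = k`, or `0` if this is negative.  Reversing both vectors turns
the shift by `i` into a shift by the index of the result. -/
def conv (c : Cmd) : Cmd :=
  .seq (.assign 3 (.load 0 (.const 0))) <|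
  .seq (.assign 5 (.add (.reg 3) (.load 0 (.add (.reg 3) (.const 1))))) <|
  .seq (tab 2 1 1 (.sub (.reg 5) (.const 1))
    (.mul (.le (.sub (.reg 5) (.add (.reg 2) (.const 1))) (.reg 3))
      (.load 0 (.sub (.reg 5) (.add (.reg 2) (.const 1)))))) <|
  .seq (tab 2 1 1 (.sub (.reg 5) (.const 1))
    (.sub (.load 0 (.sub (.add (.reg 3) (.reg 5)) (.reg 2)))
      (.sub (.add (.reg 5) (.reg 2)) (.const 2)))) <|
  .seq (.call c 1 (.reg 1) 2 6) <|
  .seq (tab 2 3 7 (.sub (.reg 5) (.const 1))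
    (.mul (.le (.const 1) (.load 2 (.sub (.add (.reg 5) (.reg 5)) (.add (.reg 2) (.const 4)))))
      (.load 2 (.sub (.add (.reg 5) (.reg 5)) (.add (.reg 2) (.const 4))))))
  (ret 3 7)

/-- The instance of max-min-skewed-convolution solved for the vectors `a` and `b`. -/
def convInput (a b : List ℤ) : ConvInput where
  n := a.length + b.length - 2
  A i := nth a (a.length + b.length - 2 - i)
  B j := nth b (a.length + b.length - 2 - j) - (a.length + b.length - 2 : ℕ) - j

theorem conv_mem (x : ConvInput) {k : ℕ} (hk : k ≤ 2 * x.n) :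
    ∃ i, k - x.n ≤ i ∧ i ≤ min k x.n ∧ x.conv k = min (x.A i) (x.B (k - i) + k) := by
  have hne : ((fun i : ℕ => min (x.A i) (x.B (k - i) + k)) ''
      Set.Icc (k - x.n) (min k x.n)).Nonempty := by
    refine Set.Nonempty.image _ ⟨k - x.n, le_rfl, ?_⟩
    simp only [le_min_iff]; omega
  have hfin : ((fun i : ℕ => min (x.A i) (x.B (k - i) + k)) ''
      Set.Icc (k - x.n) (min k x.n)).Finite := (Set.finite_Icc _ _).image _
  obtain ⟨i, ⟨h1, h2⟩, h3⟩ := Int.csSup_mem hne hfin.bddAbove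
  exact ⟨i, h1, h2, h3.symm⟩

theorem lt_conv_iff (x : ConvInput) {k : ℕ} (hk : k ≤ 2 * x.n) (t : ℤ) :
    t < x.conv k ↔ ∃ i, k - x.n ≤ i ∧ i ≤ min k x.n ∧ t < x.A i ∧ t < x.B (k - i) + k := by
  constructor
  · obtain ⟨i, h1, h2, h3⟩ := conv_mem x hk
    intro h
    rw [h3, lt_min_iff] at h
    exact ⟨i, h1, h2, h⟩
  · rintro ⟨i, h1, h2, h3⟩
    have hfin : ((fun i : ℕ => min (x.A i) (x.B (k - i) + k)) ''
      Set.Icc (k - x.n) (min k x.n)).Finite := (Set.finite_Icc _ _).image _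
    exact (lt_min_iff.mpr h3).trans_le (le_csSup hfin.bddAbove ⟨i, ⟨h1, h2⟩, rfl⟩)

/-- Whether an entry of the convolution exceeds `t`, for the index `k` in the reversed order. -/
theorem lt_conv_convInput {a b : List ℤ} (ha : a ≠ []) (hb : b ≠ []) {k : ℕ}
    (hk : k ≤ (convInput a b).n) (t : ℤ) :
    t < (convInput a b).conv (2 * (convInput a b).n - k) ↔
      ∃ i j, i + j = k ∧ t < nth a i ∧ t + i < nth b j := by
  have ha1 : 1 ≤ a.length := List.length_pos_iff.mpr ha
  have hb1 : 1 ≤ b.length := List.length_pos_iff.mpr hb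
  rw [lt_conv_iff _ (by omega)]
  have hn : (convInput a b).n = a.length + b.length - 2 := rfl
  set n := a.length + b.length - 2 with hn'
  rw [hn] at hk ⊢
  simp only [convInput, ← hn']
  constructor
  · rintro ⟨i, h1, h2, h3, h4⟩
    rw [le_min_iff] at h2
    have e1 : n - (2 * n - k - i) = k - (n - i) := by omega
    rw [e1] at h4
    refine ⟨n - i, k - (n - i), by omega, h3, ?_⟩
    omega
  · rintro ⟨i, j, rfl, h3, h4⟩
    have e1 : n - (n - i) = i := by omega
    have e2 : n - (2 * n - (i + j) - (n - i)) = j := by omega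
    refine ⟨n - i, by omega, by rw [le_min_iff]; omega, by rwa [e1], ?_⟩
    rw [e2]
    omega

/-- The routine `conv` on vectors with entries of absolute value at most `X`; the hypothesis on `c`
bounds the cost per entry by `H` for vectors of size at most `N`. -/
theorem conv_runs {c : Cmd} {X N H Y : ℕ}
    (hc : ∀ x : ConvInput, x.n + 1 ≤ N → (∀ i ≤ x.n, (x.A i).natAbs ≤ 16 * X) →
      (∀ i ≤ x.n, (x.B i).natAbs ≤ 16 * X) → RunsIn c x.input x.output ((x.n + 1) * H))
    {a b : List ℤ} (ha : a ≠ []) (hb : b ≠ [])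
    (haX : ∀ z ∈ a, z.natAbs ≤ X) (hbX : ∀ z ∈ b, z.natAbs ≤ X) (haY : ∀ z ∈ a, z.natAbs ≤ Y)
    (hX : a.length + b.length + 2 ≤ X) (hN : a.length + b.length ≤ N + 1) :
    ∃ out, RunsIn (conv c) (seg a ++ seg b) out
        ((a.length + b.length + 2) * (6 * (H + 2000)) * lg X) ∧
      out.length + 1 = a.length + b.length ∧ (∀ z ∈ out, z.natAbs ≤ Y) ∧
      ∀ k, ∀ t : ℤ, 0 ≤ t → (t < nth out k ↔ ∃ i j, i + j = k ∧ t < nth a i ∧ t + i < nth b j) := by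
  have hkey := fun k hk t => lt_conv_convInput ha hb (k := k) hk t
  set x := convInput a b with hx
  set m := a.length with hm
  set n := b.length with hn
  have hm1 : 1 ≤ m := List.length_pos_iff.mpr ha
  have hn1 : 1 ≤ n := List.length_pos_iff.mpr hb
  have hxn : x.n = m + n - 2 := rfl
  have hxA : ∀ i, x.A i = nth a (m + n - 2 - i) := fun i => rfl
  have hxB : ∀ i, x.B i = nth b (m + n - 2 - i) - (m + n - 2 : ℕ) - i := fun i => rfl
  have hAX : ∀ i, (x.A i).natAbs ≤ X := fun i => natAbs_nth_le haX _
  have hBX : ∀ i, i ≤ x.n → (x.B i).natAbs ≤ 3 * X := fun i hi => by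
    have := natAbs_nth_le hbX (m + n - 2 - i)
    rw [hxB]; omega
  have hCX : ∀ k, k ≤ 2 * x.n → (x.conv k).natAbs ≤ 16 * X := fun k hk => by
    obtain ⟨i, h1, h2, h3⟩ := conv_mem x hk
    have h4 := hAX i
    rw [le_min_iff] at h2
    have h5 := hBX (k - i) (by omega)
    rw [h3]
    rcases min_choice (x.A i) (x.B (k - i) + k) with h | h <;> rw [h] <;> omega
  have hCY : ∀ k, k ≤ x.n → 1 ≤ x.conv (2 * x.n - k) → (x.conv (2 * x.n - k)).natAbs ≤ Y := by
    intro k hk h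
    obtain ⟨i, h1, h2, h3⟩ := conv_mem x (k := 2 * x.n - k) (by omega)
    have h4 : (x.A i).natAbs ≤ Y := natAbs_nth_le haY _
    have := min_le_left (x.A i) (x.B (2 * x.n - k - i) + (2 * x.n - k : ℕ))
    omega
  set g : ℕ → ℤ := fun k => (if 1 ≤ x.conv (2 * x.n - k) then 1 else 0) * x.conv (2 * x.n - k)
    with hg
  have hgX : ∀ k, (g k).natAbs ≤ (x.conv (2 * x.n - k)).natAbs := by
    intro k; simp only [hg]; split_ifs <;> simp
  refine ⟨(List.range (m + n - 1)).map g, ?_, by simp; omega, ?_, ?_⟩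
  · have hlg := lg_sixteen_mul_le X
    set l := seg a ++ seg b with hl
    have h0 : nth l 0 = m := by rw [hl, nth_append_left (by simp)]; rfl
    have h1 : ∀ i, i < m → nth l (i + 1) = nth a i := by
      intro i hi
      rw [hl, nth_append_left (by simp; omega)]; rfl
    have h2 : ∀ i, nth l (m + 1 + i) = nth (seg b) i := by
      intro i; exact nth_append_add (seg a) (seg b) i
    have h3 : nth l (m + 1) = n := by rw [← add_zero (m + 1), h2]; rfl
    have h4 : ∀ i, nth l (m + 2 + i) = nth b i := by
      intro i
      have := h2 (i + 1)
      rw [show m + 2 + i = m + 1 + (i + 1) by ring, this]; rfl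
    have hlb : ∀ z ∈ l, z.natAbs ≤ 16 * X := by
      intro z hz
      rcases List.mem_append.mp hz with hz | hz <;> rcases List.mem_cons.mp hz with rfl | hz
      · rw [Int.natAbs_natCast]; omega
      · have := haX z hz; omega
      · rw [Int.natAbs_natCast]; omega
      · have := hbX z hz; omega
    have hrun : RunsIn (conv c) l ((List.range (m + n - 1)).map g)
        (((m + n - 1) * H + 1000 * (m + n)) * lg (16 * X)) := by
      refine RunsIn.of_wp hlb (by simp [hl]; omega) ?_
      have hmem : (State.init l).mem 0 = nth l := init_mem_zero l
      unfold conv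
      apply wp.le
      · apply wp_seq
        refine wp_set (m : ℤ) (by simp [Expr.eval, hmem, h0]) (by omega) ?_
        apply wp_seq
        refine wp_set ((m + n : ℕ) : ℤ) ?_ (by omega) ?_
        · have : ((m : ℤ) + 1).toNat = m + 1 := by omega
          simp [Expr.eval, hmem, this, h3]
        apply wp_seq
        refine wp_tab (l := []) (m + n - 1) x.A (by decide) (Has.nil _ _) (by simp [init_reg_ne])
          (by simp; omega) ?_ ?_ ?_
        · intro s' hF
          simp only [Expr.eval]
          rw [hF.reg 5 (by decide)]; simp; omega
        · intro i hi s' hB hF hj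
          have e0 : s'.mem 0 = nth l := by
            rw [hF.mem 0 (by decide)]; simp [hmem]
          have e3 : s'.reg 3 = m := by rw [hF.reg 3 (by decide)]; simp
          have e5 : s'.reg 5 = ((m + n : ℕ) : ℤ) := by rw [hF.reg 5 (by decide)]; simp
          have e1 : (((m + n : ℕ) : ℤ) - ((i : ℤ) + 1)).toNat = (m + n - 2 - i) + 1 := by omega
          refine ⟨?_, by have := hAX i; omega⟩
          simp only [Expr.eval, e0, e3, e5, hj, e1, hxA]
          rcases lt_or_ge (m + n - 2 - i) m with h | h
          · rw [if_pos (by omega), h1 _ h, one_mul]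
          · rw [if_neg (by omega), nth_of_le (l := a) (by omega), zero_mul]
        intro s1 hF1 hq1 hs1
        apply wp_seq
        refine wp_tab (m + n - 1) x.B (by decide) hs1 (by rw [hq1]; simp)
          (by simp; omega) ?_ ?_ ?_
        · intro s' hF
          simp only [Expr.eval]
          rw [hF.reg 5 (by decide), hF1.reg 5 (by decide)]; simp; omega
        · intro i hi s' hB hF hj
          have e0 : s'.mem 0 = nth l := by
            rw [hF.mem 0 (by decide), hF1.mem 0 (by decide)]; simp [hmem]
          have e3 : s'.reg 3 = m := by
            rw [hF.reg 3 (by decide), hF1.reg 3 (by decide)]; simp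
          have e5 : s'.reg 5 = ((m + n : ℕ) : ℤ) := by
            rw [hF.reg 5 (by decide), hF1.reg 5 (by decide)]; simp
          have e1 : ((m : ℤ) + ((m + n : ℕ) : ℤ) - (i : ℤ)).toNat = m + 2 + (m + n - 2 - i) := by
            omega
          refine ⟨?_, by have := hBX i (by omega); omega⟩
          simp only [Expr.eval, e0, e3, e5, hj, e1, hxB, h4]
          omega
        intro s2 hF2 hq2 hs2
        have hin : Has s2 1 x.input := by
          have : x.n + 1 = m + n - 1 := by omega
          rw [ConvInput.input, this]; simpa using hs2
        have hinl : x.input.length = 2 * (m + n - 1) := by simp [ConvInput.input]; omega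
        have houtl : x.output.length = 2 * (m + n - 2) + 1 := by simp [ConvInput.output]; omega
        apply wp_seq
        refine wp_call (b := (m + n - 1) * H) hin
          (by rw [hinl]; simp [Expr.eval, hq2]; omega) (by rw [hinl]; omega)
          ((hc x (by omega) (fun i _ => by have := hAX i; omega)
            (fun i hi => by have := hBX i hi; omega)).le ?_) ?_ (by rw [houtl]; omega)
          fun h5 => ?_
        · rw [show x.n + 1 = m + n - 1 by omega]
          exact Nat.le_mul_of_pos_right _ (one_le_lg _)
        · intro z hz
          obtain ⟨k, hk, rfl⟩ := List.mem_map.mp hz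
          exact hCX k (by have := List.mem_range.mp hk; omega)
        have e3 : s2.reg 3 = m := by
            rw [hF2.reg 3 (by decide), hF1.reg 3 (by decide)]; simp
        have e5 : s2.reg 5 = ((m + n : ℕ) : ℤ) := by
          rw [hF2.reg 5 (by decide), hF1.reg 5 (by decide)]; simp
        have e7 : s2.reg 7 = 0 := by
          rw [hF2.reg 7 (by decide), hF1.reg 7 (by decide)]; simp [init_reg_ne]
        apply wp_seq
        refine wp_tab (l := []) (m + n - 1) g (by decide) (Has.nil _ _) (by simp [e7])
          (by simp; omega) ?_ ?_ ?_
        · intro s' hF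
          simp only [Expr.eval]
          rw [hF.reg 5 (by decide)]
          simp [e5]; omega
        · intro i hi s' hB hF hj
          refine ⟨?_, (hgX i).trans (hCX _ (by omega))⟩
          have e5' : s'.reg 5 = ((m + n : ℕ) : ℤ) := by
            rw [hF.reg 5 (by decide)]; simp [e5]
          have e6 : s'.mem 2 (2 * x.n - i) = x.conv (2 * x.n - i) := by
            rw [hF.mem 2 (by decide)]
            rw [h5 _ (by omega), ConvInput.output, nth_map_range _ (by omega)]
          have e1 : (((m + n : ℕ) : ℤ) + ((m + n : ℕ) : ℤ) - ((i : ℤ) + 4)).toNat =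
            2 * x.n - i := by omega
          simp only [Expr.eval, e5', hj, e1, e6, hg]
        intro s4 hF4 hq4 hs4
        refine wp_ret (l := (List.range (m + n - 1)).map g) (by simpa using hs4)
          (by simpa using hq4) (by simp; omega) fun s' hs' => hs'
      · have hinl : x.input.length = 2 * (m + n - 1) := by simp [ConvInput.input]; omega
        have houtl : x.output.length = 2 * (m + n - 2) + 1 := by simp [ConvInput.output]; omega
        simp [Expr.C, Expr.K, Expr.L, hinl, houtl]; omega
    refine hrun.le ?_
    calc _ ≤ ((m + n + 2) * H + 2000 * (m + n + 2)) * (6 * lg X) :=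
          Nat.mul_le_mul (Nat.add_le_add (Nat.mul_le_mul_right _ (by omega)) (by omega)) hlg
      _ = _ := by ring
  · intro z hz
    obtain ⟨k, hk, rfl⟩ := List.mem_map.mp hz
    have hk := List.mem_range.mp hk
    simp only [hg]; split_ifs with h
    · rw [one_mul]; exact hCY k (by omega) h
    · simp
  · intro k t ht
    rcases lt_or_ge k (m + n - 1) with hk | hk
    · rw [nth_map_range _ hk, ← hkey k (by omega)]
      simp only [hg]; split_ifs with h <;> omega
    · rw [nth_of_le (by simpa using hk)]
      constructor
      · omega
      · rintro ⟨i, j, hij, h1, h2⟩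
        have := lt_of_nth_pos (l := a) (i := i) (by omega)
        have := lt_of_nth_pos (l := b) (i := j) (by omega)
        omega

/-! ### Sorting jobs -/

/-- A list of jobs (processing time, due date) as a list of integers. -/
def flat (z : List (ℕ × ℕ)) : List ℤ := z.flatMap fun j => [(j.1 : ℤ), (j.2 : ℤ)]

@[simp] theorem flat_nil : flat [] = [] := rfl

@[simp] theorem flat_cons (j : ℕ × ℕ) (z : List (ℕ × ℕ)) :
    flat (j :: z) = (j.1 : ℤ) :: (j.2 : ℤ) :: flat z := rfl

@[simp] theorem flat_append (z w : List (ℕ × ℕ)) : flat (z ++ w) = flat z ++ flat w := by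
  simp [flat]

@[simp] theorem length_flat (z : List (ℕ × ℕ)) : (flat z).length = 2 * z.length := by
  induction z with
  | nil => rfl
  | cons j z ih => simp [ih]; ring

theorem mem_flat {z : List (ℕ × ℕ)} {x : ℤ} :
    x ∈ flat z ↔ ∃ j ∈ z, x = (j.1 : ℤ) ∨ x = (j.2 : ℤ) := by
  simp [flat]

theorem nth_mid (p r : List ℤ) (x : ℤ) : nth (p ++ x :: r) p.length = x := by
  rw [nth_append_right le_rfl]; simp

theorem nth_mid_succ (p r : List ℤ) (x y : ℤ) : nth (p ++ x :: y :: r) (p.length + 1) = y := by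
  rw [nth_append_add]; simp

/-- Comparison of jobs by their due dates. -/
def dueLe (x y : ℕ × ℕ) : Bool := decide (x.2 ≤ y.2)

/-- Merge two lists of jobs that are sorted by due dates.  The registers `2` and `4` are the reading
positions, and the first list ends at the position in register `3`.  Sums and products of
comparisons serve as disjunctions and conjunctions. -/
def mergeJobs : Cmd :=
  .seq (.assign 2 (.const 1)) <|
  .seq (.assign 3 (.add (.const 1) (.load 0 (.const 0)))) <|
  .seq (.assign 4 (.add (.reg 3) (.const 1))) <|
  .seq (.loop (.add (.le (.add (.reg 2) (.const 1)) (.reg 3))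
      (.le (.add (.reg 4) (.const 1)) (.reg 0)))
    (.branch (.add (.le (.reg 0) (.reg 4)) (.mul (.le (.add (.reg 2) (.const 1)) (.reg 3))
        (.le (.load 0 (.add (.reg 2) (.const 1))) (.load 0 (.add (.reg 4) (.const 1))))))
      (.seq (push 1 1 (.load 0 (.reg 2))) <|
        .seq (push 1 1 (.load 0 (.add (.reg 2) (.const 1))))
        (.assign 2 (.add (.reg 2) (.const 2))))
      (.seq (push 1 1 (.load 0 (.reg 4))) <|
        .seq (push 1 1 (.load 0 (.add (.reg 4) (.const 1))))
        (.assign 4 (.add (.reg 4) (.const 2))))))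
    (ret 1 1)

theorem mergeJobs_runs {X : ℕ} {z w : List (ℕ × ℕ)} (hz : ∀ x ∈ flat z, x.natAbs ≤ X)
    (hw : ∀ x ∈ flat w, x.natAbs ≤ X) (hX : 2 * z.length + 2 * w.length + 2 ≤ X) :
    RunsIn mergeJobs (seg (flat z) ++ seg (flat w)) (flat (List.merge z w dueLe))
      ((1000 * (z.length + w.length) + 1000) * lg (2 * X)) := by
  set l := seg (flat z) ++ seg (flat w) with hl
  have hll : l.length = 2 * z.length + 2 * w.length + 2 := by simp [hl]; ring
  have hlb : ∀ x ∈ l, x.natAbs ≤ 2 * X := by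
    intro x hx
    rcases List.mem_append.mp hx with hx | hx <;> rcases List.mem_cons.mp hx with rfl | hx
    · simp; omega
    · have := hz x hx; omega
    · simp; omega
    · have := hw x hx; omega
  refine RunsIn.of_wp hlb (by omega) ?_
  have hmem : (State.init l).mem 0 = nth l := init_mem_zero l
  have h0 : nth l 0 = (2 * z.length : ℕ) := by rw [hl, nth_append_left (by simp)]; simp [seg]
  have hnX : ∀ i, (nth l i).natAbs ≤ 2 * X := natAbs_nth_le hlb
  -- The entries at the two reading positions.
  have hz1 : ∀ z1 j u, z = z1 ++ j :: u → nth l (2 * z1.length + 1) = (j.1 : ℤ) ∧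
      nth l (2 * z1.length + 1 + 1) = (j.2 : ℤ) := by
    intro z1 j u h
    have e : l = (((flat z).length : ℤ) :: flat z1) ++
        ((j.1 : ℤ) :: (j.2 : ℤ) :: (flat u ++ seg (flat w))) := by
      rw [hl, seg, h]; simp
    have e2 : (((flat z).length : ℤ) :: flat z1).length = 2 * z1.length + 1 := by simp
    rw [← e2, e]
    exact ⟨nth_mid _ _ _, nth_mid_succ _ _ _ _⟩
  have hw1 : ∀ w1 j v, w = w1 ++ j :: v →
      nth l (2 * z.length + 2 + 2 * w1.length) = (j.1 : ℤ) ∧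
      nth l (2 * z.length + 2 + 2 * w1.length + 1) = (j.2 : ℤ) := by
    intro w1 j v h
    have e : l = (seg (flat z) ++ (((flat w).length : ℤ) :: flat w1)) ++
        ((j.1 : ℤ) :: (j.2 : ℤ) :: flat v) := by
      rw [hl, h]; simp [seg]
    have e2 : (seg (flat z) ++ (((flat w).length : ℤ) :: flat w1)).length =
        2 * z.length + 2 + 2 * w1.length := by simp; ring
    rw [← e2, e]
    exact ⟨nth_mid _ _ _, nth_mid_succ _ _ _ _⟩
  unfold mergeJobs
  apply wp.le
  · apply wp_seq
    refine wp_set 1 (by simp [Expr.eval]) (by omega) ?_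
    apply wp_seq
    refine wp_set ((2 * z.length + 1 : ℕ) : ℤ) (by simp [Expr.eval, hmem, h0]; ring) (by omega) ?_
    apply wp_seq
    refine wp_set ((2 * z.length + 2 : ℕ) : ℤ) (by simp [Expr.eval]; ring) (by omega) ?_
    apply wp_seq
    set I : ℕ → State → Prop := fun B s => ∃ z1 u w1 v done, z = z1 ++ u ∧ w = w1 ++ v ∧
      done ++ List.merge u v dueLe = List.merge z w dueLe ∧ done.length + u.length + v.length =
        z.length + w.length ∧ s.reg 0 = (2 * z.length + 2 * w.length + 2 : ℕ) ∧
      s.reg 3 = (2 * z.length + 1 : ℕ) ∧ s.reg 2 = (2 * z1.length + 1 : ℕ) ∧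
      s.reg 4 = (2 * z.length + 2 + 2 * w1.length : ℕ) ∧ s.reg 1 = ((flat done).length : ℕ) ∧
      Has s 1 (flat done) ∧ s.mem 0 = nth l ∧ B = (u.length + v.length) * 300 + 50 with hI
    refine wp_while I ?_ ((z.length + w.length) * 300 + 50) _ ?_
    · rintro B s hB ⟨z1, u, w1, v, done, hz2, hw2, hm, hlen, r0, r3, r2, r4, r1, hh, hm0, rfl⟩
      have hzl : z.length = z1.length + u.length := by rw [hz2]; simp
      have hwl : w.length = w1.length + v.length := by rw [hw2]; simp
      have hu : (Expr.le (.add (.reg 2) (.const 1)) (.reg 3)).eval s =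
          if 0 < u.length then 1 else 0 := by
        simp only [Expr.eval, r2, r3]
        congr 1; exact propext (by omega)
      have hv : (Expr.le (.add (.reg 4) (.const 1)) (.reg 0)).eval s =
          if 0 < v.length then 1 else 0 := by
        simp only [Expr.eval, r4, r0]
        congr 1; exact propext (by omega)
      by_cases hend : u.length = 0 ∧ v.length = 0
      · left
        refine ⟨?_, by simp [Expr.C, Expr.K, Expr.L], ?_⟩
        · rw [Expr.eval, hu, hv]; simp [hend]
        · obtain ⟨h1, h2⟩ := hend
          rw [List.length_eq_zero_iff] at h1 h2
          subst h1 h2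
          simp only [List.merge_right, List.append_nil] at hm
          refine (wp_ret (l := flat done) hh r1 ?_ fun s' hs' => ?_).le
            (b' := 4 * (2 * (z.length + w.length)) + 4) ?_
          · simp at hlen ⊢; omega
          · rw [hs', hm]
          · simp at hlen ⊢; omega
      right
      have hv' : (Expr.le (.reg 0) (.reg 4)).eval s = if v.length = 0 then 1 else 0 := by
        simp only [Expr.eval, r4, r0]
        congr 1; exact propext (by omega)
      have e1 : ((2 * z1.length + 1 : ℕ) : ℤ).toNat = 2 * z1.length + 1 := by omega
      have e2 : (((2 * z1.length + 1 : ℕ) : ℤ) + 1).toNat = 2 * z1.length + 1 + 1 := by omega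
      have e3 : ((2 * z.length + 2 + 2 * w1.length : ℕ) : ℤ).toNat =
        2 * z.length + 2 + 2 * w1.length := by omega
      have e4 : (((2 * z.length + 2 + 2 * w1.length : ℕ) : ℤ) + 1).toNat =
        2 * z.length + 2 + 2 * w1.length + 1 := by omega
      have hfd : (flat done).length = 2 * done.length := length_flat _
      refine ⟨?_, ?_⟩
      · rw [Expr.eval, hu, hv]
        split_ifs <;> simp
        omega
      by_cases hcond : 0 < u.length ∧ (v.length = 0 ∨
          ∀ j ∈ u.head?, ∀ j' ∈ v.head?, j.2 ≤ j'.2)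
      · obtain ⟨h1, h2⟩ := hcond
        obtain ⟨j, u, rfl⟩ := List.exists_cons_of_length_pos h1
        obtain ⟨n1, n2⟩ := hz1 z1 j u hz2
        have hmerge : List.merge (j :: u) v dueLe = j :: List.merge u v dueLe := by
          rcases v with _ | ⟨j', v⟩
          · simp
          · rw [List.cons_merge_cons, if_pos]
            simpa [dueLe] using h2
        rw [List.length_cons] at hzl hlen
        refine wp_while_step (I := I) (b₁ := 180) ((u.length + v.length) * 300 + 50) ?_ ?_
        · apply wp.le
          · apply wp_branch_pos
            · rw [Expr.eval, Expr.eval, hu, hv']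
              rw [if_pos h1, one_mul]
              rcases v with _ | ⟨j', v⟩
              · simp only [List.length_nil, if_true, Expr.eval]; split_ifs <;> omega
              · obtain ⟨n3, n4⟩ := hw1 w1 j' v hw2
                have : j.2 ≤ j'.2 := by simpa using h2
                simp only [Expr.eval, hm0, r2, r4, e2, e4, n2, n4]
                rw [if_neg (by simp), if_pos (by exact_mod_cast this)]; simp
            · apply wp_seq
              refine wp_pushv (j.1 : ℤ) hh r1 (by omega)
                (by simp only [Expr.eval, r2, e1, hm0, n1]) (by rw [← n1]; exact hnX _) fun h3 => ?_
              apply wp_seq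
              refine wp_pushv (j.2 : ℤ) h3 (by simp) (by simp; omega)
                (by
                  simp only [Expr.eval, setReg_reg, setMem_reg, setReg_mem]
                  rw [if_neg (by decide), r2, e2, setMem_mem_ne _ _ _ _ _ (by decide), hm0, n2])
                (by rw [← n2]; exact hnX _) fun h4 => ?_
              refine wp_set ((2 * (z1.length + 1) + 1 : ℕ) : ℤ)
                (by simp [Expr.eval, r2]; ring) (by omega) ?_
              refine ⟨z1 ++ [j], u, w1, v, done ++ [j], by simp [hz2], hw2, ?_, ?_, ?_, ?_, ?_, ?_,
                ?_, ?_, ?_, rfl⟩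
              · rw [← hm, hmerge]; simp
              · simp; omega
              · simpa using r0
              · simpa using r3
              · simp
              · simpa using r4
              · simp; ring
              · simpa using h4
              · simpa [setMem_mem_ne] using hm0
          · simp [Expr.C, Expr.K, Expr.L]
        · simp [Expr.C, Expr.K, Expr.L]; omega
      · have h1 : v ≠ [] := by
          rintro rfl
          simp only [List.length_nil, and_true] at hend hcond
          exact hcond ⟨by omega, by simp⟩
        obtain ⟨j', v, rfl⟩ := List.exists_cons_of_ne_nil h1
        obtain ⟨n1, n2⟩ := hw1 w1 j' v hw2
        have hmerge : List.merge u (j' :: v) dueLe = j' :: List.merge u v dueLe := by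
          rcases u with _ | ⟨j, u⟩
          · simp
          · rw [List.cons_merge_cons, if_neg]
            simpa [dueLe] using hcond
        rw [List.length_cons] at hwl hlen
        refine wp_while_step (I := I) (b₁ := 180) ((u.length + v.length) * 300 + 50) ?_ ?_
        · apply wp.le
          · apply wp_branch_neg
            · rw [Expr.eval, Expr.eval, hu, hv', if_neg (by simp), zero_add]
              rcases u with _ | ⟨j, u⟩
              · simp
              · obtain ⟨n3, n4⟩ := hz1 z1 j u hz2
                have : ¬ j.2 ≤ j'.2 := by simpa using hcond
                simp only [Expr.eval, hm0, r2, r4, e2, e4, n2, n4]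
                rw [if_pos (by simp), if_neg (by exact_mod_cast this), mul_zero]
            · apply wp_seq
              refine wp_pushv (j'.1 : ℤ) hh r1 (by omega)
                (by simp only [Expr.eval, r4, e3, hm0, n1]) (by rw [← n1]; exact hnX _) fun h3 => ?_
              apply wp_seq
              refine wp_pushv (j'.2 : ℤ) h3 (by simp) (by simp; omega)
                (by
                  simp only [Expr.eval, setReg_reg, setMem_reg, setReg_mem]
                  rw [if_neg (by decide), r4, e4, setMem_mem_ne _ _ _ _ _ (by decide), hm0, n2])
                (by rw [← n2]; exact hnX _) fun h4 => ?_
              refine wp_set ((2 * z.length + 2 + 2 * (w1.length + 1) : ℕ) : ℤ)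
                (by simp [Expr.eval, r4]; ring) (by omega) ?_
              refine ⟨z1, u, w1 ++ [j'], v, done ++ [j'], hz2, by simp [hw2], ?_, ?_, ?_, ?_, ?_,
                  ?_,
                ?_, ?_, ?_, rfl⟩
              · rw [← hm, hmerge]; simp
              · simp; omega
              · simpa using r0
              · simpa using r3
              · simpa using r2
              · simp
              · simp; ring
              · simpa using h4
              · simpa [setMem_mem_ne] using hm0
          · simp [Expr.C, Expr.K, Expr.L]
        · simp [Expr.C, Expr.K, Expr.L]; omega
    · exact ⟨[], z, [], w, [], rfl, rfl, rfl, by simp, by simp [init_reg_zero, hll], by simp,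
        by simp, by simp, by simp [init_reg_ne], Has.nil _ _, by simp [hmem], rfl⟩
  · simp [Expr.C, Expr.K, Expr.L]; omega

theorem mergeOp_mergeJobs {X : ℕ} {all : List (ℕ × ℕ)} (hX : ∀ x ∈ flat all, x.natAbs ≤ X) :
    MergeOp mergeJobs 6000 X
      (fun v z => ∃ z', v = flat z' ∧ z'.Perm z ∧ z'.Pairwise (fun x y => dueLe x y = true)) all :=
          by
  have hb : ∀ z' z : List (ℕ × ℕ), z'.Perm z → z.Sublist all → ∀ x ∈ flat z', x.natAbs ≤ X := by
    intro z' z h1 h2 x hx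
    obtain ⟨j, hj, h⟩ := mem_flat.mp hx
    exact hX x (mem_flat.mpr ⟨j, h2.subset (h1.subset hj), h⟩)
  refine ⟨?_, ?_⟩
  · rintro _ _ z w ⟨z', rfl, h1, h2⟩ ⟨w', rfl, h3, h4⟩ hs hX'
    rw [length_flat, length_flat] at hX'
    refine ⟨_, (mergeJobs_runs (hb z' z h1 ((List.sublist_append_left z w).trans hs))
      (hb w' w h3 ((List.sublist_append_right z w).trans hs)) hX').le ?_, ⟨_, rfl, ?_, ?_⟩, ?_⟩
    · have h5 := (lg_mono (show 2 * X ≤ 16 * X by omega)).trans (lg_sixteen_mul_le X)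
      rw [length_flat, length_flat]
      calc _ ≤ (1000 * (z'.length + w'.length) + 1000) * (6 * lg X) := Nat.mul_le_mul_left _ h5
        _ = (z'.length + w'.length + 1) * 6000 * lg X := by ring
        _ ≤ _ := Nat.mul_le_mul_right _ (Nat.mul_le_mul_right _ (by omega))
    · exact (List.merge_perm_append _).trans (h1.append h3)
    · refine List.pairwise_merge ?_ ?_ _ _ h2 h4
      · intro a b c; simp only [dueLe, decide_eq_true_eq]; exact le_trans
      · intro a b; simp only [dueLe, Bool.or_eq_true, decide_eq_true_eq]; exact le_total _ _
    · have := (List.merge_perm_append dueLe (xs := z') (ys := w')).length_eq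
      simp at this ⊢; omega
  · rintro _ z ⟨z', rfl, h1, -⟩ hs
    exact hb z' z h1 hs

theorem sort_runs {X : ℕ} {z : List (ℕ × ℕ)} (hz : z ≠ []) (hX : ∀ x ∈ flat z, x.natAbs ≤ X)
    (hzX : 6 * z.length + 4 ≤ X) :
    ∃ z' : List (ℕ × ℕ), z'.Perm z ∧ z'.Pairwise (fun x y => x.2 ≤ y.2) ∧
      RunsIn (treeOf mergeJobs) (((z.length : ℤ) - 1) ::
          z.flatMap fun j => [2, (j.1 : ℤ), (j.2 : ℤ)])
        (0 :: seg (flat z')) (lg X * (3 * z.length * 6350 * lg X)) := by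
  have h1 : (z.map fun j => flat [j]).flatMap seg =
      z.flatMap fun j => [2, (j.1 : ℤ), (j.2 : ℤ)] := by
    rw [List.flatMap_map]; rfl
  have h2 : (z.flatMap fun j => [2, (j.1 : ℤ), (j.2 : ℤ)]).length = 3 * z.length := by
    clear h1 hz hX hzX
    induction z with
    | nil => rfl
    | cons j z ih => rw [List.flatMap_cons, List.length_append, ih]; simp; ring
  obtain ⟨v, ⟨z', rfl, h3, h4⟩, -, h5⟩ := treeOf_runs (mergeOp_mergeJobs hX)
    (vs := z.map fun j => flat [j]) (zs := z.map fun j => [j]) (by simpa using hz)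
    (by
      rw [List.forall₂_map_left_iff, List.forall₂_map_right_iff, List.forall₂_same]
      exact fun j _ => ⟨[j], rfl, List.Perm.refl _, by simp⟩)
    (by simp [← List.flatMap_def]) (by rw [h1, h2]; omega)
  refine ⟨z', h3, h4.imp (by simp [dueLe]), ?_⟩
  rw [h1, h2, List.length_map] at h5
  exact h5

/-! ### Computing the blocks of due dates -/

/-- The start of the block with end `m`, if `k, …, m` belong to the block; `ld k m` is the load of
the due dates `k, …, m` and `θ` is the threshold. -/
def blockStart (ld : ℕ → ℕ → ℕ) (θ m : ℕ) : ℕ → ℕ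
  | 0 => 0
  | 1 => 1
  | k + 2 => if ld (k + 1) m ≤ θ then blockStart ld θ m (k + 1) else k + 2

theorem blockStart_le (ld : ℕ → ℕ → ℕ) (θ m : ℕ) : ∀ k, blockStart ld θ m k ≤ k
  | 0 => le_rfl
  | 1 => le_rfl
  | k + 2 => by
    unfold blockStart
    split_ifs
    · exact (blockStart_le ld θ m (k + 1)).trans (by omega)
    · exact le_rfl

theorem one_le_blockStart (ld : ℕ → ℕ → ℕ) (θ m : ℕ) : ∀ k, 1 ≤ k → 1 ≤ blockStart ld θ m k
  | 0 => by simp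
  | 1 => by simp [blockStart]
  | k + 2 => by
    intro _
    unfold blockStart
    split_ifs
    · exact one_le_blockStart ld θ m (k + 1) (by omega)
    · omega

/-- The partition of the due dates `1, …, m` into blocks, given by their first and last elements;
the last block comes first.  A block is a bundle or a single red due date: if `ld` is the load, no
block with more than one due date can contain a due date with a load above `θ`. -/
def blockList (ld : ℕ → ℕ → ℕ) (θ : ℕ) : ℕ → List (ℕ × ℕ)
  | 0 => []
  | m + 1 => (blockStart ld θ (m + 1) (m + 1), m + 1) ::
      blockList ld θ (blockStart ld θ (m + 1) (m + 1) - 1)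
termination_by m => m
decreasing_by
  have h := blockStart_le ld θ (m + 1) (m + 1)
  omega

/-- The positions `s m, …, s (m + 1) - 1` of the list `z` hold the jobs with the due date
`due (m + 1)`, where `due 1 < … < due D` are all due dates. -/
structure Grouped (z : List (ℕ × ℕ)) (D : ℕ) (s due : ℕ → ℕ) : Prop where
  s_zero : s 0 = 0
  s_D : s D = z.length
  s_lt : ∀ m < D, s m < s (m + 1)
  due_zero : due 0 = 0
  due_lt : ∀ m < D, due m < due (m + 1)
  due_eq : ∀ m < D, ∀ i (hi : i < z.length), s m ≤ i → i < s (m + 1) → z[i].2 = due (m + 1)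

/-- The total processing time of the first `i` jobs. -/
def preSum (z : List (ℕ × ℕ)) (i : ℕ) : ℕ := ((z.take i).map Prod.fst).sum

theorem preSum_succ {z : List (ℕ × ℕ)} {i : ℕ} (hi : i < z.length) :
    preSum z (i + 1) = preSum z i + z[i].1 := by
  unfold preSum
  rw [List.take_add_one, List.getElem?_eq_getElem hi, List.map_append, List.sum_append]
  simp

theorem preSum_mono (z : List (ℕ × ℕ)) {i j : ℕ} (h : i ≤ j) : preSum z i ≤ preSum z j := by
  induction j, h using Nat.le_induction with
  | base => exact le_rfl
  | succ j _ ih =>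
    rcases lt_or_ge j z.length with hj | hj
    · rw [preSum_succ hj]; omega
    · refine ih.trans (le_of_eq ?_)
      unfold preSum
      rw [List.take_of_length_le hj, List.take_of_length_le (by omega)]

theorem preSum_le (z : List (ℕ × ℕ)) (i : ℕ) : preSum z i ≤ (z.map Prod.fst).sum := by
  rcases le_total i z.length with h | h
  · have := preSum_mono z h
    rwa [preSum, preSum, List.take_length] at this
  · rw [preSum, List.take_of_length_le h]

theorem nth_flat {z : List (ℕ × ℕ)} {i : ℕ} (hi : i < z.length) :
    nth (flat z) (2 * i) = z[i].1 ∧ nth (flat z) (2 * i + 1) = z[i].2 := by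
  have e : flat z = flat (z.take i) ++ ((z[i].1 : ℤ) :: (z[i].2 : ℤ) :: flat (z.drop (i + 1))) := by
    rw [← flat_cons, ← flat_append, ← List.drop_eq_getElem_cons hi, List.take_append_drop]
  have e2 : (flat (z.take i)).length = 2 * i := by simp; omega
  rw [e, ← e2]
  exact ⟨nth_mid _ _ _, nth_mid_succ _ _ _ _⟩

namespace Grouped

variable {z : List (ℕ × ℕ)} {D : ℕ} {s due : ℕ → ℕ}

theorem s_mono (h : Grouped z D s due) {i j : ℕ} (hij : i ≤ j) (hj : j ≤ D) : s i ≤ s j := by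
  induction j, hij using Nat.le_induction with
  | base => exact le_rfl
  | succ j _ ih => exact (ih (by omega)).trans (h.s_lt j (by omega)).le

theorem le_s (h : Grouped z D s due) {m : ℕ} (hm : m ≤ D) : m ≤ s m := by
  induction m with
  | zero => omega
  | succ m ih => have := ih (by omega); have := h.s_lt m (by omega); omega

end Grouped

/-- The blocks of due dates for a list of jobs sorted by due dates.  The input is the threshold,
the length of the list of jobs and the list; the output has three entries for each block `k, …, m`:
the index `m` and the first and last position of its jobs (the latter exclusively).  Array `1` takes
the total processing times of the first jobs and array `2` the first positions of the due dates; the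
blocks are found from the last one on, with end `m` in register `7`, and reversed in the end. -/
def plan : Cmd :=
  .seq (.assign 3 (.div (.load 0 (.const 1)) (.const 2))) <|
  .seq (push 1 1 (.const 0)) <|
  .seq (For 6 (.reg 3)
    (.seq (.branch (.le (.add (.reg 4) (.const 1))
        (.load 0 (.add (.mul (.const 2) (.reg 6)) (.const 3))))
      (.seq (push 2 2 (.reg 6)) (.assign 4 (.load 0 (.add (.mul (.const 2) (.reg 6)) (.const 3)))))
      .skip) <|
    .seq (.assign 5 (.add (.reg 5) (.load 0 (.add (.mul (.const 2) (.reg 6)) (.const 2)))))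
      (push 1 1 (.reg 5)))) <|
  .seq (push 2 2 (.reg 3)) <|
  .seq (.assign 7 (.sub (.reg 2) (.const 1))) <|
  .seq (.loop (.reg 7)
    (.seq (.assign 8 (.reg 7)) <|
    .seq (.loop (.mul (.le (.const 2) (.reg 8))
        (.le (.sub (.load 1 (.load 2 (.reg 7))) (.load 1 (.load 2 (.sub (.reg 8) (.const 2)))))
          (.load 0 (.const 0))))
      (.assign 8 (.sub (.reg 8) (.const 1)))) <|
    .seq (push 3 9 (.reg 7)) <|
    .seq (push 3 9 (.load 2 (.sub (.reg 8) (.const 1)))) <|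
    .seq (push 3 9 (.load 2 (.reg 7)))
      (.assign 7 (.sub (.reg 8) (.const 1))))) <|
  .seq (tab 11 4 10 (.reg 9)
    (.load 3 (.sub (.add (.sub (.reg 9) (.const 3)) (.reg 11))
      (.mul (.const 6) (.div (.reg 11) (.const 3))))))
    (ret 4 10)

/-- The description of a list of blocks in the output of `plan`. -/
def planOut (s : ℕ → ℕ) (L : List (ℕ × ℕ)) : List ℤ :=
  L.flatMap fun b => [(b.2 : ℤ), (s (b.1 - 1) : ℤ), (s b.2 : ℤ)]

@[simp] theorem length_planOut (s : ℕ → ℕ) (L : List (ℕ × ℕ)) :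
    (planOut s L).length = 3 * L.length := by
  induction L with
  | nil => rfl
  | cons b L ih => rw [planOut, List.flatMap_cons, List.length_append, ← planOut, ih]; simp; ring

theorem planOut_append (s : ℕ → ℕ) (L L' : List (ℕ × ℕ)) :
    planOut s (L ++ L') = planOut s L ++ planOut s L' := by simp [planOut]

theorem planOut_concat (s : ℕ → ℕ) (L : List (ℕ × ℕ)) (b : ℕ × ℕ) :
    planOut s (L ++ [b]) = planOut s L ++ [(b.2 : ℤ), (s (b.1 - 1) : ℤ), (s b.2 : ℤ)] := by
  simp [planOut]

/-- Reading the triples from the last one on reverses the list of blocks. -/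
theorem planOut_reverse (s : ℕ → ℕ) (L : List (ℕ × ℕ)) :
    (List.range (3 * L.length)).map (fun i => nth (planOut s L)
        (3 * L.length - 3 + i - 6 * (i / 3))) =
      planOut s L.reverse := by
  induction L with
  | nil => rfl
  | cons b L ih =>
    rw [List.reverse_cons, planOut_concat, ← ih, List.length_cons, mul_add, mul_one,
      range_map_append]
    have e : planOut s (b :: L) = [(b.2 : ℤ), (s (b.1 - 1) : ℤ), (s b.2 : ℤ)] ++ planOut s L := rfl
    congr 1
    · apply List.map_congr_left
      intro i hi
      have hi := List.mem_range.mp hi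
      have e2 : 3 * L.length + 3 - 3 + i - 6 * (i / 3) =
          [(b.2 : ℤ), (s (b.1 - 1) : ℤ), (s b.2 : ℤ)].length +
            (3 * L.length - 3 + i - 6 * (i / 3)) := by simp; omega
      rw [e, e2, nth_append_add]
    · have h0 : 3 * L.length + 3 - 3 + (3 * L.length + 0) - 6 * ((3 * L.length + 0) / 3) = 0 := by
        omega
      have h1 : 3 * L.length + 3 - 3 + (3 * L.length + 1) - 6 * ((3 * L.length + 1) / 3) = 1 := by
        omega
      have h2 : 3 * L.length + 3 - 3 + (3 * L.length + 2) - 6 * ((3 * L.length + 2) / 3) = 2 := by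
        omega
      simp only [List.range_succ, List.range_zero, List.map_append, List.map_cons, List.map_nil,
        List.nil_append, h0, h1, h2]
      rfl

theorem tl_succ (n : ℕ) (f : ℕ → ℕ) : tl (n + 1) f = tl n f ++ [(f n : ℤ)] := by
  simp [tl, List.range_succ]

theorem length_blockList_le (ld : ℕ → ℕ → ℕ) (θ m : ℕ) : (blockList ld θ m).length ≤ m := by
  induction m using Nat.strong_induction_on with
  | _ m ih =>
    rcases m with _ | m
    · simp [blockList]
    · rw [blockList, List.length_cons]
      have h := blockStart_le ld θ (m + 1) (m + 1)
      have := ih (blockStart ld θ (m + 1) (m + 1) - 1) (by omega)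
      omega

theorem mem_blockList {ld : ℕ → ℕ → ℕ} {θ m : ℕ} {b : ℕ × ℕ} (h : b ∈ blockList ld θ m) :
    1 ≤ b.1 ∧ b.1 ≤ b.2 ∧ b.2 ≤ m := by
  induction m using Nat.strong_induction_on with
  | _ m ih =>
    rcases m with _ | m
    · simp [blockList] at h
    · rw [blockList] at h
      have h1 := blockStart_le ld θ (m + 1) (m + 1)
      have h2 := one_le_blockStart ld θ (m + 1) (m + 1) (by omega)
      rcases List.mem_cons.mp h with rfl | h
      · exact ⟨h2, h1, le_rfl⟩
      · obtain ⟨h3, h4, h5⟩ := ih _ (by omega) h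
        exact ⟨h3, h4, by omega⟩

theorem plan_runs {X θ D : ℕ} {z : List (ℕ × ℕ)} {s due : ℕ → ℕ} (hg : Grouped z D s due)
    (hz : ∀ x ∈ flat z, x.natAbs ≤ X) (hθ : θ ≤ X) (hP : (z.map Prod.fst).sum ≤ X)
    (hX : 3 * z.length + 3 ≤ X) :
    RunsIn plan (θ :: seg (flat z))
      (planOut s (blockList (fun k m => preSum z (s m) - preSum z (s (k - 1))) θ D).reverse)
      ((3000 * z.length + 1000) * lg X) := by
  set l : List ℤ := θ :: seg (flat z) with hl
  set n := z.length with hn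
  have hll : l.length = 2 * n + 2 := by simp [hl, hn]
  have hlb : ∀ x ∈ l, x.natAbs ≤ X := by
    intro x hx
    rcases List.mem_cons.mp hx with rfl | hx
    · simpa using hθ
    rcases List.mem_cons.mp hx with rfl | hx
    · simp; omega
    · exact hz x hx
  have h0 : nth l 0 = θ := rfl
  have h1 : nth l 1 = (2 * n : ℕ) := by simp [hl, seg, hn]
  have hp : ∀ i (hi : i < n), nth l (2 * i + 2) = z[i].1 := fun i hi => (nth_flat hi).1
  have he : ∀ i (hi : i < n), nth l (2 * i + 3) = z[i].2 := fun i hi => (nth_flat hi).2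
  have hDn : D ≤ n := by have := hg.le_s le_rfl; rw [hg.s_D] at this; exact this
  have hsn : ∀ m ≤ D, s m ≤ n := fun m hm => by
    have := hg.s_mono hm le_rfl; rwa [hg.s_D] at this
  set ld : ℕ → ℕ → ℕ := fun k m => preSum z (s m) - preSum z (s (k - 1)) with hld
  refine RunsIn.of_wp hlb (by omega) ?_
  have hmem : (State.init l).mem 0 = nth l := init_mem_zero l
  unfold plan
  apply wp.le
  · apply wp_seq
    refine wp_set (n : ℤ) (by simp [Expr.eval, hmem, h1]) (by omega) ?_
    apply wp_seq
    refine wp_pushv (l := []) 0 (Has.nil _ _) (by simp [init_reg_ne]) (by simp; omega)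
      (by simp [Expr.eval]) (by simp) fun i1 => ?_
    apply wp_seq
    -- The first `i` jobs have the first `g` due dates, whose first positions are in array `2`.
    refine wp_for n (fun i t => ∃ g ≤ D, (g = 0 ∧ i = 0 ∨ 0 < g ∧ s (g - 1) < i) ∧ i ≤ s g ∧
      t.reg 4 = due g ∧ t.reg 5 = preSum z i ∧ t.reg 2 = g ∧ Has t 2 (tl g s) ∧
      t.reg 1 = (i + 1 : ℕ) ∧ Has t 1 (tl (i + 1) (preSum z))) (fun _ => 300)
      (by decide) (by omega) ?_ ?_ ?_ ?_
    · intro i hi t hF _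
      rw [Expr.eval, hF.reg 3 (by decide)]; simp
    · refine ⟨0, by omega, .inl ⟨rfl, rfl⟩, by omega, ?_, ?_, ?_, Has.nil _ _, by simp, ?_⟩
      · simp [init_reg_ne, hg.due_zero]
      · simp [init_reg_ne, preSum]
      · simp [init_reg_ne]
      · simpa [tl, preSum] using i1
    · rintro i hi t hB hF h6 ⟨g, hgD, hgi, hig, r4, r5, r2, m2, r1, m1⟩
      have hm0 : t.mem 0 = nth l := by
        rw [hF.mem 0 (by decide)]; simp [setMem_mem_ne, hmem]
      have e2 : ((2 : ℤ) * (i : ℤ) + 2).toNat = 2 * i + 2 := by omega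
      have e3 : ((2 : ℤ) * (i : ℤ) + 3).toNat = 2 * i + 3 := by omega
      have hzi := hz (z[i].1 : ℤ) (mem_flat.mpr ⟨_, List.getElem_mem hi, .inl rfl⟩)
      have hzi2 := hz (z[i].2 : ℤ) (mem_flat.mpr ⟨_, List.getElem_mem hi, .inr rfl⟩)
      have hps := preSum_le z (i + 1)
      have hps' := preSum_succ hi
      apply wp.le
      · apply wp_seq
        have hbr : wp X (.branch (.le (.add (.reg 4) (.const 1))
              (.load 0 (.add (.mul (.const 2) (.reg 6)) (.const 3))))
            (.seq (push 2 2 (.reg 6))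
              (.assign 4 (.load 0 (.add (.mul (.const 2) (.reg 6)) (.const 3))))) .skip) t 180
            (fun t' => Fr [2, 4] [2] t t' ∧ ∃ g ≤ D, (0 < g ∧ s (g - 1) ≤ i) ∧ i < s g ∧
              t'.reg 4 = due g ∧ t'.reg 2 = g ∧ Has t' 2 (tl g s)) := by
          have hcond : (Expr.le (.add (.reg 4) (.const 1))
              (.load 0 (.add (.mul (.const 2) (.reg 6)) (.const 3)))).eval t =
              if due g < z[i].2 then 1 else 0 := by
            simp only [Expr.eval, h6, r4, hm0, e3, he i hi]
            congr 1; exact propext (by omega)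
          apply wp.le
          · refine wp.imp (Q := fun t' => ∃ g ≤ D, (0 < g ∧ s (g - 1) ≤ i) ∧ i < s g ∧
              t'.reg 4 = due g ∧ t'.reg 2 = g ∧ Has t' 2 (tl g s)) (wp_branch (b := 100) ?_ ?_) ?_
            · intro hc
              rw [hcond] at hc
              have hlt : due g < z[i].2 := by by_contra h; simp [h] at hc
              have hig' : i = s g := by
                rcases hig.lt_or_eq with h | h
                · exfalso
                  rcases hgi with ⟨rfl, rfl⟩ | ⟨h4, h5⟩
                  · rw [hg.s_zero] at h; omega
                  · have := hg.due_eq (g - 1) (by omega) i hi (by omega)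
                      (by rwa [Nat.sub_add_cancel h4])
                    rw [Nat.sub_add_cancel h4] at this
                    omega
                · exact h
              have hgD' : g < D := by
                by_contra h
                have : g = D := by omega
                rw [hig', this, hg.s_D] at hi; omega
              apply wp.le
              · apply wp_seq
                refine wp_pushv (i : ℤ) m2 (by rw [r2, length_tl]) (by rw [length_tl]; omega)
                  (by simp [Expr.eval, h6]) (by omega) fun h7 => ?_
                refine wp_set (z[i].2 : ℤ) ?_ hzi2 ?_
                · simp only [Expr.eval, setReg_reg, setMem_reg, setReg_mem]
                  rw [if_neg (by decide), h6, e3, setMem_mem_ne _ _ _ _ _ (by decide), hm0, he i hi]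
                · refine ⟨g + 1, by omega, ⟨by omega, ?_⟩, ?_, ?_, ?_, ?_⟩
                  · rw [Nat.add_sub_cancel]; exact hig'.ge
                  · rw [hig']; exact hg.s_lt g hgD'
                  · rw [setReg_reg, if_pos rfl, hg.due_eq g hgD' i hi hig'.ge
                      (by rw [hig']; exact hg.s_lt g hgD')]
                  · simp
                  · rw [tl_succ, ← hig']; exact h7
              · simp [Expr.C, Expr.K, Expr.L]
            · intro hc
              rw [hcond] at hc
              have hlt : ¬ due g < z[i].2 := by intro h; simp [h] at hc
              have hig' : i < s g := by
                rcases hig.lt_or_eq with h | h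
                · exact h
                · exfalso
                  have hgD' : g < D := by
                    by_contra h'
                    have : g = D := by omega
                    rw [h, this, hg.s_D] at hi; omega
                  have := hg.due_eq g hgD' i hi h.ge (by rw [h]; exact hg.s_lt g hgD')
                  have := hg.due_lt g hgD'
                  omega
              refine (wp_skip ⟨g, hgD, ?_, hig', r4, r2, m2⟩).le (by omega)
              rcases hgi with ⟨rfl, rfl⟩ | ⟨h4, h5⟩
              · rw [hg.s_zero] at hig'; omega
              · exact ⟨h4, h5.le⟩
            · intro t' _ hF' hQ
              exact ⟨hF'.mono (by decide) (by decide), hQ⟩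
          · simp [Expr.C, Expr.K, Expr.L]
        refine hbr.imp fun t' hB' _ hQ => ?_
        obtain ⟨hF', g, hgD, ⟨hg0, hgi⟩, hig, r4', r2', m2'⟩ := hQ
        apply wp_seq
        refine wp_set (preSum z (i + 1) : ℤ) ?_ (by omega) ?_
        · simp only [Expr.eval]
          rw [hF'.reg 5 (by decide), hF'.reg 6 (by decide), hF'.mem 0 (by decide), h6, r5, e2, hm0,
            hp i hi, hps']
          simp
        refine wp_pushv (l := tl (i + 1) (preSum z)) (preSum z (i + 1) : ℤ) ?_ ?_
          (by rw [length_tl]; omega) (by simp [Expr.eval]) (by omega) fun h7 => ?_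
        · rw [has_setReg]; exact m1.of_mem_eq (hF'.mem 1 (by decide))
        · rw [setReg_reg, if_neg (by decide), hF'.reg 1 (by decide), r1, length_tl]
        · refine ⟨g, hgD, .inr ⟨hg0, by omega⟩, hig, by simpa using r4', by simp,
              by simpa using r2',
            ?_, by simp, ?_⟩
          · rw [has_setReg, has_setReg]
            refine Has.setMem_ne ?_ (by decide)
            exact m2'
          · rw [tl_succ (i + 1), has_setReg]; exact h7
      · simp [Expr.C, Expr.K, Expr.L]
    rintro t hB hF h6 ⟨g, hgD, hgi, hig, r4, r5, r2, m2, r1, m1⟩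
    obtain rfl : D = g := by
      rcases hgi with ⟨rfl, h⟩ | ⟨h3, h4⟩
      · omega
      · by_contra h
        have := hg.s_mono (i := g) (j := D - 1) (by omega) (by omega)
        have := hg.s_lt (D - 1) (by omega)
        rw [Nat.sub_add_cancel (by omega), hg.s_D] at this
        omega
    have hm0 : t.mem 0 = nth l := by
      rw [hF.mem 0 (by decide)]; simp [setMem_mem_ne, hmem]
    have r3 : t.reg 3 = n := by rw [hF.reg 3 (by decide)]; simp
    have r9 : t.reg 9 = 0 := by rw [hF.reg 9 (by decide)]; simp [init_reg_ne]
    have r10 : t.reg 10 = 0 := by rw [hF.reg 10 (by decide)]; simp [init_reg_ne]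
    clear hF
    apply wp_seq
    refine wp_pushv (n : ℤ) m2 (by rw [r2, length_tl]) (by rw [length_tl]; omega)
      (by simp [Expr.eval, r3]) (by omega) fun h7 => ?_
    replace h7 : Has ((t.setMem 2 (tl D s).length n).setReg 2 ((tl D s).length + 1 : ℕ)) 2
        (tl (D + 1) s) := by
      rw [tl_succ, hg.s_D]; exact h7
    apply wp_seq
    refine wp_set (D : ℤ) (by simp [Expr.eval]) (by omega) ?_
    -- The blocks `L` have been found, and the due dates `1, …, m` are left.
    set J : ℕ → State → Prop := fun B u => ∃ m ≤ D, ∃ L, u.reg 7 = m ∧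
      L ++ blockList ld θ m = blockList ld θ D ∧ L.length + m ≤ D ∧
      u.mem 0 = nth l ∧ Has u 1 (tl (n + 1) (preSum z)) ∧ Has u 2 (tl (D + 1) s) ∧ u.reg 10 = 0 ∧
      u.reg 9 = (3 * L.length : ℕ) ∧ Has u 3 (planOut s L) ∧ B = m * 400 + 50 with hJ
    set L := blockList ld θ D with hL
    have hLg : L.length ≤ D := length_blockList_le _ _ _
    have hLX : ∀ x ∈ planOut s L, x.natAbs ≤ X := by
      intro x hx
      obtain ⟨b, hb, hx⟩ := List.mem_flatMap.mp hx
      obtain ⟨b1, b2, b3⟩ := mem_blockList hb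
      have := hsn (b.1 - 1) (by omega)
      have := hsn b.2 (by omega)
      simp only [List.mem_cons, List.not_mem_nil, or_false] at hx
      rcases hx with rfl | rfl | rfl <;> omega
    apply wp_seq
    refine wp_while J ?_ (D * 400 + 50) _ ?_
    · rintro B u hBu ⟨m, hm, K, u7, hK, hKm, u0, u1, u2, u10, u9, u3, rfl⟩
      rcases m with _ | m
      · left
        refine ⟨by simpa [Expr.eval] using u7, by simp [Expr.C, Expr.K, Expr.L], ?_⟩
        obtain rfl : K = L := by simpa [blockList] using hK
        apply wp_seq
        refine wp_tab (l := []) (3 * L.length)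
          (fun i => nth (planOut s L) (3 * L.length - 3 + i - 6 * (i / 3))) (by decide)
              (Has.nil _ _)
          (by simp [u10]) (by simp; omega) ?_ ?_ ?_
        · intro u' hF'
          rw [Expr.eval, hF'.reg 9 (by decide), u9]
        · intro i hi u' hB' hF' h11
          have e1 : ((3 * L.length : ℕ) : ℤ) - 3 + (i : ℤ) - 6 * ((i : ℤ) / 3) =
            (3 * L.length - 3 + i - 6 * (i / 3) : ℕ) := by omega
          refine ⟨?_, ?_⟩
          · simp only [Expr.eval]
            rw [hF'.reg 9 (by decide), u9, h11, e1, Int.toNat_natCast, hF'.mem 3 (by decide)]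
            exact u3 _ (by simp; omega)
          · exact natAbs_nth_le hLX _
        · intro u' hF' v10 v4
          rw [planOut_reverse] at v4
          refine wp_ret v4 (by simpa using v10)
            (by
              have := length_blockList_le ld θ D
              rw [List.nil_append, length_planOut, List.length_reverse]; omega) fun s' hs' => hs'
      · right
        refine ⟨by rw [Expr.eval, u7]; omega, ?_⟩
        set k := blockStart ld θ (m + 1) (m + 1) with hk
        have hk1 : 1 ≤ k := one_le_blockStart _ _ _ _ (by omega)
        have hkm : k ≤ m + 1 := blockStart_le _ _ _ _
        refine wp_while_step (I := J) (b₁ := (m + 1 - k) * 300 + 300) ((k - 1) * 400 + 50) ?_ ?_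
        · have hm1 : s (m + 1) ≤ n := hsn _ hm
          have ek : k - 1 ≤ D := by omega
          have hk1n := hsn (k - 1) ek
          apply wp.le
          · apply wp_seq
            refine wp_set ((m + 1 : ℕ) : ℤ) (by rw [Expr.eval, u7]) (by omega) ?_
            apply wp_seq
            set J' : ℕ → State → Prop := fun B v => ∃ k', 1 ≤ k' ∧ k' ≤ m + 1 ∧ v.reg 8 = (k' : ℤ) ∧
              blockStart ld θ (m + 1) k' = k ∧ Fr [8] [] u v ∧ B = (k' - k) * 200 + 100 with hJ'
            refine wp_while J' ?_ ((m + 1 - k) * 200 + 100) _ ⟨m + 1, by omega, le_rfl, by simp,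
              rfl, ⟨fun r hr => by simp at hr; simp [hr], fun _ _ => rfl⟩, rfl⟩
            rintro B v hBv ⟨k', hk'1, hk'm, v8, hbs, hF', rfl⟩
            have hkk' : k ≤ k' := hbs ▸ blockStart_le _ _ _ _
            have v7 : v.reg 7 = (m + 1 : ℕ) := by rw [hF'.reg 7 (by decide), u7]
            have v2 : ∀ i ≤ D, v.mem 2 i = s i := fun i hi => by
              rw [hF'.mem 2 (by simp), u2 i (by simp; omega), nth_tl _ (by omega)]
            have v1 : ∀ i ≤ n, v.mem 1 i = preSum z i := fun i hi => by
              rw [hF'.mem 1 (by simp), u1 i (by simp; omega), nth_tl _ (by omega)]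
            have v0 : v.mem 0 0 = θ := by rw [hF'.mem 0 (by simp), u0, h0]
            have e8 : ((k' : ℤ) - 2).toNat = k' - 2 := by omega
            have hcond : (Expr.mul (.le (.const 2) (.reg 8))
                (.le (.sub (.load 1 (.load 2 (.reg 7)))
                    (.load 1 (.load 2 (.sub (.reg 8) (.const 2)))))
                  (.load 0 (.const 0)))).eval v =
                if 2 ≤ k' ∧ ld (k' - 1) (m + 1) ≤ θ then 1 else 0 := by
              have hk2 : k' - 2 ≤ D := by omega
              simp only [Expr.eval, v8, v7, e8, Int.toNat_natCast, v2 _ hm, v2 _ hk2, v1 _ hm1,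
                v1 _ (hsn _ hk2), Int.toNat_zero, v0]
              have hle := preSum_mono z (hg.s_mono (show k' - 2 ≤ m + 1 by omega) hm)
              have hld1 : ld (k' - 1) (m + 1) = preSum z (s (m + 1)) - preSum z (s (k' - 2)) := rfl
              rw [hld1]
              by_cases c1 : 2 ≤ k'
              · rw [if_pos (by omega), one_mul]
                by_cases c2 : preSum z (s (m + 1)) - preSum z (s (k' - 2)) ≤ θ
                · rw [if_pos (by omega), if_pos ⟨c1, c2⟩]
                · rw [if_neg (by omega), if_neg (fun h => c2 h.2)]
              · rw [if_neg (by omega), zero_mul, if_neg (fun h => c1 h.1)]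
            rw [hcond]
            by_cases hc : 2 ≤ k' ∧ ld (k' - 1) (m + 1) ≤ θ
            · right
              refine ⟨by simp [hc], ?_⟩
              obtain ⟨q, rfl⟩ := Nat.exists_eq_add_of_le' hc.1
              have hbs' : blockStart ld θ (m + 1) (q + 1) = k := by
                rw [← hbs, blockStart]; exact (if_pos hc.2).symm
              have hkq : k ≤ q + 1 := hbs' ▸ blockStart_le _ _ _ _
              refine wp_while_step (I := J') (b₁ := 20) ((q + 1 - k) * 200 + 100) ?_ ?_
              · refine (wp_set ((q + 1 : ℕ) : ℤ) (by simp [Expr.eval, v8]; ring) (by omega)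
                    ?_).le ?_
                · exact ⟨q + 1, by omega, by omega, by simp, hbs', hF'.trans
                    ⟨fun r hr => by simp at hr; simp [hr], fun _ _ => rfl⟩, rfl⟩
                · simp [Expr.C, Expr.K, Expr.L]
              · simp [Expr.C, Expr.K, Expr.L]; omega
            · left
              refine ⟨by simp [hc], by simp [Expr.C, Expr.K, Expr.L], ?_⟩
              obtain rfl : k = k' := by
                rw [← hbs]
                rcases k' with _ | _ | q
                · omega
                · rfl
                · rw [blockStart, if_neg (by intro h; exact hc ⟨by omega, h⟩)]
              have w9 : v.reg 9 = (3 * K.length : ℕ) := by rw [hF'.reg 9 (by decide), u9]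
              have w3 : Has v 3 (planOut s K) := u3.of_mem_eq (hF'.mem 3 (by simp))
              have ek1 : ((k : ℤ) - 1).toNat = k - 1 := by omega
              apply wp_seq
              refine wp_pushv ((m + 1 : ℕ) : ℤ) w3 (by rw [w9, length_planOut])
                (by rw [length_planOut]; omega) (by rw [Expr.eval, v7]) (by omega) fun w3 => ?_
              apply wp_seq
              refine wp_pushv (s (k - 1) : ℤ) w3 (by simp) (by simp; omega) ?_ (by omega)
                fun w3 => ?_
              · simp only [Expr.eval, setReg_reg, setMem_reg, setReg_mem]
                rw [if_neg (by decide), v8, ek1, setMem_mem_ne _ _ _ _ _ (by decide), v2 _ ek]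
              apply wp_seq
              refine wp_pushv (s (m + 1) : ℤ) w3 (by simp; ring) (by simp; omega) ?_ (by omega)
                fun w3 => ?_
              · simp only [Expr.eval, setReg_reg, setMem_reg, setReg_mem]
                rw [if_neg (by decide), if_neg (by decide), v7, Int.toNat_natCast,
                  setMem_mem_ne _ _ _ _ _ (by decide), setReg_mem,
                  setMem_mem_ne _ _ _ _ _ (by decide), v2 _ hm]
              refine wp_set ((k - 1 : ℕ) : ℤ) (by simp [Expr.eval, v8]; omega) (by omega) ?_
              refine ⟨k - 1, ek, K ++ [(k, m + 1)], by simp, ?_, by simp; omega, ?_, ?_, ?_, ?_, ?_,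
                ?_, rfl⟩
              · rw [← hK, blockList]; simp [← hk]
              · simp [setMem_mem_ne, hF'.mem 0, u0]
              · refine u1.of_mem_eq ?_
                simp only [setReg_mem]
                rw [setMem_mem_ne _ _ _ _ _ (by decide), setReg_mem,
                  setMem_mem_ne _ _ _ _ _ (by decide), setReg_mem,
                  setMem_mem_ne _ _ _ _ _ (by decide), hF'.mem 1 (by simp)]
              · refine u2.of_mem_eq ?_
                simp only [setReg_mem]
                rw [setMem_mem_ne _ _ _ _ _ (by decide), setReg_mem,
                  setMem_mem_ne _ _ _ _ _ (by decide), setReg_mem,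
                  setMem_mem_ne _ _ _ _ _ (by decide), hF'.mem 2 (by simp)]
              · simpa [hF'.reg 10 (by decide)] using u10
              · simp
                ring
              · rw [planOut_concat]; simpa using w3
          · simp [Expr.C, Expr.K, Expr.L]; omega
        · simp [Expr.C, Expr.K, Expr.L]; omega
    · refine ⟨D, le_rfl, [], by simp, rfl, by simp, ?_, ?_, ?_, ?_, ?_, Has.nil _ _, rfl⟩
      · simp [setMem_mem_ne, hm0]
      · rw [has_setReg, has_setReg]; exact m1.setMem_ne (by decide)
      · rw [has_setReg]; exact h7
      · simp [r10]
      · simp [r9]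
  · have hLD := length_blockList_le ld θ D
    simp [Expr.C, Expr.K, Expr.L]; omega

/-! ### Schedules of lists of jobs -/

/-- The total processing time of a list of jobs. -/
def sm (Z : List (ℕ × ℕ)) : ℕ := (Z.map Prod.fst).sum

@[simp] theorem sm_nil : sm [] = 0 := rfl

@[simp] theorem sm_cons (j : ℕ × ℕ) (Z : List (ℕ × ℕ)) : sm (j :: Z) = j.1 + sm Z := by simp [sm]

@[simp] theorem sm_append (Z W : List (ℕ × ℕ)) : sm (Z ++ W) = sm Z + sm W := by simp [sm]

theorem sm_le_of_sublist {W Z : List (ℕ × ℕ)} (h : W.Sublist Z) : sm W ≤ sm Z := by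
  induction h with
  | slnil => exact le_rfl
  | cons j _ ih => rw [sm_cons]; omega
  | cons_cons j _ ih => rw [sm_cons, sm_cons]; omega

/-- If the jobs are run in the order of the list from time `t` on, none of them is tardy. -/
def OnTime : List (ℕ × ℕ) → ℕ → Prop
  | [], _ => True
  | j :: W, t => t + j.1 ≤ j.2 ∧ OnTime W (t + j.1)

theorem onTime_append {W W' : List (ℕ × ℕ)} {t : ℕ} :
    OnTime (W ++ W') t ↔ OnTime W t ∧ OnTime W' (t + sm W) := by
  induction W generalizing t with
  | nil => simp [OnTime]
  | cons j W ih => simp [OnTime, ih, and_assoc, add_assoc]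

theorem OnTime.anti {W : List (ℕ × ℕ)} {t t' : ℕ} (h : OnTime W t') (ht : t ≤ t') : OnTime W t := by
  induction W generalizing t t' with
  | nil => trivial
  | cons j W ih => exact ⟨by have := h.1; omega, ih h.2 (by omega)⟩

theorem OnTime.le {W : List (ℕ × ℕ)} {t d : ℕ} (h : OnTime W t) (hd : ∀ j ∈ W, j.2 ≤ d) :
    W = [] ∨ t + sm W ≤ d := by
  induction W generalizing t with
  | nil => exact .inl rfl
  | cons j W ih =>
    right
    rcases ih h.2 (fun j hj => hd j (List.mem_cons_of_mem _ hj)) with rfl | h'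
    · have := h.1; have := hd j (by simp); simp; omega
    · rw [sm_cons]; omega

theorem onTime_of_le {W : List (ℕ × ℕ)} {t : ℕ} (h : ∀ j ∈ W, t + sm W ≤ j.2) : OnTime W t := by
  induction W generalizing t with
  | nil => trivial
  | cons j W ih =>
    rw [sm_cons] at h
    refine ⟨by have := h j (by simp); omega, ih fun j' hj => ?_⟩
    have := h j' (List.mem_cons_of_mem _ hj); omega

theorem OnTime.fst_le {W : List (ℕ × ℕ)} {t : ℕ} (h : OnTime W t) : ∀ j ∈ W, j.1 ≤ j.2 := by
  induction W generalizing t with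
  | nil => simp
  | cons j W ih =>
    intro j' hj'
    rcases List.mem_cons.mp hj' with rfl | hj'
    · have := h.1; omega
    · exact ih h.2 j' hj'

/-- Some jobs of the list, of total processing time `x`, can be run in the order of the list from
time `t` on such that none of them is tardy. -/
def Sched (Z : List (ℕ × ℕ)) (x t : ℕ) : Prop := ∃ W, W.Sublist Z ∧ sm W = x ∧ OnTime W t

theorem sched_append {Z W : List (ℕ × ℕ)} {x t : ℕ} :
    Sched (Z ++ W) x t ↔ ∃ i j, i + j = x ∧ Sched Z i t ∧ Sched W j (t + i) := by
  constructor
  · rintro ⟨V, h1, rfl, h3⟩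
    obtain ⟨V1, V2, rfl, h4, h5⟩ := List.sublist_append_iff.mp h1
    rw [onTime_append] at h3
    exact ⟨sm V1, sm V2, by simp, ⟨V1, h4, rfl, h3.1⟩, ⟨V2, h5, rfl, h3.2⟩⟩
  · rintro ⟨_, _, rfl, ⟨V1, h4, rfl, h3⟩, ⟨V2, h5, rfl, h6⟩⟩
    exact ⟨V1 ++ V2, h4.append h5, by simp, onTime_append.mpr ⟨h3, h6⟩⟩

theorem Sched.le_sm {Z : List (ℕ × ℕ)} {x t : ℕ} (h : Sched Z x t) : x ≤ sm Z := by
  obtain ⟨W, h1, rfl, -⟩ := h; exact sm_le_of_sublist h1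

theorem Sched.anti {Z : List (ℕ × ℕ)} {x t t' : ℕ} (h : Sched Z x t') (ht : t ≤ t') :
    Sched Z x t := by
  obtain ⟨W, h1, h2, h3⟩ := h; exact ⟨W, h1, h2, h3.anti ht⟩

theorem Sched.le_due {Z : List (ℕ × ℕ)} {x t d : ℕ} (h : Sched Z x t) (hd : ∀ j ∈ Z, j.2 ≤ d) :
    x = 0 ∨ t + x ≤ d := by
  obtain ⟨W, h1, rfl, h3⟩ := h
  rcases h3.le (fun j hj => hd j (h1.subset hj)) with rfl | h
  · exact .inl rfl
  · exact .inr h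

theorem sched_zero (Z : List (ℕ × ℕ)) (t : ℕ) : Sched Z 0 t :=
    ⟨[], List.nil_sublist _, rfl, trivial⟩

/-- Jobs that all have enough time. -/
theorem Sched.of_le {Z : List (ℕ × ℕ)} {x t t' : ℕ} (h : Sched Z x t')
    (ht : ∀ j ∈ Z, t + sm Z ≤ j.2) : Sched Z x t := by
  obtain ⟨W, h1, h2, -⟩ := h
  refine ⟨W, h1, h2, onTime_of_le fun j hj => ?_⟩
  have := ht j (h1.subset hj)
  have := sm_le_of_sublist h1
  omega

theorem sched_singleton {j : ℕ × ℕ} {x t : ℕ} :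
    Sched [j] x t ↔ x = 0 ∨ (x = j.1 ∧ t + j.1 ≤ j.2) := by
  constructor
  · rintro ⟨W, h1, rfl, h3⟩
    rcases List.sublist_singleton.mp h1 with rfl | rfl
    · exact .inl rfl
    · exact .inr ⟨by simp, h3.1⟩
  · rintro (rfl | ⟨rfl, h⟩)
    · exact sched_zero _ _
    · exact ⟨[j], List.Sublist.refl _, by simp, h, trivial⟩

/-- Some jobs of the list have total processing time `x`, and each of them alone would be on
time. -/
def SubSum (Z : List (ℕ × ℕ)) (x : ℕ) : Prop := ∃ W, W.Sublist Z ∧ sm W = x ∧ ∀ j ∈ W, j.1 ≤ j.2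

theorem subSum_append {Z W : List (ℕ × ℕ)} {x : ℕ} :
    SubSum (Z ++ W) x ↔ ∃ i j, i + j = x ∧ SubSum Z i ∧ SubSum W j := by
  constructor
  · rintro ⟨V, h1, rfl, h3⟩
    obtain ⟨V1, V2, rfl, h4, h5⟩ := List.sublist_append_iff.mp h1
    exact ⟨sm V1, sm V2, by simp, ⟨V1, h4, rfl, fun j hj => h3 j (by simp [hj])⟩,
      ⟨V2, h5, rfl, fun j hj => h3 j (by simp [hj])⟩⟩
  · rintro ⟨_, _, rfl, ⟨V1, h4, rfl, h3⟩, ⟨V2, h5, rfl, h6⟩⟩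
    refine ⟨V1 ++ V2, h4.append h5, by simp, fun j hj => ?_⟩
    rcases List.mem_append.mp hj with hj | hj
    · exact h3 j hj
    · exact h6 j hj

theorem subSum_singleton {j : ℕ × ℕ} {x : ℕ} :
    SubSum [j] x ↔ x = 0 ∨ (x = j.1 ∧ j.1 ≤ j.2) := by
  constructor
  · rintro ⟨W, h1, rfl, h3⟩
    rcases List.sublist_singleton.mp h1 with rfl | rfl
    · exact .inl rfl
    · exact .inr ⟨by simp, h3 j (by simp)⟩
  · rintro (rfl | ⟨rfl, h⟩)
    · exact ⟨[], List.nil_sublist _, rfl, by simp⟩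
    · exact ⟨[j], List.Sublist.refl _, by simp, by simpa using h⟩

/-- With a common due date the order of the jobs does not matter. -/
theorem sched_iff_subSum {Z : List (ℕ × ℕ)} {x t d : ℕ} (hd : ∀ j ∈ Z, j.2 = d) :
    Sched Z x t ↔ SubSum Z x ∧ (x = 0 ∨ t + x ≤ d) := by
  constructor
  · intro h
    refine ⟨?_, h.le_due fun j hj => (hd j hj).le⟩
    obtain ⟨W, h1, h2, h3⟩ := h
    exact ⟨W, h1, h2, h3.fst_le⟩
  · rintro ⟨⟨W, h1, rfl, h3⟩, h | h⟩
    · rw [h]; exact sched_zero _ _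
    · exact ⟨W, h1, rfl, onTime_of_le fun j hj => by rw [hd j (h1.subset hj)]; exact h⟩

/-! ### The vectors for single jobs and their combination -/

/-- The vector for a single job.  Entries are by one larger than the latest starting times, so that
`0` stands for `-∞`; and `U` takes the place of `+∞` as the latest starting time of the empty set.
-/
def leaf (U : ℕ) (j : ℕ × ℕ) : List ℤ :=
  ((U : ℤ) + 1) :: (List.range (j.1 - 1)).map (fun _ => (0 : ℤ)) ++ [(j.2 : ℤ) - j.1 + 1]

theorem length_leaf {U : ℕ} {j : ℕ × ℕ} (hj : 1 ≤ j.1) : (leaf U j).length = j.1 + 1 := by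
  simp [leaf]; omega

theorem leaf_bound {U : ℕ} {j : ℕ × ℕ} (h1 : j.1 ≤ U) (h2 : j.2 ≤ U) :
    ∀ x ∈ leaf U j, x.natAbs ≤ U + 1 := by
  intro x hx
  simp only [leaf, List.cons_append, List.mem_cons, List.mem_append, List.mem_map,
    List.not_mem_nil, or_false] at hx
  rcases hx with rfl | ⟨i, -, rfl⟩ | rfl <;> omega

theorem lt_nth_leaf {U : ℕ} {j : ℕ × ℕ} (hj : 1 ≤ j.1) (x : ℕ) {t : ℕ} (ht : t ≤ U) :
    (t : ℤ) < nth (leaf U j) x ↔ x = 0 ∨ (x = j.1 ∧ t + j.1 ≤ j.2) := by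
  have hl : ((((U : ℤ) + 1) :: (List.range (j.1 - 1)).map (fun _ => (0 : ℤ)))).length = j.1 := by
    simp; omega
  rcases lt_trichotomy x j.1 with h | rfl | h
  · rw [leaf, nth_append_left (by rw [hl]; exact h)]
    rcases x with _ | x
    · simp; omega
    · rw [nth_cons_succ, nth_map_range _ (by omega)]; omega
  · have := nth_append_right (l := (((U : ℤ) + 1) :: (List.range (j.1 - 1)).map (fun _ => (0 : ℤ))))
      (l' := [(j.2 : ℤ) - j.1 + 1]) (i := j.1) (by rw [hl])
    rw [hl, Nat.sub_self, nth_cons_zero] at this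
    rw [leaf, this]; omega
  · rw [nth_of_le (by rw [length_leaf hj]; omega)]; omega

/-- The vector `v` of latest starting times for the jobs `z`: a schedule of total processing time
`x` can start at time `t` if and only if `t < v x`.  This is required as long as the schedule would
end by `U`, which takes the place of `+∞`. -/
def LatestStart (U : ℕ) (v : List ℤ) (z : List (ℕ × ℕ)) : Prop :=
  v.length = sm z + 1 ∧ (∀ x ∈ v, x.natAbs ≤ U + 1) ∧
    ∀ x t : ℕ, t + sm z ≤ U → ((t : ℤ) < nth v x ↔ Sched z x t)

/-- The positive entries of `v` mark the subset sums of the jobs `z`. -/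
def SumMarks (U : ℕ) (v : List ℤ) (z : List (ℕ × ℕ)) : Prop :=
  v.length = sm z + 1 ∧ (∀ x ∈ v, x.natAbs ≤ U + 1) ∧ ∀ x : ℕ, 0 < nth v x ↔ SubSum z x

theorem latestStart_leaf {U : ℕ} {j : ℕ × ℕ} (hj : 1 ≤ j.1) (h1 : j.1 ≤ U) (h2 : j.2 ≤ U) :
    LatestStart U (leaf U j) [j] := by
  refine ⟨by simpa using length_leaf hj, leaf_bound h1 h2, fun x t ht => ?_⟩
  rw [lt_nth_leaf hj x (by omega), sched_singleton]

theorem sumMarks_leaf {U : ℕ} {j : ℕ × ℕ} (hj : 1 ≤ j.1) (h1 : j.1 ≤ U) (h2 : j.2 ≤ U) :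
    SumMarks U (leaf U j) [j] := by
  refine ⟨by simpa using length_leaf hj, leaf_bound h1 h2, fun x => ?_⟩
  have := lt_nth_leaf hj x (Nat.zero_le U)
  rw [Nat.cast_zero, zero_add] at this
  rw [this, subSum_singleton]

theorem mergeOp_sumset {U X : ℕ} (hX : U + 1 ≤ X) (all : List (ℕ × ℕ)) :
    MergeOp sumset (100000000 * lg X ^ 2) X (SumMarks U) all := by
  refine ⟨?_, fun a z h _ x hx => (h.2.1 x hx).trans hX⟩
  rintro a b z w ⟨h1, h2, h3⟩ ⟨h4, h5, h6⟩ - hab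
  obtain ⟨out, hr, hl, h01, hout⟩ := sumset_runs (X := X) (a := a) (b := b)
    (by rintro rfl; simp at h1) (by rintro rfl; simp at h4) (fun x hx => (h2 x hx).trans hX)
    (fun x hx => (h5 x hx).trans hX) hab
  refine ⟨out, hr, ⟨by rw [sm_append]; omega, fun x hx => ?_, fun x => ?_⟩, by omega⟩
  · rcases h01 x hx with rfl | rfl <;> simp
  · rw [hout, subSum_append]; simp only [h3, h6]

/-- Latest starting times for the concatenation of two lists of jobs: if the first jobs take time
`i` and start at `t`, the second ones start at `t + i`, which is the skew of the convolution. -/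
theorem mergeOp_conv {c : Cmd} {X N H U : ℕ}
    (hc : ∀ x : ConvInput, x.n + 1 ≤ N → (∀ i ≤ x.n, (x.A i).natAbs ≤ 16 * X) →
      (∀ i ≤ x.n, (x.B i).natAbs ≤ 16 * X) → RunsIn c x.input x.output ((x.n + 1) * H))
    (hX : U + 1 ≤ X) {all : List (ℕ × ℕ)} (hall : sm all + 1 ≤ N) :
    MergeOp (conv c) (6 * (H + 2000)) X (LatestStart U) all := by
  refine ⟨?_, fun a z h _ x hx => (h.2.1 x hx).trans hX⟩
  rintro a b z w ⟨h1, h2, h3⟩ ⟨h4, h5, h6⟩ hzw hab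
  have hs := sm_le_of_sublist hzw
  rw [sm_append] at hs
  obtain ⟨out, hr, hl, h01, hout⟩ := conv_runs (X := X) (a := a) (b := b) hc
    (by rintro rfl; simp at h1) (by rintro rfl; simp at h4) (fun x hx => (h2 x hx).trans hX)
    (fun x hx => (h5 x hx).trans hX) h2 hab (by omega)
  refine ⟨out, hr, ⟨by rw [sm_append]; omega, h01, fun x t ht => ?_⟩, by omega⟩
  rw [sm_append] at ht
  rw [hout x t (by omega), sched_append]
  constructor
  · rintro ⟨i, k, hik, h7, h8⟩
    have hi := lt_of_nth_pos (l := a) (i := i) (by omega)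
    refine ⟨i, k, hik, (h3 i t (by omega)).mp h7, (h6 k (t + i)
        (by omega)).mp (by push_cast; exact h8)⟩
  · rintro ⟨i, k, hik, h7, h8⟩
    have hi := h7.le_sm
    refine ⟨i, k, hik, (h3 i t (by omega)).mpr h7, ?_⟩
    have := (h6 k (t + i) (by omega)).mpr h8
    push_cast at this; exact this

theorem length_leaves {U : ℕ} {z : List (ℕ × ℕ)} (hz : ∀ j ∈ z, 1 ≤ j.1) :
    ((z.map (leaf U)).flatMap seg).length = sm z + 2 * z.length ∧ z.length ≤ sm z := by
  induction z with
  | nil => exact ⟨rfl, le_rfl⟩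
  | cons j z ih =>
    obtain ⟨h1, h2⟩ := ih fun j hj => hz j (List.mem_cons_of_mem _ hj)
    have := hz j (by simp)
    rw [List.map_cons, List.flatMap_cons, List.length_append, h1, length_seg, length_leaf this,
      List.length_cons, sm_cons]
    omega

/-! ### One iteration on marked sets -/

open Classical in
/-- The set of all `y < n` with the property `p`, as a vector of marks. -/
noncomputable def markList (n : ℕ) (p : ℕ → Prop) : List ℤ :=
    (List.range n).map fun y => if p y then 1 else 0

@[simp] theorem length_markList (n : ℕ) (p : ℕ → Prop) : (markList n p).length = n := by
  simp [markList]

theorem nth_markList_pos {n : ℕ} {p : ℕ → Prop} {y : ℕ} :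
    0 < nth (markList n p) y ↔ y < n ∧ p y := by
  rcases lt_or_ge y n with h | h
  · rw [markList, nth_map_range _ h]; split_ifs with h' <;> simp [h, h']
  · rw [nth_of_le (by simpa using h)]; simp; omega

theorem markList_bound {n X : ℕ} (p : ℕ → Prop) (hX : 1 ≤ X) :
    ∀ x ∈ markList n p, x.natAbs ≤ X := by
  intro x hx
  obtain ⟨i, -, rfl⟩ := List.mem_map.mp hx
  split_ifs <;> simp; omega

/-- The case distinction in the iteration for a bundle.  If the earlier jobs are completed by
`dk - sm Z`, every set of jobs of the bundle that is feasible at all can follow, and a sumset is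
sufficient; the other completion times lie in a window of length `sm Z` up to `dk`, on which the
skewed convolution decides. -/
theorem bundle_iff {Z₁ Z : List (ℕ × ℕ)} {U dk di : ℕ} {v : List ℤ} (hv : LatestStart U v Z)
    (h1 : ∀ j ∈ Z₁, j.2 ≤ dk) (h2 : ∀ j ∈ Z, dk ≤ j.2) (h3 : ∀ j ∈ Z, j.2 ≤ di) (h4 : dk ≤ di)
    (hU : dk + sm Z ≤ U) (y : ℕ) :
    (y ≤ di ∧ ((∃ x k, x + k = y ∧ Sched Z₁ x 0 ∧ (x : ℤ) ≤ (dk : ℤ) - sm Z ∧ 0 < nth v k) ∨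
      (dk + 1 - sm Z ≤ y ∧ ∃ i k, i + k = y - (dk + 1 - sm Z) ∧ i ≤ sm Z ∧
        Sched Z₁ (dk + 1 - sm Z + i) 0 ∧ ((dk + 1 - sm Z + i : ℕ) : ℤ) < nth v k))) ↔
    Sched (Z₁ ++ Z) y 0 := by
  have hle : ∀ {x}, Sched Z₁ x 0 → x ≤ dk := fun {x} h => by
    have := h.le_due h1; omega
  have hfeas : ∀ k x, x ≤ dk → ((x : ℤ) < nth v k ↔ Sched Z k x) := fun k x hx =>
    hv.2.2 k x (by omega)
  constructor
  · rintro ⟨-, ⟨x, k, hxk, h5, h6, h7⟩ | ⟨h5, i, k, hik, hi, h6, h7⟩⟩ <;> rw [sched_append]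
    · have h8 := (hfeas k 0 (by omega)).mp (by simpa using h7)
      refine ⟨x, k, hxk, h5, h8.of_le fun j hj => ?_⟩
      have := h2 j hj
      omega
    · refine ⟨_, k, by omega, h6, ?_⟩
      rw [zero_add]
      exact (hfeas k _ (hle h6)).mp h7
  · intro h
    have hy := h.le_due (d := di) (fun j hj => by
      rcases List.mem_append.mp hj with hj | hj
      · exact (h1 j hj).trans h4
      · exact h3 j hj)
    obtain ⟨x, k, hxk, h5, h6⟩ := sched_append.mp h
    have hx := hle h5
    rw [zero_add] at h6
    refine ⟨by omega, ?_⟩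
    rcases le_or_gt (x + sm Z) dk with h7 | h7
    · left
      refine ⟨x, k, hxk, h5, by omega, ?_⟩
      have := (hfeas k 0 (by omega)).mpr (h6.anti (by omega))
      simpa using this
    · right
      have e : dk + 1 - sm Z + (x - (dk + 1 - sm Z)) = x := by omega
      refine ⟨by omega, x - (dk + 1 - sm Z), k, by omega, by omega, by rwa [e], ?_⟩
      rw [e]; exact (hfeas k x hx).mpr h6

/-- In the iteration for a red due date all jobs have the same due date, and a sumset is
sufficient. -/
theorem red_iff {Z₁ Z : List (ℕ × ℕ)} {U di : ℕ} {v : List ℤ} (hv : SumMarks U v Z)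
    (h1 : ∀ j ∈ Z₁, j.2 ≤ di) (h2 : ∀ j ∈ Z, j.2 = di) (hU : di ≤ U) (y : ℕ) :
    (y ≤ di ∧ ∃ x k, x + k = y ∧ Sched Z₁ x 0 ∧ (x : ℤ) ≤ (U : ℤ) ∧ 0 < nth v k) ↔
    Sched (Z₁ ++ Z) y 0 := by
  rw [sched_append]
  constructor
  · rintro ⟨hy, x, k, hxk, h5, h6, h7⟩
    exact ⟨x, k, hxk, h5, (sched_iff_subSum h2).mpr ⟨(hv.2.2 k).mp h7, by omega⟩⟩
  · rintro ⟨x, k, hxk, h5, h6⟩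
    have hx := h5.le_due h1
    obtain ⟨h7, h8⟩ := (sched_iff_subSum h2).mp h6
    exact ⟨by omega, x, k, hxk, h5, by omega, (hv.2.2 k).mpr h7⟩

/-- The vectors for the single jobs of a block, with their lengths, in array `1`.  From here on the
registers `2`, `3` and `6` have twice the number of the jobs, the number of marks of `T` and the
load of the block. -/
def mkLeaves : Cmd :=
  .seq (.assign 2 (.load 0 (.const 4))) <|
  .seq (.assign 3 (.sub (.sub (.reg 0) (.const 5)) (.reg 2))) <|
  .seq (push 1 1 (.sub (.div (.reg 2) (.const 2)) (.const 1))) <|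
  For 4 (.div (.reg 2) (.const 2))
    (.seq (.assign 5 (.load 0 (.add (.const 5) (.mul (.const 2) (.reg 4))))) <|
    .seq (.assign 6 (.add (.reg 6) (.reg 5))) <|
    .seq (push 1 1 (.add (.reg 5) (.const 1))) <|
    .seq (push 1 1 (.add (.load 0 (.const 1)) (.const 1))) <|
    .seq (tab 7 1 1 (.sub (.reg 5) (.const 1)) (.const 0)) <|
    push 1 1 (.add (.sub (.load 0 (.add (.const 6) (.mul (.const 2) (.reg 4)))) (.reg 5))
        (.const 1)))

/-- Preparations in the case of a bundle: the vector of latest starting times for its jobs (array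
`2`), the time `t` up to which the elements of `T` enter the sumset (register `9`), the beginning of
the window (register `10`), and the skewed convolution of the marks of `T` in the window with the
vector of latest starting times, counted from this beginning (array `5`). -/
def bundlePart (c : Cmd) : Cmd :=
  .seq (.call (treeOf (conv c)) 1 (.reg 1) 2 8) <|
  .seq (.assign 9 (.sub (.load 0 (.const 2)) (.reg 6))) <|
  .seq (.assign 10 (.mul (.le (.const 0) (.add (.reg 9) (.const 1))) (.add (.reg 9) (.const 1)))) <|
  .seq (push 4 11 (.add (.reg 6) (.const 1))) <|
  .seq (tab 7 4 11 (.add (.reg 6) (.const 1))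
    (.load 0 (.add (.add (.const 5) (.reg 2)) (.add (.reg 10) (.reg 7))))) <|
  .seq (push 4 11 (.add (.reg 6) (.const 1))) <|
  .seq (tab 7 4 11 (.add (.reg 6) (.const 1)) (.sub (.load 2 (.add (.const 2) (.reg 7))) (.reg 10)))
  (.call (conv c) 4 (.reg 11) 5 12)

/-- Preparations in the case of a red due date: the marks of the subset sums of its jobs.  All
elements of `T` enter the sumset, and array `5` stays empty. -/
def redPart : Cmd :=
  .seq (.call (treeOf sumset) 1 (.reg 1) 2 8) (.assign 9 (.load 0 (.const 1)))

/-- The new set is the union of a sumset and of the set found by the skewed convolution. -/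
def unionPart : Cmd :=
  .seq (push 3 13 (.reg 3)) <|
  .seq (tab 7 3 13 (.reg 3) (.mul (.load 0 (.add (.add (.const 5) (.reg 2)) (.reg 7)))
    (.le (.reg 7) (.reg 9)))) <|
  .seq (push 3 13 (.add (.reg 6) (.const 1))) <|
  .seq (tab 7 3 13 (.add (.reg 6) (.const 1)) (.load 2 (.add (.const 2) (.reg 7)))) <|
  .seq (.call sumset 3 (.reg 13) 6 14) <|
  .seq (tab 7 15 15 (.add (.reg 3) (.reg 6))
    (.mul (.le (.reg 7) (.load 0 (.const 3)))
      (.le (.const 1) (.add (.le (.const 1) (.load 6 (.reg 7)))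
        (.mul (.le (.reg 10) (.reg 7)) (.le (.const 1) (.load 5 (.sub (.reg 7) (.reg 10))))))))) <|
  ret 15 15

/-- One iteration.  The input is the threshold, the bound `U`, the first and the last due date of
the block, its jobs (preceded by the length of this list) and the marks of the set `T`; the output
is the vector of marks of the new set. -/
def step (c : Cmd) : Cmd :=
  .seq mkLeaves <|
  .seq (.branch (.le (.reg 6) (.load 0 (.const 0))) (bundlePart c) redPart)
  unionPart

/-- The input of an iteration. -/
def stepInput (θ U dk di : ℕ) (Z : List (ℕ × ℕ)) (T : List ℤ) : List ℤ :=
  θ :: U :: dk :: di :: (seg (flat Z) ++ T)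

theorem nth_stepInput_T {θ U dk di : ℕ} {Z : List (ℕ × ℕ)} {T : List ℤ} (i : ℕ) :
    nth (stepInput θ U dk di Z T) (5 + 2 * Z.length + i) = nth T i := by
  have e : stepInput θ U dk di Z T = ((θ : ℤ) :: (U : ℤ) :: (dk : ℤ) :: (di : ℤ) :: seg (flat Z))
      ++ T :=
    rfl
  have e2 : ((θ : ℤ) :: (U : ℤ) :: (dk : ℤ) :: (di : ℤ) :: seg (flat Z)).length =
      5 + 2 * Z.length := by simp; ring
  rw [e, ← e2, nth_append_add]

theorem nth_stepInput_job {θ U dk di : ℕ} {Z : List (ℕ × ℕ)} {T : List ℤ} {i : ℕ}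
    (hi : i < Z.length) : nth (stepInput θ U dk di Z T) (5 + 2 * i) = Z[i].1 ∧
      nth (stepInput θ U dk di Z T) (6 + 2 * i) = Z[i].2 := by
  have h : ∀ k, k < 2 * Z.length → nth (stepInput θ U dk di Z T) (5 + k) = nth (flat Z) k := by
    intro k hk
    rw [add_comm]
    simp only [stepInput, seg, List.cons_append, nth_cons_succ]
    rw [nth_append_left (by simpa using hk)]
  obtain ⟨h1, h2⟩ := nth_flat hi
  refine ⟨by rw [h _ (by omega), h1], ?_⟩
  rw [show 6 + 2 * i = 5 + (2 * i + 1) by ring, h _ (by omega), h2]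

theorem length_stepInput (θ U dk di : ℕ) (Z : List (ℕ × ℕ)) (T : List ℤ) :
    (stepInput θ U dk di Z T).length = 5 + 2 * Z.length + T.length := by
  simp [stepInput]; ring

theorem sum_getD_fst (z : List (ℕ × ℕ)) :
    ∑ i ∈ Finset.range z.length, (z.getD i (0, 0)).1 = sm z := by
  induction z with
  | nil => rfl
  | cons j z ih => rw [List.length_cons, Finset.sum_range_succ', sm_cons, ← ih, add_comm]; rfl

theorem mkLeaves_wp {X θ U dk di : ℕ} {Z : List (ℕ × ℕ)} {T : List ℤ}
    (hZ1 : ∀ j ∈ Z, 1 ≤ j.1) (hZ2 : ∀ j ∈ Z, j.1 ≤ U ∧ j.2 ≤ U) (hU : sm Z + 1 ≤ U)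
    (hX : 20 * (U + 2) ≤ X) (hT : 5 + 2 * Z.length + T.length ≤ X) (hZ : Z ≠ []) :
    wp X mkLeaves (State.init (stepInput θ U dk di Z T)) (700 * sm Z + 200)
      (fun s => s.reg 2 = (2 * Z.length : ℕ) ∧ s.reg 3 = (T.length : ℕ) ∧ s.reg 6 = (sm Z : ℕ) ∧
        Has s 1 (((Z.length : ℤ) - 1) :: (Z.map (leaf U)).flatMap seg) ∧
        s.reg 1 = (sm Z + 2 * Z.length + 1 : ℕ)) := by
  set l := stepInput θ U dk di Z T with hl
  obtain ⟨hlen, hnb⟩ := length_leaves (U := U) hZ1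
  have hZlen : 1 ≤ Z.length := List.length_pos_iff.mpr hZ
  have hmem : (State.init l).mem 0 = nth l := init_mem_zero l
  have h4 : nth l 4 = (2 * Z.length : ℕ) := by simp [hl, stepInput, seg]
  have h1 : nth l 1 = U := rfl
  unfold mkLeaves
  apply wp.le
  · apply wp_seq
    refine wp_set ((2 * Z.length : ℕ) : ℤ) (by simp only [Expr.eval, hmem]; exact h4) (by omega) ?_
    apply wp_seq
    refine wp_set (T.length : ℤ) ?_ (by omega) ?_
    · simp [Expr.eval, init_reg_zero, hl, length_stepInput]; ring
    apply wp_seq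
    refine wp_pushv (l := []) ((Z.length : ℤ) - 1) (Has.nil _ _) (by simp [init_reg_ne])
      (by simp; omega) (by simp [Expr.eval]) (by omega) fun i1 => ?_
    refine wp_for Z.length (fun i t => t.reg 6 = (preSum Z i : ℕ) ∧
      t.reg 1 = (1 + (((Z.take i).map (leaf U)).flatMap seg).length : ℕ) ∧
      Has t 1 (((Z.length : ℤ) - 1) :: ((Z.take i).map (leaf U)).flatMap seg))
      (fun i => 60 * (Z.getD i (0, 0)).1 + 250) (by decide) (by omega) ?_ ?_ ?_ ?_
    · intro i hi t hF _
      simp only [Expr.eval]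
      rw [hF.reg 2 (by decide)]; simp
    · refine ⟨by simp [init_reg_ne, preSum], by simp, by simpa using i1⟩
    · rintro i hi t hB hF h6 ⟨r6, r1, m1⟩
      have hm0 : t.mem 0 = nth l := by
        rw [hF.mem 0 (by decide)]; simp [setMem_mem_ne, hmem]
      have e5 : ((5 : ℤ) + 2 * (i : ℤ)).toNat = 5 + 2 * i := by omega
      have e6 : ((6 : ℤ) + 2 * (i : ℤ)).toNat = 6 + 2 * i := by omega
      obtain ⟨n1, n2⟩ := nth_stepInput_job (θ := θ) (U := U) (dk := dk) (di := di) (T := T) hi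
      rw [← hl] at n1 n2
      have hj1 := hZ1 _ (List.getElem_mem hi)
      have hj2 := hZ2 _ (List.getElem_mem hi)
      have hp := preSum_succ hi
      have hp2 : preSum Z (i + 1) ≤ sm Z := preSum_le Z (i + 1)
      have htake : (Z.take (i + 1)).map (leaf U) = (Z.take i).map (leaf U) ++ [leaf U Z[i]] := by
        rw [List.take_add_one, List.getElem?_eq_getElem hi, List.map_append]; rfl
      have hsplit : ((Z.take (i + 1)).map (leaf U)).flatMap seg =
          ((Z.take i).map (leaf U)).flatMap seg ++ seg (leaf U Z[i]) := by
        rw [htake, List.flatMap_append]; simp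
      have hlX : (((Z.take (i + 1)).map (leaf U)).flatMap seg).length + 10 ≤ X := by
        have h := (length_leaves (U := U) (z := Z.take (i + 1))
          fun j hj => hZ1 j (List.mem_of_mem_take hj)).1
        have h2 : sm (Z.take (i + 1)) ≤ sm Z := sm_le_of_sublist (List.take_sublist _ _)
        have h3 : (Z.take (i + 1)).length ≤ Z.length := by simp
        omega
      rw [hsplit, List.length_append, length_seg, length_leaf hj1] at hlX
      have hgd : (Z.getD i (0, 0)).1 = Z[i].1 := by simp [hi]
      change wp X _ t (60 * (Z.getD i (0, 0)).1 + 250) _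
      rw [hgd]
      generalize ((Z.take i).map (leaf U)).flatMap seg = p at r1 m1 hlX hsplit
      apply wp.le
      · apply wp_seq
        refine wp_set (Z[i].1 : ℤ) (by simp only [Expr.eval, h6, e5, hm0, n1]) (by omega) ?_
        apply wp_seq
        refine wp_set (preSum Z (i + 1) : ℤ) (by simp [Expr.eval, r6, hp]) (by omega) ?_
        apply wp_seq
        refine wp_pushv ((Z[i].1 + 1 : ℕ) : ℤ) (l := ((Z.length : ℤ) - 1) :: p) ?_ ?_
          (by rw [List.length_cons]; omega) (by simp [Expr.eval]) (by omega) fun m1 => ?_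
        · simpa using m1
        · simp [r1]; ring
        apply wp_seq
        refine wp_pushv ((U : ℤ) + 1) m1 (by simp) (by simp; omega) ?_ (by omega) fun m1 => ?_
        · simp [Expr.eval, setMem_mem_ne, hm0, h1]
        apply wp_seq
        refine wp_tab (j := 7) (a := 1) (q := 1) (Z[i].1 - 1) (fun _ => 0) (by decide)
            m1 (by simp; ring)
          (X := X) (by simp; omega) ?_ ?_ ?_
        · intro s' hF'
          simp only [Expr.eval]
          rw [hF'.reg 5 (by decide)]; simp; omega
        · intro k _ s' _ _ _
          exact ⟨rfl, by simp⟩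
        intro s' hF' q1 m1
        refine wp_pushv ((Z[i].2 : ℤ) - Z[i].1 + 1) m1 (by rw [q1]; simp; ring) (by simp; omega) ?_
          (by omega) fun m1 => ?_
        · have g4 : s'.reg 4 = i := by rw [hF'.reg 4 (by decide)]; simpa using h6
          have g5 : s'.reg 5 = Z[i].1 := by rw [hF'.reg 5 (by decide)]; simp
          have g0 : s'.mem 0 = nth l := by
            rw [hF'.mem 0 (by decide)]; simp [setMem_mem_ne, hm0]
          simp only [Expr.eval, g4, g5, e6, g0, n2]
        · refine ⟨?_, ?_, ?_⟩
          · simp [hF'.reg 6 (by decide)]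
          · rw [hsplit]
            simp [length_leaf hj1]
            omega
          · rw [hsplit, has_setReg]
            have : leaf U Z[i] = (U + 1 : ℤ) :: (List.map (fun _ => (0 : ℤ))
                (List.range (Z[i].1 - 1)) ++
              [(Z[i].2 : ℤ) - Z[i].1 + 1]) := rfl
            rw [seg, length_leaf hj1, this]
            simpa using m1
      · simp [Expr.C, Expr.K, Expr.L]; omega
    · rintro t hB hF _ ⟨r6, r1, m1⟩
      rw [List.take_length] at r1 m1
      refine ⟨?_, ?_, ?_, m1, ?_⟩
      · rw [hF.reg 2 (by decide)]; simp
      · rw [hF.reg 3 (by decide)]; simp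
      · rw [r6, preSum, List.take_length]; rfl
      · rw [r1, hlen]; congr 1; ring
  · rw [Finset.sum_add_distrib, ← Finset.mul_sum, sum_getD_fst]
    simp [Expr.C, Expr.K, Expr.L]; omega

theorem bundlePart_wp {c : Cmd} {X N H θ U dk di : ℕ} {Z : List (ℕ × ℕ)} {T : List ℤ} {s : State}
    (hc : ∀ x : ConvInput, x.n + 1 ≤ N → (∀ i ≤ x.n, (x.A i).natAbs ≤ 16 * X) →
      (∀ i ≤ x.n, (x.B i).natAbs ≤ 16 * X) → RunsIn c x.input x.output ((x.n + 1) * H))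
    (hZ1 : ∀ j ∈ Z, 1 ≤ j.1) (hZ2 : ∀ j ∈ Z, j.1 ≤ U ∧ j.2 ≤ U) (hU : sm Z + 1 ≤ U)
    (hdk : dk ≤ U) (hX : 20 * (U + 2) ≤ X) (hN : 2 * sm Z + 1 ≤ N) (hZ : Z ≠ [])
    (hTX : ∀ x ∈ T, x.natAbs ≤ X)
    (m0 : s.mem 0 = nth (stepInput θ U dk di Z T)) (r2 : s.reg 2 = (2 * Z.length : ℕ))
    (r6 : s.reg 6 = (sm Z : ℕ))
    (h1 : Has s 1 (((Z.length : ℤ) - 1) :: (Z.map (leaf U)).flatMap seg))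
    (r1 : s.reg 1 = (sm Z + 2 * Z.length + 1 : ℕ)) (r11 : s.reg 11 = 0)
    (m5 : s.mem 5 = fun _ => 0) :
    wp X (bundlePart c) s (200000 * (lg X * ((sm Z + 1) * (H + 1)))) (fun s' => ∃ v V : List ℤ,
      LatestStart U v Z ∧ Has s' 2 (0 :: seg v) ∧ s'.reg 9 = (dk : ℤ) - sm Z ∧
      s'.reg 10 = (dk + 1 - sm Z : ℕ) ∧ s'.mem 5 = nth V ∧
      ∀ y, 0 < nth V y ↔ ∃ i k, i + k = y ∧ i ≤ sm Z ∧ 0 < nth T (dk + 1 - sm Z + i) ∧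
        ((dk + 1 - sm Z + i : ℕ) : ℤ) < nth v k) := by
  obtain ⟨hlen, hnb⟩ := length_leaves (U := U) hZ1
  have hnb1 : 1 ≤ Z.length := List.length_pos_iff.mpr hZ
  obtain ⟨v, hv, -, hrun⟩ := treeOf_runs (mergeOp_conv hc (U := U) (X := X) (by omega) (all := Z)
      (by omega))
    (vs := Z.map (leaf U)) (zs := Z.map fun j => [j]) (by simpa using hZ)
    (by
      rw [List.forall₂_map_left_iff, List.forall₂_map_right_iff, List.forall₂_same]
      exact fun j hj => latestStart_leaf (hZ1 j hj) (hZ2 j hj).1 (hZ2 j hj).2)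
    (by simp [← List.flatMap_def]) (by rw [hlen]; omega)
  obtain ⟨hv1, hv2, hv3⟩ := hv
  rw [hlen, List.length_map] at hrun
  set base := dk + 1 - sm Z with hbase
  set T' : List ℤ := (List.range (sm Z + 1)).map (fun i => nth T (base + i)) with hT'
  set v' : List ℤ := (List.range (sm Z + 1)).map (fun i => nth v i - base) with hv'
  have hT'l : T'.length = sm Z + 1 := by simp [hT']
  have hv'l : v'.length = sm Z + 1 := by simp [hv']
  have hvX : ∀ i, (nth v i).natAbs ≤ U + 1 := natAbs_nth_le hv2
  have hTX' := natAbs_nth_le hTX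
  have hT'X : ∀ x ∈ T', x.natAbs ≤ X := by
    intro x hx
    obtain ⟨i, -, rfl⟩ := List.mem_map.mp hx
    exact hTX' _
  have hv'X : ∀ x ∈ v', x.natAbs ≤ X := by
    intro x hx
    obtain ⟨i, -, rfl⟩ := List.mem_map.mp hx
    have := hvX i; omega
  obtain ⟨V, hVrun, hVl, hVX, hV⟩ := conv_runs (X := X) (Y := X) hc (a := T') (b := v')
    (by rintro h; simp [h] at hT'l) (by rintro h; simp [h] at hv'l) hT'X hv'X hT'X
    (by omega) (by omega)
  have hV' : ∀ y, 0 < nth V y ↔ ∃ i k, i + k = y ∧ i ≤ sm Z ∧ 0 < nth T (base + i) ∧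
      ((base + i : ℕ) : ℤ) < nth v k := by
    intro y
    rw [hV y 0 le_rfl]
    constructor
    · rintro ⟨i, k, hik, h2, h3⟩
      have hi := lt_of_nth_pos h2
      have hk := lt_of_nth_pos (l := v') (i := k) (by omega)
      rw [hT', nth_map_range _ (by omega)] at h2
      rw [hv', nth_map_range _ (by omega)] at h3
      exact ⟨i, k, hik, by omega, h2, by push_cast; omega⟩
    · rintro ⟨i, k, hik, hi, h2, h3⟩
      have hk := lt_of_nth_pos (l := v) (i := k) (by omega)
      refine ⟨i, k, hik, ?_, ?_⟩
      · rw [hT', nth_map_range _ (by omega)]; exact h2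
      · rw [hv', nth_map_range _ (by omega)]; push_cast at h3; omega
  unfold bundlePart
  apply wp.le
  · apply wp_seq
    refine wp_call (b := lg X * ((sm Z + 2 * Z.length) * (6 * (H + 2000) + 350))) h1
      (by rw [Expr.eval, r1, List.length_cons, hlen]) (by rw [List.length_cons, hlen]; omega)
      (hrun.le (mul_assoc _ _ _).ge) ?_ (by simp; omega) fun h2 => ?_
    · intro x hx
      rcases List.mem_cons.mp hx with rfl | hx
      · simp
      rcases List.mem_cons.mp hx with rfl | hx
      · omega
      · have := hv2 x hx; omega
    apply wp_seq
    refine wp_set ((dk : ℤ) - sm Z) ?_ (by omega) ?_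
    · have : ((2 : ℤ)).toNat = 2 := rfl
      simp only [Expr.eval, setReg_reg, setReg_mem, write_reg]
      rw [if_neg (by decide), r6, write_mem_ne _ _ _ _ (by decide), m0]; rfl
    apply wp_seq
    refine wp_set (base : ℤ) ?_ (by omega) ?_
    · simp only [Expr.eval, setReg_reg, if_true]
      split_ifs <;> omega
    apply wp_seq
    refine wp_pushv (l := []) ((sm Z + 1 : ℕ) : ℤ) (Has.nil _ _) (by simp [r11]) (by simp; omega)
      (by simp [Expr.eval, r6]) (by omega) fun m4 => ?_
    apply wp_seq
    refine wp_tab (X := X) (sm Z + 1) (fun i => nth T (base + i)) (by decide) m4 (by simp)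
        (by simp; omega)
      ?_ ?_ ?_
    · intro s' hF
      simp only [Expr.eval]
      rw [hF.reg 6 (by decide)]; simp [r6]
    · intro i hi s' hB hF h7
      have g2 : s'.reg 2 = (2 * Z.length : ℕ) := by rw [hF.reg 2 (by decide)]; simp [r2]
      have g10 : s'.reg 10 = (base : ℤ) := by rw [hF.reg 10 (by decide)]; simp
      have g0 : s'.mem 0 = nth (stepInput θ U dk di Z T) := by
        rw [hF.mem 0 (by decide)]; simp [setMem_mem_ne, write_mem_ne, m0]
      have e1 : ((5 : ℤ) + ((2 * Z.length : ℕ) : ℤ) + ((base : ℤ) + (i : ℤ))).toNat =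
        5 + 2 * Z.length + (base + i) := by omega
      refine ⟨?_, hTX' _⟩
      simp only [Expr.eval, g2, g10, h7, g0, e1, nth_stepInput_T]
    intro s1 hF1 q1 m4
    apply wp_seq
    refine wp_pushv ((sm Z + 1 : ℕ) : ℤ) m4 (by rw [q1]; simp; ring) (by simp; omega) ?_
      (by omega) fun m4 => ?_
    · simp only [Expr.eval]
      rw [hF1.reg 6 (by decide)]; simp [r6]
    apply wp_seq
    refine wp_tab (X := X) (sm Z + 1) (fun i => nth v i - base) (by decide) m4 (by simp)
        (by simp; omega)
      ?_ ?_ ?_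
    · intro s' hF
      simp only [Expr.eval]
      rw [hF.reg 6 (by decide)]; simp [r6, hF1.reg 6 (by decide)]
    · intro i hi s' hB hF h7
      have g10 : s'.reg 10 = (base : ℤ) := by
        rw [hF.reg 10 (by decide)]; simp [hF1.reg 10 (by decide)]
      have g2 : s'.mem 2 (2 + i) = nth v i := by
        rw [hF.mem 2 (by decide)]
        simp only [setReg_mem]
        rw [setMem_mem_ne _ _ _ _ _ (by decide), hF1.mem 2 (by decide)]
        simp only [setReg_mem]
        rw [setMem_mem_ne _ _ _ _ _ (by decide)]
        have := h2 (2 + i) (by simp; omega)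
        rw [setReg_mem] at this
        simp only [setReg_mem]
        rw [this, add_comm]; rfl
      have e1 : ((2 : ℤ) + (i : ℤ)).toNat = 2 + i := by omega
      refine ⟨?_, by have := hvX i; omega⟩
      simp only [Expr.eval, g10, h7, e1, g2]
    intro s2 hF2 q2 m4
    have hin : Has s2 4 (seg T' ++ seg v') := by
      have : seg T' ++ seg v' = ([] ++ [((sm Z + 1 : ℕ) : ℤ)] ++ T' ++ [((sm Z + 1 : ℕ) : ℤ)])
          ++ v' := by
        simp [seg, hT'l, hv'l]
      rw [this]; exact m4
    refine wp_call (b := (T'.length + v'.length + 2) * (6 * (H + 2000))) hin ?_ ?_ hVrun hVX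
      (by omega) fun h5 => ?_
    · rw [Expr.eval, q2]; simp [hT'l, hv'l]; ring
    · simp [hT'l, hv'l]; omega
    · refine ⟨v, V, ⟨hv1, hv2, hv3⟩, ?_, ?_, ?_, ?_, hV'⟩
      · rw [has_setReg]
        refine Has.of_mem_eq h2 ?_
        rw [write_mem_ne _ _ _ _ (by decide), hF2.mem 2 (by decide)]
        simp only [setReg_mem]
        rw [setMem_mem_ne _ _ _ _ _ (by decide), hF1.mem 2 (by decide)]
        simp only [setReg_mem]
        rw [setMem_mem_ne _ _ _ _ _ (by decide)]
        rfl
      · simp [hF2.reg 9 (by decide), hF1.reg 9 (by decide)]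
      · simp [hF2.reg 10 (by decide), hF1.reg 10 (by decide)]
      · have e5 : s2.mem 5 = fun _ => 0 := by
          rw [hF2.mem 5 (by decide)]
          simp only [setReg_mem]
          rw [setMem_mem_ne _ _ _ _ _ (by decide), hF1.mem 5 (by decide)]
          simp only [setReg_mem]
          rw [setMem_mem_ne _ _ _ _ _ (by decide)]
          simp only [setReg_mem]
          rw [write_mem_ne _ _ _ _ (by decide), m5]
        funext i
        rw [setReg_mem, write_mem_self, e5]; rfl
  · have hlg := one_le_lg X
    set A := (sm Z + 1) * (H + 1) with hA
    have b1 : (sm Z + 2 * Z.length) * (6 * (H + 2000) + 350) ≤ 37050 * A := by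
      calc _ ≤ (3 * (sm Z + 1)) * (12350 * (H + 1)) := Nat.mul_le_mul (by omega) (by omega)
        _ = _ := by rw [hA]; ring
    have b2 : lg X * ((sm Z + 2 * Z.length) * (6 * (H + 2000) + 350)) ≤ 37050 * (lg X * A) := by
      calc _ ≤ lg X * (37050 * A) := Nat.mul_le_mul_left _ b1
        _ = _ := by ring
    have b3 : (T'.length + v'.length + 2) * (6 * (H + 2000)) ≤ 48000 * (lg X * A) := by
      have b5 : T'.length + v'.length + 2 ≤ 4 * (sm Z + 1) := by rw [hT'l, hv'l]; omega
      have b6 : 6 * (H + 2000) ≤ 12000 * (H + 1) := by rw [mul_add, mul_add]; omega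
      calc _ ≤ (4 * (sm Z + 1)) * (12000 * (H + 1)) := Nat.mul_le_mul b5 b6
        _ = 48000 * A := by rw [hA]; ring
        _ ≤ _ := Nat.mul_le_mul_left _ (Nat.le_mul_of_pos_left _ (by omega))
    have b4 : sm Z + 1 ≤ lg X * A := by
      calc sm Z + 1 ≤ A := Nat.le_mul_of_pos_right _ (by omega)
        _ ≤ _ := Nat.le_mul_of_pos_left _ (by omega)
    simp only [List.length_cons, List.length_append, hlen, length_seg]
    simp [Expr.C, Expr.K, Expr.L]
    omega

theorem redPart_wp {X θ U dk di : ℕ} {Z : List (ℕ × ℕ)} {T : List ℤ} {s : State}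
    (hZ1 : ∀ j ∈ Z, 1 ≤ j.1) (hZ2 : ∀ j ∈ Z, j.1 ≤ U ∧ j.2 ≤ U) (hU : sm Z + 1 ≤ U)
    (hX : 20 * (U + 2) ≤ X) (hZ : Z ≠ [])
    (m0 : s.mem 0 = nth (stepInput θ U dk di Z T))
    (h1 : Has s 1 (((Z.length : ℤ) - 1) :: (Z.map (leaf U)).flatMap seg))
    (r1 : s.reg 1 = (sm Z + 2 * Z.length + 1 : ℕ)) :
    wp X redPart s (400000000 * (lg X ^ 3 * (sm Z + 1))) (fun s' => ∃ v : List ℤ,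
      SumMarks U v Z ∧ Has s' 2 (0 :: seg v) ∧ s'.reg 9 = (U : ℤ)) := by
  obtain ⟨hlen, hnb⟩ := length_leaves (U := U) hZ1
  have hnb1 : 1 ≤ Z.length := List.length_pos_iff.mpr hZ
  obtain ⟨v, hv, -, hrun⟩ := treeOf_runs (mergeOp_sumset (U := U) (X := X) (by omega) Z)
    (vs := Z.map (leaf U)) (zs := Z.map fun j => [j]) (by simpa using hZ)
    (by
      rw [List.forall₂_map_left_iff, List.forall₂_map_right_iff, List.forall₂_same]
      exact fun j hj => sumMarks_leaf (hZ1 j hj) (hZ2 j hj).1 (hZ2 j hj).2)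
    (by simp [← List.flatMap_def]) (by rw [hlen]; omega)
  obtain ⟨hv1, hv2, hv3⟩ := hv
  rw [hlen, List.length_map] at hrun
  unfold redPart
  apply wp.le
  · apply wp_seq
    refine wp_call (b := lg X * ((sm Z + 2 * Z.length) * (100000000 * lg X ^ 2 + 350))) h1
      (by rw [Expr.eval, r1, List.length_cons, hlen]) (by rw [List.length_cons, hlen]; omega)
      (hrun.le (mul_assoc _ _ _).ge) ?_ (by simp; omega) fun h2 => ?_
    · intro x hx
      rcases List.mem_cons.mp hx with rfl | hx
      · simp
      rcases List.mem_cons.mp hx with rfl | hx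
      · omega
      · have := hv2 x hx; omega
    refine wp_set (U : ℤ) ?_ (by omega) ?_
    · simp only [Expr.eval, setReg_mem]
      rw [write_mem_ne _ _ _ _ (by decide), m0]; rfl
    · exact ⟨v, ⟨hv1, hv2, hv3⟩, by rw [has_setReg]; exact h2, by simp⟩
  · have hlg := one_le_lg X
    set A := lg X ^ 3 * (sm Z + 1) with hA
    have h2 : 1 ≤ lg X ^ 2 := Nat.one_le_pow _ _ hlg
    have b2 : lg X * ((sm Z + 2 * Z.length) * (100000000 * lg X ^ 2 + 350)) ≤ 300001050 * A := by
      calc _ ≤ lg X * ((3 * (sm Z + 1)) * (100000350 * lg X ^ 2)) :=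
            Nat.mul_le_mul_left _ (Nat.mul_le_mul (by omega) (by omega))
        _ = _ := by rw [hA]; ring
    have b4 : sm Z + 1 ≤ A := Nat.le_mul_of_pos_left _ (Nat.pow_pos hlg)
    simp only [List.length_cons, hlen, length_seg]
    simp [Expr.C, Expr.K, Expr.L]
    omega

theorem unionPart_wp {X θ U dk di base : ℕ} {Z : List (ℕ × ℕ)} {T v V : List ℤ} {t : ℤ} {s : State}
    {p : ℕ → Prop} (hX : 20 * (U + 2) ≤ X) (hT : T ≠ [])
    (hTX : T.length + sm Z + 10 ≤ X) (hTb : ∀ x ∈ T, x.natAbs ≤ X) (hv : v.length = sm Z + 1)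
    (hvb : ∀ x ∈ v, x.natAbs ≤ X)
    (m0 : s.mem 0 = nth (stepInput θ U dk di Z T)) (r2 : s.reg 2 = (2 * Z.length : ℕ))
    (r3 : s.reg 3 = (T.length : ℕ)) (r6 : s.reg 6 = (sm Z : ℕ)) (m2 : Has s 2 (0 :: seg v))
    (r9 : s.reg 9 = t) (r10 : s.reg 10 = base) (m5 : s.mem 5 = nth V)
    (r13 : s.reg 13 = 0) (r15 : s.reg 15 = 0) (m6 : s.mem 6 = fun _ => 0)
    (hp : ∀ y, (y ≤ di ∧ ((∃ x k, x + k = y ∧ 0 < nth T x ∧ (x : ℤ) ≤ t ∧ 0 < nth v k) ∨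
      (base ≤ y ∧ 0 < nth V (y - base)))) ↔ p y) :
    wp X unionPart s (100002000 * (lg X ^ 2 * (T.length + sm Z + 3)))
      (fun s' => s'.output = markList (T.length + sm Z) p) := by
  set T' : List ℤ := (List.range T.length).map (fun x => nth T x * if (x : ℤ) ≤ t then 1 else 0)
    with hT'
  have hT'l : T'.length = T.length := by simp [hT']
  have hT1 : 1 ≤ T.length := List.length_pos_iff.mpr hT
  have hT'b : ∀ i, (nth T i * if (i : ℤ) ≤ t then 1 else 0).natAbs ≤ X := by
    intro i
    have := natAbs_nth_le hTb i
    split_ifs <;> simp [this]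
  obtain ⟨out, hrun, hol, h01, hout⟩ := sumset_runs (X := X) (a := T') (b := v)
    (by rintro h; simp [h] at hT'l; omega) (by rintro rfl; simp at hv)
    (by
      intro x hx
      obtain ⟨i, -, rfl⟩ := List.mem_map.mp hx
      exact hT'b i) hvb (by omega)
  have hout' : ∀ k, 0 < nth out k ↔ ∃ i j, i + j = k ∧ 0 < nth T i ∧ (i : ℤ) ≤ t ∧ 0 < nth v j := by
    intro k
    rw [hout]
    constructor
    · rintro ⟨i, j, hij, h1, h2⟩
      have hi := lt_of_nth_pos h1
      rw [hT', nth_map_range _ (by omega)] at h1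
      split_ifs at h1 with h
      · exact ⟨i, j, hij, by simpa using h1, h, h2⟩
      · simp at h1
    · rintro ⟨i, j, hij, h1, h, h2⟩
      have hi := lt_of_nth_pos h1
      refine ⟨i, j, hij, ?_, h2⟩
      rw [hT', nth_map_range _ (by omega), if_pos h]; simpa using h1
  unfold unionPart
  apply wp.le
  · apply wp_seq
    refine wp_pushv (l := []) (T.length : ℤ) (Has.nil _ _) (by simp [r13]) (by simp; omega)
      (by rw [Expr.eval, r3]) (by omega) fun m3 => ?_
    apply wp_seq
    refine wp_tab (X := X) T.length (fun x => nth T x * if (x : ℤ) ≤ t then 1 else 0) (by decide) m3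
      (by simp) (by simp; omega) ?_ ?_ ?_
    · intro s' hF
      simp only [Expr.eval]
      rw [hF.reg 3 (by decide)]; simp [r3]
    · intro i hi s' hB hF h7
      have g2 : s'.reg 2 = (2 * Z.length : ℕ) := by rw [hF.reg 2 (by decide)]; simp [r2]
      have g9 : s'.reg 9 = t := by rw [hF.reg 9 (by decide)]; simp [r9]
      have g0 : s'.mem 0 = nth (stepInput θ U dk di Z T) := by
        rw [hF.mem 0 (by decide)]; simp [setMem_mem_ne, m0]
      have e1 : ((5 : ℤ) + ((2 * Z.length : ℕ) : ℤ) + (i : ℤ)).toNat =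
        5 + 2 * Z.length + i := by omega
      refine ⟨?_, hT'b i⟩
      simp only [Expr.eval, g2, g9, h7, g0, e1, nth_stepInput_T]
    intro s1 hF1 q1 m3
    apply wp_seq
    refine wp_pushv ((sm Z + 1 : ℕ) : ℤ) m3 (by rw [q1]; simp; ring) (by simp; omega) ?_
      (by omega) fun m3 => ?_
    · simp only [Expr.eval]
      rw [hF1.reg 6 (by decide)]; simp [r6]
    apply wp_seq
    refine wp_tab (X := X) (sm Z + 1) (nth v) (by decide) m3 (by simp) (by simp; omega) ?_ ?_ ?_
    · intro s' hF
      simp only [Expr.eval]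
      rw [hF.reg 6 (by decide)]; simp [r6, hF1.reg 6 (by decide)]
    · intro i hi s' hB hF h7
      have g2 : s'.mem 2 (2 + i) = nth v i := by
        rw [hF.mem 2 (by decide)]
        simp only [setReg_mem]
        rw [setMem_mem_ne _ _ _ _ _ (by decide), hF1.mem 2 (by decide)]
        simp only [setReg_mem]
        rw [setMem_mem_ne _ _ _ _ _ (by decide)]
        rw [m2 (2 + i) (by simp; omega), add_comm]; rfl
      have e1 : ((2 : ℤ) + (i : ℤ)).toNat = 2 + i := by omega
      exact ⟨by simp only [Expr.eval, h7, e1, g2], natAbs_nth_le hvb i⟩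
    intro s2 hF2 q2 m3
    have hin : Has s2 3 (seg T' ++ seg v) := by
      have : seg T' ++ seg v = ([] ++ [(T.length : ℤ)] ++ T' ++ [((sm Z + 1 : ℕ) : ℤ)]) ++
          (List.range (sm Z + 1)).map (nth v) := by
        rw [← hv, map_range_nth]
        simp [seg, hT'l]
      rw [this]; exact m3
    have hreg : ∀ r, r ∉ [7, 13] → s2.reg r = s.reg r := fun r hr => by
      rw [hF2.reg r hr, setReg_reg, if_neg (fun h => hr (by simp [h])), setMem_reg, hF1.reg r hr,
        setReg_reg, if_neg (fun h => hr (by simp [h])), setMem_reg]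
    have hmm : ∀ a, a ≠ 3 → s2.mem a = s.mem a := fun a ha => by
      rw [hF2.mem a (by simpa using ha), setReg_mem, setMem_mem_ne _ _ _ _ _ ha,
        hF1.mem a (by simpa using ha), setReg_mem, setMem_mem_ne _ _ _ _ _ ha]
    clear hF2 hF1
    apply wp_seq
    refine wp_call (b := (T'.length + v.length + 2) * (100000000 * lg X ^ 2)) hin ?_ ?_ hrun ?_
      (by omega) fun h6 => ?_
    · rw [Expr.eval, q2]; simp [hT'l, hv]; ring
    · simp [hT'l, hv]; omega
    · intro x hx
      rcases h01 x hx with rfl | rfl <;> simp; omega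
    have h6' : ∀ i, ((s2.write 6 out).setReg 14 out.length).mem 6 i = nth out i := by
      intro i
      rw [setReg_mem, write_mem_self, hmm 6 (by decide), m6]; rfl
    apply wp_seq
    classical
    refine wp_tab (X := X) (l := []) (T.length + sm Z) (fun y => if p y then 1 else 0) (by decide)
      (Has.nil _ _) ?_ (by simp; omega) ?_ ?_ ?_
    · simp [hreg 15 (by decide), r15]
    · intro s' hF
      simp only [Expr.eval]
      rw [hF.reg 3 (by decide), hF.reg 6 (by decide)]
      simp [hreg 3 (by decide), hreg 6 (by decide), r3, r6]
    · intro i hi s' hB hF h7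
      have g10 : s'.reg 10 = base := by
        rw [hF.reg 10 (by decide)]; simp [hreg 10 (by decide), r10]
      have g0 : s'.mem 0 3 = di := by
        rw [hF.mem 0 (by decide), setReg_mem, write_mem_ne _ _ _ _ (by decide), hmm 0 (by decide),
            m0]
        rfl
      have g5 : s'.mem 5 = nth V := by
        rw [hF.mem 5 (by decide), setReg_mem, write_mem_ne _ _ _ _ (by decide), hmm 5 (by decide),
            m5]
      have g6 : s'.mem 6 i = nth out i := by rw [hF.mem 6 (by decide), h6']
      have e3 : (3 : ℤ).toNat = 3 := rfl
      refine ⟨?_, by split_ifs <;> simp; omega⟩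
      simp only [Expr.eval, g10, g0, g5, g6, h7, e3, Int.toNat_natCast]
      have hb : (((i : ℤ) - (base : ℤ))).toNat = i - base := by omega
      rw [hb]
      by_cases hpi : p i
      · obtain ⟨h1, h2⟩ := (hp i).mpr hpi
        rw [← hout'] at h2
        rw [if_pos (by exact_mod_cast h1), if_pos hpi, one_mul, if_pos]
        rcases h2 with h2 | ⟨h2, h3⟩
        · rw [if_pos (by omega)]
          split_ifs <;> simp
        · rw [if_pos (show (base : ℤ) ≤ i by exact_mod_cast h2),
              if_pos (show 1 ≤ nth V (i - base) by omega)]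
          split_ifs <;> simp
      · rw [if_neg hpi]
        have h1 := (not_congr (hp i)).mpr hpi
        rw [← hout', not_and_or, not_or, not_and_or] at h1
        rcases h1 with h1 | ⟨h1, h2⟩
        · rw [if_neg (by exact_mod_cast h1), zero_mul]
        · have : ((if (base : ℤ) ≤ i then (1 : ℤ) else 0) *
              if 1 ≤ nth V (i - base) then 1 else 0) = 0 := by
            rcases h2 with h2 | h2
            · rw [if_neg (by exact_mod_cast h2), zero_mul]
            · rw [if_neg (show ¬ 1 ≤ nth V (i - base) by omega), mul_zero]
          rw [this, if_neg (show ¬ 1 ≤ nth out i by omega), add_zero]; simp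
    intro s3 hF3 q3 m3
    refine wp_ret (l := markList (T.length + sm Z) p) ?_ (by simpa using q3) (by simp; omega)
      fun s' hs' => hs'
    convert m3 using 1
    rw [List.nil_append, markList]
  · have hlg : 1 ≤ lg X ^ 2 := Nat.one_le_pow _ _ (one_le_lg X)
    set A := lg X ^ 2 * (T.length + sm Z + 3) with hA
    have b1 : (T'.length + v.length + 2) * (100000000 * lg X ^ 2) = 100000000 * A := by
      rw [hT'l, hv, hA]; ring
    have b2 : T.length + sm Z + 3 ≤ A := Nat.le_mul_of_pos_left _ hlg
    simp only [List.length_append, length_seg]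
    simp [Expr.C, Expr.K, Expr.L]
    omega

/-- One iteration leads from the totals of the feasible sets of the jobs `Z₁` to those for `Z₁ ++
Z`. -/
theorem step_runs {c : Cmd} {X N H θ U dk di : ℕ} {Z₁ Z : List (ℕ × ℕ)}
    (hc : ∀ x : ConvInput, x.n + 1 ≤ N → (∀ i ≤ x.n, (x.A i).natAbs ≤ 16 * X) →
      (∀ i ≤ x.n, (x.B i).natAbs ≤ 16 * X) → RunsIn c x.input x.output ((x.n + 1) * H))
    (hN : 2 * θ + 1 ≤ N) (hZ : Z ≠ []) (hZ1 : ∀ j ∈ Z, 1 ≤ j.1) (hZU : ∀ j ∈ Z, j.1 ≤ U)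
    (h1 : ∀ j ∈ Z₁, j.2 ≤ dk) (h2 : ∀ j ∈ Z, dk ≤ j.2) (h3 : ∀ j ∈ Z, j.2 ≤ di) (h4 : dk ≤ di)
    (hred : θ < sm Z → ∀ j ∈ Z, j.2 = di) (hdi : di ≤ U) (hdk : dk + sm Z ≤ U)
    (hU : sm Z₁ + sm Z + 1 ≤ U) (hθ : θ ≤ X) (hX : 20 * (U + 2) ≤ X) :
    RunsIn (step c) (stepInput θ U dk di Z (markList (sm Z₁ + 1) (fun y => Sched Z₁ y 0)))
      (markList (sm (Z₁ ++ Z) + 1) (fun y => Sched (Z₁ ++ Z) y 0))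
      (1000000000 * (lg X ^ 3 * ((sm Z + 1) * (H + 1) + sm Z₁ + 1)) * lg X) := by
  set T := markList (sm Z₁ + 1) (fun y => Sched Z₁ y 0) with hT
  have hTl : T.length = sm Z₁ + 1 := length_markList _ _
  have hTX : ∀ x ∈ T, x.natAbs ≤ X := markList_bound _ (by omega)
  have hTpos : ∀ x, 0 < nth T x ↔ Sched Z₁ x 0 := by
    intro x
    rw [hT, nth_markList_pos]
    exact ⟨fun h => h.2, fun h => ⟨by have := h.le_sm; omega, h⟩⟩
  obtain ⟨-, hnb⟩ := length_leaves (U := U) hZ1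
  have hZ2 : ∀ j ∈ Z, j.1 ≤ U ∧ j.2 ≤ U := fun j hj => ⟨hZU j hj, (h3 j hj).trans hdi⟩
  have hlg := one_le_lg X
  set A := lg X ^ 3 * ((sm Z + 1) * (H + 1) + sm Z₁ + 1) with hA
  have hlen : 5 + 2 * Z.length + T.length ≤ X := by omega
  refine RunsIn.of_wp ?_ (by rw [length_stepInput]; omega) ?_
  · intro x hx
    simp only [stepInput, seg, List.cons_append, List.mem_cons, List.mem_append] at hx
    rcases hx with rfl | rfl | rfl | rfl | rfl | hx | hx
    · simpa using hθ
    · omega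
    · omega
    · omega
    · rw [length_flat]; omega
    · obtain ⟨j, hj, rfl | rfl⟩ := mem_flat.mp hx
      · have := hZ2 j hj; omega
      · have := hZ2 j hj; omega
    · exact hTX x hx
  unfold step
  have hB : ∀ a b, a ≤ b → a * (sm Z + 1) ≤ b * ((sm Z + 1) * (H + 1) + sm Z₁ + 1) := by
    intro a b hab
    refine Nat.mul_le_mul hab ?_
    have : sm Z + 1 ≤ (sm Z + 1) * (H + 1) := Nat.le_mul_of_pos_right _ (by omega)
    omega
  apply wp.le
  · apply wp_seq
    refine (mkLeaves_wp hZ1 hZ2 (by omega) hX hlen hZ).imp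
      fun s _ hF ⟨r2, r3, r6, m1, r1⟩ => ?_
    have m0 : s.mem 0 = nth (stepInput θ U dk di Z T) := by
      rw [hF.mem 0 (by decide), init_mem_zero]
    have hr0 : ∀ r, r ≠ 0 → r ∉ Cmd.wregs mkLeaves → s.reg r = 0 := fun r h h' => by
      rw [hF.reg r h', init_reg_ne _ h]
    have hm0 : ∀ a, a ≠ 0 → a ∉ Cmd.warrs mkLeaves → s.mem a = fun _ => 0 := fun a h h' => by
      rw [hF.mem a h', init_mem_ne _ h]
    have hcond : (Expr.le (.reg 6) (.load 0 (.const 0))).eval s = if sm Z ≤ θ then 1 else 0 := by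
      have : s.mem 0 (0 : ℤ).toNat = θ := by rw [m0]; rfl
      simp only [Expr.eval, r6, this, Nat.cast_le]
    apply wp_seq
    have hbr : wp X (.branch (.le (.reg 6) (.load 0 (.const 0))) (bundlePart c) redPart) s
        (20 + 400000000 * A) (fun s' => ∃ (v V : List ℤ) (t : ℤ) (base : ℕ), v.length = sm Z + 1 ∧
          (∀ x ∈ v, x.natAbs ≤ X) ∧ Has s' 2 (0 :: seg v) ∧ s'.reg 9 = t ∧ s'.reg 10 = base ∧
          s'.mem 5 = nth V ∧ ∀ y, (y ≤ di ∧ ((∃ x k, x + k = y ∧ 0 < nth T x ∧ (x : ℤ) ≤ t ∧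
            0 < nth v k) ∨ (base ≤ y ∧ 0 < nth V (y - base)))) ↔ Sched (Z₁ ++ Z) y 0) := by
      apply wp.le
      · apply wp_branch (b := 400000000 * A)
        · intro hc'
          rw [hcond] at hc'
          have hle : sm Z ≤ θ := by by_contra h; simp [h] at hc'
          apply wp.le
          · refine (bundlePart_wp hc hZ1 hZ2 (by omega) (by omega) hX (by omega) hZ hTX m0 r2 r6
              m1 r1 (hr0 11 (by decide) (by decide)) (hm0 5 (by decide) (by decide))).imp
              fun s' _ _ ⟨v, V, hv, q2, q9, q10, q5, hV⟩ => ?_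
            refine ⟨v, V, _, _, hv.1, fun x hx => (hv.2.1 x hx).trans (by omega), q2, q9, q10, q5,
              fun y => ?_⟩
            rw [← bundle_iff hv h1 h2 h3 h4 (by omega) y, hV]
            simp only [hTpos]
          · calc 200000 * (lg X * ((sm Z + 1) * (H + 1)))
                ≤ 400000000 * (lg X ^ 3 * ((sm Z + 1) * (H + 1) + sm Z₁ + 1)) := by
                  refine Nat.mul_le_mul (by norm_num) (Nat.mul_le_mul ?_ (by omega))
                  exact Nat.le_self_pow (by omega) _
              _ = _ := rfl
        · intro hc'
          rw [hcond] at hc'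
          have hle : θ < sm Z := by by_contra h; simp [not_lt.mp h] at hc'
          apply wp.le
          · refine (redPart_wp hZ1 hZ2 (by omega) hX hZ m0 m1 r1).imp
              fun s' _ hF' ⟨v, hv, q2, q9⟩ => ?_
            refine ⟨v, [], _, 0, hv.1, fun x hx => (hv.2.1 x hx).trans (by omega), q2, q9, ?_, ?_,
              fun y => ?_⟩
            · rw [hF'.reg 10 (by decide), hr0 10 (by decide) (by decide)]; rfl
            · rw [hF'.mem 5 (by decide), hm0 5 (by decide) (by decide)]
              funext i; rw [nth_of_le (by simp)]
            · rw [← red_iff hv (fun j hj => (h1 j hj).trans h4) (hred hle) hdi y]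
              have : ∀ i, nth [] i = 0 := fun i => nth_of_le (by simp)
              simp only [hTpos, this, lt_irrefl, and_false, or_false]
          · calc 400000000 * (lg X ^ 3 * (sm Z + 1))
                ≤ 400000000 * (lg X ^ 3 * ((sm Z + 1) * (H + 1) + sm Z₁ + 1)) :=
                  Nat.mul_le_mul_left _ (hB _ _ le_rfl)
              _ = _ := rfl
      · refine Nat.add_le_add_right ?_ _
        simp [Expr.C, Expr.K, Expr.L]
    refine hbr.imp fun s' _ hF' ⟨v, V, t, base, hv, hvb, q2, q9, q10, q5, hp⟩ => ?_
    have hF'' := hF'.mono (show Cmd.wregs (.branch (.le (.reg 6) (.load 0 (.const 0)))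
      (bundlePart c) redPart) ⊆ [8, 9, 10, 11, 7, 12] by
        simp [Cmd.wregs, bundlePart, redPart, push, tab, For]) (show Cmd.warrs
      (.branch (.le (.reg 6) (.load 0 (.const 0))) (bundlePart c) redPart) ⊆ [2, 4, 5] by
        simp [Cmd.warrs, bundlePart, redPart, push, tab, For])
    have hfin := unionPart_wp (s := s') (p := fun y => Sched (Z₁ ++ Z) y 0) hX
      (by rintro h; simp [h] at hTl) (by omega) hTX hv hvb
      (by rw [hF''.mem 0 (by decide), m0]) (by rw [hF''.reg 2 (by decide), r2])
      (by rw [hF''.reg 3 (by decide), r3]) (by rw [hF''.reg 6 (by decide), r6]) q2 q9 q10 q5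
      (by rw [hF''.reg 13 (by decide), hr0 13 (by decide) (by decide)])
      (by rw [hF''.reg 15 (by decide), hr0 15 (by decide) (by decide)])
      (by rw [hF''.mem 6 (by decide), hm0 6 (by decide) (by decide)]) hp
    have e : sm (Z₁ ++ Z) + 1 = T.length + sm Z := by rw [sm_append, hTl]; ring
    rw [e]
    exact hfin
  · have h5 : sm Z + 1 ≤ A := by
      have := hB 1 (lg X ^ 3) (Nat.one_le_pow _ _ hlg)
      rwa [one_mul] at this
    have h6 : lg X ^ 2 * (T.length + sm Z + 3) ≤ 3 * A := by
      have h7 : T.length + sm Z + 3 ≤ 3 * ((sm Z + 1) * (H + 1) + sm Z₁ + 1) := by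
        have : sm Z + 1 ≤ (sm Z + 1) * (H + 1) := Nat.le_mul_of_pos_right _ (by omega)
        rw [hTl]
        generalize (sm Z + 1) * (H + 1) = B at this ⊢
        omega
      calc _ ≤ lg X ^ 3 * (3 * ((sm Z + 1) * (H + 1) + sm Z₁ + 1)) :=
            Nat.mul_le_mul (Nat.pow_le_pow_right hlg (by norm_num)) h7
        _ = _ := by rw [hA]; ring
    omega

/-! ### Listing the elements of a marked set -/

open Classical in
/-- The number of `y < n` with the property `p`, followed by these `y` in increasing order. -/
noncomputable def members (n : ℕ) (p : ℕ → Prop) : List ℤ :=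
  seg (((List.range n).filter fun y => p y).map fun y : ℕ => (y : ℤ))

theorem length_members_le (n : ℕ) (p : ℕ → Prop) : (members n p).length ≤ n + 1 := by
  simp only [members, seg, List.length_cons, List.length_map]
  exact Nat.add_le_add_right ((List.length_filter_le _ _).trans_eq List.length_range) 1

theorem members_bound {n X : ℕ} (p : ℕ → Prop) (hX : n ≤ X) :
    ∀ x ∈ members n p, x.natAbs ≤ X := by
  intro x hx
  rcases List.mem_cons.mp hx with rfl | hx
  · have := length_members_le n p
    simp only [members, seg, List.length_cons] at this
    simp only [Int.natAbs_natCast]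
    omega
  · obtain ⟨y, hy, rfl⟩ := List.mem_map.mp hx
    have := List.mem_range.mp (List.mem_filter.mp hy).1
    simp only [Int.natAbs_natCast]
    omega

/-- The elements of a set that is given by marks. -/
def listMarks : Cmd :=
  .seq (push 1 1 (.const 0)) <|
  .seq (For 2 (.reg 0) (.branch (.load 0 (.reg 2)) (push 1 1 (.reg 2)) .skip)) <|
  .seq (.store 1 (.const 0) (.sub (.reg 1) (.const 1))) (ret 1 1)

theorem listMarks_runs {X n : ℕ} (p : ℕ → Prop) (hX : n + 1 ≤ X) :
    RunsIn listMarks (markList n p) (members n p) ((60 * n + 80) * lg X) := by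
  classical
  refine RunsIn.of_wp (markList_bound p (by omega)) (by simp; omega) ?_
  have hmem := init_mem_zero (markList n p)
  have hr0 : (State.init (markList n p)).reg 0 = n := by rw [init_reg_zero]; simp
  set s := State.init (markList n p) with hs
  set f : ℕ → List ℤ := fun i => ((List.range i).filter fun y => p y).map fun y : ℕ => (y : ℤ)
    with hf
  have hfl : ∀ i, (f i).length ≤ i := fun i => by
    simp only [hf, List.length_map]
    exact (List.length_filter_le _ _).trans (by simp)
  have hfs : ∀ i, f (i + 1) = f i ++ (if p i then [(i : ℤ)] else []) := fun i => by
    simp only [hf, List.range_succ, List.filter_append, List.map_append]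
    split_ifs with h <;> simp [h]
  have hr1 : s.reg 1 = 0 := init_reg_ne _ (by decide)
  unfold listMarks
  apply wp.le
  · apply wp_seq
    refine wp_pushv (l := []) 0 (Has.nil _ _) (by simp [hr1]) (by simp; omega) rfl (by simp)
      fun h1 => ?_
    apply wp_seq
    refine wp_for n (fun i s' => s'.reg 1 = ((f i).length + 1 : ℕ) ∧
      Has s' 1 (0 :: f i)) (fun _ => 20) (by simp [Cmd.wregs, push]) (by omega) ?_ ?_ ?_ ?_
    · intro i _ s' hF _
      rw [Expr.eval, hF.reg 0 (by simp [Cmd.wregs, push])]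
      simp [hr0]
    · simpa [hf] using h1
    · rintro i hi s' hB hF h2 ⟨h3, h4⟩
      have hm0 : s'.mem 0 i = if p i then 1 else 0 := by
        rw [hF.mem 0 (by simp [Cmd.warrs, push]), setReg_mem, setMem_mem_ne _ _ _ _ _ (by decide),
          hmem, markList, nth_map_range _ hi]
      have he : (Expr.load 0 (.reg 2)).eval s' = if p i then 1 else 0 := by
        simp only [Expr.eval, h2, Int.toNat_natCast, hm0]
      have := hfl i
      apply wp.le
      · apply wp_branch (b := 13)
        · intro hc
          rw [he] at hc
          have hp : p i := by by_contra h; simp [h] at hc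
          refine (wp_pushv (i : ℤ) h4 (by rw [h3]; simp) (by simp; omega)
            (by rw [Expr.eval, h2]) (by simp; omega) fun h5 => ⟨?_, ?_⟩).le
              (by simp [Expr.C, Expr.K, Expr.L])
          · rw [hfs, if_pos hp]; simp
          · rw [hfs, if_pos hp]; exact h5
        · intro hc
          rw [he] at hc
          have hp : ¬ p i := by intro h; simp [h] at hc
          refine (wp_skip ⟨?_, ?_⟩).le (by omega)
          · rw [hfs, if_neg hp]; simpa using h3
          · rw [hfs, if_neg hp]; simpa using h4
      · simp [Expr.C, Expr.K, Expr.L]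
    · rintro s' hB hF h2 ⟨h3, h4⟩
      have h5 := hfl n
      have e : members n p = ((f n).length : ℤ) :: f n := by
        simp only [members, seg, hf]
      have hv : (Expr.sub (.reg 1) (.const 1)).eval s' = (f n).length := by
        simp only [Expr.eval, h3]; push_cast; ring
      apply wp_seq
      refine wp_store (fun _ => by rw [hv]; simp; omega) ?_
      rw [hv]
      have h6 := Has.set (l := []) (z := ((f n).length : ℤ)) h4
      refine (wp_ret (l := members n p) (by rw [e]; exact h6) ?_ ?_ fun s' h => h).le
        (b' := 4 * (n + 1) + 4) ?_
      · rw [e]; simp [h3]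
      · rw [e]; simp; omega
      · rw [e]; simp; omega
  · simp [Expr.C, Expr.K, Expr.L]; omega

/-! ### The chain of blocks -/

/-- The end of the block before the `i`-th one. -/
def prevEnd (L : List (ℕ × ℕ)) (i : ℕ) : ℕ := (0 :: L.map Prod.snd).getD i 0

@[simp] theorem prevEnd_zero (L : List (ℕ × ℕ)) : prevEnd L 0 = 0 := rfl

theorem prevEnd_succ {L : List (ℕ × ℕ)} {i : ℕ} (hi : i < L.length) :
    prevEnd L (i + 1) = L[i].2 := by
  simp [prevEnd, hi]

theorem prevEnd_append {L L' : List (ℕ × ℕ)} {i : ℕ} (hi : i ≤ L.length) :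
    prevEnd (L ++ L') i = prevEnd L i := by
  rcases i with _ | i
  · rfl
  · rw [prevEnd_succ (by simp; omega), prevEnd_succ (by omega), List.getElem_append_left]

theorem blockList_chain (ld : ℕ → ℕ → ℕ) (θ m : ℕ) :
    (∀ i (hi : i < (blockList ld θ m).reverse.length),
      (blockList ld θ m).reverse[i].1 = prevEnd (blockList ld θ m).reverse i + 1) ∧
    prevEnd (blockList ld θ m).reverse (blockList ld θ m).reverse.length = m := by
  induction m using Nat.strong_induction_on with
  | _ m ih =>
    rcases m with _ | m
    · simp [blockList]
    · have h1 := one_le_blockStart ld θ (m + 1) (m + 1) (by omega)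
      have h2 := blockStart_le ld θ (m + 1) (m + 1)
      obtain ⟨h3, h4⟩ := ih (blockStart ld θ (m + 1) (m + 1) - 1) (by omega)
      rw [blockList, List.reverse_cons]
      set L := (blockList ld θ (blockStart ld θ (m + 1) (m + 1) - 1)).reverse
      refine ⟨fun i hi => ?_, ?_⟩
      · rw [List.length_append, List.length_singleton] at hi
        rw [prevEnd_append (by omega)]
        rcases Nat.lt_succ_iff_lt_or_eq.mp hi with h | rfl
        · rw [List.getElem_append_left h, h3 i h]
        · rw [List.getElem_concat_length rfl, h4]
          simp only; omega
      · rw [List.length_append, List.length_singleton, prevEnd_succ (by simp)]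
        rw [List.getElem_concat_length rfl]

/-- A block has a load of at most `θ` unless it is a single due date. -/
theorem ld_blockStart (ld : ℕ → ℕ → ℕ) (θ m : ℕ) : ∀ k, blockStart ld θ m k = k ∨
    ld (blockStart ld θ m k) m ≤ θ
  | 0 => Or.inl rfl
  | 1 => Or.inl rfl
  | k + 2 => by
    unfold blockStart
    split_ifs with h
    · right
      rcases ld_blockStart ld θ m (k + 1) with h' | h'
      · rwa [h']
      · exact h'
    · exact Or.inl rfl

/-- A block with a load above the threshold consists of a single due date. -/
theorem blockList_single {ld : ℕ → ℕ → ℕ} {θ m : ℕ} {b : ℕ × ℕ} (hb : b ∈ blockList ld θ m)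
    (h : θ < ld b.1 b.2) : b.1 = b.2 := by
  induction m using Nat.strong_induction_on with
  | _ m ih =>
    rcases m with _ | m
    · simp [blockList] at hb
    · have h1 := one_le_blockStart ld θ (m + 1) (m + 1) (by omega)
      have h2 := blockStart_le ld θ (m + 1) (m + 1)
      rw [blockList] at hb
      rcases List.mem_cons.mp hb with rfl | hb
      · rcases ld_blockStart ld θ (m + 1) (m + 1) with h3 | h3
        · exact h3
        · simp only at h; omega
      · exact ih _ (by omega) hb

/-! ### The iterations of the algorithm -/

/-- The input for the iteration of the block in question; the register 4 has its number. -/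
def blockInput : Cmd :=
  .seq (.assign 6 (.const 0)) <|
  .seq (.assign 12 (.load 4 (.add (.mul (.const 3) (.reg 4)) (.const 1)))) <|
  .seq (.assign 13 (.load 4 (.add (.mul (.const 3) (.reg 4)) (.const 2)))) <|
  .seq (push 6 6 (.load 0 (.const 0))) <|
  .seq (push 6 6 (.reg 2)) <|
  .seq (push 6 6 (.load 2 (.add (.mul (.const 2) (.reg 12)) (.const 3)))) <|
  .seq (push 6 6 (.load 2 (.add (.mul (.const 2) (.reg 13)) (.const 1)))) <|
  .seq (push 6 6 (.mul (.const 2) (.sub (.reg 13) (.reg 12)))) <|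
  .seq (tab 14 6 6 (.mul (.const 2) (.sub (.reg 13) (.reg 12)))
    (.load 2 (.add (.add (.mul (.const 2) (.reg 12)) (.const 2)) (.reg 14))))
  (tab 14 6 6 (.reg 5) (.load 5 (.reg 14)))

/-- The iteration for a block, together with the output for it. -/
def blockStep (c : Cmd) : Cmd :=
  .seq blockInput <|
  .seq (.call (step c) 6 (.reg 6) 5 5) <|
  .seq (push 8 8 (.load 4 (.mul (.const 3) (.reg 4)))) <|
  .seq (.call listMarks 5 (.reg 5) 7 7)
  (tab 14 8 8 (.reg 7) (.load 7 (.reg 14)))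

theorem flat_slice {z : List (ℕ × ℕ)} {a b : ℕ} (hb : b ≤ z.length) :
    flat ((z.take b).drop a) = (List.range (2 * (b - a))).map fun i => nth (flat z) (2 * a + i) :=
        by
  have hl : (flat ((z.take b).drop a)).length = 2 * (b - a) := by
    simp; omega
  conv_lhs => rw [← map_range_nth (flat ((z.take b).drop a)), hl]
  refine List.map_congr_left fun i hi => ?_
  have hi := List.mem_range.mp hi
  have e : flat z = flat (z.take a) ++ (flat ((z.take b).drop a) ++ flat (z.drop b)) := by
    rw [← flat_append, ← flat_append]
    congr 1
    rcases le_or_gt a b with h | h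
    · conv_lhs => rw [← List.take_append_drop b z, ← List.take_append_drop a (z.take b)]
      rw [List.take_take, min_eq_left h, List.append_assoc]
    · omega
  have e2 : (flat (z.take a)).length = 2 * a := by
    simp; omega
  rw [e, ← e2, nth_append_add, nth_append_left (by omega)]

theorem blockInput_wp {X θ U a b i : ℕ} {s : State} {z : List (ℕ × ℕ)} {T : List ℤ}
    (hab : a < b) (hb : b ≤ z.length) (hm0 : s.mem 0 0 = θ) (h2 : Has s 2 (θ :: seg (flat z)))
    (r2 : s.reg 2 = U) (r4 : s.reg 4 = i) (ha : s.mem 4 (3 * i + 1) = a)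
    (hb' : s.mem 4 (3 * i + 2) = b) (h5 : Has s 5 T) (r5 : s.reg 5 = T.length)
    (hθ : θ ≤ X) (hU : U ≤ X) (hz : ∀ x ∈ flat z, x.natAbs ≤ X) (hT : ∀ x ∈ T, x.natAbs ≤ X)
    (hX : 2 * z.length + T.length + 5 ≤ X) :
    wp X blockInput s (200 * (b - a) + 60 * T.length + 500) fun s' =>
      Has s' 6 (stepInput θ U z[a].2 z[b - 1].2 ((z.take b).drop a) T) ∧
      s'.reg 6 = (stepInput θ U z[a].2 z[b - 1].2 ((z.take b).drop a) T).length := by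
  have hm2 : ∀ k < 2 * z.length, s.mem 2 (k + 2) = nth (flat z) k := fun k hk => by
    rw [h2 _ (by simp [seg]; omega)]; rfl
  obtain ⟨-, ha2⟩ := nth_flat (z := z) (i := a) (by omega)
  obtain ⟨-, hb2⟩ := nth_flat (z := z) (i := b - 1) (by omega)
  have hzX := natAbs_nth_le hz
  have e1 : ((3 : ℤ) * (i : ℤ) + 1).toNat = 3 * i + 1 := by omega
  have e2 : ((3 : ℤ) * (i : ℤ) + 2).toNat = 3 * i + 2 := by omega
  have e3 : ((2 : ℤ) * (a : ℤ) + 3).toNat = 2 * a + 1 + 2 := by omega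
  have e4 : ((2 : ℤ) * (b : ℤ) + 1).toNat = 2 * (b - 1) + 1 + 2 := by omega
  have e5 : (2 : ℤ) * ((b : ℤ) - (a : ℤ)) = (2 * (b - a) : ℕ) := by omega
  have hlz : ((z.take b).drop a).length = b - a := by simp; omega
  have hfl : (2 * (b - a) : ℕ) = ((flat ((z.take b).drop a)).length : ℤ) := by
    rw [length_flat, hlz]
  unfold blockInput
  apply wp.le
  · apply wp_seq
    refine wp_set 0 rfl (by simp) ?_
    apply wp_seq
    refine wp_set (a : ℤ) ?_ (by omega) ?_
    · simp only [Expr.eval, setReg_reg, setReg_mem, r4]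
      rw [if_neg (by decide), e1, ha]
    apply wp_seq
    refine wp_set (b : ℤ) ?_ (by omega) ?_
    · simp only [Expr.eval, setReg_reg, setReg_mem, r4]
      rw [if_neg (by decide), if_neg (by decide), e2, hb']
    apply wp_seq
    refine wp_pushv (l := []) (θ : ℤ) (Has.nil _ _) (by simp) (by simp; omega)
      (by simp [Expr.eval, hm0]) (by omega) fun h6 => ?_
    apply wp_seq
    refine wp_pushv (U : ℤ) h6 (by simp) (by simp; omega) (by simp [Expr.eval, r2]) (by omega)
      fun h6 => ?_
    apply wp_seq
    refine wp_pushv (z[a].2 : ℤ) h6 (by simp) (by simp; omega) ?_ (by rw [← ha2]; exact hzX _)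
      fun h6 => ?_
    · simp only [Expr.eval, setReg_reg, setReg_mem, setMem_reg]
      rw [if_neg (by decide), if_neg (by decide), if_neg (by decide), if_pos trivial, e3,
        setMem_mem_ne _ _ _ _ _ (by decide), setReg_mem, setMem_mem_ne _ _ _ _ _ (by decide),
        setReg_mem, setReg_mem, setReg_mem, hm2 _ (by omega), ha2]
    apply wp_seq
    refine wp_pushv (z[b - 1].2 : ℤ) h6 (by simp) (by simp; omega) ?_
      (by rw [← hb2]; exact hzX _) fun h6 => ?_
    · simp only [Expr.eval, setReg_reg, setReg_mem, setMem_reg]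
      rw [if_neg (by decide), if_neg (by decide), if_neg (by decide), if_pos trivial, e4,
        setMem_mem_ne _ _ _ _ _ (by decide), setReg_mem, setMem_mem_ne _ _ _ _ _ (by decide),
        setReg_mem, setMem_mem_ne _ _ _ _ _ (by decide),
        setReg_mem, setReg_mem, setReg_mem, hm2 _ (by omega), hb2]
    apply wp_seq
    refine wp_pushv ((2 * (b - a) : ℕ) : ℤ) h6 (by simp) (by simp; omega) ?_
      (by simp only [Int.natAbs_natCast]; omega) fun h6 => ?_
    · simp only [Expr.eval, setReg_reg, setMem_reg]
      simp [e5]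
    set s1 := State.setReg _ _ _ with hs1
    have q12 : s1.reg 12 = a := by simp [hs1]
    have q13 : s1.reg 13 = b := by simp [hs1]
    have q5 : s1.reg 5 = T.length := by simp [hs1, r5]
    have m2 : s1.mem 2 = s.mem 2 := by simp [hs1, setMem_mem_ne]
    have m5 : s1.mem 5 = s.mem 5 := by simp [hs1, setMem_mem_ne]
    have q6 : s1.reg 6 = (5 : ℕ) := by simp [hs1]
    clear_value s1
    apply wp_seq
    refine wp_tab (2 * (b - a)) (fun i => nth (flat z) (2 * a + i)) (by decide) h6
      (by rw [q6]; simp) (by simp; omega) ?_ ?_ ?_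
    · intro s' hF
      simp only [Expr.eval, hF.reg 12 (by decide), hF.reg 13 (by decide), q12, q13, e5]
    · intro k hk s' hB hF h14
      refine ⟨?_, hzX _⟩
      have e6 : ((2 : ℤ) * (a : ℤ) + 2 + (k : ℤ)).toNat = 2 * a + k + 2 := by omega
      simp only [Expr.eval, hF.reg 12 (by decide), q12, h14, e6, hF.mem 2 (by decide), m2]
      exact hm2 _ (by omega)
    · intro s' hF q6' h6'
      rw [← flat_slice hb] at h6'
      refine wp_tab T.length (nth T) (by decide) h6' ?_ ?_ ?_ ?_ ?_
      · rw [q6']; simp; omega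
      · simp; omega
      · intro s'' hF'
        rw [Expr.eval, hF'.reg 5 (by decide), hF.reg 5 (by decide), q5]
      · intro k hk s'' hB hF' h14
        refine ⟨?_, natAbs_nth_le hT _⟩
        simp only [Expr.eval, h14, Int.toNat_natCast]
        rw [hF'.mem 5 (by decide), hF.mem 5 (by decide), m5, h5 k hk]
      · intro s'' hF' q6'' h6''
        rw [map_range_nth] at h6''
        have e : stepInput θ U z[a].2 z[b - 1].2 ((z.take b).drop a) T =
            [] ++ [(θ : ℤ)] ++ [(U : ℤ)] ++ [(z[a].2 : ℤ)] ++ [(z[b - 1].2 : ℤ)] ++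
              [((2 * (b - a) : ℕ) : ℤ)] ++ flat ((z.take b).drop a) ++ T := by
          rw [hfl]; simp [stepInput, seg]
        rw [e]
        refine ⟨h6'', ?_⟩
        rw [q6'']
        simp; omega
  · simp [Expr.C, Expr.K, Expr.L]; omega

theorem blockStep_wp {c : Cmd} {X θ U a b i m n B : ℕ} {p : ℕ → Prop} {s : State}
    {z : List (ℕ × ℕ)} {T out : List ℤ}
    (hab : a < b) (hb : b ≤ z.length) (hm0 : s.mem 0 0 = θ) (h2 : Has s 2 (θ :: seg (flat z)))
    (r2 : s.reg 2 = U) (r4 : s.reg 4 = i) (hm : s.mem 4 (3 * i) = m) (ha : s.mem 4 (3 * i + 1) = a)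
    (hb' : s.mem 4 (3 * i + 2) = b) (h5 : Has s 5 T) (r5 : s.reg 5 = T.length)
    (h8 : Has s 8 out) (r8 : s.reg 8 = out.length)
    (hθ : θ ≤ X) (hU : U ≤ X) (hz : ∀ x ∈ flat z, x.natAbs ≤ X) (hT : ∀ x ∈ T, x.natAbs ≤ X)
    (hX : 2 * z.length + T.length + 5 ≤ X) (hmX : m ≤ X) (hn : n + 1 ≤ X)
    (hout : out.length + n + 2 ≤ X)
    (hstep : RunsIn (step c) (stepInput θ U z[a].2 z[b - 1].2 ((z.take b).drop a) T)
      (markList n p) (B * lg X)) :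
    wp X (blockStep c) s (B + (210 * (b - a) + 70 * T.length + 200 * n + 1000)) fun s' =>
      Has s' 5 (markList n p) ∧ s'.reg 5 = (markList n p).length ∧
      Has s' 8 (out ++ (m : ℤ) :: members n p) ∧
      s'.reg 8 = (out ++ (m : ℤ) :: members n p).length := by
  have hlz : ((z.take b).drop a).length = b - a := by simp; omega
  have hml := length_members_le n p
  unfold blockStep
  apply wp.le
  · apply wp_seq
    refine (blockInput_wp hab hb hm0 h2 r2 r4 ha hb' h5 r5 hθ hU hz hT hX).imp
      fun s1 _ hF1 ⟨h6, r6⟩ => ?_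
    apply wp_seq
    refine wp_call (b := B) h6 r6 ?_ hstep (markList_bound _ (by omega)) (by simp; omega)
      fun h5' => ?_
    · rw [length_stepInput, hlz]; omega
    set s2 := State.setReg _ _ _ with hs2
    have q4 : s2.reg 4 = i := by
      rw [hs2, setReg_reg, if_neg (by decide), write_reg, hF1.reg 4 (by decide), r4]
    have q8 : s2.reg 8 = out.length := by
      rw [hs2, setReg_reg, if_neg (by decide), write_reg, hF1.reg 8 (by decide), r8]
    have q5 : s2.reg 5 = (markList n p).length := by rw [hs2]; simp
    have m4 : s2.mem 4 = s.mem 4 := by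
      rw [hs2, setReg_mem, write_mem_ne _ _ _ _ (by decide), hF1.mem 4 (by decide)]
    have m8 : s2.mem 8 = s.mem 8 := by
      rw [hs2, setReg_mem, write_mem_ne _ _ _ _ (by decide), hF1.mem 8 (by decide)]
    clear_value s2
    have e1 : ((3 : ℤ) * (i : ℤ)).toNat = 3 * i := by omega
    apply wp_seq
    refine wp_pushv (m : ℤ) (h8.of_mem_eq m8) q8 (by omega) ?_ (by omega) fun h8' => ?_
    · simp only [Expr.eval, q4, e1, m4, hm]
    apply wp_seq
    refine wp_call (b := 60 * n + 80) (l := markList n p) (out := members n p)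
        ?_ ?_ (by simp; omega)
      (listMarks_runs p hn) (members_bound p (by omega)) (by omega) fun h7 => ?_
    · rw [has_setReg]; exact h5'.setMem_ne (by decide)
    · simp only [Expr.eval, setReg_reg, setMem_reg]
      rw [if_neg (by decide), q5]
    set s3 := State.setReg _ 7 _ with hs3
    have u5 : Has s3 5 (markList n p) := by
      rw [hs3, has_setReg]
      refine Has.of_mem_eq ?_ (write_mem_ne _ _ _ _ (by decide))
      rw [has_setReg]; exact h5'.setMem_ne (by decide)
    have u5' : s3.reg 5 = (markList n p).length := by rw [hs3]; simp [q5]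
    have u8 : Has s3 8 (out ++ [(m : ℤ)]) := by
      rw [hs3, has_setReg]
      exact h8'.of_mem_eq (write_mem_ne _ _ _ _ (by decide))
    have u8' : s3.reg 8 = (out.length + 1 : ℕ) := by rw [hs3]; simp
    have u7 : s3.reg 7 = (members n p).length := by rw [hs3]; simp
    clear_value s3
    refine wp_tab (members n p).length (nth (members n p)) (by decide) u8 (by rw [u8']; simp)
      (by simp; omega) ?_ ?_ ?_
    · intro s' hF
      rw [Expr.eval, hF.reg 7 (by decide), u7]
    · intro k hk s' hB hF h14
      refine ⟨?_, natAbs_nth_le (members_bound p (by omega)) _⟩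
      simp only [Expr.eval, h14, Int.toNat_natCast]
      rw [hF.mem 7 (by decide), h7 k hk]
    · intro s' hF v8 v8'
      rw [map_range_nth] at v8'
      refine ⟨u5.of_mem_eq (hF.mem 5 (by decide)), by rw [hF.reg 5 (by decide), u5'], ?_, ?_⟩
      · simpa using v8'
      · rw [v8]; simp; ring
  · rw [length_stepInput, hlz]
    simp [Expr.C, Expr.K, Expr.L]; omega

/-! ### The whole algorithm -/

/-- The first part of the program: compute the sum of all numbers in the list of jobs and the sum
of the processing times, sort the jobs and find the blocks. -/
def prepare : Cmd :=
  .seq (.assign 10 (.div (.reg 0) (.const 2))) <|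
  .seq (push 1 1 (.sub (.reg 10) (.const 1))) <|
  .seq (For 4 (.reg 10)
    (.seq (.assign 2 (.add (.reg 2) (.add (.load 0 (.add (.mul (.const 2) (.reg 4)) (.const 1)))
      (.load 0 (.add (.mul (.const 2) (.reg 4)) (.const 2)))))) <|
    .seq (.assign 3 (.add (.reg 3) (.load 0 (.add (.mul (.const 2) (.reg 4)) (.const 1))))) <|
    .seq (push 1 1 (.const 2)) <|
    .seq (push 1 1 (.load 0 (.add (.mul (.const 2) (.reg 4)) (.const 1))))
      (push 1 1 (.load 0 (.add (.mul (.const 2) (.reg 4)) (.const 2)))))) <|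
  .seq (.call (treeOf mergeJobs) 1 (.reg 1) 2 11) <|
  .seq (.store 2 (.const 0) (.load 0 (.const 0))) (.call plan 2 (.reg 11) 4 9)

/-- The algorithm, for a given program `c` that computes max-min-skewed-convolutions.  Array `2`
has the sorted jobs, array `4` the blocks, array `5` the marks of `T`, and array `8` collects the
output; register `2` has the bound for all numbers, and register `3` the total processing time. -/
def solve (c : Cmd) : Cmd :=
  .seq prepare <|
  .seq (push 5 5 (.const 1)) <|
  .seq (For 4 (.div (.reg 9) (.const 3)) (blockStep c)) <|
  .seq (push 8 8 (.sub (.reg 3) (.load 8 (.sub (.reg 8) (.const 1))))) (ret 8 8)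

/-- The sum of all processing times and due dates. -/
def tot (z : List (ℕ × ℕ)) : ℕ := sm z + (z.map Prod.snd).sum

theorem tot_append (z w : List (ℕ × ℕ)) : tot (z ++ w) = tot z + tot w := by
  simp [tot]; ring

theorem le_tot {z : List (ℕ × ℕ)} {j : ℕ × ℕ} (h : j ∈ z) : sm z + j.2 ≤ tot z := by
  have := List.single_le_sum (l := z.map Prod.snd) (by simp) _ (List.mem_map.mpr ⟨j, h, rfl⟩)
  unfold tot; omega

theorem fst_le_sm {z : List (ℕ × ℕ)} {j : ℕ × ℕ} (h : j ∈ z) : j.1 ≤ sm z :=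
  List.single_le_sum (l := z.map Prod.fst) (by simp) _ (List.mem_map.mpr ⟨j, h, rfl⟩)

theorem length_le_sm {z : List (ℕ × ℕ)} (h : ∀ j ∈ z, 1 ≤ j.1) : z.length ≤ sm z := by
  induction z with
  | nil => simp
  | cons j z ih =>
    have := h j (by simp)
    have := ih fun j hj => h j (by simp [hj])
    simp; omega

theorem prepare_wp {X θ : ℕ} {z : List (ℕ × ℕ)} (hz : z ≠ []) (h1 : ∀ j ∈ z, 1 ≤ j.1)
    (hθ : θ ≤ X) (hX : 6 * tot z + 6 ≤ X) :
    ∃ z' : List (ℕ × ℕ), z'.Perm z ∧ z'.Pairwise (fun x y => x.2 ≤ y.2) ∧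
      ∀ D s due, Grouped z' D s due → wp X prepare (State.init (θ :: flat z))
        (100000 * (z.length * lg X)) fun s' => s'.reg 2 = tot z ∧ s'.reg 3 = sm z ∧
          Has s' 2 (θ :: seg (flat z')) ∧
          Has s' 4 (planOut s
            (blockList (fun k m => preSum z' (s m) - preSum z' (s (k - 1))) θ D).reverse) ∧
          s'.reg 9 = (planOut s
            (blockList (fun k m => preSum z' (s m) - preSum z' (s (k - 1))) θ D).reverse).length :=
                by
  have hn : z.length ≤ sm z := length_le_sm h1
  have hsm : sm z ≤ tot z := Nat.le_add_right _ _
  have hn0 : 1 ≤ z.length := List.length_pos_iff.mpr hz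
  have hjX : ∀ j ∈ z, j.1 ≤ tot z ∧ j.2 ≤ tot z := fun j hj => by
    have := fst_le_sm hj; have := le_tot hj; omega
  have hb : ∀ x ∈ flat z, x.natAbs ≤ X := by
    intro x hx
    obtain ⟨j, hj, rfl | rfl⟩ := mem_flat.mp hx
    · have := hjX j hj; omega
    · have := hjX j hj; omega
  obtain ⟨z', hp, hs', hrun⟩ := sort_runs hz hb (by omega)
  refine ⟨z', hp, hs', fun D s due hg => ?_⟩
  have hl' : z'.length = z.length := hp.length_eq
  have hb' : ∀ x ∈ flat z', x.natAbs ≤ X := by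
    intro x hx
    obtain ⟨j, hj, h⟩ := mem_flat.mp hx
    exact hb x (mem_flat.mpr ⟨j, hp.mem_iff.mp hj, h⟩)
  have hsm' : sm z' = sm z := (hp.map Prod.fst).sum_eq
  have hplan := plan_runs (X := X) (θ := θ) hg hb' hθ (by
    change sm z' ≤ X; omega) (by omega)
  set L := (blockList (fun k m => preSum z' (s m) - preSum z' (s (k - 1))) θ D).reverse with hL
  have hD : D ≤ z.length := by
    have := hg.le_s le_rfl; rw [hg.s_D] at this; omega
  have hLl : L.length ≤ D := by rw [hL, List.length_reverse]; exact length_blockList_le _ _ _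
  have hpl : ∀ x ∈ planOut s L, x.natAbs ≤ X := by
    intro x hx
    obtain ⟨b, hb, hx⟩ := List.mem_flatMap.mp hx
    obtain ⟨b1, b2, b3⟩ := mem_blockList (List.mem_reverse.mp hb)
    have h4 := hg.s_mono (show b.1 - 1 ≤ D by omega) le_rfl
    have h5 := hg.s_mono b3 le_rfl
    rw [hg.s_D] at h4 h5
    simp only [List.mem_cons, List.not_mem_nil, or_false] at hx
    rcases hx with rfl | rfl | rfl <;> omega
  have hm0 : (State.init (θ :: flat z)).mem 0 = nth (θ :: flat z) := init_mem_zero _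
  have hr0 : (State.init (θ :: flat z)).reg 0 = (2 * z.length + 1 : ℕ) := by
    rw [init_reg_zero]; simp
  have hr : ∀ r, r ≠ 0 → (State.init (θ :: flat z)).reg r = 0 := fun r h => init_reg_ne _ h
  set s0 := State.init (θ :: flat z) with hs0
  clear_value s0
  unfold prepare
  apply wp.le
  · apply wp_seq
    refine wp_set (z.length : ℤ) (by simp only [Expr.eval, hr0]; omega) (by omega) ?_
    apply wp_seq
    refine wp_pushv (l := []) (z.length - 1 : ℤ) (Has.nil _ _) (by simp [hr]) (by simp; omega)
      (by simp [Expr.eval]) (by omega) fun g1 => ?_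
    apply wp_seq
    set f : ℕ → List ℤ := fun i => (z.take i).flatMap fun j => [(2 : ℤ), j.1, j.2] with hf
    have hfl : ∀ i ≤ z.length, (f i).length = 3 * i := fun i hi => by
      simp [hf, List.length_flatMap, hi, mul_comm]
    refine wp_for z.length (fun i s' => s'.reg 2 = tot (z.take i) ∧ s'.reg 3 = sm (z.take i) ∧
      Has s' 1 ((z.length - 1 : ℤ) :: f i) ∧ s'.reg 1 = (3 * i + 1 : ℕ)) (fun _ => 300)
      (by simp [Cmd.wregs, push]) (by omega) ?_ ?_ ?_ ?_
    · intro i _ s' hF _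
      rw [Expr.eval, hF.reg 10 (by simp [Cmd.wregs, push])]
      simp
    · simpa [hf, tot, hr] using g1
    · rintro i hi s' hB hF h4 ⟨q2, q3, g1, q1⟩
      have m0 : s'.mem 0 = nth (θ :: flat z) := by
        rw [hF.mem 0 (by simp [Cmd.warrs, push]), setReg_mem,
          setMem_mem_ne _ _ _ _ _ (by decide), setReg_mem, hm0]
      obtain ⟨n1, n2⟩ := nth_flat hi
      have e1 : ((2 : ℤ) * (i : ℤ) + 1).toNat = 2 * i + 1 := by omega
      have e2 : ((2 : ℤ) * (i : ℤ) + 2).toNat = 2 * i + 1 + 1 := by omega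
      have ht : z.take (i + 1) = z.take i ++ [z[i]] := by
        rw [List.take_add_one, List.getElem?_eq_getElem hi]; rfl
      have hle : tot (z.take (i + 1)) ≤ tot z := by
        conv_rhs => rw [← List.take_append_drop (i + 1) z]
        rw [tot_append]; omega
      have hle' : sm (z.take (i + 1)) ≤ tot (z.take (i + 1)) := Nat.le_add_right _ _
      have ht1 : tot (z.take (i + 1)) = tot (z.take i) + (z[i].1 + z[i].2) := by
        rw [ht, tot_append]; simp [tot]
      have ht2 : sm (z.take (i + 1)) = sm (z.take i) + z[i].1 := by
        rw [ht, sm_append]; simp [sm]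
      have hj := hjX _ (List.getElem_mem hi)
      have hfi := hfl i hi.le
      apply wp.le
      · apply wp_seq
        refine wp_set (tot (z.take (i + 1)) : ℤ) ?_ (by omega) ?_
        · simp only [Expr.eval, h4, q2, e1, e2, m0, nth_cons_succ, n1, n2, ht1]; push_cast; ring
        apply wp_seq
        refine wp_set (sm (z.take (i + 1)) : ℤ) ?_ (by omega) ?_
        · simp only [Expr.eval, setReg_reg, setReg_mem]
          rw [if_neg (by decide), if_neg (by decide), h4, e1, m0, nth_cons_succ, n1, q3, ht2]
          simp
        apply wp_seq
        refine wp_pushv (2 : ℤ) g1 (by simp [q1, hfi]) (by simp; omega) rfl (by omega)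
          fun g1 => ?_
        apply wp_seq
        refine wp_pushv (z[i].1 : ℤ) g1 (by simp) (by simp; omega) ?_ (by omega)
          fun g1 => ?_
        · simp only [Expr.eval, setReg_reg, setReg_mem, setMem_reg]
          rw [setMem_mem_ne _ _ _ _ _ (by decide), setReg_mem, setReg_mem, m0]
          simp [h4, e1, n1]
        refine wp_pushv (z[i].2 : ℤ) g1 (by simp; ring) (by simp; omega) ?_ (by omega)
          fun g1 => ⟨by simp, by simp, ?_, by simp [hfi]; ring⟩
        · simp only [Expr.eval, setReg_reg, setReg_mem, setMem_reg]
          rw [setMem_mem_ne _ _ _ _ _ (by decide), setReg_mem,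
            setMem_mem_ne _ _ _ _ _ (by decide), setReg_mem, setReg_mem, m0]
          simp [h4, e2, n2]
        · have : f (i + 1) = f i ++ [(2 : ℤ), (z[i].1 : ℤ), (z[i].2 : ℤ)] := by
            simp only [hf, ht, List.flatMap_append]; simp
          rw [has_setReg, this]
          simpa using g1
      · simp [Expr.C, Expr.K, Expr.L]
    · rintro s' hB hF h4 ⟨q2, q3, g1, q1⟩
      have m0 : s'.mem 0 = nth (θ :: flat z) := by
        rw [hF.mem 0 (by simp [Cmd.warrs, push]), setReg_mem,
          setMem_mem_ne _ _ _ _ _ (by decide), setReg_mem, hm0]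
      simp only [hf, List.take_length] at q2 q3 g1
      have hfn : (z.flatMap fun j => [(2 : ℤ), j.1, j.2]).length = 3 * z.length := by
        have := hfl _ le_rfl; simpa only [hf, List.take_length] using this
      apply wp_seq
      refine wp_call (b := 3 * z.length * 6350 * lg X) (out := 0 :: seg (flat z')) g1 ?_ ?_
        (hrun.le (mul_comm _ _).le) ?_ ?_ fun g2 => ?_
      · rw [Expr.eval, q1, List.length_cons, hfn]
      · rw [List.length_cons, hfn]; omega
      · intro x hx
        rcases List.mem_cons.mp hx with rfl | hx
        · simp
        rcases List.mem_cons.mp hx with rfl | hx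
        · simp; omega
        · exact hb' x hx
      · simp [seg]; omega
      apply wp_seq
      have hv : (Expr.load 0 (.const 0)).eval ((s'.write 2 (0 :: seg (flat z'))).setReg 11
          ((0 :: seg (flat z')).length : ℤ)) = θ := by
        simp only [Expr.eval, setReg_mem]
        rw [write_mem_ne _ _ _ _ (by decide), m0]; rfl
      refine wp_store (fun _ => by rw [hv]; omega) ?_
      rw [hv]
      have g2' : Has _ 2 ([] ++ (θ : ℤ) :: seg (flat z')) := Has.set (l := []) (z := (θ : ℤ)) g2
      refine wp_call (b := 3000 * z'.length + 1000) g2' ?_ ?_ hplan hpl ?_ fun g4 => ?_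
      · simp [Expr.eval, seg]
      · simp [seg]; omega
      · rw [length_planOut]; omega
      refine ⟨?_, ?_, ?_, g4, by simp⟩
      · simpa using q2
      · simpa using q3
      · rw [has_setReg]
        exact g2'.of_mem_eq (write_mem_ne _ _ _ _ (by decide))
  · have hlg := one_le_lg X
    have : z.length ≤ z.length * lg X := Nat.le_mul_of_pos_right _ hlg
    have h5 : 3 * z.length * 6350 * lg X = 19050 * (z.length * lg X) := by ring
    have hfn : (z.flatMap fun j => [(2 : ℤ), j.1, j.2]).length = 3 * z.length := by
      simp [List.length_flatMap, mul_comm]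
    simp only [List.length_cons, hfn, length_planOut, List.nil_append, h5]
    simp [Expr.C, Expr.K, Expr.L, seg]
    omega

/-- The output for the block with end `m`: the number `m` and the total processing times of the
sets of jobs with the due dates `1, …, m` that can be run on time. -/
noncomputable def blockOut (z : List (ℕ × ℕ)) (s : ℕ → ℕ) (m : ℕ) : List ℤ :=
  (m : ℤ) :: members (sm (z.take (s m)) + 1) fun y => Sched (z.take (s m)) y 0

/-- The output of the algorithm, for the list `L` of blocks. -/
noncomputable def solveOut (z : List (ℕ × ℕ)) (s : ℕ → ℕ) (L : List (ℕ × ℕ)) : List ℤ :=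
  (L.flatMap fun b => blockOut z s b.2) ++
    [(sm z : ℤ) - nth (L.flatMap fun b => blockOut z s b.2)
      ((L.flatMap fun b => blockOut z s b.2).length - 1)]

theorem sm_take_le (z : List (ℕ × ℕ)) (i : ℕ) : sm (z.take i) ≤ sm z :=
  sm_le_of_sublist (List.take_sublist _ _)

theorem nth_planOut {s : ℕ → ℕ} {L : List (ℕ × ℕ)} {i : ℕ} (hi : i < L.length) :
    nth (planOut s L) (3 * i) = L[i].2 ∧ nth (planOut s L) (3 * i + 1) = s (L[i].1 - 1) ∧
      nth (planOut s L) (3 * i + 2) = s L[i].2 := by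
  have e : planOut s L = planOut s (L.take i) ++
      ([(L[i].2 : ℤ), (s (L[i].1 - 1) : ℤ), (s L[i].2 : ℤ)] ++ planOut s (L.drop (i + 1))) := by
    conv_lhs => rw [← List.take_append_drop i L, List.drop_eq_getElem_cons hi, planOut_append]
    rfl
  have e2 : (planOut s (L.take i)).length = 3 * i := by simp; omega
  rw [e, ← e2]
  refine ⟨?_, ?_, ?_⟩
  · rw [nth_append_right le_rfl, Nat.sub_self]; rfl
  · rw [nth_append_add]; rfl
  · rw [nth_append_add]; rfl

theorem take_append_slice (z : List (ℕ × ℕ)) {a b : ℕ} (h : a ≤ b) :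
    z.take a ++ (z.take b).drop a = z.take b := by
  conv_rhs => rw [← List.take_append_drop a (z.take b)]
  rw [List.take_take, min_eq_left h]

theorem snd_mono {z : List (ℕ × ℕ)} (hs : z.Pairwise (fun x y => x.2 ≤ y.2)) {i j : ℕ}
    (hij : i ≤ j) (hj : j < z.length) : z[i].2 ≤ z[j].2 := by
  rcases hij.lt_or_eq with h | rfl
  · exact List.pairwise_iff_getElem.mp hs i j (by omega) hj h
  · exact le_rfl

theorem mem_slice {z : List (ℕ × ℕ)} {a b : ℕ} {j : ℕ × ℕ} (h : j ∈ (z.take b).drop a) :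
    ∃ i, ∃ hi : i < z.length, a ≤ i ∧ i < b ∧ j = z[i] := by
  obtain ⟨i, hi, rfl⟩ := List.getElem_of_mem h
  simp only [List.length_drop, List.length_take] at hi
  exact ⟨a + i, by omega, by omega, by omega, by simp⟩

theorem blockOut_length_le (z : List (ℕ × ℕ)) (s : ℕ → ℕ) (m : ℕ) :
    (blockOut z s m).length ≤ sm z + 3 := by
  have := length_members_le (sm (z.take (s m)) + 1) fun y => Sched (z.take (s m)) y 0
  have := sm_take_le z (s m)
  simp only [blockOut, List.length_cons]; omega

/-- The `i`-th iteration leads from the set for the blocks before to the set with this block. -/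
theorem step_runs_block {c : Cmd} {X N H θ D i : ℕ} {z : List (ℕ × ℕ)} {s due : ℕ → ℕ}
    {L : List (ℕ × ℕ)}
    (hc : ∀ x : ConvInput, x.n + 1 ≤ N → (∀ i ≤ x.n, (x.A i).natAbs ≤ 16 * X) →
      (∀ i ≤ x.n, (x.B i).natAbs ≤ 16 * X) → RunsIn c x.input x.output ((x.n + 1) * H))
    (hN : 2 * θ + 1 ≤ N) (h1 : ∀ j ∈ z, 1 ≤ j.1 ∧ 1 ≤ j.2) (hs : z.Pairwise (fun x y => x.2 ≤ y.2))
    (hθ : θ ≤ X) (hX : 20 * (tot z + 2) ≤ X) (hg : Grouped z D s due)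
    (hL : L = (blockList (fun k m => preSum z (s m) - preSum z (s (k - 1))) θ D).reverse)
    (hi : i < L.length) {u w : ℕ} (hu : prevEnd L i = u) (hw : prevEnd L (i + 1) = w) :
    ∃ (hab : s u < s w) (hb : s w ≤ z.length),
      RunsIn (step c) (stepInput θ (tot z) z[s u].2 z[s w - 1].2
        ((z.take (s w)).drop (s u))
        (markList (sm (z.take (s u)) + 1)
          fun y => Sched (z.take (s u)) y 0))
      (markList (sm (z.take (s w)) + 1)
        fun y => Sched (z.take (s w)) y 0)
      (1000000000 * (lg X ^ 3 * ((sm (z.take (s w)) -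
        sm (z.take (s u)) + 1) * (H + 1) + sm z + 1)) * lg X) := by
  have hmem : L[i] ∈ blockList (fun k m => preSum z (s m) - preSum z (s (k - 1))) θ D := by
    have := List.getElem_mem hi
    rw [← List.mem_reverse, ← hL]; exact this
  obtain ⟨b1, b2, b3⟩ := mem_blockList hmem
  have hch : L[i].1 = u + 1 := by
    rw [← hu]; subst hL; exact (blockList_chain _ _ _).1 i hi
  have he2 : w = L[i].2 := hw ▸ prevEnd_succ hi
  have hlt : u < w := by omega
  have hsingle : θ < preSum z (s (w)) - preSum z (s (u)) →
      w = u + 1 := by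
    intro h
    have := blockList_single hmem (by
      rw [hch, ← he2]; exact h)
    omega
  have hw3 : w ≤ D := by omega
  have hab : s u < s w := lt_of_lt_of_le (hg.s_lt u (by omega)) (hg.s_mono (by omega) hw3)
  have hb : s w ≤ z.length := by rw [← hg.s_D]; exact hg.s_mono hw3 le_rfl
  refine ⟨hab, hb, ?_⟩
  have happ := take_append_slice z hab.le
  have hsm : sm ((z.take (s w)).drop (s u)) = sm (z.take (s w)) - sm (z.take (s u)) := by
    have := congrArg sm happ
    rw [sm_append] at this; omega
  have hslice := fun j => mem_slice (z := z) (a := s u) (b := s w) (j := j)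
  have ha' : z[s u] ∈ z := List.getElem_mem _
  have hb' : z[s w - 1] ∈ z := List.getElem_mem _
  have hle := le_tot ha'
  have hle' := le_tot hb'
  have hsw := sm_take_le z (s w)
  have hmono : ∀ {i j : ℕ} (_ : i ≤ j) (hj : j < z.length), z[i].2 ≤ z[j].2 := snd_mono hs
  have hpos := (h1 _ ha').2
  have hrun := step_runs (X := X) (θ := θ) (U := tot z) (dk := z[s u].2) (di := z[s w - 1].2)
    (Z₁ := z.take (s u)) (Z := (z.take (s w)).drop (s u)) hc hN
    (by
      intro h
      have := congrArg List.length h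
      simp at this; omega)
    (fun j hj => by obtain ⟨i, hi, -, -, rfl⟩ := hslice j hj; exact (h1 _ (List.getElem_mem _)).1)
    (fun j hj => by
      obtain ⟨i, hi, -, -, rfl⟩ := hslice j hj
      have := fst_le_sm (List.getElem_mem hi); omega)
    (fun j hj => by
      obtain ⟨i, hi, rfl⟩ := List.getElem_of_mem hj
      simp only [List.length_take] at hi
      rw [List.getElem_take]
      exact hmono (by omega) _)
    (fun j hj => by
      obtain ⟨i, hi, h3, -, rfl⟩ := hslice j hj
      exact hmono h3 hi)
    (fun j hj => by
      obtain ⟨i, hi, -, h3, rfl⟩ := hslice j hj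
      exact hmono (by omega) _)
    (hmono (by omega) _)
    (fun h j hj => by
      rw [hsm] at h
      have hwu := hsingle h
      obtain ⟨i, hi, h3, h4, rfl⟩ := hslice j hj
      subst hwu
      rw [hg.due_eq u (by omega) i hi h3 h4,
        hg.due_eq u (by omega) (s (u + 1) - 1) (by omega) (by omega) (by omega)])
    (by omega) (by rw [hsm]; omega)
    (by
      rw [hsm]
      have := sm_le_of_sublist (List.take_sublist_take_left (l := z) hab.le); omega) hθ hX
  rw [happ, hsm] at hrun
  refine hrun.le (Nat.mul_le_mul_right _ (Nat.mul_le_mul_left _ (Nat.mul_le_mul_left _ ?_)))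
  have := sm_take_le z (s u)
  omega

/-- The program `solve` computes `solveOut` for the sorted list of jobs.  Its cost is dominated by
the skewed convolutions, `H` per unit of processing time in total, and by the treatment of the set
`T`, whose size is at most `sm z + 1`, for each block. -/
theorem solve_runs {c : Cmd} {X N H θ : ℕ} {z : List (ℕ × ℕ)}
    (hc : ∀ x : ConvInput, x.n + 1 ≤ N → (∀ i ≤ x.n, (x.A i).natAbs ≤ 16 * X) →
      (∀ i ≤ x.n, (x.B i).natAbs ≤ 16 * X) → RunsIn c x.input x.output ((x.n + 1) * H))
    (hN : 2 * θ + 1 ≤ N) (hz : z ≠ []) (h1 : ∀ j ∈ z, 1 ≤ j.1 ∧ 1 ≤ j.2) (hθ : θ ≤ X)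
    (hX : 20 * (tot z + 3) ^ 2 ≤ X) :
    ∃ z' : List (ℕ × ℕ), z'.Perm z ∧ z'.Pairwise (fun x y => x.2 ≤ y.2) ∧
      ∀ D s due L, Grouped z' D s due →
        L = (blockList (fun k m => preSum z' (s m) - preSum z' (s (k - 1))) θ D).reverse →
        RunsIn (solve c) (θ :: flat z) (solveOut z' s L)
          (10000000000 * (lg X ^ 3 * (2 * (sm z * (H + 1)) + L.length * (sm z + 1))) * lg X) := by
  have hX1 : 20 * (tot z + 3) ≤ X := le_trans (Nat.mul_le_mul_left _ (Nat.le_self_pow (by omega)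
      _)) hX
  have h1' : ∀ j ∈ z, 1 ≤ j.1 := fun j hj => (h1 j hj).1
  obtain ⟨z', hp, hs', hprep⟩ := prepare_wp hz h1' hθ (by omega)
  refine ⟨z', hp, hs', fun D s due L hg hL => ?_⟩
  have hprep := hprep D s due hg
  rw [← hL] at hprep
  have hl' : z'.length = z.length := hp.length_eq
  have hsm' : sm z' = sm z := (hp.map Prod.fst).sum_eq
  have htot' : tot z' = tot z := by rw [tot, tot, hsm', (hp.map Prod.snd).sum_eq]
  have hmemp : ∀ j ∈ z', j ∈ z := fun j hj => hp.mem_iff.mp hj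
  have hn : z.length ≤ sm z := length_le_sm h1'
  have hn0 : 1 ≤ z.length := List.length_pos_iff.mpr hz
  have hsmt : sm z ≤ tot z := Nat.le_add_right _ _
  have hb : ∀ x ∈ flat z, x.natAbs ≤ tot z := by
    intro x hx
    obtain ⟨j, hj, rfl | rfl⟩ := mem_flat.mp hx
    · have := fst_le_sm hj; omega
    · have := le_tot hj; omega
  have hb' : ∀ x ∈ flat z', x.natAbs ≤ X := by
    intro x hx
    obtain ⟨j, hj, h⟩ := mem_flat.mp hx
    have := hb x (mem_flat.mpr ⟨j, hmemp j hj, h⟩); omega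
  have hD : D ≤ z.length := by
    have := hg.le_s le_rfl; rw [hg.s_D] at this; omega
  have hD0 : 1 ≤ D := by
    by_contra h
    have : D = 0 := by omega
    subst this
    have := hg.s_zero ▸ hg.s_D
    omega
  have hLl : L.length ≤ D := by rw [hL, List.length_reverse]; exact length_blockList_le _ _ _
  have hL0 : 1 ≤ L.length := by
    rw [hL, List.length_reverse]
    obtain ⟨D, rfl⟩ := Nat.exists_eq_add_of_le' hD0
    simp [blockList]
  have hend : prevEnd L L.length = D := by rw [hL]; exact (blockList_chain _ _ _).2
  set O : ℕ → List ℤ := fun i => (L.take i).flatMap fun b => blockOut z' s b.2 with hO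
  have hOs : ∀ i (hi : i < L.length), O (i + 1) = O i ++ blockOut z' s (prevEnd L (i + 1)) := by
    intro i hi
    simp only [hO]
    rw [List.take_add_one, List.getElem?_eq_getElem hi, List.flatMap_append, prevEnd_succ hi]
    simp
  have hOl : ∀ i ≤ L.length, (O i).length ≤ i * (sm z + 3) := by
    intro i
    induction i with
    | zero => intro _; simp [hO]
    | succ i ih =>
      intro hi
      have := ih (by omega)
      have := blockOut_length_le z' s (prevEnd L (i + 1))
      rw [hOs i hi, List.length_append, add_mul]; omega
  have hOb : ∀ i ≤ L.length, (O i).length + (sm z + 3) ≤ X := by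
    intro i hi
    have h := hOl i hi
    have : i * (sm z + 3) ≤ tot z * (tot z + 3) := Nat.mul_le_mul (by omega) (by omega)
    nlinarith
  set G : ℕ → ℕ := fun i => sm (z'.take (s (prevEnd L i))) with hG
  have hGle : ∀ i, G i ≤ sm z := fun i => hsm' ▸ sm_take_le z' _
  -- The loads of the blocks add up to the total processing time.
  have hGsum : ∑ i ∈ Finset.range L.length, (G (i + 1) - G i) = sm z := by
    have hstep : ∀ i < L.length, G i ≤ G (i + 1) := fun i hi => by
      obtain ⟨hab, -, -⟩ := step_runs_block hc hN (fun j hj => h1 j (hmemp j hj)) hs' hθ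
        (by omega) hg hL hi rfl rfl
      exact sm_le_of_sublist (List.take_sublist_take_left hab.le)
    have : ∀ n ≤ L.length, ∑ i ∈ Finset.range n, (G (i + 1) - G i) = G n := by
      intro n
      induction n with
      | zero => intro _; simp [hG, hg.s_zero]
      | succ n ih =>
        intro hn
        have := hstep n hn
        rw [Finset.sum_range_succ, ih (by omega)]; omega
    rw [this _ le_rfl]
    simp only [hG, hend, hg.s_D, List.take_length, hsm']
  have hr : ∀ r, r ≠ 0 → (State.init (θ :: flat z)).reg r = 0 := fun r h => init_reg_ne _ h
  have hm0 : (State.init (θ :: flat z)).mem 0 0 = θ := by rw [init_mem_zero]; rfl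
  refine RunsIn.of_wp (X := X) ?_ (by simp; omega) ?_
  · intro x hx
    rcases List.mem_cons.mp hx with rfl | hx
    · simpa using hθ
    · have := hb x hx; omega
  set s0 := State.init (θ :: flat z) with hs0
  clear_value s0
  set A := lg X ^ 3 * (2 * (sm z * (H + 1)) + L.length * (sm z + 1)) with hA
  have hmark : markList 1 (fun y => Sched [] y 0) = [1] := by
    simp [markList, sched_zero]
  -- An iteration costs a multiple of the load of its block and of the size of the set `T`.
  set B : ℕ → ℕ := fun i => 1000000000 * (lg X ^ 3 * ((G (i + 1) - G i + 1) * (H + 1) + sm z + 1)) +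
    (210 * (sm z) + 70 * (sm z + 1) + 200 * (sm z + 1) + 1000) with hB
  unfold solve
  apply wp.le
  · apply wp_seq
    refine hprep.imp fun s1 _ hF1 ⟨q2, q3, g2, g4, q9⟩ => ?_
    apply wp_seq
    refine wp_pushv (l := []) 1 (Has.nil _ _)
      (by rw [hF1.reg 5 (by decide), hr _ (by decide)]; rfl) (by simp; omega) rfl (by simp; omega)
      fun g5 => ?_
    apply wp_seq
    refine wp_for L.length (fun i s' =>
      Has s' 5 (markList (G i + 1) fun y => Sched (z'.take (s (prevEnd L i))) y 0) ∧
      s'.reg 5 = (G i + 1 : ℕ) ∧ Has s' 8 (O i) ∧ s'.reg 8 = (O i).length) B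
      (by simp [Cmd.wregs, blockStep, blockInput, push, tab, For]) (by omega) ?_ ?_ ?_ ?_
    · intro i _ s' hF _
      simp only [Expr.eval]
      rw [hF.reg 9 (by simp [Cmd.wregs, blockStep, blockInput, push, tab, For])]
      simp [q9]
    · refine ⟨?_, ?_, ?_, ?_⟩
      · simp only [hG, prevEnd_zero, hg.s_zero, List.take_zero, sm_nil, zero_add, hmark]
        simpa using g5
      · simp [hG, hg.s_zero]
      · simp only [hO, List.take_zero, List.flatMap_nil]; exact Has.nil _ _
      · rw [setReg_reg, if_neg (by decide), setReg_reg, if_neg (by decide), setMem_reg,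
          hF1.reg 8 (by decide), hr _ (by decide)]
        simp [hO]
    · rintro i hi s' hBs hF h4 ⟨g5', q5, g8, q8⟩
      obtain ⟨hab, hbl, hrun⟩ := step_runs_block hc hN (fun j hj => h1 j (hmemp j hj)) hs' hθ
        (by omega) hg hL hi rfl rfl
      obtain ⟨n1, n2, n3⟩ := nth_planOut (s := s) hi
      have hch : L[i].1 = prevEnd L i + 1 := by
        subst hL; exact (blockList_chain _ _ _).1 i hi
      have he2 : prevEnd L (i + 1) = L[i].2 := prevEnd_succ hi
      have hF2 : Fr [4, 5, 6, 7, 8, 12, 13, 14] [5, 6, 7, 8] s1 s' := by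
        refine Fr.trans (s₂ := (s1.setMem 5 ([] : List ℤ).length 1).setReg 5
          ((([] : List ℤ).length + 1 : ℕ) : ℤ)) ⟨fun r hr => ?_, fun a ha => ?_⟩ (hF.mono ?_ ?_)
        · simp only [List.mem_cons, not_or] at hr
          simp [hr]
        · simp only [List.mem_cons, not_or] at ha
          rw [setReg_mem, setMem_mem_ne _ _ _ _ _ ha.1]
        · simp [Cmd.wregs, blockStep, blockInput, push, tab, For]
        · simp [Cmd.warrs, blockStep, blockInput, push, tab, For]
      have hpl : ∀ k, k < 3 * L.length → s'.mem 4 k = nth (planOut s L) k := fun k hk => by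
        rw [hF2.mem 4 (by decide)]; exact g4 k (by rw [length_planOut]; exact hk)
      have hGi := hGle i
      have hGi' := hGle (i + 1)
      have hOi := hOb i hi.le
      have hwD : prevEnd L (i + 1) ≤ D := by
        have := List.getElem_mem hi
        rw [he2]
        simp only [hL] at this ⊢
        exact (mem_blockList (List.mem_reverse.mp this)).2.2
      apply wp.le
      · refine (blockStep_wp (X := X) (θ := θ) (U := tot z') (i := i) (m := prevEnd L (i + 1))
          (n := G (i + 1) + 1) (p := fun y => Sched (z'.take (s (prevEnd L (i + 1)))) y 0) hab hbl
          ?_ (g2.of_mem_eq (hF2.mem 2 (by decide))) ?_ h4 ?_ ?_ ?_ g5' ?_ g8 q8 hθ (by omega)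
          hb' (markList_bound _ (by omega)) ?_ (by omega) (by omega) (by omega) hrun).imp
          fun s2 _ _ ⟨v5, w5, v8, w8⟩ => ⟨?_, ?_, ?_, ?_⟩
        · rw [hF2.mem 0 (by decide), hF1.mem 0 (by decide), hm0]
        · rw [hF2.reg 2 (by decide), q2, htot']
        · rw [hpl _ (by omega), n1, he2]
        · rw [hpl _ (by omega), n2, hch]; rfl
        · rw [hpl _ (by omega), n3, he2]
        · rw [q5, length_markList]
        · rw [length_markList]; omega
        · rw [has_setReg]; exact v5
        · rw [setReg_reg, if_neg (by decide), w5, length_markList]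
        · rw [has_setReg, hOs i hi]; exact v8
        · rw [setReg_reg, if_neg (by decide), w8, hOs i hi]; rfl
      · simp only [hB, hsm', length_markList]
        have h6 : s (prevEnd L (i + 1)) - s (prevEnd L i) ≤ sm z := by omega
        rw [show sm (z'.take (s (prevEnd L (i + 1)))) = G (i + 1) from rfl,
          show sm (z'.take (s (prevEnd L i))) = G i from rfl]
        omega
    · rintro s' hBs hF h4 ⟨g5', q5, g8, q8⟩
      have hO0 : 1 ≤ (O L.length).length := by
        obtain ⟨R, hR⟩ := Nat.exists_eq_add_of_le' hL0
        rw [hR, hOs R (by omega)]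
        simp only [blockOut, List.length_append, List.length_cons]; omega
      have hob := hOb L.length le_rfl
      have q3' : s'.reg 3 = sm z := by
        rw [hF.reg 3 (by simp [Cmd.wregs, blockStep, blockInput, push, tab, For])]
        simpa using q3
      have hlast : (nth (O L.length) ((O L.length).length - 1)).natAbs ≤ tot z + 1 := by
        refine natAbs_nth_le (fun x hx => ?_) _
        obtain ⟨b, hbL, hx⟩ := List.mem_flatMap.mp hx
        have hbL := List.mem_of_mem_take hbL
        have hb3 : b.2 ≤ D := by
          rw [hL] at hbL; exact (mem_blockList (List.mem_reverse.mp hbL)).2.2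
        rcases List.mem_cons.mp hx with rfl | hx
        · simp only [Int.natAbs_natCast]; omega
        · refine members_bound _ ?_ _ hx
          have := sm_take_le z' (s b.2)
          omega
      have eO : O L.length = L.flatMap fun b => blockOut z' s b.2 := by simp [hO]
      apply wp_seq
      refine wp_pushv ((sm z : ℤ) - nth (O L.length) ((O L.length).length - 1)) g8 q8 (by omega)
        ?_ (by omega) fun g8' => ?_
      · simp only [Expr.eval, q3', q8]
        rw [show (((O L.length).length : ℤ) - 1).toNat = (O L.length).length - 1 by omega,
          g8 _ (by omega)]
      refine (wp_ret g8' (by simp) (by simp; omega) fun s'' h => ?_).le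
        (b' := 4 * (L.length * (sm z + 3) + 1) + 4) ?_
      · rw [h, solveOut, eO, hsm']
      · have := hOl _ (le_refl L.length)
        simp; omega
  · have hlg := one_le_lg X
    set W := 2 * (sm z * (H + 1)) + L.length * (sm z + 1) with hW
    have hAW : W ≤ A := Nat.le_mul_of_pos_left _ (by positivity)
    have h2 : ∑ i ∈ Finset.range L.length, ((G (i + 1) - G i + 1) * (H + 1) + sm z + 1) ≤ W := by
      have e : ∑ i ∈ Finset.range L.length, ((G (i + 1) - G i + 1) * (H + 1) + sm z + 1) =
          (sm z + L.length) * (H + 1) + L.length * (sm z + 1) := by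
        simp only [add_assoc, Finset.sum_add_distrib, ← Finset.sum_mul, hGsum, Finset.sum_const,
          Finset.card_range, smul_eq_mul]
        ring
      rw [e, hW]
      have : (sm z + L.length) * (H + 1) ≤ (2 * sm z) * (H + 1) :=
        Nat.mul_le_mul_right _ (by omega)
      rw [mul_assoc] at this
      omega
    have h3 : ∑ i ∈ Finset.range L.length, B i ≤ 1000000000 * A +
        L.length * (480 * sm z + 1270) := by
      simp only [hB, Finset.sum_add_distrib, ← Finset.mul_sum, Finset.sum_const, Finset.card_range,
        smul_eq_mul]
      refine Nat.add_le_add (Nat.mul_le_mul_left _ (Nat.mul_le_mul_left _ ?_)) (le_of_eq (by ring))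
      rw [← hW]
      simpa only [add_assoc, Finset.sum_add_distrib, Finset.sum_const, Finset.card_range,
        smul_eq_mul] using h2
    have h4 : L.length * (480 * sm z + 1270) ≤ 1270 * (L.length * (sm z + 1)) := by
      rw [mul_left_comm]; exact Nat.mul_le_mul_left _ (by omega)
    have h5 : L.length * (sm z + 3) ≤ 3 * (L.length * (sm z + 1)) := by
      rw [mul_left_comm]; exact Nat.mul_le_mul_left _ (by omega)
    have h6 : z.length * lg X ≤ A := by
      have : sm z ≤ sm z * (H + 1) := Nat.le_mul_of_pos_right _ (by omega)
      rw [mul_comm]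
      exact Nat.mul_le_mul (Nat.le_self_pow (by omega) _) (by omega)
    have h7 : L.length ≤ L.length * (sm z + 1) := Nat.le_mul_of_pos_right _ (by omega)
    simp [Expr.C, Expr.K, Expr.L]
    omega

end RAM

namespace Instance

open RAM

variable (J : Instance)

/-! ### Schedules of sets of jobs -/

/-- The earliest-due-date rule: a set of jobs can be run on time from `t` on if and only if for each
of its jobs all jobs that are due no later than this job can be completed until its due date. -/
theorem feasibleFrom_iff {Z : Finset (Fin J.n)} {t : ℕ} :
    J.FeasibleFrom Z t ↔ ∀ j ∈ Z, t + ∑ i ∈ Z.filter (fun i => J.e i ≤ J.e j), J.p i ≤ J.e j := by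
  constructor
  · rintro ⟨σ, h⟩ j hj
    obtain ⟨k, hk, hmax⟩ := Finset.exists_max_image (Z.filter fun i => J.e i ≤ J.e j) σ
      ⟨j, by simp [hj]⟩
    obtain ⟨hkZ, hkj⟩ := Finset.mem_filter.mp hk
    refine le_trans ?_ ((h k hkZ).trans hkj)
    refine Nat.add_le_add_left (Finset.sum_le_sum_of_subset fun i hi => ?_) _
    exact Finset.mem_filter.mpr ⟨(Finset.mem_filter.mp hi).1, hmax i hi⟩
  · intro h
    refine ⟨(Tuple.sort J.e)⁻¹, fun j hj => le_trans ?_ (h j hj)⟩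
    refine Nat.add_le_add_left (Finset.sum_le_sum_of_subset fun i hi => ?_) _
    obtain ⟨h1, h2⟩ := Finset.mem_filter.mp hi
    refine Finset.mem_filter.mpr ⟨h1, ?_⟩
    have := Tuple.monotone_sort J.e h2
    simpa using this

/-- A list of jobs sorted by due dates is run on time if and only if for each of its jobs all jobs
that are due no later than this job are completed until its due date. -/
theorem onTime_iff {W : List (ℕ × ℕ)} (hs : W.Pairwise fun x y => x.2 ≤ y.2) {t : ℕ} :
    OnTime W t ↔ ∀ j ∈ W, t + sm (W.filter fun i => i.2 ≤ j.2) ≤ j.2 := by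
  induction W generalizing t with
  | nil => simp [OnTime]
  | cons a W ih =>
    obtain ⟨h1, h2⟩ := List.pairwise_cons.mp hs
    have ha : sm ((a :: W).filter fun i => i.2 ≤ a.2) = a.1 + sm (W.filter fun i => i.2 ≤ a.2) := by
      simp
    have hj : ∀ j ∈ W, sm ((a :: W).filter fun i => i.2 ≤ j.2) =
        a.1 + sm (W.filter fun i => i.2 ≤ j.2) := fun j hj => by simp [h1 j hj]
    rw [OnTime, ih h2]
    constructor
    · rintro ⟨h3, h4⟩ j hjW
      have key : ∀ j ∈ W, t + sm ((a :: W).filter fun i => i.2 ≤ j.2) ≤ j.2 := fun j hjW => by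
        have := h4 j hjW
        rw [hj j hjW]; omega
      rcases List.mem_cons.mp hjW with rfl | hjW
      · by_cases hex : ∃ k ∈ W, k.2 ≤ j.2
        · obtain ⟨k, hk, hkj⟩ := hex
          have e : k.2 = j.2 := le_antisymm hkj (h1 k hk)
          have := key k hk
          rwa [e] at this
        · push Not at hex
          rw [ha, List.filter_eq_nil_iff.mpr (by simpa using hex)]
          simpa using h3
      · exact key j hjW
    · intro h
      refine ⟨?_, fun j hjW => ?_⟩
      · have := h a (by simp)
        rw [ha] at this; omega
      · have := h j (by simp [hjW])
        rw [hj j hjW] at this; omega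

/-- The processing time and the due date of a job. -/
def job (j : Fin J.n) : ℕ × ℕ := (J.p j, J.e j)

theorem sm_map_job {ids : List (Fin J.n)} (h : ids.Nodup) :
    sm (ids.map J.job) = ∑ j ∈ ids.toFinset, J.p j := by
  rw [List.sum_toFinset _ h, sm, List.map_map]; rfl

theorem sched_map_job_iff {ids : List (Fin J.n)} (hn : ids.Nodup)
    (hs : ids.Pairwise fun i j => J.e i ≤ J.e j) {x t : ℕ} :
    Sched (ids.map J.job) x t ↔
      ∃ Z ⊆ ids.toFinset, ∑ j ∈ Z, J.p j = x ∧ J.FeasibleFrom Z t := by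
  have key : ∀ W : List (Fin J.n), W.Nodup → W.Pairwise (fun i j => J.e i ≤ J.e j) →
      (OnTime (W.map J.job) t ↔ J.FeasibleFrom W.toFinset t) := by
    intro W hW hWs
    rw [onTime_iff (List.pairwise_map.mpr hWs), feasibleFrom_iff]
    simp only [List.forall_mem_map, List.mem_toFinset]
    refine forall₂_congr fun j _ => ?_
    have : (W.map J.job).filter (fun i => i.2 ≤ (J.job j).2) =
        (W.filter fun i => J.e i ≤ J.e j).map J.job := by
      rw [List.filter_map]; rfl
    rw [this, J.sm_map_job (hW.filter _), List.toFinset_filter]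
    simp [job]
  constructor
  · rintro ⟨_, h1', rfl, h3⟩
    obtain ⟨W, h1, rfl⟩ := List.sublist_map_iff.mp h1'
    have hW := hn.sublist h1
    refine ⟨W.toFinset, fun j hj => List.mem_toFinset.mpr (h1.subset (List.mem_toFinset.mp hj)),
      (J.sm_map_job hW).symm, (key W hW (hs.sublist h1)).mp h3⟩
  · rintro ⟨Z, h1, rfl, h3⟩
    have hsub : (ids.filter (· ∈ Z)).Sublist ids := List.filter_sublist
    have e : (ids.filter (· ∈ Z)).toFinset = Z := by
      ext j
      simp only [List.mem_toFinset, List.mem_filter, decide_eq_true_eq]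
      exact ⟨fun h => h.2, fun h => ⟨List.mem_toFinset.mp (h1 h), h⟩⟩
    refine ⟨(ids.filter (· ∈ Z)).map J.job, hsub.map _, ?_, ?_⟩
    · rw [J.sm_map_job (hn.sublist hsub), e]
    · rw [key _ (hn.sublist hsub) (hs.sublist hsub), e]; exact h3

/-! ### Due dates -/

theorem d_zero : J.d 0 = 0 := rfl

theorem mem_dueDates {x : ℕ} : x ∈ J.dueDates ↔ ∃ j, J.e j = x := by
  simp [dueDates]

theorem d_lt {k m : ℕ} (hkm : k < m) (hm : m ≤ J.numDue) : J.d k < J.d m := by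
  have hs : J.dueDates.SortedLT := Finset.sortedLT_sort _
  have hm' : m - 1 < J.dueDates.length := by have : J.numDue = J.dueDates.length := rfl; omega
  have e : ∀ i, i ≠ 0 → ∀ h : i - 1 < J.dueDates.length, J.d i = J.dueDates[i - 1] := by
    intro i hi h
    simp [d, hi, h]
  rw [e m (by omega) hm']
  rcases Nat.eq_zero_or_pos k with rfl | hk
  · obtain ⟨j, hj⟩ := J.mem_dueDates.mp (List.getElem_mem hm')
    rw [d_zero, ← hj]; exact J.e_pos j
  · rw [e k (by omega) (by omega)]
    exact List.pairwise_iff_getElem.mp hs.pairwise _ _ _ _ (by omega)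

theorem d_le {k m : ℕ} (hkm : k ≤ m) (hm : m ≤ J.numDue) : J.d k ≤ J.d m := by
  rcases hkm.lt_or_eq with h | rfl
  · exact (J.d_lt h hm).le
  · exact le_rfl

theorem exists_e_eq {m : ℕ} (h1 : 1 ≤ m) (hm : m ≤ J.numDue) : ∃ j, J.e j = J.d m := by
  have hm' : m - 1 < J.dueDates.length := by have : J.numDue = J.dueDates.length := rfl; omega
  obtain ⟨j, hj⟩ := J.mem_dueDates.mp (List.getElem_mem hm')
  refine ⟨j, ?_⟩
  rw [hj]
  simp [d, show m ≠ 0 by omega, hm']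

theorem exists_d_eq (j : Fin J.n) : ∃ k, 1 ≤ k ∧ k ≤ J.numDue ∧ J.e j = J.d k := by
  obtain ⟨i, hi, h⟩ := List.getElem_of_mem (J.mem_dueDates.mpr ⟨j, rfl⟩)
  refine ⟨i + 1, by omega, hi, ?_⟩
  rw [← h]
  simp [d, hi]

theorem e_le (j : Fin J.n) : J.e j ≤ J.d J.numDue := by
  obtain ⟨k, -, h2, h3⟩ := J.exists_d_eq j
  rw [h3]; exact J.d_le h2 le_rfl

theorem mem_jobsIn {k m : ℕ} (hk : 1 ≤ k) (hkm : k ≤ m) (hm : m ≤ J.numDue) {j : Fin J.n} :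
    j ∈ J.jobsIn k m ↔ J.d (k - 1) < J.e j ∧ J.e j ≤ J.d m := by
  simp only [jobsIn, Finset.mem_filter, Finset.mem_univ, true_and, Finset.mem_Icc]
  constructor
  · rintro ⟨i, ⟨h1, h2⟩, h3⟩
    rw [h3]
    exact ⟨J.d_lt (by omega) (by omega), J.d_le h2 hm⟩
  · rintro ⟨h1, h2⟩
    obtain ⟨i, hi1, hi2, hi3⟩ := J.exists_d_eq j
    refine ⟨i, ⟨?_, ?_⟩, hi3⟩
    · by_contra h
      have := J.d_le (show i ≤ k - 1 by omega) (by omega)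
      omega
    · by_contra h
      have := J.d_lt (show m < i by omega) hi2
      omega

/-! ### The sorted list of jobs -/

/-- The list of all jobs. -/
def jobs : List (ℕ × ℕ) := List.ofFn J.job

theorem encode_eq : J.encode = flat J.jobs := by
  simp only [encode, jobs, flat, List.flatMap_def, List.map_ofFn]
  rfl

/-- A list of all jobs that is sorted by due dates. -/
structure SortedJobs (ids : List (Fin J.n)) : Prop where
  nodup : ids.Nodup
  mem : ∀ j, j ∈ ids
  sorted : ids.Pairwise fun i j => J.e i ≤ J.e j

theorem exists_sortedJobs {z : List (ℕ × ℕ)} (hz : z.Perm J.jobs)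
    (hs : z.Pairwise fun x y => x.2 ≤ y.2) : ∃ ids, J.SortedJobs ids ∧ z = ids.map J.job := by
  have h : z.Perm ((List.finRange J.n).map J.job) := by
    rwa [← List.ofFn_eq_map]
  obtain ⟨ids, h1, h2⟩ :=
    (congrFun (congrFun (List.eq_map_comp_perm J.job) z) (List.finRange J.n)).mpr h
  refine ⟨ids, ⟨h2.nodup_iff.mpr (List.nodup_finRange _), fun j =>
    h2.mem_iff.mpr (List.mem_finRange j), ?_⟩, h1⟩
  rw [h1, List.pairwise_map] at hs
  exact hs

/-- The jobs with the due dates `1, …, m`. -/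
def upTo (m : ℕ) : Finset (Fin J.n) := Finset.univ.filter fun j => J.e j ≤ J.d m

theorem take_drop_filter {ids : List (Fin J.n)} (hs : ids.Pairwise fun i j => J.e i ≤ J.e j)
    (x : ℕ) : ids.take (ids.filter (J.e · ≤ x)).length = ids.filter (J.e · ≤ x) ∧
      ids.drop (ids.filter (J.e · ≤ x)).length = ids.filter (x < J.e ·) := by
  induction ids with
  | nil => simp
  | cons a ids ih =>
    obtain ⟨h1, h2⟩ := List.pairwise_cons.mp hs
    by_cases h : J.e a ≤ x
    · obtain ⟨h3, h4⟩ := ih h2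
      simp [h, h3, h4]
    · have h5 : ∀ j ∈ ids, x < J.e j := fun j hj => by have := h1 j hj; omega
      have e : (a :: ids).filter (J.e · ≤ x) = [] := by
        rw [List.filter_eq_nil_iff]
        intro j hj
        rcases List.mem_cons.mp hj with rfl | hj
        · simpa using h
        · simpa using h5 j hj
      rw [e]
      refine ⟨rfl, ?_⟩
      rw [List.length_nil, List.drop_zero, eq_comm, List.filter_eq_self]
      intro j hj
      rcases List.mem_cons.mp hj with rfl | hj
      · simpa using h
      · simpa using h5 j hj

end Instance

namespace Instance

open RAM

variable (J : Instance)

/-- The position in the sorted list of jobs after those with the due dates `1, …, m`. -/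
def pos (m : ℕ) : ℕ := (J.upTo m).card

theorem pos_zero : J.pos 0 = 0 := by
  rw [pos, Finset.card_eq_zero, upTo, Finset.filter_eq_empty_iff]
  intro j _
  have := J.e_pos j
  simp [d_zero]; omega

namespace SortedJobs

variable {J} {ids : List (Fin J.n)}

theorem length_filter (h : J.SortedJobs ids) (m : ℕ) : (ids.filter (J.e · ≤ J.d m)).length =
    J.pos m := by
  rw [← List.toFinset_card_of_nodup (h.nodup.filter _), List.toFinset_filter, pos, upTo]
  congr 1
  ext j
  simp [h.mem j]

theorem take_pos (h : J.SortedJobs ids) (m : ℕ) : ids.take (J.pos m) = ids.filter (J.e · ≤ J.d m)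
    := by
  rw [← h.length_filter]; exact (J.take_drop_filter h.sorted _).1

theorem slice_pos (h : J.SortedJobs ids) {k m : ℕ} (hkm : J.d k ≤ J.d m) :
    (ids.take (J.pos m)).drop (J.pos k) = ids.filter (fun j => J.d k < J.e j ∧ J.e j ≤ J.d m) := by
  have h1 := J.take_drop_filter (h.sorted.filter (J.e · ≤ J.d m)) (J.d k)
  have e : (ids.filter (J.e · ≤ J.d m)).filter (J.e · ≤ J.d k) = ids.filter (J.e · ≤ J.d k) := by
    rw [List.filter_filter]
    refine List.filter_congr fun j _ => ?_
    by_cases h2 : J.e j ≤ J.d k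
    · simp [h2, h2.trans hkm]
    · simp [h2]
  rw [e, h.length_filter] at h1
  rw [h.take_pos, h1.2, List.filter_filter]
  refine List.filter_congr fun j _ => ?_
  simp

theorem grouped (h : J.SortedJobs ids) : Grouped (ids.map J.job) J.numDue J.pos J.d where
  s_zero := J.pos_zero
  s_D := by
    rw [← h.length_filter, List.length_map, List.filter_eq_self.mpr]
    intro j _
    simpa using J.e_le j
  s_lt m hm := by
    refine Finset.card_lt_card ((Finset.ssubset_iff_of_subset ?_).mpr ?_)
    · intro j hj
      simp only [upTo, Finset.mem_filter, Finset.mem_univ, true_and] at hj ⊢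
      exact hj.trans (J.d_le (by omega) hm)
    · obtain ⟨j, hj⟩ := J.exists_e_eq (m := m + 1) (by omega) hm
      have := J.d_lt (show m < m + 1 by omega) hm
      exact ⟨j, by simp [upTo, hj], by simp [upTo, hj]; omega⟩
  due_zero := J.d_zero
  due_lt m hm := J.d_lt (by omega) hm
  due_eq m hm i hi h1 h2 := by
    rw [List.length_map] at hi
    have hslice := h.slice_pos (k := m) (m := m + 1) (J.d_le (by omega) hm)
    have hmem : ids[i] ∈ (ids.take (J.pos (m + 1))).drop (J.pos m) := by
      rw [List.mem_iff_getElem]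
      refine ⟨i - J.pos m, by simp; omega, ?_⟩
      simp only [List.getElem_drop, List.getElem_take]
      congr 1; omega
    rw [hslice, List.mem_filter] at hmem
    have hj := (J.mem_jobsIn (k := m + 1) (m := m + 1) (by omega) le_rfl hm (j := ids[i])).mpr
      (by simpa using hmem.2)
    simp only [jobsIn, Finset.mem_filter, Finset.Icc_self, Finset.mem_singleton,
        exists_eq_left] at hj
    simpa [job] using hj.2

theorem preSum_pos (h : J.SortedJobs ids) (m : ℕ) : preSum (ids.map J.job) (J.pos m) =
    ∑ j ∈ J.upTo m, J.p j := by
  change sm ((ids.map J.job).take (J.pos m)) = _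
  rw [← List.map_take, h.take_pos, J.sm_map_job (h.nodup.filter _)]
  congr 1
  ext j
  simp [upTo, h.mem j]

theorem load_eq (h : J.SortedJobs ids) {k m : ℕ} (hk : 1 ≤ k) (hkm : k ≤ m) (hm : m ≤ J.numDue) :
    J.load k m = preSum (ids.map J.job) (J.pos m) - preSum (ids.map J.job) (J.pos (k - 1)) := by
  rw [h.preSum_pos, h.preSum_pos]
  have hsub : J.upTo (k - 1) ⊆ J.upTo m := fun j hj => by
    simp only [upTo, Finset.mem_filter, Finset.mem_univ, true_and] at hj ⊢
    exact hj.trans (J.d_le (by omega) hm)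
  have e : J.jobsIn k m = J.upTo m \ J.upTo (k - 1) := by
    ext j
    rw [J.mem_jobsIn hk hkm hm]
    simp [upTo, and_comm]
  have := Finset.sum_sdiff (f := J.p) hsub
  rw [load, e]; omega

theorem sm_slice (h : J.SortedJobs ids) {k m : ℕ} (hk : 1 ≤ k) (hkm : k ≤ m) (hm : m ≤ J.numDue) :
    sm (((ids.map J.job).take (J.pos m)).drop (J.pos (k - 1))) = J.load k m := by
  rw [← List.map_take, ← List.map_drop, h.slice_pos (J.d_le (by omega) hm),
    J.sm_map_job (h.nodup.filter _), load]
  congr 1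
  ext j
  rw [J.mem_jobsIn hk hkm hm]
  simp [h.mem j]

theorem sched_slice_iff (h : J.SortedJobs ids) {k m : ℕ} (hk : 1 ≤ k) (hkm : k ≤ m)
    (hm : m ≤ J.numDue) {x t : ℕ} :
    Sched (((ids.map J.job).take (J.pos m)).drop (J.pos (k - 1))) x t ↔
      ∃ Z ⊆ J.jobsIn k m, ∑ j ∈ Z, J.p j = x ∧ J.FeasibleFrom Z t := by
  rw [← List.map_take, ← List.map_drop, h.slice_pos (J.d_le (by omega) hm),
    J.sched_map_job_iff (h.nodup.filter _) (h.sorted.filter _)]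
  have : (ids.filter fun j => J.d (k - 1) < J.e j ∧ J.e j ≤ J.d m).toFinset = J.jobsIn k m := by
    ext j
    rw [J.mem_jobsIn hk hkm hm]
    simp [h.mem j]
  rw [this]

theorem sched_take_iff (h : J.SortedJobs ids) {m x t : ℕ} :
    Sched ((ids.map J.job).take (J.pos m)) x t ↔
      ∃ Z ⊆ J.upTo m, ∑ j ∈ Z, J.p j = x ∧ J.FeasibleFrom Z t := by
  rw [← List.map_take, h.take_pos, J.sched_map_job_iff (h.nodup.filter _) (h.sorted.filter _)]
  have : (ids.filter (J.e · ≤ J.d m)).toFinset = J.upTo m := by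
    ext j
    simp [upTo, h.mem j]
  rw [this]

theorem take_pos_le (h : J.SortedJobs ids) {m : ℕ} : ∀ j ∈ (ids.map J.job).take (J.pos m),
    j.2 ≤ J.d m := by
  rw [← List.map_take, h.take_pos]
  intro j hj
  obtain ⟨i, hi, rfl⟩ := List.mem_map.mp hj
  simpa [job] using (List.mem_filter.mp hi).2

theorem slice_due (h : J.SortedJobs ids) {k m : ℕ} (hk : 1 ≤ k) (hkm : k ≤ m) (hm : m ≤ J.numDue) :
    ∀ j ∈ ((ids.map J.job).take (J.pos m)).drop (J.pos (k - 1)), J.d k ≤ j.2 ∧ j.2 ≤ J.d m := by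
  rw [← List.map_take, ← List.map_drop, h.slice_pos (J.d_le (by omega) hm)]
  intro j hj
  obtain ⟨i, hi, rfl⟩ := List.mem_map.mp hj
  have h1 := (List.mem_filter.mp hi).2
  have h2 : i ∈ J.jobsIn k m := by rw [J.mem_jobsIn hk hkm hm]; simpa using h1
  simp only [jobsIn, Finset.mem_filter, Finset.mem_univ, true_and, Finset.mem_Icc] at h2
  obtain ⟨l, ⟨h3, h4⟩, h5⟩ := h2
  simp only [job, h5]
  exact ⟨J.d_le h3 (by omega), J.d_le h4 hm⟩

/-! ### The iterations on sets of numbers -/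

/-- The entries of `M(I)` in terms of schedules in the order of due dates. -/
theorem le_M_iff (h : J.SortedJobs ids) {k m : ℕ} (hk : 1 ≤ k) (hkm : k ≤ m) (hm : m ≤ J.numDue)
    {x t : ℕ} :
    (t : EReal) ≤ J.M k m x ↔
      Sched (((ids.map J.job).take (J.pos m)).drop (J.pos (k - 1))) x t := by
  set Z := ((ids.map J.job).take (J.pos m)).drop (J.pos (k - 1)) with hZ
  have hM : J.M k m x = sSup ((fun t : ℕ => (t : EReal)) '' {t | Sched Z x t}) := by
    unfold M
    simp only [hZ, h.sched_slice_iff hk hkm hm]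
  rw [hM]
  constructor
  · intro hle
    by_contra hns
    have hlt : ∀ t', Sched Z x t' → t' < t := fun t' ht' => by
      by_contra h'
      exact hns (ht'.anti (not_lt.mp h'))
    rcases t with _ | t
    · have : {t | Sched Z x t} = ∅ := by
        ext t'
        simp only [Set.mem_ofPred_eq, Set.mem_empty_iff_false, iff_false]
        intro h'; have := hlt t' h'; omega
      rw [this, Set.image_empty, sSup_empty] at hle
      exact absurd hle (by simp)
    · have : sSup ((fun t : ℕ => (t : EReal)) '' {t | Sched Z x t}) ≤ (t : EReal) := by
        refine sSup_le ?_
        rintro _ ⟨t', ht', rfl⟩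
        have := hlt t' ht'
        have h2 : t' ≤ t := by omega
        change (t' : EReal) ≤ t
        exact_mod_cast h2
      have := hle.trans this
      have : t + 1 ≤ t := by exact_mod_cast this
      omega
  · intro hs
    exact le_sSup ⟨t, hs, rfl⟩

end SortedJobs

end Instance

namespace Instance

open RAM

variable (J : Instance)

open Classical in
/-- The total processing times of the sets of jobs with the due dates `1, …, m` that can be run
without tardy jobs. -/
noncomputable def reach (m : ℕ) : Finset ℕ :=
  (Finset.range (∑ j ∈ J.upTo m, J.p j + 1)).filter fun y =>
  ∃ Z ⊆ J.upTo m, ∑ j ∈ Z, J.p j = y ∧ J.FeasibleFrom Z 0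

theorem mem_reach {m y : ℕ} :
    y ∈ J.reach m ↔ ∃ Z ⊆ J.upTo m, ∑ j ∈ Z, J.p j = y ∧ J.FeasibleFrom Z 0 := by
  simp only [reach, Finset.mem_filter, Finset.mem_range]
  refine ⟨fun h => h.2, fun h => ⟨?_, h⟩⟩
  obtain ⟨Z, h1, rfl, -⟩ := h
  exact Nat.lt_succ_of_le (Finset.sum_le_sum_of_subset h1)

namespace SortedJobs

variable {J} {ids : List (Fin J.n)}

theorem mem_reach_iff (h : J.SortedJobs ids) {m y : ℕ} :
    y ∈ J.reach m ↔ Sched ((ids.map J.job).take (J.pos m)) y 0 := by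
  rw [h.sched_take_iff, J.mem_reach]

theorem reach_zero (h : J.SortedJobs ids) : J.reach 0 = {0} := by
  ext y
  rw [h.mem_reach_iff, J.pos_zero, List.take_zero, Finset.mem_singleton]
  constructor
  · rintro ⟨W, h1, rfl, -⟩
    rw [List.sublist_nil.mp h1]; rfl
  · rintro rfl
    exact sched_zero _ _

theorem pos_mono (h : J.SortedJobs ids) {k m : ℕ} (hkm : k ≤ m) (hm : m ≤ J.numDue) :
    J.pos k ≤ J.pos m := h.grouped.s_mono hkm hm

theorem mem_reach_append (h : J.SortedJobs ids) {k m : ℕ} (hkm : k ≤ m)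
    (hm : m ≤ J.numDue) {y : ℕ} :
    y ∈ J.reach m ↔ ∃ x s, x + s = y ∧ x ∈ J.reach (k - 1) ∧
      Sched (((ids.map J.job).take (J.pos m)).drop (J.pos (k - 1))) s x := by
  rw [h.mem_reach_iff]
  conv_lhs => rw [← take_append_slice _ (h.pos_mono (show k - 1 ≤ m by omega) hm), sched_append]
  simp only [zero_add, h.mem_reach_iff]

theorem le_d_of_mem_reach (h : J.SortedJobs ids) {m y : ℕ} (hy : y ∈ J.reach m) : y ≤ J.d m := by
  have := (h.mem_reach_iff.mp hy).le_due h.take_pos_le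
  omega

/-- The iteration for a red due date is correct. -/
theorem redStep_reach (h : J.SortedJobs ids) {m : ℕ} (h1 : 1 ≤ m) (hm : m ≤ J.numDue) :
    J.redStep m (J.reach (m - 1)) = J.reach m := by
  ext y
  rw [h.mem_reach_append (le_refl m) hm, redStep, Finset.mem_filter, Finset.mem_add]
  set Z := ((ids.map J.job).take (J.pos m)).drop (J.pos (m - 1)) with hZ
  have hdue : ∀ j ∈ Z, J.d m ≤ j.2 ∧ j.2 ≤ J.d m := h.slice_due h1 le_rfl hm
  have hsub : ∀ s, s ∈ J.subsetSums m ↔ ∃ W ⊆ J.jobsIn m m, ∑ j ∈ W, J.p j = s := by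
    simp [subsetSums]
  constructor
  · rintro ⟨⟨x, hx, s, hs, rfl⟩, hy⟩
    refine ⟨x, s, rfl, hx, ?_⟩
    obtain ⟨W, hW, rfl⟩ := (hsub s).mp hs
    rw [hZ, h.sched_slice_iff h1 le_rfl hm]
    refine ⟨W, hW, rfl, J.feasibleFrom_iff.mpr fun j hj => ?_⟩
    have hj' := hW hj
    simp only [jobsIn, Finset.mem_filter, Finset.mem_univ, true_and, Finset.Icc_self,
      Finset.mem_singleton, exists_eq_left] at hj'
    rw [hj']
    have : ∑ i ∈ W.filter (fun i => J.e i ≤ J.d m), J.p i ≤ ∑ j ∈ W, J.p j :=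
      Finset.sum_le_sum_of_subset (Finset.filter_subset _ _)
    omega
  · rintro ⟨x, s, rfl, hx, hs⟩
    have h2 := h.le_d_of_mem_reach hx
    have h3 := J.d_le (show m - 1 ≤ m by omega) hm
    have h4 := hs.le_due fun j hj => (hdue j hj).2
    rw [hZ, h.sched_slice_iff h1 le_rfl hm] at hs
    obtain ⟨W, hW, h5, -⟩ := hs
    exact ⟨⟨x, hx, s, (hsub s).mpr ⟨W, hW, h5⟩, rfl⟩, by omega⟩

/-- The iteration for a bundle is correct. -/
theorem bundleStep_reach (h : J.SortedJobs ids) {k m : ℕ} (hk : 1 ≤ k) (hkm : k ≤ m)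
    (hm : m ≤ J.numDue) : J.bundleStep k m (J.reach (k - 1)) = J.reach m := by
  have hM : ∀ x t : ℕ, (t : EReal) ≤ J.M k m x ↔ _ := fun x t => h.le_M_iff hk hkm hm
  have happ := fun y => h.mem_reach_append hkm hm (y := y)
  have hdue := h.slice_due hk hkm hm
  have hsm := h.sm_slice hk hkm hm
  set Z := ((ids.map J.job).take (J.pos m)).drop (J.pos (k - 1)) with hZ
  have hlt : ∀ x ∈ J.reach (k - 1), x < J.d k := fun x hx =>
    lt_of_le_of_lt (h.le_d_of_mem_reach hx) (J.d_lt (by omega) (by omega))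
  have hbot : ∀ x, J.M k m x ≠ ⊥ ↔ Sched Z x 0 := by
    intro x
    rw [← hM]
    constructor
    · intro hne
      by_contra hlt'
      have h0 : ∀ t : ℕ, ¬ Sched Z x t := fun t ht => hlt' ((hM x 0).mpr (ht.anti (Nat.zero_le _)))
      apply hne
      unfold M
      have : {t | ∃ W ⊆ J.jobsIn k m, ∑ j ∈ W, J.p j = x ∧ J.FeasibleFrom W t} = ∅ := by
        ext t
        simp only [Set.mem_ofPred_eq, Set.mem_empty_iff_false, iff_false]
        rw [← h.sched_slice_iff hk hkm hm]
        exact h0 t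
      rw [this, Set.image_empty, sSup_empty]
    · intro hle hb
      rw [hb] at hle
      simp at hle
  set T := J.reach (k - 1) with hT
  set t : ℤ := (J.d k : ℤ) - J.load k m with ht
  have hC : ∀ y, (Finset.range (y + 1)).sup (fun x => min
      ((fun x => if x < J.d k ∧ x ∈ suff T t then 0 else ⊥ : ℕ → EReal) x)
        (J.M k m (y - x) - (x : EReal))) = 0 ↔
      ∃ x ≤ y, x ∈ T ∧ t < x ∧ Sched Z (y - x) x := by
    intro y
    have hterm : ∀ x, min ((fun x => if x < J.d k ∧ x ∈ suff T t then 0 else ⊥ : ℕ → EReal) x)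
        (J.M k m (y - x) - (x : EReal)) = 0 ↔ x ∈ T ∧ t < x ∧ Sched Z (y - x) x := by
      intro x
      have hsub : 0 ≤ J.M k m (y - x) - (x : EReal) ↔ Sched Z (y - x) x := by
        rw [EReal.sub_nonneg (.inr (EReal.natCast_ne_top x)) (.inr (EReal.natCast_ne_bot x)), hM]
      rw [← hsub]
      by_cases hc : x < J.d k ∧ x ∈ suff T t
      · have hc2 := Finset.mem_filter.mp hc.2
        simp only [if_pos hc, min_eq_left_iff, hc2, true_and]
      · have hc' : ¬ (x ∈ T ∧ t < x) := fun h' => hc ⟨hlt x h'.1, Finset.mem_filter.mpr h'⟩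
        simp only [if_neg hc, min_eq_left bot_le]
        constructor
        · intro h'; exact absurd h' (by simp)
        · rintro ⟨h1, h2, -⟩; exact absurd ⟨h1, h2⟩ hc'
    have hle0 : ∀ x, min ((fun x => if x < J.d k ∧ x ∈ suff T t then 0 else ⊥ : ℕ → EReal) x)
        (J.M k m (y - x) - (x : EReal)) ≤ 0 := by
      intro x
      refine (min_le_left _ _).trans ?_
      simp only
      split_ifs <;> simp
    constructor
    · intro h0
      obtain ⟨x, hx, he⟩ := Finset.exists_mem_eq_sup (Finset.range (y + 1)) ⟨0, by simp⟩
        (fun x => min ((fun x => if x < J.d k ∧ x ∈ suff T t then 0 else ⊥ : ℕ → EReal) x)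
          (J.M k m (y - x) - (x : EReal)))
      rw [h0] at he
      exact ⟨x, Nat.le_of_lt_succ (Finset.mem_range.mp hx), (hterm x).mp he.symm⟩
    · rintro ⟨x, hx, h'⟩
      refine le_antisymm (Finset.sup_le fun x _ => hle0 x) ?_
      refine ((hterm x).mpr h').ge.trans ?_
      exact Finset.le_sup (b := x) (f := fun x => min
        ((fun x => if x < J.d k ∧ x ∈ suff T t then 0 else ⊥ : ℕ → EReal) x)
          (J.M k m (y - x) - (x : EReal))) (Finset.mem_range.mpr (by omega))
  ext y
  rw [happ]
  unfold bundleStep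
  simp only [← ht]
  rw [Finset.mem_filter, Finset.mem_union, Finset.mem_filter, hC, Finset.mem_range]
  have hT1 : (y ∈ if 0 ≤ t then T ∪ (pref T t +
      (Finset.range (J.load k m + 1)).filter fun x => J.M k m x ≠ ⊥) else T) ↔
      y ∈ T ∨ ∃ x s, x + s = y ∧ x ∈ T ∧ (x : ℤ) ≤ t ∧ Sched Z s 0 := by
    have e : ∀ s, s ∈ (Finset.range (J.load k m + 1)).filter (fun x => J.M k m x ≠ ⊥) ↔
        Sched Z s 0 := by
      intro s
      rw [Finset.mem_filter, hbot, Finset.mem_range]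
      refine ⟨fun h' => h'.2, fun h' => ⟨?_, h'⟩⟩
      have := h'.le_sm; omega
    split_ifs with h0
    · rw [Finset.mem_union, Finset.mem_add]
      refine or_congr Iff.rfl ⟨?_, ?_⟩
      · rintro ⟨x, hx, s, hs, h'⟩
        obtain ⟨h2, h3⟩ := Finset.mem_filter.mp hx
        exact ⟨x, s, h', h2, h3, (e s).mp hs⟩
      · rintro ⟨x, s, h', h2, h3, h4⟩
        exact ⟨x, Finset.mem_filter.mpr ⟨h2, h3⟩, s, (e s).mpr h4, h'⟩
    · refine ⟨.inl, ?_⟩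
      rintro (h' | ⟨x, s, -, -, h', -⟩)
      · exact h'
      · omega
  rw [hT1]
  constructor
  · rintro ⟨(h' | ⟨x, s, rfl, hx, hxt, hs⟩) | ⟨-, x, hxy, hx, -, hs⟩, -⟩
    · exact ⟨y, 0, rfl, h', sched_zero _ _⟩
    · refine ⟨x, s, rfl, hx, hs.of_le fun j hj => ?_⟩
      have := (hdue j hj).1
      omega
    · exact ⟨x, y - x, by omega, hx, hs⟩
  · rintro ⟨x, s, rfl, hx, hs⟩
    have h2 := hlt x hx
    have h3 := hs.le_sm
    have h4 := hs.le_due fun j hj => (hdue j hj).2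
    have h5 := J.d_le hkm hm
    refine ⟨?_, by omega⟩
    rcases le_or_gt (x : ℤ) t with h6 | h6
    · exact .inl (.inr ⟨x, s, rfl, hx, h6, hs.anti (Nat.zero_le _)⟩)
    · exact .inr ⟨by omega, x, by omega, hx, h6, by rwa [Nat.add_sub_cancel_left]⟩

end SortedJobs

end Instance

namespace RAM

/-! ### Bundles and blocks -/

/-- A block cannot be extended by the due date before it. -/
theorem lt_ld_blockStart (ld : ℕ → ℕ → ℕ) (θ m : ℕ) : ∀ k, blockStart ld θ m k ≤ 1 ∨
    θ < ld (blockStart ld θ m k - 1) m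
  | 0 => Or.inl (by simp [blockStart])
  | 1 => Or.inl (by simp [blockStart])
  | k + 2 => by
    unfold blockStart
    split_ifs with h
    · exact lt_ld_blockStart ld θ m (k + 1)
    · exact Or.inr (by simpa using h)

theorem blockList_fst {ld : ℕ → ℕ → ℕ} {θ m : ℕ} {b : ℕ × ℕ} (hb : b ∈ blockList ld θ m) :
    b.1 = blockStart ld θ b.2 b.2 := by
  induction m using Nat.strong_induction_on with
  | _ m ih =>
    rcases m with _ | m
    · simp [blockList] at hb
    · have h2 := blockStart_le ld θ (m + 1) (m + 1)
      have h1 := one_le_blockStart ld θ (m + 1) (m + 1) (by omega)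
      rw [blockList] at hb
      rcases List.mem_cons.mp hb with rfl | hb
      · rfl
      · exact ih _ (by omega) hb

theorem blockList_snd_pairwise (ld : ℕ → ℕ → ℕ) (θ m : ℕ) :
    (blockList ld θ m).Pairwise fun x y => y.2 < x.2 := by
  induction m using Nat.strong_induction_on with
  | _ m ih =>
    rcases m with _ | m
    · simp [blockList]
    · have h2 := blockStart_le ld θ (m + 1) (m + 1)
      have h1 := one_le_blockStart ld θ (m + 1) (m + 1) (by omega)
      rw [blockList, List.pairwise_cons]
      refine ⟨fun b hb => ?_, ih _ (by omega)⟩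
      have := (mem_blockList hb).2.2
      simp only; omega

/-- Every due date belongs to a block. -/
theorem exists_mem_blockList (ld : ℕ → ℕ → ℕ) (θ m : ℕ) {i : ℕ} (h1 : 1 ≤ i) (hi : i ≤ m) :
    ∃ b ∈ blockList ld θ m, b.1 ≤ i ∧ i ≤ b.2 := by
  induction m using Nat.strong_induction_on with
  | _ m ih =>
    rcases m with _ | m
    · omega
    · have h2 := blockStart_le ld θ (m + 1) (m + 1)
      have h3 := one_le_blockStart ld θ (m + 1) (m + 1) (by omega)
      rw [blockList]
      rcases le_or_gt (blockStart ld θ (m + 1) (m + 1)) i with h | h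
      · exact ⟨_, List.mem_cons_self, h, hi⟩
      · obtain ⟨b, hb, h4⟩ := ih (blockStart ld θ (m + 1) (m + 1) - 1) (by omega) (by omega)
        exact ⟨b, List.mem_cons_of_mem _ hb, h4⟩

end RAM

namespace Instance

open RAM

variable (J : Instance)

/-- The threshold for the colouring. -/
noncomputable def threshold (δ : ℝ) : ℕ := ⌊(J.P : ℝ) ^ (1 - δ)⌋₊

theorem red_iff_threshold {δ : ℝ} {k : ℕ} : J.Red δ k ↔ J.threshold δ < J.load k k :=
  (Nat.floor_lt (by positivity)).symm

theorem le_threshold_iff {δ : ℝ} {x : ℕ} : x ≤ J.threshold δ ↔ (x : ℝ) ≤ (J.P : ℝ) ^ (1 - δ) :=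
  Nat.le_floor_iff (by positivity)

theorem load_anti {k k' m m' : ℕ} (hk : k' ≤ k) (hm : m ≤ m') : J.load k m ≤ J.load k' m' := by
  refine Finset.sum_le_sum_of_subset fun j hj => ?_
  simp only [jobsIn, Finset.mem_filter, Finset.mem_univ, true_and, Finset.mem_Icc] at hj ⊢
  obtain ⟨i, hi, he⟩ := hj
  exact ⟨i, by omega, he⟩

/-- The loads in terms of a sorted list of all jobs. -/
def ldOf (ids : List (Fin J.n)) (k m : ℕ) : ℕ :=
  preSum (ids.map J.job) (J.pos m) - preSum (ids.map J.job) (J.pos (k - 1))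

/-- The blocks of due dates in increasing order: the bundles and the single red due dates. -/
noncomputable def blocks (δ : ℝ) (ids : List (Fin J.n)) : List (ℕ × ℕ) :=
  (blockList (J.ldOf ids) (J.threshold δ) J.numDue).reverse

namespace SortedJobs

variable {J} {ids : List (Fin J.n)} {δ : ℝ}

open Classical in
/-- The greedy choice of the start of a block, which looks at loads only, agrees with the
definition of bundles: loads are monotone, so a bundle within the threshold contains no red due
date. -/
theorem blockStart_eq (h : J.SortedJobs ids) {m : ℕ} (h1 : 1 ≤ m) (hm : m ≤ J.numDue) :
    blockStart (J.ldOf ids) (J.threshold δ) m m = if J.Red δ m then m else J.bundleStart δ m := by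
  have hld : ∀ k, 1 ≤ k → k ≤ m → J.ldOf ids k m = J.load k m := fun k hk hkm =>
    (h.load_eq hk hkm hm).symm
  set k := blockStart (J.ldOf ids) (J.threshold δ) m m with hk
  have hkm : k ≤ m := blockStart_le _ _ _ _
  have hk1 : 1 ≤ k := one_le_blockStart _ _ _ _ h1
  have hup : k = m ∨ J.load k m ≤ J.threshold δ := by
    have := ld_blockStart (J.ldOf ids) (J.threshold δ) m m
    rwa [← hk, hld k hk1 hkm] at this
  have hlow : ∀ i, 1 ≤ i → i < k → J.threshold δ < J.load i m := by
    intro i hi hik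
    have := lt_ld_blockStart (J.ldOf ids) (J.threshold δ) m m
    rw [← hk, hld (k - 1) (by omega) (by omega)] at this
    have h2 := J.load_anti (show i ≤ k - 1 by omega) (le_refl m)
    omega
  split_ifs with hr
  · rw [red_iff_threshold] at hr
    rcases hup with h2 | h2
    · exact h2
    · have := J.load_anti hkm (le_refl m)
      omega
  · have hup' : J.load k m ≤ J.threshold δ := by
      rcases hup with h2 | h2
      · rw [red_iff_threshold, not_lt] at hr
        rwa [h2]
      · exact h2
    refine le_antisymm (le_csInf ?_ ?_) (Nat.sInf_le ?_)
    · refine ⟨k, hk1, hkm, fun i hi => ?_, J.le_threshold_iff.mp hup'⟩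
      rw [red_iff_threshold, not_lt]
      have := Finset.mem_Icc.mp hi
      exact (J.load_anti this.1 this.2).trans hup'
    · rintro i ⟨hi1, -, -, hi4⟩
      by_contra hik
      have := hlow i hi1 (by omega)
      have := J.le_threshold_iff.mpr hi4
      omega
    · refine ⟨hk1, hkm, fun i hi => ?_, J.le_threshold_iff.mp hup'⟩
      rw [red_iff_threshold, not_lt]
      have := Finset.mem_Icc.mp hi
      exact (J.load_anti this.1 this.2).trans hup'

open Classical in
theorem bundlesUpTo_eq (h : J.SortedJobs ids) {m : ℕ} (hm : m ≤ J.numDue) :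
    J.bundlesUpTo δ m =
      (blockList (J.ldOf ids) (J.threshold δ) m).filter fun b => ¬ J.Red δ b.2 := by
  induction m using Nat.strong_induction_on with
  | _ m ih =>
    rcases m with _ | m
    · simp [bundlesUpTo, blockList]
    · have h1 := h.blockStart_eq (δ := δ) (m := m + 1) (by omega) hm
      have h2 := blockStart_le (J.ldOf ids) (J.threshold δ) (m + 1) (m + 1)
      have h3 := one_le_blockStart (J.ldOf ids) (J.threshold δ) (m + 1) (m + 1) (by omega)
      rw [bundlesUpTo, blockList]
      rw [h1] at h2 h3 ⊢
      split_ifs at h2 h3 ⊢ with hr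
      · rw [ih m (by omega) (by omega), List.filter_cons, if_neg (by simpa using hr)]
        rfl
      · rw [ih _ (by omega) (by omega), List.filter_cons, if_pos (by simpa using hr)]

theorem mem_blocks {b : ℕ × ℕ} (hb : b ∈ J.blocks δ ids) :
    b ∈ blockList (J.ldOf ids) (J.threshold δ) J.numDue := List.mem_reverse.mp hb

theorem active_iff (h : J.SortedJobs ids) {i : ℕ} (h1 : 1 ≤ i) (hi : i ≤ J.numDue) :
    J.Active δ i ↔ ∃ b ∈ J.blocks δ ids, b.2 = i := by
  classical
  have hbun : ∀ b, b ∈ J.bundles δ ↔ b ∈ J.blocks δ ids ∧ ¬ J.Red δ b.2 := by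
    intro b
    rw [bundles, h.bundlesUpTo_eq le_rfl, List.mem_filter, blocks, List.mem_reverse]
    simp
  constructor
  · rintro (hr | hb)
    · obtain ⟨b, hb, h2, h3⟩ := exists_mem_blockList (J.ldOf ids) (J.threshold δ) J.numDue h1 hi
      obtain ⟨h4, h5, h6⟩ := mem_blockList hb
      have hs := blockList_single hb (by
        rw [show J.ldOf ids b.1 b.2 = J.load b.1 b.2 from (h.load_eq h4 h5 h6).symm]
        exact lt_of_lt_of_le (J.red_iff_threshold.mp hr) (J.load_anti h2 h3))
      exact ⟨b, List.mem_reverse.mpr hb, by omega⟩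
    · exact ⟨_, ((hbun _).mp hb).1, rfl⟩
  · rintro ⟨b, hb, rfl⟩
    by_cases hr : J.Red δ b.2
    · exact .inl hr
    · right
      rw [hbun]
      refine ⟨?_, hr⟩
      have h2 := blockList_fst (mem_blocks hb)
      rw [h.blockStart_eq h1 hi, if_neg hr] at h2
      rw [← h2]; exact hb

theorem solveT_of_not_active {i : ℕ} (hi : ¬ J.Active δ (i + 1)) :
    J.solveT δ (i + 1) = J.solveT δ i := by
  simp only [Active, not_or] at hi
  rw [solveT, if_neg hi.1, if_neg hi.2]

/-- After the last iteration for a block the set `T` consists of the total processing times of all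
feasible sets of jobs with due dates up to the end of the block. -/
theorem solveT_prevEnd (h : J.SortedJobs ids) {i : ℕ} (hi : i ≤ (J.blocks δ ids).length) :
    J.solveT δ (prevEnd (J.blocks δ ids) i) = J.reach (prevEnd (J.blocks δ ids) i) := by
  classical
  obtain ⟨hch, -⟩ := blockList_chain (J.ldOf ids) (J.threshold δ) J.numDue
  change ∀ i (hi : i < (J.blocks δ ids).length),
    (J.blocks δ ids)[i].1 = prevEnd (J.blocks δ ids) i + 1 at hch
  have hpw : (J.blocks δ ids).Pairwise fun x y => x.2 < y.2 :=
    List.pairwise_reverse.mpr (blockList_snd_pairwise _ _ _)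
  induction i with
  | zero => rw [prevEnd_zero, h.reach_zero]; rfl
  | succ i ih =>
    have hi' : i < (J.blocks δ ids).length := hi
    have ih := ih hi'.le
    have hmem := List.getElem_mem hi'
    obtain ⟨h1, h2, h3⟩ := mem_blockList (mem_blocks hmem)
    have hc := hch i hi'
    have he : prevEnd (J.blocks δ ids) (i + 1) = (J.blocks δ ids)[i].2 := prevEnd_succ hi'
    have hnext : ∀ b ∈ J.blocks δ ids, b.2 < (J.blocks δ ids)[i].2 →
        b.2 ≤ prevEnd (J.blocks δ ids) i := by
      intro b hb hlt
      obtain ⟨i', hi2, rfl⟩ := List.getElem_of_mem hb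
      have hii : i' < i := by
        by_contra hge
        rcases (not_lt.mp hge).lt_or_eq with hgt | rfl
        · have := List.pairwise_iff_getElem.mp hpw i i' hi' hi2 hgt; omega
        · omega
      obtain ⟨q, rfl⟩ : ∃ q, i = q + 1 := ⟨i - 1, by omega⟩
      rw [prevEnd_succ (by omega)]
      rcases (Nat.le_of_lt_succ hii).lt_or_eq with hlt' | rfl
      · exact (List.pairwise_iff_getElem.mp hpw i' q hi2 (by omega) hlt').le
      · exact le_rfl
    rw [he]
    set b := (J.blocks δ ids)[i] with hb
    set a := prevEnd (J.blocks δ ids) i with ha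
    have hconst : ∀ m, a ≤ m → m < b.2 → J.solveT δ m = J.reach a := by
      intro m ham
      induction m, ham using Nat.le_induction with
      | base => intro _; exact ih
      | succ m ham ihm =>
        intro hmb
        rw [solveT_of_not_active, ihm (by omega)]
        rw [h.active_iff (by omega) (by omega)]
        rintro ⟨b', hb', hb2⟩
        have := hnext b' hb' (by omega)
        omega
    obtain ⟨m, hm⟩ : ∃ m, b.2 = m + 1 := ⟨b.2 - 1, by omega⟩
    have hT := hconst m (by omega) (by omega)
    have hfst := blockList_fst (mem_blocks hmem)
    rw [h.blockStart_eq (by omega) h3, hm] at hfst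
    rw [hm, solveT, hT]
    split_ifs with hr hbun
    · rw [if_pos hr] at hfst
      have e : a = (m + 1) - 1 := by omega
      rw [e]
      exact h.redStep_reach (by omega) (by omega)
    · rw [if_neg hr] at hfst
      have e : a = J.bundleStart δ (m + 1) - 1 := by omega
      rw [e]
      exact h.bundleStep_reach (by omega) (by omega) (by omega)
    · exfalso
      have hact : J.Active δ (m + 1) := by
        rw [h.active_iff (by omega) (by omega)]
        exact ⟨b, hmem, hm⟩
      rcases hact with h' | h'
      · exact hr h'
      · exact hbun h'

theorem solveT_end (h : J.SortedJobs ids) {b : ℕ × ℕ} (hb : b ∈ J.blocks δ ids) :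
    J.solveT δ b.2 = J.reach b.2 := by
  obtain ⟨i, hi, rfl⟩ := List.getElem_of_mem hb
  have := h.solveT_prevEnd (δ := δ) (i := i + 1) hi
  rwa [prevEnd_succ hi] at this

theorem solveT_numDue (h : J.SortedJobs ids) : J.solveT δ J.numDue = J.reach J.numDue := by
  have h1 := h.solveT_prevEnd (δ := δ) le_rfl
  rwa [show prevEnd (J.blocks δ ids) (J.blocks δ ids).length = J.numDue from
    (blockList_chain _ _ _).2] at h1

theorem filter_active (h : J.SortedJobs ids) [DecidablePred fun i => J.Active δ i] :
    (List.range' 1 J.numDue).filter (fun i => J.Active δ i) = (J.blocks δ ids).map Prod.snd := by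
  have hpw : ((J.blocks δ ids).map Prod.snd).Pairwise (· < ·) :=
    List.pairwise_map.mpr (List.pairwise_reverse.mpr (blockList_snd_pairwise _ _ _))
  have hpw' : ((List.range' 1 J.numDue).filter (fun i => J.Active δ i)).Pairwise (· < ·) :=
    List.Pairwise.filter _ List.pairwise_lt_range'
  refine List.Perm.eq_of_pairwise (fun a b _ _ h1 h2 => absurd h1 (lt_asymm h2)) hpw' hpw ?_
  rw [List.perm_ext_iff_of_nodup (hpw'.imp fun h => ne_of_lt h) (hpw.imp fun h => ne_of_lt h)]
  intro i
  rw [List.mem_filter, List.mem_map, List.mem_range'_1, decide_eq_true_eq]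
  constructor
  · rintro ⟨⟨h1, h2⟩, h3⟩
    exact (h.active_iff h1 (by omega)).mp h3
  · rintro ⟨b, hb, rfl⟩
    obtain ⟨h1, h2, h3⟩ := mem_blockList (mem_blocks hb)
    exact ⟨⟨by omega, by omega⟩, (h.active_iff (by omega) h3).mpr ⟨b, hb, rfl⟩⟩

end SortedJobs

end Instance

namespace Instance

open RAM

variable (J : Instance)

/-! ### The output of the algorithm -/

theorem sort_filter_range (n : ℕ) (p : ℕ → Prop) [DecidablePred p] :
    ((Finset.range n).filter p).sort (· ≤ ·) = (List.range n).filter p := by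
  have h1 : ((List.range n).filter p).Pairwise (· < ·) := List.pairwise_lt_range.filter _
  refine List.Perm.eq_of_pairwise (fun a b _ _ h1 h2 => absurd h1 (lt_asymm h2))
    (Finset.sortedLT_sort _).pairwise h1 ?_
  rw [List.perm_ext_iff_of_nodup (Finset.sort_nodup _ _) (h1.imp fun h => ne_of_lt h)]
  intro i
  simp

namespace SortedJobs

variable {J} {ids : List (Fin J.n)} {δ : ℝ}

theorem blockOut_eq (h : J.SortedJobs ids) (m : ℕ) :
    blockOut (ids.map J.job) J.pos m = (m : ℤ) :: ((J.reach m).card : ℤ) ::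
      ((J.reach m).sort (· ≤ ·)).map (fun x : ℕ => (x : ℤ)) := by
  have e : sm ((ids.map J.job).take (J.pos m)) = ∑ j ∈ J.upTo m, J.p j := h.preSum_pos m
  have e2 : ∀ y, Sched ((ids.map J.job).take (J.pos m)) y 0 ↔
      ∃ Z ⊆ J.upTo m, ∑ j ∈ Z, J.p j = y ∧ J.FeasibleFrom Z 0 := fun y => h.sched_take_iff
  rw [← Finset.length_sort (s := J.reach m) (r := (· ≤ ·)), blockOut, e,
    funext fun y => propext (e2 y), reach, sort_filter_range, members, seg, List.length_map]
  congr!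

theorem sum_p (h : J.SortedJobs ids) : sm (ids.map J.job) = J.P := by
  rw [J.sm_map_job h.nodup, P]
  congr 1
  ext j
  simp [h.mem j]

theorem zero_mem_reach (h : J.SortedJobs ids) (m : ℕ) : 0 ∈ J.reach m :=
  h.mem_reach_iff.mpr (sched_zero _ _)

theorem numDue_pos : 1 ≤ J.numDue := by
  obtain ⟨k, h1, h2, -⟩ := J.exists_d_eq ⟨0, J.n_pos⟩
  omega

/-- The last number of the last list of elements is the maximum of the set `T`. -/
theorem last_eq (h : J.SortedJobs ids) {l : List ℤ}
    (hl : l = (J.blocks δ ids).flatMap fun b => blockOut (ids.map J.job) J.pos b.2) :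
    nth l (l.length - 1) = ((J.reach J.numDue).sup id : ℕ) := by
  obtain ⟨D, hD⟩ : ∃ D, J.numDue = D + 1 := ⟨J.numDue - 1, by have := numDue_pos (J := J); omega⟩
  have hne : (J.reach J.numDue).sort (· ≤ ·) ≠ [] := by
    intro h0
    have := (Finset.mem_sort (s := J.reach J.numDue) (· ≤ ·)).mpr (h.zero_mem_reach J.numDue)
    rw [h0] at this
    simp at this
  obtain ⟨l₁, x, hx⟩ := (List.eq_nil_or_concat' ((J.reach J.numDue).sort (· ≤ ·))).resolve_left hne
  have hsup : (J.reach J.numDue).sup id = x := by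
    have hmem : ∀ y, y ∈ J.reach J.numDue ↔ y ∈ l₁ ++ [x] := fun y => by
      rw [← hx, Finset.mem_sort]
    have hpw : (l₁ ++ [x]).Pairwise (· ≤ ·) := hx ▸ Finset.pairwise_sort _ _
    refine le_antisymm (Finset.sup_le fun y hy => ?_) ?_
    · rcases List.mem_append.mp ((hmem y).mp hy) with hy | hy
      · exact (List.pairwise_append.mp hpw).2.2 y hy x (by simp)
      · simp at hy; exact hy.le
    · exact Finset.le_sup (f := id) ((hmem x).mpr (by simp))
  obtain ⟨q, hq⟩ : ∃ q, l = q ++ [(x : ℤ)] := by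
    rw [hl, blocks, hD, blockList, List.reverse_cons, List.flatMap_append, List.flatMap_singleton,
      h.blockOut_eq, ← hD, hx]
    rw [List.map_append, List.map_singleton, ← List.cons_append, ← List.cons_append,
      ← List.append_assoc]
    exact ⟨_, rfl⟩
  rw [hsup, hq, List.length_append, List.length_singleton, Nat.add_sub_cancel]
  exact nth_mid _ _ _

theorem solveTrace_eq (h : J.SortedJobs ids) :
    J.solveTrace δ = solveOut (ids.map J.job) J.pos (J.blocks δ ids) := by
  classical
  rw [solveTrace, solveOut, h.last_eq rfl, solveValue, h.solveT_numDue, h.sum_p]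
  congr 1
  rw [h.filter_active, List.flatMap_map]
  refine List.flatMap_congr fun b hb => ?_
  rw [h.blockOut_eq, h.solveT_end hb]

end SortedJobs

/-! ### The minimum total processing time of tardy jobs -/

theorem exists_sortedJobs' : ∃ ids, J.SortedJobs ids := by
  have hp := List.mergeSort_perm J.jobs fun x y => decide (x.2 ≤ y.2)
  have hs : (J.jobs.mergeSort fun x y => decide (x.2 ≤ y.2)).Pairwise
      fun x y => x.2 ≤ y.2 := by
    have := List.pairwise_mergeSort (le := fun x y : ℕ × ℕ => decide (x.2 ≤ y.2))
      (fun a b c h1 h2 => by simp at *; omega) (fun a b => by simp; omega) J.jobs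
    simpa using this
  obtain ⟨ids, h, -⟩ := J.exists_sortedJobs hp hs
  exact ⟨ids, h⟩

theorem upTo_numDue : J.upTo J.numDue = Finset.univ := by
  rw [upTo, Finset.filter_eq_self]
  exact fun j _ => J.e_le j

/-- The jobs that are on time can be run first, in the order of their due dates. -/
theorem exists_tardyTime_le {Z : Finset (Fin J.n)} (hZ : J.FeasibleFrom Z 0) :
    ∃ σ, J.tardyTime σ + ∑ j ∈ Z, J.p j ≤ J.P := by
  rw [feasibleFrom_iff] at hZ
  set g : Fin J.n → ℕ := fun j => if j ∈ Z then J.e j else ∑ i, J.e i + 1 with hg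
  refine ⟨(Tuple.sort g)⁻¹, ?_⟩
  have hon : ∀ j ∈ Z, J.completion (Tuple.sort g)⁻¹ j ≤ J.e j := by
    intro j hj
    have := hZ j hj
    rw [zero_add] at this
    refine le_trans (Finset.sum_le_sum_of_subset fun i hi => ?_) this
    have h1 : g i ≤ g j := by simpa using Tuple.monotone_sort g (Finset.mem_filter.mp hi).2
    have hj' : g j = J.e j := if_pos hj
    have hle : J.e j ≤ ∑ i, J.e i := Finset.single_le_sum (f := J.e) (by simp) (Finset.mem_univ j)
    by_cases hi' : i ∈ Z
    · have : g i = J.e i := if_pos hi'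
      exact Finset.mem_filter.mpr ⟨hi', by omega⟩
    · have : g i = ∑ i, J.e i + 1 := if_neg hi'
      omega
  rw [tardyTime, P, ← Finset.sum_sdiff (Finset.subset_univ Z)]
  refine Nat.add_le_add_right (Finset.sum_le_sum_of_subset fun j hj => ?_) _
  have := (Finset.mem_filter.mp hj).2
  refine Finset.mem_sdiff.mpr ⟨Finset.mem_univ j, fun hjZ => ?_⟩
  have := hon j hjZ
  omega

/-- The jobs that are not tardy form a feasible set. -/
theorem exists_feasibleFrom (σ : Equiv.Perm (Fin J.n)) :
    ∃ Z, J.FeasibleFrom Z 0 ∧ J.tardyTime σ + ∑ j ∈ Z, J.p j = J.P := by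
  refine ⟨Finset.univ.filter fun j => ¬ J.e j < J.completion σ j, ⟨σ, fun j hj => ?_⟩, ?_⟩
  · have := (Finset.mem_filter.mp hj).2
    rw [zero_add]
    refine le_trans (Finset.sum_le_sum_of_subset fun i hi => ?_) (not_lt.mp this)
    exact Finset.mem_filter.mpr ⟨Finset.mem_univ _, (Finset.mem_filter.mp hi).2⟩
  · rw [tardyTime, P, Finset.sum_filter_add_sum_filter_not]

/-- The value that the algorithm returns is optimal. -/
theorem solveValue_eq (δ : ℝ) : J.solveValue δ = J.minTardyTime := by
  obtain ⟨ids, h⟩ := J.exists_sortedJobs'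
  rw [solveValue, h.solveT_numDue]
  have hm : ∀ y, y ∈ J.reach J.numDue ↔ ∃ Z, ∑ j ∈ Z, J.p j = y ∧ J.FeasibleFrom Z 0 := fun y => by
    rw [mem_reach, upTo_numDue]
    simp
  obtain ⟨y, hy, hsup⟩ := Finset.exists_mem_eq_sup (J.reach J.numDue) ⟨0, h.zero_mem_reach _⟩ id
  rw [hsup]
  obtain ⟨Z, rfl, hZ⟩ := (hm y).mp hy
  obtain ⟨σ, hσ⟩ := J.exists_tardyTime_le hZ
  have h1 : J.minTardyTime ≤ J.tardyTime σ := Finset.inf'_le _ (Finset.mem_univ σ)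
  obtain ⟨τ, -, hτ⟩ := Finset.exists_mem_eq_inf' (Finset.univ_nonempty) J.tardyTime
  obtain ⟨Z', hZ', hsum⟩ := J.exists_feasibleFrom τ
  have h2 : ∑ j ∈ Z', J.p j ≤ (J.reach J.numDue).sup id :=
    Finset.le_sup (f := id) ((hm _).mpr ⟨Z', rfl, hZ'⟩)
  rw [hsup] at h2
  change J.minTardyTime = _ at hτ
  simp only [id_eq] at h2 ⊢
  omega

end Instance

namespace Instance

open RAM

variable (J : Instance)

/-! ### The running time -/

/-- Two consecutive blocks together have a load above the threshold, so there are few blocks. -/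
theorem SortedJobs.length_blocks {J : Instance} {ids : List (Fin J.n)} {δ : ℝ}
    (h : J.SortedJobs ids) :
    (J.blocks δ ids).length / 2 * (J.threshold δ + 1) ≤ J.P := by
  obtain ⟨hch, -⟩ := blockList_chain (J.ldOf ids) (J.threshold δ) J.numDue
  change ∀ i (hi : i < (J.blocks δ ids).length),
    (J.blocks δ ids)[i].1 = prevEnd (J.blocks δ ids) i + 1 at hch
  have hmem : ∀ i (hi : i < (J.blocks δ ids).length), (J.blocks δ ids)[i] ∈
      blockList (J.ldOf ids) (J.threshold δ) J.numDue := fun i hi =>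
    SortedJobs.mem_blocks (List.getElem_mem hi)
  set L := J.blocks δ ids with hL
  set g : ℕ → ℕ := fun i => preSum (ids.map J.job) (J.pos (prevEnd L i)) with hg
  have key : ∀ i, 2 * i ≤ L.length → i * (J.threshold δ + 1) ≤ g (2 * i) := by
    intro i
    induction i with
    | zero => simp
    | succ i ih =>
      intro hi
      have ih := ih (by omega)
      have e1 := prevEnd_succ (L := L) (i := 2 * i) (by omega)
      have e2 := prevEnd_succ (L := L) (i := 2 * i + 1) (by omega)
      have c1 := hch (2 * i) (by omega)
      have c2 := hch (2 * i + 1) (by omega)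
      have h1 := mem_blockList (hmem (2 * i) (by omega))
      have h2 := mem_blockList (hmem (2 * i + 1) (by omega))
      have h3 := blockList_fst (hmem (2 * i + 1) (by omega))
      have h4 := lt_ld_blockStart (J.ldOf ids) (J.threshold δ) L[2 * i + 1].2 L[2 * i + 1].2
      rw [← h3] at h4
      have h5 := h4.resolve_left (by omega)
      have h6 : preSum (ids.map J.job) (J.pos (prevEnd L (2 * i))) ≤
          preSum (ids.map J.job) (J.pos (L[2 * i + 1].1 - 1 - 1)) :=
        preSum_mono _ (h.pos_mono (by omega) (by omega))
      have h7 : J.ldOf ids (L[2 * i + 1].1 - 1) L[2 * i + 1].2 =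
        preSum (ids.map J.job) (J.pos L[2 * i + 1].2) -
          preSum (ids.map J.job) (J.pos (L[2 * i + 1].1 - 1 - 1)) := rfl
      simp only [hg] at ih ⊢
      rw [show 2 * (i + 1) = 2 * i + 1 + 1 by ring, e2, add_mul]
      omega
  refine (key _ (by omega)).trans ?_
  rw [← h.sum_p]
  exact preSum_le _ _

theorem one_le_P : 1 ≤ J.P := by
  have := Finset.single_le_sum (f := J.p) (by simp) (Finset.mem_univ ⟨0, J.n_pos⟩)
  have := J.p_pos ⟨0, J.n_pos⟩
  rw [P]; omega

theorem one_le_rpow {a : ℝ} (ha : 0 ≤ a) : (1 : ℝ) ≤ (J.P : ℝ) ^ a :=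
  Real.one_le_rpow (by exact_mod_cast J.one_le_P) ha

theorem SortedJobs.length_blocks_le {J : Instance} {ids : List (Fin J.n)} {δ : ℝ}
    (h : J.SortedJobs ids) (hδ : 0 ≤ δ) : ((J.blocks δ ids).length : ℝ) ≤ 3 * (J.P : ℝ) ^ δ := by
  have hP : (0 : ℝ) < J.P := by exact_mod_cast J.one_le_P
  have h1 : (((J.blocks δ ids).length / 2 : ℕ) : ℝ) * ((J.threshold δ : ℝ) + 1) ≤ J.P := by
    exact_mod_cast h.length_blocks
  have h2 : (J.P : ℝ) ^ (1 - δ) < (J.threshold δ : ℝ) + 1 := Nat.lt_floor_add_one _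
  have h3 : (0 : ℝ) < (J.P : ℝ) ^ (1 - δ) := Real.rpow_pos_of_pos hP _
  have h4 : (((J.blocks δ ids).length / 2 : ℕ) : ℝ) ≤ (J.P : ℝ) ^ δ := by
    have h5 : (((J.blocks δ ids).length / 2 : ℕ) : ℝ) * (J.P : ℝ) ^ (1 - δ) ≤
        (J.P : ℝ) ^ δ * (J.P : ℝ) ^ (1 - δ) := by
      rw [← Real.rpow_add hP, add_sub_cancel, Real.rpow_one]
      exact (mul_le_mul_of_nonneg_left h2.le (Nat.cast_nonneg _)).trans h1
    exact le_of_mul_le_mul_right h5 h3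
  have h5 := J.one_le_rpow hδ
  have h6 : ((J.blocks δ ids).length : ℝ) ≤ 2 * (((J.blocks δ ids).length / 2 : ℕ) : ℝ) + 1 := by
    exact_mod_cast (show (J.blocks δ ids).length ≤ 2 * ((J.blocks δ ids).length / 2) + 1 by omega)
  linarith

theorem sum_encode : (J.encode.map Int.natAbs).sum = tot J.jobs := by
  rw [encode_eq, tot, sm]
  generalize J.jobs = z
  induction z with
  | nil => rfl
  | cons j z ih =>
    simp only [flat_cons, List.map_cons, List.sum_cons, Int.natAbs_natCast, ih]
    ring

theorem tot_le_magnitude : tot J.jobs ≤ magnitude J.encode := by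
  rw [magnitude, sum_encode]; exact Nat.le_add_left _ _

theorem magnitude_encode_le (δ : ℝ) : magnitude J.encode ≤ magnitude (J.solveInput δ) := by
  simp only [magnitude, solveInput, List.length_cons, List.map_cons, List.sum_cons]; omega

theorem threshold_le_P {δ : ℝ} (hδ : 0 ≤ δ) : J.threshold δ ≤ J.P := by
  rw [threshold]
  refine Nat.floor_le_of_le ?_
  calc (J.P : ℝ) ^ (1 - δ) ≤ (J.P : ℝ) ^ (1 : ℝ) :=
        Real.rpow_le_rpow_of_exponent_le (by exact_mod_cast J.one_le_P) (by linarith)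
    _ = J.P := Real.rpow_one _

end Instance

namespace RAM

theorem logb_le_lg {x : ℝ} {X : ℕ} (h0 : 0 < x) (h : x ≤ X) : Real.logb 2 x ≤ lg X := by
  have h1 : (X : ℝ) < (2 : ℝ) ^ ((lg X : ℕ) : ℝ) := by
    rw [Real.rpow_natCast]
    exact_mod_cast Nat.lt_pow_succ_log_self Nat.one_lt_two X
  calc Real.logb 2 x ≤ Real.logb 2 ((2 : ℝ) ^ ((lg X : ℕ) : ℝ)) :=
        Real.logb_le_logb_of_le (by norm_num) h0 (h.trans h1.le)
    _ = lg X := Real.logb_rpow (by norm_num) (by norm_num)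

theorem lg_le_logb {X : ℕ} (h : 0 < X) : (lg X : ℝ) ≤ Real.logb 2 X + 1 := by
  have h1 : (2 : ℝ) ^ ((Nat.log 2 X : ℕ) : ℝ) ≤ X := by
    rw [Real.rpow_natCast]
    exact_mod_cast Nat.pow_log_le_self 2 h.ne'
  have h2 : ((Nat.log 2 X : ℕ) : ℝ) ≤ Real.logb 2 X := by
    rw [← Real.logb_rpow (b := 2) (x := ((Nat.log 2 X : ℕ) : ℝ)) (by norm_num) (by norm_num)]
    exact Real.logb_le_logb_of_le (by norm_num) (by positivity) h1
  rw [lg]; push_cast; linarith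

/-- The length of numbers that are polynomial in the magnitude of the input. -/
theorem lg_bound_le {u m : ℕ} (h : u ≤ m) :
    (lg (20 * (u + 3) ^ 2) : ℝ) ≤ 10 * Real.logb 2 ((m : ℝ) + 2) := by
  have hM : (2 : ℝ) ≤ (m : ℝ) + 2 := by have : (0 : ℝ) ≤ m := Nat.cast_nonneg _; linarith
  have h1 : 1 ≤ Real.logb 2 ((m : ℝ) + 2) := by
    rw [Real.le_logb_iff_rpow_le (by norm_num) (by linarith), Real.rpow_one]; exact hM
  have h2 : 20 * (u + 3) ^ 2 ≤ (m + 2) ^ 9 := by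
    have h3 : (u + 3) ^ 2 ≤ (2 * (m + 2)) ^ 2 := Nat.pow_le_pow_left (by omega) _
    have h4 : 2 ^ 7 ≤ (m + 2) ^ 7 := Nat.pow_le_pow_left (by omega) _
    calc 20 * (u + 3) ^ 2 ≤ 20 * (2 * (m + 2)) ^ 2 := Nat.mul_le_mul_left _ h3
      _ = 80 * (m + 2) ^ 2 := by ring
      _ ≤ (m + 2) ^ 7 * (m + 2) ^ 2 := Nat.mul_le_mul_right _ (by omega)
      _ = _ := by ring
  have h3 := lg_le_logb (X := (m + 2) ^ 9) (by positivity)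
  have h4 : (lg (20 * (u + 3) ^ 2) : ℝ) ≤ lg ((m + 2) ^ 9) := by exact_mod_cast lg_mono h2
  have h5 : Real.logb 2 (((m + 2) ^ 9 : ℕ) : ℝ) = 9 * Real.logb 2 ((m : ℝ) + 2) := by
    push_cast; rw [Real.logb_pow]; norm_num
  rw [h5] at h3
  linarith

/-- A program for max-min-skewed-convolutions, seen from an application to vectors of size at most
`N` with entries of absolute value at most `16 * X`: the exponent `α` is replaced by
`β = max α 1`, so that the bound is linear in the size of the vectors. -/
theorem conv_oracle {α : ℝ} {c : Cmd} {C k : ℕ}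
    (hc : ∀ x : ConvInput, ∃ t : ℕ, Runs c x.input x.output t ∧
      (t : ℝ) ≤ C * ((x.n : ℝ) + 1) ^ α * Real.logb 2 ((magnitude x.input : ℝ) + 2) ^ k)
    {N X : ℕ} (hNX : N ≤ X) (hX : 60 ≤ X) (x : ConvInput) (hx : x.n + 1 ≤ N)
    (hA : ∀ i ≤ x.n, (x.A i).natAbs ≤ 16 * X) (hB : ∀ i ≤ x.n, (x.B i).natAbs ≤ 16 * X) :
    RunsIn c x.input x.output
      ((x.n + 1) * (C * ⌈(N : ℝ) ^ (max α 1 - 1)⌉₊ * (3 * lg X) ^ k)) := by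
  obtain ⟨t, ht, hle⟩ := hc x
  refine ⟨t, ?_, ht⟩
  have hmag : magnitude x.input + 2 ≤ X ^ 3 := by
    have hl : x.input.length = 2 * (x.n + 1) := by simp [ConvInput.input]; ring
    have hs : (x.input.map Int.natAbs).sum ≤ (x.input.map Int.natAbs).length • (16 * X) := by
      refine List.sum_le_card_nsmul _ _ fun y hy => ?_
      obtain ⟨z, hz, rfl⟩ := List.mem_map.mp hy
      rcases List.mem_append.mp hz with hz | hz
      · obtain ⟨i, hi, rfl⟩ := List.mem_map.mp hz
        exact hA i (by have := List.mem_range.mp hi; omega)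
      · obtain ⟨i, hi, rfl⟩ := List.mem_map.mp hz
        exact hB i (by have := List.mem_range.mp hi; omega)
    rw [List.length_map, hl, smul_eq_mul] at hs
    have h1 : 2 * (x.n + 1) * (16 * X) ≤ 2 * X * (16 * X) := Nat.mul_le_mul_right _ (by omega)
    have h2 : 2 * X * (16 * X) + (2 * X + 2) ≤ X ^ 3 := by
      calc 2 * X * (16 * X) + (2 * X + 2) ≤ 60 * (X * X) := by nlinarith
        _ ≤ X * (X * X) := Nat.mul_le_mul_right _ hX
        _ = X ^ 3 := by ring
    rw [magnitude, hl]
    omega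
  have hlog : Real.logb 2 ((magnitude x.input : ℝ) + 2) ≤ ((3 * lg X : ℕ) : ℝ) := by
    have h1 : Real.logb 2 ((magnitude x.input : ℝ) + 2) ≤ Real.logb 2 ((X : ℝ) ^ 3) :=
      Real.logb_le_logb_of_le (by norm_num) (by positivity) (by exact_mod_cast hmag)
    rw [Real.logb_pow] at h1
    have h2 := logb_le_lg (x := (X : ℝ)) (X := X) (by have : 0 < X := by omega
                                                      exact_mod_cast this) le_rfl
    push_cast at h1 ⊢
    linarith
  have hlog0 : 0 ≤ Real.logb 2 ((magnitude x.input : ℝ) + 2) :=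
    Real.logb_nonneg (by norm_num) (by have : (0 : ℝ) ≤ magnitude x.input := Nat.cast_nonneg _
                                       linarith)
  have h1n : (1 : ℝ) ≤ (x.n : ℝ) + 1 := by have : (0 : ℝ) ≤ x.n := Nat.cast_nonneg _; linarith
  have hpow : ((x.n : ℝ) + 1) ^ α ≤ ((x.n : ℝ) + 1) * (⌈(N : ℝ) ^ (max α 1 - 1)⌉₊ : ℝ) := by
    calc ((x.n : ℝ) + 1) ^ α ≤ ((x.n : ℝ) + 1) ^ (1 + (max α 1 - 1)) :=
          Real.rpow_le_rpow_of_exponent_le h1n (by have := le_max_left α 1; linarith)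
      _ = ((x.n : ℝ) + 1) * ((x.n : ℝ) + 1) ^ (max α 1 - 1) := by
          rw [Real.rpow_add (by linarith), Real.rpow_one]
      _ ≤ ((x.n : ℝ) + 1) * (N : ℝ) ^ (max α 1 - 1) := by
          refine mul_le_mul_of_nonneg_left (Real.rpow_le_rpow (by linarith) (by exact_mod_cast hx)
            (by have := le_max_right α 1; linarith)) (by linarith)
      _ ≤ _ := mul_le_mul_of_nonneg_left (Nat.le_ceil _) (by linarith)
  have : (t : ℝ) ≤ (((x.n + 1) * (C * ⌈(N : ℝ) ^ (max α 1 - 1)⌉₊ * (3 * lg X) ^ k) : ℕ) : ℝ) := by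
    refine hle.trans ?_
    calc (C : ℝ) * ((x.n : ℝ) + 1) ^ α * Real.logb 2 ((magnitude x.input : ℝ) + 2) ^ k
        ≤ C * (((x.n : ℝ) + 1) * (⌈(N : ℝ) ^ (max α 1 - 1)⌉₊ : ℝ)) * ((3 * lg X : ℕ) : ℝ) ^ k := by
          refine mul_le_mul (mul_le_mul_of_nonneg_left hpow (Nat.cast_nonneg _))
            (pow_le_pow_left₀ hlog0 hlog _) (by positivity) (by positivity)
      _ = _ := by push_cast; ring
  exact_mod_cast this

/-- The number of steps counted with the word length `Λ`, in terms of the logarithm `l`. -/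
theorem polylog_bound {k : ℕ} {K C P H R D E F l Λ W : ℝ} (hK : 0 ≤ K) (hC : 0 ≤ C) (hF : 0 ≤ F)
    (hP : 1 ≤ P) (hΛ : 1 ≤ Λ) (hΛl : Λ ≤ 10 * l) (hl : 1 ≤ l) (hD : 0 ≤ D)
    (hH : H + 1 ≤ 2 * (C + 1) * F * E * (3 * Λ) ^ k) (hR : R ≤ 3 * D) (hPE : P * E ≤ W)
    (hPD : P * D ≤ W) :
    K * (Λ ^ 3 * (2 * (P * (H + 1)) + R * (P + 1))) * Λ ≤
      K * (4 * (C + 1) * F * 30 ^ k + 6) * 10000 * W * l ^ (k + 4) := by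
  have hW : 0 ≤ W := (mul_nonneg (by linarith) hD).trans hPD
  have hk : (3 * Λ) ^ k ≤ 30 ^ k * l ^ k := by
    rw [← mul_pow]
    exact pow_le_pow_left₀ (by linarith) (by linarith) _
  have hk1 : 1 ≤ l ^ k := one_le_pow₀ hl
  have h1 : P * (H + 1) ≤ 2 * (C + 1) * F * (30 ^ k * l ^ k) * W := by
    calc P * (H + 1) ≤ P * (2 * (C + 1) * F * E * (3 * Λ) ^ k) :=
          mul_le_mul_of_nonneg_left hH (by linarith)
      _ = 2 * (C + 1) * F * (3 * Λ) ^ k * (P * E) := by ring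
      _ ≤ 2 * (C + 1) * F * (3 * Λ) ^ k * W := mul_le_mul_of_nonneg_left hPE (by positivity)
      _ ≤ 2 * (C + 1) * F * (30 ^ k * l ^ k) * W :=
          mul_le_mul_of_nonneg_right (mul_le_mul_of_nonneg_left hk (by positivity)) hW
  have h2 : R * (P + 1) ≤ 6 * l ^ k * W := by
    calc R * (P + 1) ≤ (3 * D) * (P + 1) := mul_le_mul_of_nonneg_right hR (by linarith)
      _ ≤ (3 * D) * (2 * P) := mul_le_mul_of_nonneg_left (by linarith) (by linarith)
      _ = 6 * 1 * (P * D) := by ring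
      _ ≤ 6 * l ^ k * W := mul_le_mul (by linarith) hPD (by positivity) (by positivity)
  have h3 : 2 * (P * (H + 1)) + R * (P + 1) ≤ (4 * (C + 1) * F * 30 ^ k + 6) * l ^ k * W := by
    linarith
  have h4 : Λ ^ 4 ≤ 10000 * l ^ 4 := by
    calc Λ ^ 4 ≤ (10 * l) ^ 4 := pow_le_pow_left₀ (by linarith) hΛl _
      _ = 10000 * l ^ 4 := by ring
  calc K * (Λ ^ 3 * (2 * (P * (H + 1)) + R * (P + 1))) * Λ
      = K * Λ ^ 4 * (2 * (P * (H + 1)) + R * (P + 1)) := by ring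
    _ ≤ K * Λ ^ 4 * ((4 * (C + 1) * F * 30 ^ k + 6) * l ^ k * W) :=
        mul_le_mul_of_nonneg_left h3 (by positivity)
    _ ≤ K * (10000 * l ^ 4) * ((4 * (C + 1) * F * 30 ^ k + 6) * l ^ k * W) :=
        mul_le_mul_of_nonneg_right (mul_le_mul_of_nonneg_left h4 hK) (by positivity)
    _ = _ := by ring

theorem succ_le_of_le_two_mul {C F E Q Y : ℝ} (hC : 0 ≤ C) (hF : 1 ≤ F) (hE : 1 ≤ E) (hY : 1 ≤ Y)
    (hQ : Q ≤ 2 * (F * E)) : C * Q * Y + 1 ≤ 2 * (C + 1) * F * E * Y := by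
  have h1 : C * Q * Y ≤ C * (2 * (F * E)) * Y :=
    mul_le_mul_of_nonneg_right (mul_le_mul_of_nonneg_left hQ hC) (by linarith)
  have h2 : 1 ≤ F * E * Y := one_le_mul_of_one_le_of_one_le (one_le_mul_of_one_le_of_one_le hF hE)
      hY
  linarith

theorem one_le_logb (m : ℕ) : 1 ≤ Real.logb 2 ((m : ℝ) + 2) := by
  have hM : (2 : ℝ) ≤ (m : ℝ) + 2 := by have : (0 : ℝ) ≤ m := Nat.cast_nonneg _; linarith
  rw [Real.le_logb_iff_rpow_le (by norm_num) (by linarith), Real.rpow_one]; exact hM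

/-- The running time of the program, uniformly in the parameter `δ`. -/
theorem exists_solve_bound {α : ℝ} {c : Cmd}
    (hc : ComputesInSoftO c ConvInput.input ConvInput.output fun x => ((x.n : ℝ) + 1) ^ α) :
    ∃ C k : ℕ, ∀ δ : ℝ, 0 < δ → δ < 1 → ∀ J : Instance, ∃ t : ℕ,
      Runs (solve c) (J.solveInput δ) (J.solveTrace δ) t ∧
      (t : ℝ) ≤ C * (((J.P : ℝ) ^ ((1 - δ) * α) + J.P) * (J.P : ℝ) ^ δ) *
        Real.logb 2 ((magnitude J.encode : ℝ) + 2) ^ k := by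
  obtain ⟨C, k, hc⟩ := hc
  set β := max α 1 with hβ
  refine ⟨⌈(10000000000 : ℝ) * (4 * (C + 1) * 3 ^ (β - 1) * 30 ^ k + 6) * 10000⌉₊, k + 4,
    fun δ hδ0 hδ1 J => ?_⟩
  set z := J.jobs with hz
  set θ := J.threshold δ with hθ
  set X := 20 * (tot z + 3) ^ 2 with hX
  have hlenz : z.length = J.n := by simp [hz, Instance.jobs]
  have hz0 : z ≠ [] := by
    have := J.n_pos
    rw [← List.length_pos_iff]; omega
  have hmem : ∀ j ∈ z, 1 ≤ j.1 ∧ 1 ≤ j.2 := by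
    intro j hj
    obtain ⟨i, rfl⟩ := List.mem_ofFn.mp hj
    exact ⟨J.p_pos i, J.e_pos i⟩
  have hsm : sm z = J.P := by
    rw [hz, Instance.jobs, sm, List.map_ofFn, List.sum_ofFn]; rfl
  have hsmt : sm z ≤ tot z := Nat.le_add_right _ _
  have hXt : 20 * (tot z + 3) ≤ X := Nat.mul_le_mul_left _ (Nat.le_self_pow (by omega) _)
  have hθP : θ ≤ J.P := J.threshold_le_P hδ0.le
  set H := C * ⌈((2 * θ + 1 : ℕ) : ℝ) ^ (β - 1)⌉₊ * (3 * lg X) ^ k with hH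
  obtain ⟨z', hp, hs, hrun⟩ := solve_runs (X := X) (N := 2 * θ + 1) (H := H) (θ := θ)
    (conv_oracle hc (by omega) (by have := J.one_le_P; omega)) le_rfl hz0 hmem (by omega) le_rfl
  obtain ⟨ids, hids, rfl⟩ := J.exists_sortedJobs hp hs
  obtain ⟨t, ht, hruns⟩ := hrun _ _ _ (J.blocks δ ids) hids.grouped rfl
  rw [← hids.solveTrace_eq] at hruns
  have hin : (θ : ℤ) :: flat z = J.solveInput δ := by
    rw [Instance.solveInput, J.encode_eq]; rfl
  rw [hin] at hruns
  refine ⟨t, hruns, ?_⟩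
  rw [hsm] at ht
  set R := (J.blocks δ ids).length with hR
  have hRle : (R : ℝ) ≤ 3 * (J.P : ℝ) ^ δ := hids.length_blocks_le hδ0.le
  have hP : (1 : ℝ) ≤ J.P := by exact_mod_cast J.one_le_P
  have hβ1 : 1 ≤ β := le_max_right _ _
  have hq := J.one_le_rpow (a := 1 - δ) (by linarith)
  set A := (J.P : ℝ) ^ ((1 - δ) * α) + J.P with hA
  set D := (J.P : ℝ) ^ δ with hD
  set l := Real.logb 2 ((magnitude J.encode : ℝ) + 2) with hl
  have hlg : (lg X : ℝ) ≤ 10 * l := lg_bound_le J.tot_le_magnitude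
  have hlg1 : (1 : ℝ) ≤ lg X := by exact_mod_cast one_le_lg X
  have hN : ((2 * θ + 1 : ℕ) : ℝ) ^ (β - 1) ≤ 3 ^ (β - 1) * (J.P : ℝ) ^ ((1 - δ) * (β - 1)) := by
    rw [Real.rpow_mul (by linarith), ← Real.mul_rpow (by norm_num) (by linarith)]
    refine Real.rpow_le_rpow (by positivity) ?_ (by linarith)
    have : (θ : ℝ) ≤ (J.P : ℝ) ^ (1 - δ) := J.le_threshold_iff.mp le_rfl
    push_cast; linarith
  have hE1 : (1 : ℝ) ≤ (J.P : ℝ) ^ ((1 - δ) * (β - 1)) :=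
    J.one_le_rpow (mul_nonneg (by linarith) (by linarith))
  have h31 : (1 : ℝ) ≤ 3 ^ (β - 1) := Real.one_le_rpow (by norm_num) (by linarith)
  set E := (J.P : ℝ) ^ ((1 - δ) * (β - 1)) with hE
  set F := (3 : ℝ) ^ (β - 1) with hF
  have hceil : (⌈((2 * θ + 1 : ℕ) : ℝ) ^ (β - 1)⌉₊ : ℝ) ≤ 2 * (F * E) := by
    have h1 := (Nat.ceil_lt_add_one (a := ((2 * θ + 1 : ℕ) : ℝ) ^ (β - 1)) (by positivity)).le
    have : 1 ≤ F * E := one_le_mul_of_one_le_of_one_le h31 hE1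
    linarith
  have hHr : (H : ℝ) = C * (⌈((2 * θ + 1 : ℕ) : ℝ) ^ (β - 1)⌉₊ : ℝ) * (3 * (lg X : ℝ)) ^ k := by
    rw [hH, Nat.cast_mul, Nat.cast_mul, Nat.cast_pow, Nat.cast_mul, Nat.cast_ofNat]
  clear_value H
  have hH1 : (H : ℝ) + 1 ≤ 2 * (C + 1) * F * E * (3 * lg X) ^ k := by
    rw [hHr]
    exact succ_le_of_le_two_mul (Nat.cast_nonneg C) h31 hE1 (one_le_pow₀ (by linarith)) hceil
  -- The convolutions: `P * E = P ^ ((1 - δ) * β) * D` for `β = max α 1`, and the case `β = 1` is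
  -- covered by the second term of the bound.
  have hPE : (J.P : ℝ) * E ≤ A * D := by
    have e : (J.P : ℝ) * E = (J.P : ℝ) ^ ((1 - δ) * β) * D := by
      rw [hE, hD, ← Real.rpow_add (by linarith)]
      nth_rw 1 [← Real.rpow_one (J.P : ℝ)]
      rw [← Real.rpow_add (by linarith)]
      congr 1; ring
    rw [e]
    refine mul_le_mul_of_nonneg_right ?_ (by positivity)
    rcases le_total α 1 with h | h
    · have hb : β = 1 := max_eq_right h
      have h1 : (J.P : ℝ) ^ ((1 - δ) * β) ≤ (J.P : ℝ) ^ (1 : ℝ) :=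
        Real.rpow_le_rpow_of_exponent_le hP (by rw [hb]; linarith)
      rw [Real.rpow_one] at h1
      have : 0 ≤ (J.P : ℝ) ^ ((1 - δ) * α) := by positivity
      linarith
    · have hb : β = α := max_eq_left h
      rw [hb]; linarith
  have hPD : (J.P : ℝ) * D ≤ A * D := by
    refine mul_le_mul_of_nonneg_right ?_ (by positivity)
    have : 0 ≤ (J.P : ℝ) ^ ((1 - δ) * α) := by positivity
    linarith
  have ht' : (t : ℝ) ≤ 10000000000 * ((lg X : ℝ) ^ 3 *
      (2 * ((J.P : ℝ) * (H + 1)) + R * (J.P + 1))) * lg X := by exact_mod_cast ht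
  refine ht'.trans ((polylog_bound (by norm_num) (Nat.cast_nonneg C) (by linarith) hP hlg1 hlg
    (one_le_logb _) (by positivity) hH1 hRle hPE hPD).trans ?_)
  exact mul_le_mul_of_nonneg_right (mul_le_mul_of_nonneg_right (Nat.le_ceil _) (by positivity))
    (pow_nonneg (by linarith [one_le_logb (magnitude J.encode)]) _)

/-! ### A program for the scheduling problem -/

/-- The output of the algorithm is short enough to be passed on within its running time. -/
theorem solveOut_bound {z : List (ℕ × ℕ)} {θ D : ℕ} {s due : ℕ → ℕ} {L : List (ℕ × ℕ)}
    (h1 : ∀ j ∈ z, 1 ≤ j.1) (hg : Grouped z D s due)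
    (hL : L = (blockList (fun k m => preSum z (s m) - preSum z (s (k - 1))) θ D).reverse) :
    L.length ≤ sm z ∧ (solveOut z s L).length ≤ L.length * (sm z + 3) + 1 ∧
      ∀ x ∈ solveOut z s L, x.natAbs ≤ 2 * sm z + 1 := by
  have hD : D ≤ sm z := by
    have h2 := hg.le_s le_rfl
    have := length_le_sm h1
    rw [hg.s_D] at h2; omega
  have hb : ∀ x ∈ L.flatMap fun b => blockOut z s b.2, x.natAbs ≤ sm z + 1 := by
    intro x hx
    obtain ⟨b, hbL, hx⟩ := List.mem_flatMap.mp hx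
    rcases List.mem_cons.mp hx with rfl | hx
    · have := (mem_blockList (List.mem_reverse.mp (hL ▸ hbL))).2.2
      simp only [Int.natAbs_natCast]; omega
    · exact members_bound _ (Nat.add_le_add_right (sm_take_le z _) 1) _ hx
  refine ⟨?_, ?_, fun x hx => ?_⟩
  · rw [hL, List.length_reverse]; exact (length_blockList_le _ _ _).trans hD
  · rw [solveOut, List.length_append, List.length_singleton, List.length_flatMap]
    refine Nat.add_le_add_right ((List.sum_le_card_nsmul _ (sm z + 3) ?_).trans (by simp)) 1
    intro x hx
    obtain ⟨b, -, rfl⟩ := List.mem_map.mp hx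
    exact blockOut_length_le _ _ _
  · rcases List.mem_append.mp hx with hx | hx
    · have := hb x hx; omega
    · have := natAbs_nth_le hb ((L.flatMap fun b => blockOut z s b.2).length - 1)
      rw [List.mem_singleton.mp hx]; omega

/-- The expression for the power `e ^ n`. -/
def Expr.pow (e : Expr) : ℕ → Expr
  | 0 => .const 1
  | n + 1 => .mul (e.pow n) e

theorem Expr.eval_pow (e : Expr) (s : State) (n : ℕ) : (e.pow n).eval s = e.eval s ^ n := by
  induction n with
  | zero => rw [Expr.pow, Expr.eval, pow_zero]
  | succ n ih => rw [Expr.pow, Expr.eval, ih, pow_succ]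

/-- Compute the minimum total processing time of the tardy jobs from the jobs alone: with `P` in
register `1`, the largest number `θ ≤ P` with `θ ^ a ≤ P ^ b` is the threshold, and the last number
in the output of `Solve` is the value. -/
def tardy (a b : ℕ) (c : Cmd) : Cmd :=
  .seq (For 2 (.div (.reg 0) (.const 2))
    (.assign 1 (.add (.reg 1) (.load 0 (.mul (.const 2) (.reg 2)))))) <|
  .seq (For 4 (.reg 1) (.branch
    (.le ((Expr.add (.reg 4) (.const 1)).pow a) ((Expr.reg 1).pow b))
    (.assign 3 (.add (.reg 4) (.const 1))) .skip)) <|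
  .seq (push 1 5 (.reg 3)) <|
  .seq (tab 6 1 5 (.reg 0) (.load 0 (.reg 6))) <|
  .seq (.call (solve c) 1 (.reg 5) 2 7) <|
  .seq (push 3 8 (.load 2 (.sub (.reg 7) (.const 1)))) (ret 3 8)

/-- The program `tardy`, for a run of `solve` with output ending in `v`.  The powers in the search
for the threshold are computed within one expression, and `a` and `b` are constants, so that they
cost a constant multiple of the word length. -/
theorem tardy_runs {a b : ℕ} {c : Cmd} {X θ T : ℕ} {z : List (ℕ × ℕ)} {out : List ℤ} {v : ℤ}
    (h1 : ∀ j ∈ z, 1 ≤ j.1) (hX : 20 * (tot z + 3) ^ 2 ≤ X)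
    (hθ : ∀ i, i ≤ θ ↔ i ^ a ≤ sm z ^ b) (hθP : θ ≤ sm z)
    (hrun : RunsIn (solve c) (θ :: flat z) (out ++ [v]) (T * lg X))
    (hout : ∀ x ∈ out ++ [v], x.natAbs ≤ X) (hol : (out ++ [v]).length ≤ X) :
    RunsIn (tardy a b c) (flat z) [v]
      ((T + sm z * ((((Expr.add (.reg 4) (.const 1)).pow a).C + ((Expr.reg 1).pow b).C) + 500) +
        2 * (out ++ [v]).length + 500) * lg X) := by
  have hX1 : 20 * (tot z + 3) ≤ X := (Nat.mul_le_mul_left _ (Nat.le_self_pow (by omega) _)).trans hX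
  have hn : z.length ≤ sm z := length_le_sm h1
  have hsmt : sm z ≤ tot z := Nat.le_add_right _ _
  have hb : ∀ x ∈ flat z, x.natAbs ≤ X := by
    intro x hx
    obtain ⟨j, hj, rfl | rfl⟩ := mem_flat.mp hx
    · have := fst_le_sm hj; omega
    · have := le_tot hj; omega
  have hlen : (flat z).length = 2 * z.length := length_flat z
  refine RunsIn.of_wp hb (by omega) ?_
  have hm0 : (State.init (flat z)).mem 0 = nth (flat z) := init_mem_zero _
  have hr0 : (State.init (flat z)).reg 0 = (2 * z.length : ℕ) := by rw [init_reg_zero, hlen]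
  have hr : ∀ r, r ≠ 0 → (State.init (flat z)).reg r = 0 := fun r h => init_reg_ne _ h
  set s0 := State.init (flat z) with hs0
  clear_value s0
  set Ka := (Expr.add (.reg 4) (.const 1)).pow a with hKa
  set Kb := (Expr.reg 1).pow b with hKb
  have eKa : ∀ s : State, Ka.eval s = (s.reg 4 + 1) ^ a := fun s => Expr.eval_pow _ s a
  have eKb : ∀ s : State, Kb.eval s = s.reg 1 ^ b := fun s => Expr.eval_pow _ s b
  unfold tardy
  rw [← hKa, ← hKb]
  clear_value Ka Kb
  apply wp.le
  · apply wp_seq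
    refine wp_for z.length (fun i s' => s'.reg 1 = sm (z.take i)) (fun _ => 30)
      (by simp [Cmd.wregs]) (by omega) ?_ ?_ ?_ ?_
    · intro i _ s' hF _
      simp only [Expr.eval, hF.reg 0 (by simp [Cmd.wregs]), hr0]; omega
    · simp [hr]
    · intro i hi s' _ hF h2 q1
      have ht : sm (z.take (i + 1)) = sm (z.take i) + z[i].1 := by
        rw [List.take_add_one, List.getElem?_eq_getElem hi, sm_append]; simp [sm]
      have hv : (Expr.add (.reg 1) (.load 0 (.mul (.const 2) (.reg 2)))).eval s' =
          (sm (z.take (i + 1)) : ℤ) := by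
        have e1 : ((2 : ℤ) * (i : ℤ)).toNat = 2 * i := by omega
        simp only [Expr.eval, q1, h2, hF.mem 0 (by simp [Cmd.warrs]), hm0, e1, (nth_flat hi).1, ht]
        push_cast; rfl
      have := sm_take_le z (i + 1)
      refine (wp_set _ hv (by omega) ?_).le (by simp [Expr.C, Expr.K, Expr.L])
      simp
    intro s1 _ hF1 _ q1
    rw [List.take_length] at q1
    apply wp_seq
    refine wp_for (sm z) (fun i s' => s'.reg 3 = (min i θ : ℕ)) (fun _ => Ka.C + Kb.C + 20)
      (by simp [Cmd.wregs]) (by omega) ?_ ?_ ?_ ?_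
    · intro i _ s' hF _
      simp only [Expr.eval, hF.reg 1 (by simp [Cmd.wregs]), q1]
    · simp [hF1.reg 3 (by simp [Cmd.wregs]), hr]
    · intro i hi s' _ hF h4 q3
      have hcond : (Expr.le Ka Kb).eval s' = if i + 1 ≤ θ then 1 else 0 := by
        simp only [Expr.eval, eKa, eKb, h4, hF.reg 1 (by simp [Cmd.wregs]), q1]
        congr 1
        rw [hθ]
        exact propext (by norm_cast)
      refine (wp_branch (b := 9) (fun h => ?_) fun h => ?_).le
        (by simp only [Expr.C, Expr.K, Expr.L]; omega)
      · rw [hcond] at h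
        have hi' : i + 1 ≤ θ := by by_contra h'; simp [h'] at h
        refine (wp_set ((i + 1 : ℕ) : ℤ) (by simp [Expr.eval, h4]) (by omega) ?_).le
          (by simp [Expr.C, Expr.K, Expr.L])
        simp [hi']
      · rw [hcond] at h
        have hi' : ¬ i + 1 ≤ θ := by intro h'; simp [h'] at h
        refine (wp_skip ?_).le (by omega)
        rw [setReg_reg, if_neg (by decide), q3]
        congr 1; omega
    intro s2 _ hF2 _ q3
    rw [min_eq_right hθP] at q3
    have hFF : Fr [1, 2, 3, 4] [] s0 s2 :=
      (hF1.mono (by simp [Cmd.wregs]) (by simp [Cmd.warrs])).trans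
        (hF2.mono (by simp [Cmd.wregs]) (by simp [Cmd.warrs]))
    apply wp_seq
    refine wp_pushv (l := []) (θ : ℤ) (Has.nil _ _)
      (by rw [hFF.reg 5 (by decide), hr _ (by decide)]; rfl) (by simp; omega)
      (by simp [Expr.eval, q3]) (by simp; omega) fun g1 => ?_
    apply wp_seq
    refine wp_tab (2 * z.length) (nth (flat z)) (by decide) g1 (by simp) (by simp; omega)
      ?_ ?_ ?_
    · intro s' hF
      simp only [Expr.eval, hF.reg 0 (by decide)]
      simp [hFF.reg 0 (by decide), hr0]
    · intro i hi s' _ hF h6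
      refine ⟨?_, natAbs_nth_le hb _⟩
      simp only [Expr.eval, hF.mem 0 (by decide), h6, Int.toNat_natCast]
      simp [setMem_mem_ne, hFF.mem 0 (by decide), hm0]
    intro s3 hF3 q5 g1'
    rw [← hlen, map_range_nth] at g1'
    apply wp_seq
    refine wp_call (l := θ :: flat z) g1' (by simp [Expr.eval, q5, hlen]; ring)
      (by simp; omega) hrun hout hol fun g2 => ?_
    apply wp_seq
    refine wp_pushv (l := []) v (Has.nil _ _) ?_ (by rw [List.length_nil]; omega) ?_
      (hout v (List.mem_append_right _ (List.mem_singleton.mpr rfl)))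
      fun g3 => wp_ret g3 (by simp) (by simp; omega) fun s' h => by simpa using h
    · rw [setReg_reg, if_neg (by decide), write_reg, hF3.reg 8 (by decide)]
      simp [hFF.reg 8 (by decide), hr]
    · have e : ((((out ++ [v]).length : ℕ) : ℤ) - 1).toNat = out.length := by simp
      simp only [Expr.eval]
      rw [setReg_reg, if_pos rfl, e, g2 _ (by simp), nth_append_right le_rfl]
      simp
  · simp only [Expr.C, Expr.K, Expr.L, Finset.sum_const, Finset.card_range, smul_eq_mul,
      List.length_cons, List.length_append, List.length_nil, hlen, Int.natAbs_one]
    rw [mul_add (sm z) _ 20, mul_add (sm z) _ 500, show Int.natAbs 2 = 2 from rfl]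
    omega

/-- For `1 - δ = b / a`, the threshold is the largest number `θ` with `θ ^ a ≤ P ^ b`. -/
theorem le_threshold_iff_pow (J : Instance) {a b : ℕ} (ha : 0 < a) {δ : ℝ}
    (hδ : 1 - δ = (b : ℝ) / a) (i : ℕ) : i ≤ J.threshold δ ↔ i ^ a ≤ J.P ^ b := by
  have ha' : (a : ℝ) ≠ 0 := by positivity
  have hP : (0 : ℝ) ≤ J.P := Nat.cast_nonneg _
  have e : ((J.P : ℝ) ^ ((b : ℝ) / a)) ^ a = (J.P : ℝ) ^ b := by
    rw [← Real.rpow_natCast, ← Real.rpow_mul hP, div_mul_cancel₀ _ ha', Real.rpow_natCast]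
  rw [J.le_threshold_iff, hδ, ← pow_le_pow_iff_left₀ (Nat.cast_nonneg i)
    (Real.rpow_nonneg hP _) ha.ne', e]
  exact_mod_cast Iff.rfl

/-- For `δ = 1 - 1 / α` both terms of the bound are `P ^ (2 - 1 / α)`. -/
theorem rpow_conv_add_mul (J : Instance) {α : ℝ} (hα : 1 < α) :
    ((J.P : ℝ) ^ ((1 - (1 - 1 / α)) * α) + J.P) * (J.P : ℝ) ^ (1 - 1 / α) =
      2 * (J.P : ℝ) ^ (2 - 1 / α) := by
  have hP : (0 : ℝ) < J.P := by exact_mod_cast J.one_le_P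
  have e : (1 - (1 - 1 / α)) * α = 1 := by field_simp; ring
  rw [e, Real.rpow_one, ← two_mul, mul_assoc, show 2 - 1 / α = 1 + (1 - 1 / α) by ring,
    Real.rpow_add hP, Real.rpow_one]

theorem tardy_polylog {t C M P S W Λ l : ℝ} {k : ℕ} (hl : 1 ≤ l) (hC : 0 ≤ C) (hM : 0 ≤ M)
    (hP : 1 ≤ P)
    (hPW : P ≤ W) (hΛ0 : 0 ≤ Λ) (ht : t ≤ C * (2 * W) * l ^ k) (hS : S ≤ 13 * W)
    (hΛ : Λ ≤ 10 * l) :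
    (t + P * (M + 500) + 2 * S + 500) * Λ ≤ (2 * C + M + 1026) * W * l ^ k * (10 * l) := by
  have hlk : 1 ≤ l ^ k := one_le_pow₀ hl
  have h1 : P * (M + 500) ≤ W * (M + 500) := mul_le_mul_of_nonneg_right hPW (by linarith)
  have h2 : W * (M + 1026) ≤ W * (M + 1026) * l ^ k :=
    le_mul_of_one_le_right (mul_nonneg (by linarith) (by linarith)) hlk
  have h3 : t + P * (M + 500) + 2 * S + 500 ≤ (2 * C + M + 1026) * W * l ^ k := by linarith
  have hW : 0 ≤ W := by linarith
  exact mul_le_mul h3 hΛ hΛ0 (by positivity)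

/-- For rational `α = a / b` the threshold `⌊P ^ (1 / α)⌋` is found with integer arithmetic, by
trying all numbers up to `P`; this takes time `Õ(P)`, which is within the bound. -/
theorem tardyInTime {α : ℝ} (hα : 1 < α) (hq : ∃ q : ℚ, α = (q : ℝ)) {c : Cmd}
    (hc : ComputesInSoftO c ConvInput.input ConvInput.output fun x => ((x.n : ℝ) + 1) ^ α) :
    TardyInTime (2 - 1 / α) := by
  obtain ⟨q, rfl⟩ := hq
  obtain ⟨C, k, hsolve⟩ := exists_solve_bound hc
  have hq0 : 0 < q := by exact_mod_cast (zero_lt_one.trans hα : (0 : ℝ) < q)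
  have hnum : 0 < q.num := Rat.num_pos.mpr hq0
  set a := q.num.toNat with ha
  set b := q.den with hb
  have hac : ((a : ℕ) : ℝ) = (q.num : ℝ) := by
    have : ((a : ℕ) : ℤ) = q.num := Int.toNat_of_nonneg hnum.le
    exact_mod_cast this
  have ha0 : 0 < a := by omega
  have hδ : (1 : ℝ) - (1 - 1 / (q : ℝ)) = (b : ℝ) / a := by
    rw [hac, Rat.cast_def]; field_simp; ring
  set δ : ℝ := 1 - 1 / (q : ℝ) with hδd
  have hinv : 1 / (q : ℝ) < 1 := by rw [div_lt_one (by linarith)]; exact hα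
  have hinv0 : 0 < 1 / (q : ℝ) := by positivity
  have hδ0 : 0 < δ := by linarith
  have hδ1 : δ < 1 := by linarith
  set M := ((Expr.add (.reg 4) (.const 1)).pow a).C + ((Expr.reg 1).pow b).C with hM
  refine ⟨tardy a b c, 10 * (2 * C + M + 1026), k + 1, fun J => ?_⟩
  obtain ⟨t, ht, hle⟩ := hsolve δ hδ0 hδ1 J
  rw [rpow_conv_add_mul J hα] at hle
  obtain ⟨ids, hids⟩ := J.exists_sortedJobs'
  have hP1 := J.one_le_P
  have hjobs : ∀ j ∈ J.jobs, 1 ≤ j.1 := by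
    intro j hj
    obtain ⟨i, rfl⟩ := List.mem_ofFn.mp hj
    exact J.p_pos i
  have hsm : sm J.jobs = J.P := by
    rw [Instance.jobs, sm, List.map_ofFn, List.sum_ofFn]; rfl
  have hsm' : sm (ids.map J.job) = J.P := hids.sum_p
  obtain ⟨hR, hlen, hval⟩ := solveOut_bound (z := ids.map J.job) (θ := J.threshold δ)
    (L := J.blocks δ ids) (by
      intro j hj
      obtain ⟨i, -, rfl⟩ := List.mem_map.mp hj
      exact J.p_pos i) hids.grouped rfl
  rw [← hids.solveTrace_eq, hsm'] at hlen hval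
  rw [hsm'] at hR
  have hRle : ((J.blocks δ ids).length : ℝ) ≤ 3 * (J.P : ℝ) ^ δ := hids.length_blocks_le hδ0.le
  set R := (J.blocks δ ids).length with hRd
  set X := 20 * (tot J.jobs + 3) ^ 2 with hX
  have hPt : J.P ≤ tot J.jobs := hsm ▸ Nat.le_add_right _ _
  have hlenX : (J.solveTrace δ).length ≤ X := by
    have : R * (J.P + 3) ≤ (tot J.jobs + 3) * (tot J.jobs + 3) :=
      Nat.mul_le_mul (by omega) (by omega)
    have : 1 ≤ (tot J.jobs + 3) * (tot J.jobs + 3) := Nat.mul_pos (by omega) (by omega)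
    rw [hX, sq]; omega
  have hvalX : ∀ x ∈ J.solveTrace δ, x.natAbs ≤ X := fun x hx => by
    have h1 := hval x hx
    have h2 : tot J.jobs + 3 ≤ (tot J.jobs + 3) ^ 2 := Nat.le_self_pow (by omega) _
    omega
  have hin : J.solveInput δ = (J.threshold δ : ℤ) :: flat J.jobs := by
    rw [Instance.solveInput, J.encode_eq]; rfl
  rw [hin] at ht
  obtain ⟨t', ht', hruns⟩ := tardy_runs (a := a) (b := b) (X := X) (T := t) hjobs le_rfl
    (fun i => by rw [hsm]; exact le_threshold_iff_pow J ha0 hδ i)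
    (by rw [hsm]; exact J.threshold_le_P hδ0.le)
    ⟨t, Nat.le_mul_of_pos_right _ (one_le_lg X), ht⟩ hvalX hlenX
  rw [J.solveValue_eq, ← J.encode_eq] at hruns
  refine ⟨t', hruns, ?_⟩
  change t' ≤ (t + sm J.jobs * (M + 500) + 2 * (J.solveTrace δ).length + 500) * lg X at ht'
  have hlg : (lg X : ℝ) ≤ 10 * Real.logb 2 ((magnitude J.encode : ℝ) + 2) :=
    lg_bound_le J.tot_le_magnitude
  have hl1 := one_le_logb (magnitude J.encode)
  set l := Real.logb 2 ((magnitude J.encode : ℝ) + 2) with hl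
  have hPr : (1 : ℝ) ≤ J.P := by exact_mod_cast hP1
  set W := (J.P : ℝ) ^ (2 - 1 / (q : ℝ)) with hW
  have hWe : W = J.P * (J.P : ℝ) ^ δ := by
    rw [hW, show 2 - 1 / (q : ℝ) = 1 + δ by rw [hδd]; ring, Real.rpow_add (by linarith),
      Real.rpow_one]
  have hD := J.one_le_rpow hδ0.le
  have hPW : (J.P : ℝ) ≤ W := by rw [hWe]; exact le_mul_of_one_le_right (by linarith) hD
  have hlenW : ((J.solveTrace δ).length : ℝ) ≤ 13 * W := by
    have h1 : ((J.solveTrace δ).length : ℝ) ≤ R * (J.P + 3) + 1 := by exact_mod_cast hlen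
    have h2 : (R : ℝ) * (J.P + 3) ≤ 3 * (J.P : ℝ) ^ δ * (4 * J.P) :=
      mul_le_mul hRle (by linarith) (by linarith) (by linarith)
    linarith
  have ht'' : (t' : ℝ) ≤ (t + J.P * (M + 500) + 2 * (J.solveTrace δ).length + 500) * lg X := by
    rw [← hsm]; exact_mod_cast ht'
  refine (ht''.trans (tardy_polylog hl1 (Nat.cast_nonneg _) (Nat.cast_nonneg _)
      hPr hPW (Nat.cast_nonneg _) hle hlenW
    hlg)).trans (le_of_eq ?_)
  push_cast; ring

end RAM

theorem mainTheorem2 (α : ℝ) (hconv : MMSConvInTime α) :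
    (∃ solve : RAM.Cmd,
      (∀ δ : ℝ, 0 < δ → δ < 1 →
        RAM.ComputesInSoftO solve (fun J : Instance => J.solveInput δ)
          (fun J : Instance => J.solveTrace δ)
          (fun J : Instance => ((J.P : ℝ) ^ ((1 - δ) * α) + (J.P : ℝ)) * (J.P : ℝ) ^ δ)) ∧
      (1 < α →
        RAM.ComputesInSoftO solve (fun J : Instance => J.solveInput (1 - 1 / α))
          (fun J : Instance => J.solveTrace (1 - 1 / α))
          (fun J : Instance => (J.P : ℝ) ^ (2 - 1 / α)))) ∧
    (1 < α → (∃ q : ℚ, α = (q : ℝ)) → TardyInTime (2 - 1 / α)) ∧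
    (α = 5 / 3 → TardyInTime (7 / 5)) := by
  obtain ⟨c, hc⟩ := hconv
  obtain ⟨C, k, hsolve⟩ := RAM.exists_solve_bound hc
  have hlog : ∀ (δ : ℝ) (J : Instance),
      Real.logb 2 ((RAM.magnitude J.encode : ℝ) + 2) ^ k ≤
        Real.logb 2 ((RAM.magnitude (J.solveInput δ) : ℝ) + 2) ^ k := fun δ J => by
    have h0 : (0 : ℝ) ≤ RAM.magnitude J.encode := Nat.cast_nonneg _
    have h1 : (RAM.magnitude J.encode : ℝ) ≤ RAM.magnitude (J.solveInput δ) := by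
      exact_mod_cast J.magnitude_encode_le δ
    refine pow_le_pow_left₀ (by linarith [RAM.one_le_logb (RAM.magnitude J.encode)]) ?_ _
    exact Real.logb_le_logb_of_le (by norm_num) (by linarith) (by linarith)
  refine ⟨⟨RAM.solve c, fun δ h0 h1 => ⟨C, k, fun J => ?_⟩, fun hα => ⟨2 * C, k, fun J => ?_⟩⟩,
    fun hα hq => RAM.tardyInTime hα hq hc, fun hα => ?_⟩
  · obtain ⟨t, ht, hle⟩ := hsolve δ h0 h1 J
    exact ⟨t, ht, hle.trans (mul_le_mul_of_nonneg_left (hlog δ J) (by positivity))⟩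
  · have h0 : 0 < 1 / α := by positivity
    have h1 : 1 / α < 1 := by rw [div_lt_one (by linarith)]; exact hα
    obtain ⟨t, ht, hle⟩ := hsolve (1 - 1 / α) (by linarith) (by linarith) J
    refine ⟨t, ht, hle.trans ?_⟩
    rw [RAM.rpow_conv_add_mul J hα]
    calc (C : ℝ) * (2 * (J.P : ℝ) ^ (2 - 1 / α)) *
          Real.logb 2 ((RAM.magnitude J.encode : ℝ) + 2) ^ k
        ≤ C * (2 * (J.P : ℝ) ^ (2 - 1 / α)) *
          Real.logb 2 ((RAM.magnitude (J.solveInput (1 - 1 / α)) : ℝ) + 2) ^ k :=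
          mul_le_mul_of_nonneg_left (hlog _ J) (by positivity)
      _ = _ := by push_cast; ring
  · have h := RAM.tardyInTime (α := α) (by rw [hα]; norm_num) ⟨5 / 3, by rw [hα]; norm_num⟩ hc
    rwa [hα, show (2 : ℝ) - 1 / (5 / 3) = 7 / 5 by norm_num] at h
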